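/- Let $a>0$. For $f\in L^2(0,\infty;dx)$ let $\mathcal C(f)(y)=\int_0^\infty 2\cos(2\pi xy)f(x)\,dx$ (limit in $L^2$ of the integrals over $(0,R)$), and let $K_a\subset L^2(0,\infty;dx)$ be the subspace of the $f$ such that $f$ and $\mathcal C(f)$ both vanish almost everywhere on $(0,a)$. Let $H_0=-i\left(x\frac{d}{dx}+\frac12\right)$ on its maximal domain in $L^2(0,\infty;dx)$: the $f\in L^2$ which are locally absolutely continuous on $(0,\infty)$ with $xf'+\frac12 f\in L^2$. For $b>0$ let $C_b$ be the operator with kernel $2\cos(2\pi xy)$ on $L^2(0,b;dx)$, and put $$\mu(u)=b\frac{d}{db}\log\frac{\det(1+C_b)}{\det(1-C_b)}\Big|_{b=e^u}$$ (Fredholm determinants). Let $\phi_b^{\pm}$ be the continuous functions on $\mathbb R$ with $\phi_b^\pm(x)\pm\int_0^b2\cos(2\pi xy)\phi_b^\pm(y)\,dy=2\cos(2\pi bx)$ and, for $\mathrm{Re}\,s>0$, let $$\mathcal E_b(s)=\pi^{-s/2}\Gamma(\tfrac s2)\sqrt b\Big(b^{-s}+\tfrac12\int_b^\infty(\phi_b^+(x)-\phi_b^-(x))x^{-s}\,dx\Big).$$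 For $0<\mathrm{Re}\,s<1$ put $\mathcal A(u,s)=\frac12(\mathcal E_{e^u}(s)+\mathcal E_{e^u}(1-s))$ and $\mathcal B(u,s)=\frac i2(\mathcal E_{e^u}(s)-\mathcal E_{e^u}(1-s))$. Let $H_0^a$ be the operator in $L^2((\log a,\infty)\to\mathbb C^2;\frac{du}2)$ acting by $$H_0^a\begin{bmatrix}\alpha\\ \beta\end{bmatrix}=\begin{bmatrix}\beta'-\mu\beta\\ -\alpha'-\mu\alpha\end{bmatrix},$$ with domain the square-integrable $(\alpha,\beta)$ whose components are locally absolutely continuous on $[\log a,\infty)$, with $\alpha(\log a)=0$ and with square-integrable image. Then: 1. If $f\in K_a$ is in the domain of $H_0$, then $H_0(f)\in K_a$. 2. The restriction of $H_0$ to $K_a$, as an operator in the Hilbert space $K_a$ with domain $K_a\cap\mathrm{dom}(H_0)$, is densely defined and symmetric, with deficiency indices $(1,1)$. 3. $H_0^a$ is self-adjoint, and it extends the restriction of $H_0$ to $K_a$ under the identification of $K_a$ with $L^2((\log a,\infty)\to\mathbb C^2;\frac{du}2)$. That is, there is a unitary map $U$ from $K_a$ onto $L^2((\log a,\infty)\to\mathbb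 C^2;\frac{du}2)$ such that, for each $f\in K_a$ with $Uf=(\alpha,\beta)$ and almost every $E\in\mathbb R$, with $s=\frac12+iE$, $$\pi^{-s/2}\Gamma(\tfrac s2)\int_0^\infty f(x)x^{-s}\,dx=\int_{\log a}^\infty\big(\alpha(u)\,2\mathcal A(u,s)+\beta(u)\,2\mathcal B(u,s)\big)\frac{du}2$$ (the left integral in the sense of Mellin-Plancherel, the right one absolutely convergent); and for every $f\in K_a\cap\mathrm{dom}(H_0)$ one has $Uf\in\mathrm{dom}(H_0^a)$ and $H_0^a(Uf)=U(H_0f)$. -/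

import Mathlib

open MeasureTheory Set Filter Topology
open scoped ENNReal

noncomputable section

namespace DiracCosine

/-! ### The Hilbert space `L²(0,∞; dx)`, the cosine transform and the spaces `K_a` -/

/-- `L²(0,∞; dx)`, complex valued. -/
abbrev HalfLineL2 : Type := Lp ℂ 2 (volume.restrict (Ioi (0 : ℝ)))

/-- The cosine kernel `2 cos (2π x y)`. -/
def cosKernel (x y : ℝ) : ℝ := 2 * Real.cos (2 * Real.pi * x * y)

/-- The truncated cosine integral `∫_0^R 2 cos (2π x y) f(x) dx`. -/
def cosTrunc (f : ℝ → ℂ) (R y : ℝ) : ℂ := ∫ x in Ioo 0 R, (cosKernel x y : ℂ) * f x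

/-- `g` is the cosine transform of `f` in `L²(0,∞)`: it is the `L²`-limit, as `R → ∞`, of the
truncated integrals `∫_0^R 2 cos (2π x y) f(x) dx`. -/
def IsCosineTransform (f g : HalfLineL2) : Prop :=
  Tendsto (fun R : ℝ => eLpNorm (fun y => g y - cosTrunc f R y) 2 (volume.restrict (Ioi (0 : ℝ))))
    atTop (𝓝 0)

/-- `f` vanishes almost everywhere on `(0,a)`. -/
def VanishesBelow (a : ℝ) (f : HalfLineL2) : Prop :=
  ∀ᵐ x ∂(volume.restrict (Ioi (0 : ℝ))), x < a → f x = 0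

theorem integrableOn_cosTrunc (f : HalfLineL2) (R y : ℝ) :
    Integrable (fun x => (cosKernel x y : ℂ) * f x) (volume.restrict (Ioo 0 R)) := by
  have h1 : MemLp f 2 (volume.restrict (Ioo 0 R)) :=
    (Lp.memLp f).mono_measure (Measure.restrict_mono (fun x hx => hx.1) le_rfl)
  have h2 : Integrable f (volume.restrict (Ioo 0 R)) := h1.integrable (by norm_num)
  refine h2.bdd_mul (c := 2) ?_ ?_
  · unfold cosKernel
    exact (by fun_prop : Continuous fun x : ℝ =>
      ((2 * Real.cos (2 * Real.pi * x * y) : ℝ) : ℂ)).aestronglyMeasurable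
  · refine Filter.Eventually.of_forall fun x => ?_
    unfold cosKernel
    rw [Complex.norm_real, norm_mul]
    have := Real.abs_cos_le_one (2 * Real.pi * x * y)
    simp only [Real.norm_eq_abs]
    norm_num
    linarith

theorem aestronglyMeasurable_cosTrunc (f : HalfLineL2) (R : ℝ) (μ : Measure ℝ) :
    AEStronglyMeasurable (cosTrunc f R) μ := by
  unfold cosTrunc
  have h : StronglyMeasurable (fun p : ℝ × ℝ => (cosKernel p.2 p.1 : ℂ) * f p.2) := by
    refine StronglyMeasurable.mul ?_ ?_
    · unfold cosKernel
      exact (by fun_prop : Continuous fun p : ℝ × ℝ =>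
        ((2 * Real.cos (2 * Real.pi * p.2 * p.1) : ℝ) : ℂ)).stronglyMeasurable
    · exact (Lp.stronglyMeasurable f).comp_measurable measurable_snd
  exact h.integral_prod_right'.aestronglyMeasurable

theorem cosTrunc_congr {f g : ℝ → ℂ} (h : f =ᵐ[volume.restrict (Ioi (0 : ℝ))] g) (R y : ℝ) :
    cosTrunc f R y = cosTrunc g R y := by
  unfold cosTrunc
  refine integral_congr_ae ?_
  have : f =ᵐ[volume.restrict (Ioo 0 R)] g :=
    ae_mono (Measure.restrict_mono (fun x hx => hx.1) le_rfl) h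
  filter_upwards [this] with x hx
  rw [hx]

theorem IsCosineTransform.zero : IsCosineTransform 0 0 := by
  unfold IsCosineTransform
  have h : ∀ R : ℝ, eLpNorm (fun y => (0 : HalfLineL2) y - cosTrunc (0 : HalfLineL2) R y) 2
      (volume.restrict (Ioi (0 : ℝ))) = 0 := by
    intro R
    have h0 := Lp.coeFn_zero ℂ 2 (volume.restrict (Ioi (0 : ℝ)))
    rw [eLpNorm_congr_ae (g := fun _ => (0 : ℂ)) ?_, eLpNorm_zero']
    filter_upwards [h0] with y hy
    rw [hy, cosTrunc_congr h0]
    simp [cosTrunc]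
  simp only [h]
  exact tendsto_const_nhds

theorem IsCosineTransform.add {f f' g g' : HalfLineL2} (h : IsCosineTransform f g)
    (h' : IsCosineTransform f' g') : IsCosineTransform (f + f') (g + g') := by
  unfold IsCosineTransform at *
  have hs := h.add h'
  rw [add_zero] at hs
  refine tendsto_of_tendsto_of_tendsto_of_le_of_le tendsto_const_nhds hs
    (fun _ => zero_le) (fun R => ?_)
  refine le_trans (le_of_eq ?_) (eLpNorm_add_le
    ((Lp.aestronglyMeasurable g).sub (aestronglyMeasurable_cosTrunc f R _))
    ((Lp.aestronglyMeasurable g').sub (aestronglyMeasurable_cosTrunc f' R _)) (by norm_num))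
  refine eLpNorm_congr_ae ?_
  filter_upwards [Lp.coeFn_add g g'] with y hy
  rw [hy, cosTrunc_congr (Lp.coeFn_add f f')]
  have : cosTrunc (⇑f + ⇑f') R y = cosTrunc f R y + cosTrunc f' R y := by
    unfold cosTrunc
    rw [← integral_add (integrableOn_cosTrunc f R y) (integrableOn_cosTrunc f' R y)]
    simp [mul_add]
  rw [this]
  simp only [Pi.add_apply]
  ring

theorem IsCosineTransform.smul {f g : HalfLineL2} (c : ℂ) (h : IsCosineTransform f g) :
    IsCosineTransform (c • f) (c • g) := by
  unfold IsCosineTransform at *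
  have hs := ENNReal.Tendsto.const_mul (a := ‖c‖ₑ) h (Or.inr (by simp))
  rw [mul_zero] at hs
  refine hs.congr fun R => ?_
  rw [← eLpNorm_const_smul]
  refine eLpNorm_congr_ae ?_
  filter_upwards [Lp.coeFn_smul c g] with y hy
  rw [hy, cosTrunc_congr (Lp.coeFn_smul c f)]
  have : cosTrunc (c • ⇑f) R y = c * cosTrunc f R y := by
    unfold cosTrunc
    rw [← integral_const_mul]
    congr 1
    ext x
    simp only [Pi.smul_apply, smul_eq_mul]
    ring
  rw [this]
  simp only [Pi.smul_apply, smul_eq_mul]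
  ring

theorem VanishesBelow.zero (a : ℝ) : VanishesBelow a 0 := by
  filter_upwards [Lp.coeFn_zero ℂ 2 (volume.restrict (Ioi (0 : ℝ)))] with x hx _
  rw [hx, Pi.zero_apply]

theorem VanishesBelow.add {a : ℝ} {f g : HalfLineL2} (hf : VanishesBelow a f)
    (hg : VanishesBelow a g) : VanishesBelow a (f + g) := by
  filter_upwards [hf, hg, Lp.coeFn_add f g] with x h1 h2 h3 hx
  rw [h3, Pi.add_apply, h1 hx, h2 hx, add_zero]

theorem VanishesBelow.smul {a : ℝ} {f : HalfLineL2} (c : ℂ) (hf : VanishesBelow a f) :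
    VanishesBelow a (c • f) := by
  filter_upwards [hf, Lp.coeFn_smul c f] with x h1 h3 hx
  rw [h3, Pi.smul_apply, h1 hx, smul_zero]

/-- `K_a`: the functions in `L²(0,∞)` which vanish on `(0,a)` and whose cosine transforms vanish
on `(0,a)`. -/
def K (a : ℝ) : Submodule ℂ HalfLineL2 where
  carrier := {f | VanishesBelow a f ∧ ∃ g, IsCosineTransform f g ∧ VanishesBelow a g}
  zero_mem' := ⟨.zero a, 0, .zero, .zero a⟩
  add_mem' := by
    rintro f f' ⟨h, g, hg, hga⟩ ⟨h', g', hg', hga'⟩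
    exact ⟨h.add h', g + g', hg.add hg', hga.add hga'⟩
  smul_mem' := by
    rintro c f ⟨h, g, hg, hga⟩
    exact ⟨h.smul c, c • g, hg.smul c, hga.smul c⟩

/-! ### Locally absolutely continuous functions -/

/-- `F` is absolutely continuous on every compact interval contained in `s`. -/
def LocallyAC (F : ℝ → ℂ) (s : Set ℝ) : Prop :=
  ∀ x y : ℝ, x ≤ y → Icc x y ⊆ s → AbsolutelyContinuousOnInterval F x y

theorem LocallyAC.zero (s : Set ℝ) : LocallyAC (fun _ => 0) s := by
  intro x y _ _
  exact ((LipschitzWith.const (0 : ℂ)).lipschitzOnWith (s := uIcc x y)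
    ).absolutelyContinuousOnInterval

theorem LocallyAC.add {F G : ℝ → ℂ} {s : Set ℝ} (hF : LocallyAC F s) (hG : LocallyAC G s) :
    LocallyAC (fun x => F x + G x) s :=
  fun x y hxy hs => (hF x y hxy hs).add (hG x y hxy hs)

theorem LocallyAC.const_mul {F : ℝ → ℂ} {s : Set ℝ} (c : ℂ) (hF : LocallyAC F s) :
    LocallyAC (fun x => c * F x) s := by
  intro x y hxy hs
  have h := hF x y hxy hs
  rw [absolutelyContinuousOnInterval_iff] at h ⊢
  intro ε hε
  obtain ⟨δ, hδ, H⟩ := h (ε / (‖c‖ + 1)) (by positivity)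
  refine ⟨δ, hδ, fun E hE hE' => ?_⟩
  have := H E hE hE'
  have hd : ∀ u v : ℝ, dist (c * F u) (c * F v) = ‖c‖ * dist (F u) (F v) := by
    intro u v
    rw [dist_eq_norm, dist_eq_norm, ← mul_sub, norm_mul]
  simp only [hd]
  rw [← Finset.mul_sum]
  rw [lt_div_iff₀ (by positivity)] at this
  have h0 : 0 ≤ ∑ i ∈ Finset.range E.1, dist (F (E.2 i).1) (F (E.2 i).2) :=
    Finset.sum_nonneg fun _ _ => dist_nonneg
  nlinarith [norm_nonneg c]

theorem LocallyAC.continuousOn_Ioi {F : ℝ → ℂ} {c : ℝ} (hF : LocallyAC F (Ioi c)) :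
    ContinuousOn F (Ioi c) := by
  intro x hx
  have hx' : c < x := hx
  have h := (hF ((c + x) / 2) (x + 1) (by linarith)
    (fun z hz => show c < z by linarith [hz.1])).continuousOn
  rw [uIcc_of_le (by linarith)] at h
  exact (h.continuousAt (Icc_mem_nhds (by linarith) (by linarith))).continuousWithinAt

theorem LocallyAC.ae_differentiableAt {F : ℝ → ℂ} {c : ℝ} (hF : LocallyAC F (Ioi c)) :
    ∀ᵐ x ∂(volume.restrict (Ioi c)), DifferentiableAt ℝ F x := by
  rw [ae_restrict_iff' measurableSet_Ioi]
  have h : ∀ n : ℕ, ∀ᵐ x : ℝ, x ∈ uIcc (c + 1 / (n + 1 : ℝ)) (c + 1 + n) →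
      DifferentiableAt ℝ F x := by
    intro n
    have hle : c + 1 / (n + 1 : ℝ) ≤ c + 1 + n := by
      have h1 : 1 / (n + 1 : ℝ) ≤ 1 := by
        rw [div_le_one (by positivity)]
        linarith [(Nat.cast_nonneg n : (0 : ℝ) ≤ n)]
      linarith [(Nat.cast_nonneg n : (0 : ℝ) ≤ n)]
    refine (hF _ _ hle fun z hz => ?_).boundedVariationOn.ae_differentiableAt_of_mem_uIcc
    have : (0 : ℝ) < 1 / (n + 1 : ℝ) := by positivity
    exact show c < z by linarith [hz.1]
  rw [← ae_all_iff] at h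
  filter_upwards [h] with x hx hxc
  have hxc' : 0 < x - c := sub_pos.mpr hxc
  obtain ⟨n, hn⟩ := exists_nat_one_div_lt hxc'
  obtain ⟨m, hm⟩ := exists_nat_ge (x - c)
  refine hx (max n m) ?_
  have h1 : (1 : ℝ) / ((max n m : ℕ) + 1) ≤ 1 / (n + 1) := by
    apply one_div_le_one_div_of_le (by positivity)
    have : (n : ℝ) ≤ (max n m : ℕ) := by exact_mod_cast le_max_left n m
    linarith
  have h2 : (m : ℝ) ≤ (max n m : ℕ) := by exact_mod_cast le_max_right n m
  rw [mem_uIcc]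
  left
  constructor <;> linarith

theorem LocallyAC.eq_zero {F : ℝ → ℂ} {c : ℝ} (hF : LocallyAC F (Ioi c))
    (h0 : ∀ᵐ x ∂(volume.restrict (Ioi c)), F x = 0) : ∀ x ∈ Ioi c, F x = 0 ∧ deriv F x = 0 := by
  have h : EqOn F (fun _ => 0) (Ioi c) :=
    Measure.eqOn_open_of_ae_eq h0 isOpen_Ioi hF.continuousOn_Ioi continuousOn_const
  intro x hx
  refine ⟨h hx, ?_⟩
  have : F =ᶠ[𝓝 x] fun _ => 0 := by
    filter_upwards [isOpen_Ioi.mem_nhds hx] with y hy using h hy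
  rw [this.deriv_eq]
  simp

/-! ### The free operator `H_0 = -i (x d/dx + 1/2)` on `L²(0,∞)` -/

/-- `f` is represented by a locally absolutely continuous `F` on `(0,∞)`, and
`g = -i (x F' + F/2)`. -/
def FreeRel (f g : HalfLineL2) : Prop :=
  ∃ F : ℝ → ℂ, LocallyAC F (Ioi 0) ∧ f =ᵐ[volume.restrict (Ioi (0 : ℝ))] F ∧
    g =ᵐ[volume.restrict (Ioi (0 : ℝ))] fun x => -Complex.I * (x * deriv F x + F x / 2)

/-- The graph of `H_0`. -/
def freeGraph : Submodule ℂ (HalfLineL2 × HalfLineL2) where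
  carrier := {p | FreeRel p.1 p.2}
  zero_mem' := by
    refine ⟨fun _ => 0, .zero _, Lp.coeFn_zero _ _ _, ?_⟩
    filter_upwards [Lp.coeFn_zero ℂ 2 (volume.restrict (Ioi (0 : ℝ)))] with x hx
    simpa using hx
  add_mem' := by
    rintro ⟨f, g⟩ ⟨f', g'⟩ ⟨F, hF, hfF, hgF⟩ ⟨G, hG, hfG, hgG⟩
    refine ⟨fun x => F x + G x, hF.add hG, ?_, ?_⟩
    · filter_upwards [Lp.coeFn_add f f', hfF, hfG] with x h1 h2 h3
      simp only [Prod.fst_add, h1, Pi.add_apply, h2, h3]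
    · filter_upwards [Lp.coeFn_add g g', hgF, hgG, hF.ae_differentiableAt,
        hG.ae_differentiableAt] with x h1 h2 h3 h4 h5
      simp only [Prod.snd_add, h1, Pi.add_apply, h2, h3, deriv_fun_add h4 h5]
      ring
  smul_mem' := by
    rintro c ⟨f, g⟩ ⟨F, hF, hfF, hgF⟩
    refine ⟨fun x => c * F x, hF.const_mul c, ?_, ?_⟩
    · filter_upwards [Lp.coeFn_smul c f, hfF] with x h1 h2
      simp only [Prod.smul_fst, h1, Pi.smul_apply, h2, smul_eq_mul]
    · filter_upwards [Lp.coeFn_smul c g, hgF, hF.ae_differentiableAt] with x h1 h2 h4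
      simp only [Prod.smul_snd, h1, Pi.smul_apply, h2, smul_eq_mul, deriv_const_mul c h4]
      ring

theorem freeGraph_functional :
    ∀ p ∈ freeGraph, p.1 = 0 → p.2 = 0 := by
  rintro ⟨f, g⟩ ⟨F, hF, hfF, hgF⟩ hf
  simp only at hf hfF hgF ⊢
  subst hf
  have h0 : ∀ᵐ x ∂(volume.restrict (Ioi (0 : ℝ))), F x = 0 := by
    filter_upwards [hfF, Lp.coeFn_zero ℂ 2 (volume.restrict (Ioi (0 : ℝ)))] with x h1 h2
    rw [← h1, h2, Pi.zero_apply]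
  have h1 := hF.eq_zero h0
  refine Lp.ext ?_
  filter_upwards [hgF, Lp.coeFn_zero ℂ 2 (volume.restrict (Ioi (0 : ℝ))),
    ae_restrict_mem measurableSet_Ioi] with x h2 h3 h4
  rw [h2, h3, (h1 x h4).1, (h1 x h4).2]
  simp

/-- `H_0 = -i (x d/dx + 1/2)` on `L²(0,∞)`, with its maximal domain: the locally absolutely
continuous `f ∈ L²` with `x f' + f/2 ∈ L²`. -/
def freeOp : HalfLineL2 →ₗ.[ℂ] HalfLineL2 := freeGraph.toLinearPMap

theorem freeOp_graph : freeOp.graph = freeGraph :=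
  Submodule.toLinearPMap_graph_eq _ freeGraph_functional

/-! ### Restrictions to subspaces and deficiency indices -/

section Abstract

variable {E : Type*} [NormedAddCommGroup E] [InnerProductSpace ℂ E]

/-- The restriction of `T` to `V`, as an operator in the space `V`: its graph consists of the pairs
`(f, T f)` with `f ∈ V ∩ dom T` and `T f ∈ V`. When `T` maps `V ∩ dom T` into `V`, its
domain is `V ∩ dom T`. -/
def restrictTo (T : E →ₗ.[ℂ] E) (V : Submodule ℂ E) : V →ₗ.[ℂ] V :=
  (T.graph.comap (V.subtype.prodMap V.subtype)).toLinearPMap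

theorem restrictTo_graph (T : E →ₗ.[ℂ] E) (V : Submodule ℂ E) :
    (restrictTo T V).graph = T.graph.comap (V.subtype.prodMap V.subtype) := by
  refine Submodule.toLinearPMap_graph_eq _ ?_
  rintro ⟨x, y⟩ hxy hx
  simp only at hx
  subst hx
  have := T.graph_fst_eq_zero_snd hxy (by simp)
  simpa using this

/-- `T` is a densely defined symmetric operator with deficiency indices `(m, n)`, that is,
`dim (ran (T + i))ᗮ = dim ker (T* - i) = m` and `dim (ran (T - i))ᗮ = dim ker (T* + i) = n`. -/
structure HasDeficiencyIndices (T : E →ₗ.[ℂ] E) (m n : ℕ) : Prop where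
  dense : Dense (T.domain : Set E)
  symmetric : T.IsFormalAdjoint T
  rank_plus :
    Module.rank ℂ (LinearMap.range (T.toFun + Complex.I • T.domain.subtype))ᗮ = m
  rank_minus :
    Module.rank ℂ (LinearMap.range (T.toFun - Complex.I • T.domain.subtype))ᗮ = n

end Abstract

/-! ### The potential `μ(u)` -/

/-- The Fredholm determinant `det (1 + z k)` of the kernel `k` on `L²(0,a)`, as Fredholm's series
`∑ zⁿ/n! ∫_{(0,a)ⁿ} det (k(x_i, x_j)) dx_1 ⋯ dx_n`. -/
def fredholmDet (k : ℝ → ℝ → ℝ) (a z : ℝ) : ℝ :=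
  ∑' n : ℕ, z ^ n / (n.factorial : ℝ) *
    ∫ x : Fin n → ℝ in Set.pi univ fun _ => Ioo 0 a, (Matrix.of fun i j => k (x i) (x j)).det

/-- `μ(u) = a d/da log (det (1 + C_a) / det (1 - C_a))` at `a = eᵘ`, where `C_a` is the cosine
kernel on `L²(0,a)`. -/
def potential (u : ℝ) : ℝ :=
  Real.exp u *
    deriv (fun a => Real.log (fredholmDet cosKernel a 1 / fredholmDet cosKernel a (-1)))
      (Real.exp u)

/-! ### Dirac operators on a half-line -/

/-- `L²((u₀,∞) → ℂ²; du/2)`. -/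
abbrev PairL2 (u₀ : ℝ) : Type :=
  Lp (EuclideanSpace ℂ (Fin 2)) 2 ((2⁻¹ : ℝ≥0∞) • volume.restrict (Ioi u₀))

/-- `T = (α, β)` with `α`, `β` locally absolutely continuous on `[u₀,∞)`, `α(u₀) = 0`, and
`S = (β' - m β, -α' - m α)`. -/
def DiracRel (m : ℝ → ℝ) (u₀ : ℝ) (T S : PairL2 u₀) : Prop :=
  ∃ α β : ℝ → ℂ, LocallyAC α (Ici u₀) ∧ LocallyAC β (Ici u₀) ∧ α u₀ = 0 ∧
    ∀ᵐ u ∂(volume.restrict (Ioi u₀)),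
      T u 0 = α u ∧ T u 1 = β u ∧
      S u 0 = deriv β u - m u * β u ∧ S u 1 = -deriv α u - m u * α u

theorem ae_of_ae_half {u₀ : ℝ} {p : ℝ → Prop}
    (h : ∀ᵐ u ∂((2⁻¹ : ℝ≥0∞) • volume.restrict (Ioi u₀)), p u) :
    ∀ᵐ u ∂(volume.restrict (Ioi u₀)), p u := by
  rwa [Measure.ae_ennreal_smul_measure_eq (by simp)] at h

theorem ae_half_of_ae {u₀ : ℝ} {p : ℝ → Prop}
    (h : ∀ᵐ u ∂(volume.restrict (Ioi u₀)), p u) :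
    ∀ᵐ u ∂((2⁻¹ : ℝ≥0∞) • volume.restrict (Ioi u₀)), p u := by
  rwa [Measure.ae_ennreal_smul_measure_eq (by simp)]

theorem LocallyAC.of_Ici {F : ℝ → ℂ} {c : ℝ} (hF : LocallyAC F (Ici c)) : LocallyAC F (Ioi c) :=
  fun x y hxy hs => hF x y hxy (hs.trans Ioi_subset_Ici_self)

/-- The graph of the Dirac operator with boundary condition `α(u₀) = 0`. -/
def diracGraph (m : ℝ → ℝ) (u₀ : ℝ) : Submodule ℂ (PairL2 u₀ × PairL2 u₀) where
  carrier := {p | DiracRel m u₀ p.1 p.2}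
  zero_mem' := by
    refine ⟨fun _ => 0, fun _ => 0, .zero _, .zero _, rfl, ?_⟩
    filter_upwards [ae_of_ae_half (Lp.coeFn_zero (EuclideanSpace ℂ (Fin 2)) 2
      ((2⁻¹ : ℝ≥0∞) • volume.restrict (Ioi u₀)))] with x hx
    simp only [Prod.fst_zero, Prod.snd_zero]
    rw [hx]
    simp
  add_mem' := by
    rintro ⟨T, S⟩ ⟨T', S'⟩ ⟨α, β, hα, hβ, h0, h⟩ ⟨α', β', hα', hβ', h0', h'⟩
    refine ⟨fun x => α x + α' x, fun x => β x + β' x, hα.add hα', hβ.add hβ', by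
      simp [h0, h0'], ?_⟩
    filter_upwards [h, h', ae_of_ae_half (Lp.coeFn_add T T'), ae_of_ae_half (Lp.coeFn_add S S'),
      hα.of_Ici.ae_differentiableAt, hβ.of_Ici.ae_differentiableAt,
      hα'.of_Ici.ae_differentiableAt, hβ'.of_Ici.ae_differentiableAt]
      with u ⟨a1, a2, a3, a4⟩ ⟨b1, b2, b3, b4⟩ c1 c2 d1 d2 d3 d4
    simp only [Prod.fst_add, Prod.snd_add, c1, c2, Pi.add_apply, PiLp.add_apply, a1, a2, a3, a4,
      b1, b2, b3, b4, deriv_fun_add d1 d3, deriv_fun_add d2 d4, true_and]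
    constructor <;> ring
  smul_mem' := by
    rintro c ⟨T, S⟩ ⟨α, β, hα, hβ, h0, h⟩
    refine ⟨fun x => c * α x, fun x => c * β x, hα.const_mul c, hβ.const_mul c, by
      simp [h0], ?_⟩
    filter_upwards [h, ae_of_ae_half (Lp.coeFn_smul c T), ae_of_ae_half (Lp.coeFn_smul c S),
      hα.of_Ici.ae_differentiableAt, hβ.of_Ici.ae_differentiableAt]
      with u ⟨a1, a2, a3, a4⟩ c1 c2 d1 d2
    simp only [Prod.smul_fst, Prod.smul_snd, c1, c2, Pi.smul_apply, PiLp.smul_apply, a1, a2, a3,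
      a4, smul_eq_mul, deriv_const_mul c d1, deriv_const_mul c d2, true_and]
    constructor <;> ring

theorem diracGraph_functional (m : ℝ → ℝ) (u₀ : ℝ) :
    ∀ p ∈ diracGraph m u₀, p.1 = 0 → p.2 = 0 := by
  rintro ⟨T, S⟩ ⟨α, β, hα, hβ, h0, h⟩ hT
  simp only at hT h ⊢
  subst hT
  have hz := ae_of_ae_half (Lp.coeFn_zero (EuclideanSpace ℂ (Fin 2)) 2
      ((2⁻¹ : ℝ≥0∞) • volume.restrict (Ioi u₀)))
  have hα0 := hα.of_Ici.eq_zero (by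
    filter_upwards [h, hz] with u h1 h2
    rw [← h1.1, h2]
    simp)
  have hβ0 := hβ.of_Ici.eq_zero (by
    filter_upwards [h, hz] with u h1 h2
    rw [← h1.2.1, h2]
    simp)
  refine Lp.ext (ae_half_of_ae ?_)
  filter_upwards [h, hz, ae_restrict_mem measurableSet_Ioi] with u h1 h2 hu
  obtain ⟨-, -, h3, h4⟩ := h1
  rw [(hα0 u hu).1, (hα0 u hu).2] at h4
  rw [(hβ0 u hu).1, (hβ0 u hu).2] at h3
  rw [h2]
  ext i
  fin_cases i
  · simpa using h3
  · simpa using h4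

/-- The Dirac operator `(α, β) ↦ (β' - m β, -α' - m α)` in `L²((u₀,∞) → ℂ²; du/2)` with boundary
condition `α(u₀) = 0`, on its maximal domain. -/
def diracOp (m : ℝ → ℝ) (u₀ : ℝ) : PairL2 u₀ →ₗ.[ℂ] PairL2 u₀ := (diracGraph m u₀).toLinearPMap

theorem diracOp_graph (m : ℝ → ℝ) (u₀ : ℝ) : (diracOp m u₀).graph = diracGraph m u₀ :=
  Submodule.toLinearPMap_graph_eq _ (diracGraph_functional m u₀)

/-- `H_0^a`: the Dirac operator with potential `μ` on `(log a, ∞)`, with `α(log a) = 0`. -/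
def boundOp (a : ℝ) : PairL2 (Real.log a) →ₗ.[ℂ] PairL2 (Real.log a) :=
  diracOp potential (Real.log a)

/-! ### The functions `𝒜(u,s)`, `ℬ(u,s)` and the `u`-picture of `K_a` -/

/-- `φ` is continuous and `φ(x) + ε ∫_0^a 2 cos (2π x y) φ(y) dy = 2 cos (2π a x)` for all real
`x`. -/
def IsPhi (ε a : ℝ) (φ : ℝ → ℝ) : Prop :=
  Continuous φ ∧ ∀ x, φ x + ε * ∫ y in Ioo 0 a, cosKernel x y * φ y = cosKernel a x

/-- The solution `φ_a^±` of the integral equation, for `ε = ±1` (it exists and is unique, as `±1`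
are not eigenvalues of the cosine kernel on `L²(0,a)`). -/
def phi (ε a : ℝ) : ℝ → ℝ := Classical.epsilon (IsPhi ε a)

/-- `ℰ_a(s) = π^{-s/2} Γ(s/2) √a (a^{-s} + ½ ∫_a^∞ (φ_a^+(x) - φ_a^-(x)) x^{-s} dx)`, used for
`Re s > 0`, where the integral converges absolutely. -/
def curlyE (a : ℝ) (s : ℂ) : ℂ :=
  s.Gammaℝ * ((Real.sqrt a : ℂ) * ((a : ℂ) ^ (-s) +
    1 / 2 * ∫ x in Ioi a, ((phi 1 a x - phi (-1) a x : ℝ) : ℂ) * (x : ℂ) ^ (-s)))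

/-- `𝒜(u,s) = (ℰ_a(s) + ℰ_a(1-s)) / 2` with `a = eᵘ`, for `0 < Re s < 1`. -/
def curlyA (u : ℝ) (s : ℂ) : ℂ := (curlyE (Real.exp u) s + curlyE (Real.exp u) (1 - s)) / 2

/-- `ℬ(u,s) = i (ℰ_a(s) - ℰ_a(1-s)) / 2` with `a = eᵘ`, for `0 < Re s < 1`. -/
def curlyB (u : ℝ) (s : ℂ) : ℂ :=
  Complex.I * (curlyE (Real.exp u) s - curlyE (Real.exp u) (1 - s)) / 2

/-- The point `½ + iE` of the critical line. -/
def critical (E : ℝ) : ℂ := 1 / 2 + Complex.I * E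

/-- `M(E) = ∫_0^∞ f(x) x^{-s} dx`, `s = ½ + iE`, is the Mellin-Plancherel transform of `f`: the
limit in `L²(dE)`, as `R → ∞`, of the integrals over `(1/R, R)`. -/
def IsMellinTransform (f : HalfLineL2) (M : ℝ → ℂ) : Prop :=
  AEStronglyMeasurable M volume ∧
  Tendsto (fun R : ℝ => eLpNorm
    (fun E => M E - ∫ x in Ioo R⁻¹ R, f x * (x : ℂ) ^ (-critical E)) 2 volume) atTop (𝓝 0)

/-- `T = (α, β)` in `L²((log a,∞) → ℂ²; du/2)` is the `u`-picture of `f`: for almost every real `E`,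
with `s = ½ + iE`,
`π^{-s/2} Γ(s/2) ∫_0^∞ f(x) x^{-s} dx = ∫_{log a}^∞ (α(u) 2𝒜(u,s) + β(u) 2ℬ(u,s)) du/2`,
the last integral being absolutely convergent. -/
def IsUPicture (a : ℝ) (f : HalfLineL2) (T : PairL2 (Real.log a)) : Prop :=
  ∃ M : ℝ → ℂ, IsMellinTransform f M ∧ ∀ᵐ E : ℝ,
    IntegrableOn (fun u => T u 0 * (2 * curlyA u (critical E)) + T u 1 * (2 * curlyB u (critical E)))
      (Ioi (Real.log a)) ∧
    (critical E).Gammaℝ * M E = ∫ u in Ioi (Real.log a),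
      (T u 0 * (2 * curlyA u (critical E)) + T u 1 * (2 * curlyB u (critical E))) / 2

end DiracCosine

end

/-!
Write `C` for the cosine transform, which is a self-adjoint unitary involution, and let `ε = ±1`.

An eigenfunction of the truncated kernel `C_b` for the eigenvalue `±1` would have a cosine transform
vanishing on `(b,∞)`, although the latter is entire (`eq_zero_of_cosKernel_eigen`). Hence
`1 + ε C_b` is invertible, `φ_b^ε(x)` exists and is of class `C¹` in `(b,x)`, and Fredholm's series
show that `b ↦ det (1 + ε C_b)` has the logarithmic derivative `ε φ_b^ε(b)`; so the potential is
`μ(log b) = b (φ_b^+(b) + φ_b^-(b))` (`potential_eq`). Applying `x ∂_x + 1/2` and `b ∂_b + 1/2` to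
the integral equations gives a first-order system linking `φ_b^+` and `φ_b^-` (`phi_system`).

The space `K_a` splits into the eigenspaces of `C`. The function `R - ε ∫_x^∞ φ_b^ε(x) R(b) db` has
a cosine transform which on `(0,a)` is its multiple by `-ε`, if `R = 0` there; therefore
`(1 + ε C)(R - ε ∫_x^∞ φ_b^ε(x) R(b) db)` lies in the `ε`-eigenspace of `K_a` (`transmuted`). This
construction is inverted by the Volterra operator `g ↦ g(b) - ε ∫_a^b φ_b^ε(x) g(x) dx`, and
it multiplies norms by `√2`. With `b = e^u` this yields the unitary map `U` from `K_a` onto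
the pairs `(α,β)` (`exists_uMap_unitary`).

Operators. `H_0` anticommutes with `C` (`FreeRel.cosT`) and is local, so it preserves `K_a`. By the
system for `φ_b^±`, the transmutation carries the Dirac operator on test pairs to `H_0`; by
integration by parts against transmuted functions, `U` carries every `f ∈ K_a ∩ dom H_0` to a pair
with `α(log a) = β(log a) = 0` on which the Dirac operator acts as `H_0` on `f` (`FreeRel.diracAC`).
In Green's formula for the Dirac operator there is no contribution from infinity, whatever the
continuous potential (`DiracAC.green`). This makes the operator with the condition `α(log a) = 0`
self-adjoint (`isSelfAdjoint_diracOp`), and shows that each deficiency space of the restriction of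
`H_0` is a line, on which `α(log a)` is a coordinate (`rank_deficiency`).

Mellin transforms. Splitting the integral `∫_0^∞ t^{s-1} e^{-π t² x²} dt = π^{-s/2} Γ(s/2) x^{-s}/2`
at `t = 1`, and using that the Gaussian is self-dual, one represents the completed Mellin transform
at a point `s` of the critical line by integrals of `f` and `C f` against functions which decay
rapidly (`integral_cosInt_mul_thetaTail_add`). For functions vanishing on `(0,a)` this is a bounded
functional (`thetaForm`). The same functional equation expresses `ℰ_b(s) ± ℰ_b(1-s)` through
integrals of `φ_b^±` over `(0,b)` (`curlyE_add`), hence the functional on transmuted functions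
through `𝒜` and `ℬ`. By Riesz, `𝒜` and `ℬ` are square-integrable and represent the functional in the
`u`-picture (`thetaForm_symm`); by density, and continuity of the Mellin-Plancherel transform, the
resulting formula holds on all of `K_a` (`isUPicture`).
-/

local notation "ν₀" => volume.restrict (Ioi (0 : ℝ))

namespace DiracCosine

open scoped ComplexConjugate ComplexInnerProductSpace ContDiff FourierTransform Real

open Real (exp log sqrt)

noncomputable section

/-! ### The cosine transform as a unitary involution -/

/-- The `L²` Fourier transform agrees with the Fourier integral on `L¹ ∩ L²`. -/
theorem fourier_toLp_ae_eq {h : ℝ → ℂ} (h1 : Integrable h) (h2 : MemLp h 2) :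
    (𝓕 (h2.toLp h) : Lp ℂ 2 (volume : Measure ℝ)) =ᵐ[volume] 𝓕 h := by
  have hc : Continuous (𝓕 h) :=
    VectorFourier.fourierIntegral_continuous Real.continuous_fourierChar
      (by exact continuous_inner) h1
  refine ae_eq_of_integral_contDiff_smul_eq ((Lp.memLp _).locallyIntegrable (by norm_num))
    hc.locallyIntegrable fun g g_smooth g_cpt => ?_
  have hg₁ : HasCompactSupport (Complex.ofRealCLM ∘ g) := g_cpt.comp_left rfl
  have hg₂ : ContDiff ℝ ∞ (Complex.ofRealCLM ∘ g) := by fun_prop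
  set G := hg₁.toSchwartzMap hg₂ with hG
  have hGa : ∀ x, G x = (g x : ℂ) := fun x => rfl
  have e1 : ∫ x, g x • (𝓕 (h2.toLp h) : Lp ℂ 2 (volume : Measure ℝ)) x
      = Lp.toTemperedDistribution (𝓕 (h2.toLp h) : Lp ℂ 2 (volume : Measure ℝ)) G := by
    rw [Lp.toTemperedDistribution_apply (μ := volume)]
    simp [hGa]
  rw [e1, ← Lp.fourier_toTemperedDistribution_eq (h2.toLp h), TemperedDistribution.fourier_apply,
    Lp.toTemperedDistribution_apply (μ := volume)]
  have e2 : ∫ x, (𝓕 G) x • (h2.toLp h) x = ∫ x, (𝓕 (G : ℝ → ℂ)) x • h x := by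
    refine integral_congr_ae ?_
    filter_upwards [h2.coeFn_toLp] with x hx
    rw [hx]
    rfl
  rw [e2]
  have e3 := VectorFourier.integral_fourierIntegral_smul_eq_flip (L := innerₗ ℝ)
      Real.continuous_fourierChar continuous_inner (SchwartzMap.integrable (μ := volume) G) h1
  rw [flip_innerₗ] at e3
  refine Eq.trans e3 ?_
  simp only [hGa]
  rfl

theorem eLpNorm_fourier {h : ℝ → ℂ} (h1 : Integrable h) (h2 : MemLp h 2) :
    eLpNorm (𝓕 h) 2 volume = eLpNorm h 2 volume := by
  rw [← eLpNorm_congr_ae (fourier_toLp_ae_eq h1 h2), ← eLpNorm_congr_ae h2.coeFn_toLp]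
  have := Lp.norm_fourier_eq (h2.toLp h)
  rw [Lp.norm_def, Lp.norm_def] at this
  exact (ENNReal.toReal_eq_toReal_iff' (Lp.eLpNorm_ne_top _) (Lp.eLpNorm_ne_top _)).1 this

theorem lintegral_even {G : ℝ → ℝ≥0∞} (hG : ∀ x, G (-x) = G x) :
    ∫⁻ x, G x = 2 * ∫⁻ x in Ioi 0, G x := by
  rw [← lintegral_add_compl G (measurableSet_Ioi (a := (0 : ℝ))), two_mul, compl_Ioi]
  congr 1
  rw [setLIntegral_congr (Iio_ae_eq_Iic (a := (0 : ℝ)) (μ := volume)).symm]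
  have := (Measure.measurePreserving_neg (volume : Measure ℝ)).setLIntegral_comp_preimage_emb
    (MeasurableEquiv.neg ℝ).measurableEmbedding G (Ioi 0)
  rw [← this]
  simp [hG]

theorem eLpNorm_even {G : ℝ → ℂ} (hG : ∀ x, ‖G (-x)‖ₑ = ‖G x‖ₑ) :
    eLpNorm G 2 volume = (2 : ℝ≥0∞) ^ (1 / 2 : ℝ) * eLpNorm G 2 ν₀ := by
  rw [eLpNorm_eq_lintegral_rpow_enorm_toReal (by norm_num) (by norm_num),
    eLpNorm_eq_lintegral_rpow_enorm_toReal (by norm_num) (by norm_num),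
    lintegral_even (fun x => by rw [hG]), ENNReal.mul_rpow_of_nonneg _ _ (by norm_num)]
  simp

/-- The cosine integral `∫_0^∞ 2 cos (2π x y) f(x) dx`. -/
def cosInt (f : ℝ → ℂ) (y : ℝ) : ℂ := ∫ x in Ioi 0, (cosKernel x y : ℂ) * f x

theorem continuous_cosKernel : Continuous fun p : ℝ × ℝ => cosKernel p.1 p.2 := by
  unfold cosKernel
  fun_prop

theorem abs_cosKernel_le (x y : ℝ) : |cosKernel x y| ≤ 2 := by
  unfold cosKernel
  rw [abs_mul]
  have := Real.abs_cos_le_one (2 * π * x * y)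
  norm_num
  linarith

theorem cosKernel_comm (x y : ℝ) : cosKernel x y = cosKernel y x := by
  unfold cosKernel
  ring_nf

theorem cosKernel_neg_right (x y : ℝ) : cosKernel x (-y) = cosKernel x y := by
  unfold cosKernel
  rw [mul_neg, Real.cos_neg]

theorem integrable_cosKernel_mul {f : ℝ → ℂ} {μ : Measure ℝ} (hf : Integrable f μ) (y : ℝ) :
    Integrable (fun x => (cosKernel x y : ℂ) * f x) μ := by
  refine hf.bdd_mul (c := 2) ?_ ?_
  · exact (by unfold cosKernel; fun_prop : Continuous fun x : ℝ =>
      ((cosKernel x y : ℝ) : ℂ)).aestronglyMeasurable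
  · refine Filter.Eventually.of_forall fun x => ?_
    rw [Complex.norm_real]
    exact abs_cosKernel_le x y

/-- The cosine integral is the Fourier integral of the even extension. -/
theorem fourier_evenExt {f : ℝ → ℂ} (h1 : IntegrableOn f (Ioi 0)) (y : ℝ) :
    𝓕 (fun x => (Ioi (0 : ℝ)).indicator f x + (Ioi (0 : ℝ)).indicator f (-x)) y = cosInt f y := by
  have hi : Integrable ((Ioi (0 : ℝ)).indicator f) := h1.integrable_indicator measurableSet_Ioi
  rw [Real.fourier_real_eq_integral_exp_smul]
  have hb : ∀ z : ℝ, Integrable (fun x : ℝ =>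
      Complex.exp (↑(-2 * π * x * z) * Complex.I) * (Ioi (0 : ℝ)).indicator f x) := by
    intro z
    refine hi.bdd_mul (c := 1) ?_ ?_
    · exact (by fun_prop : Continuous fun x : ℝ =>
        Complex.exp (↑(-2 * π * x * z) * Complex.I)).aestronglyMeasurable
    · refine Filter.Eventually.of_forall fun x => ?_
      rw [Complex.norm_exp_ofReal_mul_I]
  have e1 := integral_neg_eq_self (fun x : ℝ =>
      Complex.exp (↑(-2 * π * x * (-y)) * Complex.I) * (Ioi (0 : ℝ)).indicator f x) volume
  have hb2 : Integrable (fun x : ℝ => Complex.exp (↑(-2 * π * x * y) * Complex.I) *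
      (Ioi (0 : ℝ)).indicator f (-x)) := by
    refine (hb (-y)).comp_neg.congr (Eventually.of_forall fun x => ?_)
    simp only [mul_neg, neg_mul, neg_neg]
  simp only [smul_eq_mul, mul_add]
  rw [integral_add (hb y) hb2]
  have e2 : ∫ x : ℝ, Complex.exp (↑(-2 * π * x * y) * Complex.I) *
      (Ioi (0 : ℝ)).indicator f (-x) = ∫ x : ℝ,
      Complex.exp (↑(-2 * π * x * (-y)) * Complex.I) * (Ioi (0 : ℝ)).indicator f x := by
    rw [← e1]
    congr 1
    ext x
    congr 3
    push_cast
    ring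
  rw [e2, ← integral_add (hb y) (hb (-y)), cosInt, ← integral_indicator measurableSet_Ioi]
  congr 1
  ext x
  by_cases hx : x ∈ Ioi (0 : ℝ)
  · simp only [indicator_of_mem hx]
    rw [← add_mul]
    congr 1
    unfold cosKernel
    push_cast
    rw [Complex.cos]
    ring_nf
  · simp [indicator_of_notMem hx]

theorem cosInt_neg (f : ℝ → ℂ) (y : ℝ) : cosInt f (-y) = cosInt f y := by
  simp only [cosInt, cosKernel_neg_right]

/-- Plancherel's identity for the cosine transform on `L¹ ∩ L²`. -/
theorem eLpNorm_cosInt {f : ℝ → ℂ} (h1 : IntegrableOn f (Ioi 0)) (h2 : MemLp f 2 ν₀) :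
    eLpNorm (cosInt f) 2 ν₀ = eLpNorm f 2 ν₀ := by
  set H : ℝ → ℂ := fun x => (Ioi (0 : ℝ)).indicator f x + (Ioi (0 : ℝ)).indicator f (-x) with hH
  have hi : Integrable ((Ioi (0 : ℝ)).indicator f) := h1.integrable_indicator measurableSet_Ioi
  have hm : MemLp ((Ioi (0 : ℝ)).indicator f) 2 volume :=
    (memLp_indicator_iff_restrict measurableSet_Ioi).2 h2
  have H1 : Integrable H := hi.add hi.comp_neg
  have H2 : MemLp H 2 volume :=
    hm.add (hm.comp_measurePreserving (Measure.measurePreserving_neg volume))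
  have e := eLpNorm_fourier H1 H2
  have e1 : 𝓕 H = cosInt f := funext fun y => fourier_evenExt h1 y
  rw [e1, eLpNorm_even (fun x => by rw [cosInt_neg]),
    eLpNorm_even (fun x => by simp only [hH]; rw [neg_neg, add_comm])] at e
  rw [ENNReal.mul_right_inj (by simp) (ENNReal.rpow_ne_top_of_nonneg (by norm_num) (by simp))] at e
  rw [e]
  refine eLpNorm_congr_ae ?_
  filter_upwards [ae_restrict_mem measurableSet_Ioi] with x hx
  have hx' : (0 : ℝ) < x := hx
  simp only [hH]
  rw [indicator_of_mem hx, indicator_of_notMem (by simp [hx'.le]), add_zero]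

theorem continuous_cosInt {f : ℝ → ℂ} (h1 : IntegrableOn f (Ioi 0)) : Continuous (cosInt f) := by
  refine continuous_of_dominated (bound := fun x => 2 * ‖f x‖) ?_ ?_ (h1.norm.const_mul 2) ?_
  · exact fun y => (integrable_cosKernel_mul h1 y).aestronglyMeasurable
  · refine fun y => Filter.Eventually.of_forall fun x => ?_
    rw [norm_mul, Complex.norm_real]
    exact mul_le_mul_of_nonneg_right (abs_cosKernel_le x y) (norm_nonneg _)
  · refine Filter.Eventually.of_forall fun x => ?_
    unfold cosKernel
    fun_prop

theorem cosTrunc_eq_cosInt (f : ℝ → ℂ) (R : ℝ) : cosTrunc f R = cosInt ((Iio R).indicator f) := by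
  ext y
  have : ∀ x, (cosKernel x y : ℂ) * (Iio R).indicator f x
      = (Iio R).indicator (fun x => (cosKernel x y : ℂ) * f x) x := fun x => by
    by_cases hx : x ∈ Iio R
    · simp [indicator_of_mem hx]
    · simp [indicator_of_notMem hx]
  simp only [cosTrunc, cosInt, this]
  rw [integral_indicator measurableSet_Iio, Measure.restrict_restrict measurableSet_Iio,
    inter_comm, Ioi_inter_Iio]

theorem memLp_indicator_Iio {f : ℝ → ℂ} (hf : MemLp f 2 ν₀) (R : ℝ) :
    MemLp ((Iio R).indicator f) 2 ν₀ := hf.indicator measurableSet_Iio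

theorem integrableOn_indicator_Iio {f : ℝ → ℂ} (hf : MemLp f 2 ν₀) (R : ℝ) :
    IntegrableOn ((Iio R).indicator f) (Ioi 0) := by
  rw [IntegrableOn, integrable_indicator_iff measurableSet_Iio, IntegrableOn,
    Measure.restrict_restrict measurableSet_Iio, inter_comm, Ioi_inter_Iio]
  have h1 : MemLp f 2 (volume.restrict (Ioo 0 R)) :=
    hf.mono_measure (Measure.restrict_mono (fun x hx => hx.1) le_rfl)
  exact h1.integrable (by norm_num)

theorem memLp_cosInt {f : ℝ → ℂ} (h1 : IntegrableOn f (Ioi 0)) (h2 : MemLp f 2 ν₀) :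
    MemLp (cosInt f) 2 ν₀ :=
  ⟨(continuous_cosInt h1).aestronglyMeasurable, by rw [eLpNorm_cosInt h1 h2]; exact h2.2⟩

theorem cosInt_sub {f g : ℝ → ℂ} (hf : IntegrableOn f (Ioi 0)) (hg : IntegrableOn g (Ioi 0)) :
    cosInt (fun x => f x - g x) = fun y => cosInt f y - cosInt g y := by
  ext y
  simp only [cosInt, mul_sub]
  exact integral_sub (integrable_cosKernel_mul hf y) (integrable_cosKernel_mul hg y)

/-- Truncations to sets which exhaust the line converge in `L²`. -/
theorem tendsto_truncate_of {E : Type*} [NormedAddCommGroup E] {μ : Measure ℝ} (f : ℝ → E)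
    (hf : MemLp f 2 μ) {S : ℝ → Set ℝ} (hS : ∀ R, MeasurableSet (S R))
    (h : ∀ᵐ x ∂μ, ∀ᶠ R in atTop, x ∈ S R) :
    Tendsto (fun R : ℝ => eLpNorm (fun x => f x - (S R).indicator f x) 2 μ) atTop (𝓝 0) := by
  have h0 : ∀ R : ℝ, eLpNorm (fun x => f x - (S R).indicator f x) 2 μ
      = (∫⁻ x, ‖f x - (S R).indicator f x‖ₑ ^ (2 : ℝ) ∂μ) ^ (1 / 2 : ℝ) := by
    intro R
    rw [eLpNorm_eq_lintegral_rpow_enorm_toReal (by norm_num) (by norm_num)]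
    simp
  simp only [h0]
  have hz : (0 : ℝ≥0∞) = 0 ^ (1 / 2 : ℝ) := by simp
  rw [hz]
  refine (ENNReal.continuous_rpow_const.tendsto _).comp ?_
  have hz' : (0 : ℝ≥0∞) = ∫⁻ _, 0 ∂μ := by simp
  rw [hz']
  refine tendsto_lintegral_filter_of_dominated_convergence' (fun x => ‖f x‖ₑ ^ (2 : ℝ)) ?_ ?_ ?_ ?_
  · exact Eventually.of_forall fun R =>
      ((hf.1.sub (hf.1.indicator (hS R))).enorm.pow_const _)
  · refine Eventually.of_forall fun R => Eventually.of_forall fun x => ?_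
    by_cases hx : x ∈ S R
    · simp [indicator_of_mem hx]
    · simp [indicator_of_notMem hx]
  · have := hf.2
    rw [eLpNorm_lt_top_iff_lintegral_rpow_enorm_lt_top (by norm_num) (by norm_num)] at this
    simpa using this.ne
  · filter_upwards [h] with x hx
    refine tendsto_const_nhds.congr' ?_
    filter_upwards [hx] with R hR
    rw [indicator_of_mem hR]
    simp

theorem tendsto_truncate {E : Type*} [NormedAddCommGroup E] {μ : Measure ℝ} (f : ℝ → E)
    (hf : MemLp f 2 μ) :
    Tendsto (fun R : ℝ => eLpNorm (fun x => f x - (Iio R).indicator f x) 2 μ) atTop (𝓝 0) :=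
  tendsto_truncate_of f hf (fun _ => measurableSet_Iio)
    (Eventually.of_forall fun x => eventually_gt_atTop x)

theorem IsCosineTransform.unique {f g g' : HalfLineL2} (h : IsCosineTransform f g)
    (h' : IsCosineTransform f g') : g = g' := by
  have hs := Tendsto.add (id h : Tendsto _ _ _) (id h' : Tendsto _ _ _)
  rw [add_zero] at hs
  have hc : ∀ R : ℝ, eLpNorm (fun y => g y - g' y) 2 ν₀ ≤
      eLpNorm (fun y => g y - cosTrunc f R y) 2 ν₀
        + eLpNorm (fun y => g' y - cosTrunc f R y) 2 ν₀ := by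
    intro R
    refine le_trans (le_of_eq ?_) (eLpNorm_sub_le
      ((Lp.aestronglyMeasurable g).sub (aestronglyMeasurable_cosTrunc f R _))
      ((Lp.aestronglyMeasurable g').sub (aestronglyMeasurable_cosTrunc f R _)) (by norm_num))
    congr 1
    ext y
    simp
  have h0 : eLpNorm (fun y => g y - g' y) 2 ν₀ = 0 :=
    le_antisymm (ge_of_tendsto' hs hc) (zero_le)
  replace h0 := (eLpNorm_eq_zero_iff ((Lp.aestronglyMeasurable g).sub
    (Lp.aestronglyMeasurable g')) (by norm_num)).1 h0
  refine Lp.ext ?_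
  filter_upwards [h0] with y hy
  exact sub_eq_zero.1 hy

theorem IsCosineTransform.exists_of (f : HalfLineL2) :
    ∃ g : HalfLineL2, IsCosineTransform f g ∧ ‖g‖ = ‖f‖ := by
  have hf := Lp.memLp f
  set T : ℝ → HalfLineL2 := fun R => (memLp_indicator_Iio hf R).toLp _ with hT
  set G : ℝ → HalfLineL2 := fun R =>
    (memLp_cosInt (integrableOn_indicator_Iio hf R) (memLp_indicator_Iio hf R)).toLp _ with hG
  have hTf : Tendsto T atTop (𝓝 f) := by
    rw [tendsto_iff_edist_tendsto_0]
    have h0 := tendsto_truncate f hf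
    refine h0.congr fun R => ?_
    rw [edist_comm, Lp.edist_def]
    refine eLpNorm_congr_ae ?_
    filter_upwards [(memLp_indicator_Iio hf R).coeFn_toLp] with x hx
    simp only [hT, Pi.sub_apply, hx]
  -- by Plancherel, `G` is Cauchy because `T` is
  have hd : ∀ R R' : ℝ, edist (G R) (G R') = edist (T R) (T R') := by
    intro R R'
    have e1 := cosInt_sub (integrableOn_indicator_Iio hf R) (integrableOn_indicator_Iio hf R')
    rw [Lp.edist_toLp_toLp, Lp.edist_toLp_toLp]
    have e2 := eLpNorm_cosInt
      ((integrableOn_indicator_Iio hf R).sub (integrableOn_indicator_Iio hf R'))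
      ((memLp_indicator_Iio hf R).sub (memLp_indicator_Iio hf R'))
    rw [← e2]
    congr 1
    exact e1.symm
  have hn : ∀ R, ‖G R‖ = ‖T R‖ := by
    intro R
    rw [Lp.norm_toLp, Lp.norm_toLp,
      eLpNorm_cosInt (integrableOn_indicator_Iio hf R) (memLp_indicator_Iio hf R)]
  have hGc : Cauchy (map G atTop) := by
    have hc : Cauchy (map T atTop) := hTf.cauchy_map
    rw [EMetric.cauchy_iff] at hc ⊢
    refine ⟨(inferInstance : NeBot (map G atTop)).ne, fun e he => ?_⟩
    obtain ⟨t, ht, H⟩ := hc.2 e he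
    refine ⟨G '' (T ⁻¹' t), image_mem_map ht, ?_⟩
    rintro _ ⟨R, hR, rfl⟩ _ ⟨R', hR', rfl⟩
    rw [hd]
    exact H _ hR _ hR'
  obtain ⟨g, hg⟩ := CompleteSpace.complete hGc
  have hg : Tendsto G atTop (𝓝 g) := hg
  refine ⟨g, ?_, ?_⟩
  · rw [tendsto_iff_edist_tendsto_0] at hg
    unfold IsCosineTransform
    refine hg.congr fun R => ?_
    rw [edist_comm, Lp.edist_def]
    refine eLpNorm_congr_ae ?_
    filter_upwards [(memLp_cosInt (integrableOn_indicator_Iio hf R)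
      (memLp_indicator_Iio hf R)).coeFn_toLp] with y hy
    simp only [hG, Pi.sub_apply]
    rw [hy, cosTrunc_eq_cosInt]
  · refine tendsto_nhds_unique hg.norm ?_
    simp only [hn]
    exact hTf.norm

/-- The cosine transform as a linear isometry of `L²(0,∞)`. -/
def cosT : HalfLineL2 →ₗᵢ[ℂ] HalfLineL2 where
  toFun f := (IsCosineTransform.exists_of f).choose
  map_add' f f' := (IsCosineTransform.exists_of (f + f')).choose_spec.1.unique
    ((IsCosineTransform.exists_of f).choose_spec.1.add
      (IsCosineTransform.exists_of f').choose_spec.1)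
  map_smul' c f := (IsCosineTransform.exists_of (c • f)).choose_spec.1.unique
    ((IsCosineTransform.exists_of f).choose_spec.1.smul c)
  norm_map' f := (IsCosineTransform.exists_of f).choose_spec.2

theorem isCosineTransform_cosT (f : HalfLineL2) : IsCosineTransform f (cosT f) :=
  (IsCosineTransform.exists_of f).choose_spec.1

theorem isCosineTransform_iff {f g : HalfLineL2} : IsCosineTransform f g ↔ g = cosT f :=
  ⟨fun h => h.unique (isCosineTransform_cosT f), fun h => h ▸ isCosineTransform_cosT f⟩

theorem mem_K_iff {a : ℝ} {f : HalfLineL2} :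
    f ∈ K a ↔ VanishesBelow a f ∧ VanishesBelow a (cosT f) := by
  constructor
  · rintro ⟨h, g, hg, hga⟩
    rw [isCosineTransform_iff] at hg
    exact ⟨h, hg ▸ hga⟩
  · rintro ⟨h, h'⟩
    exact ⟨h, cosT f, isCosineTransform_cosT f, h'⟩

/-- On integrable functions the cosine transform is given by the cosine integral. -/
theorem cosT_ae_eq (f : HalfLineL2) (hf : IntegrableOn f (Ioi 0)) :
    cosT f =ᵐ[ν₀] cosInt f := by
  have h := isCosineTransform_cosT f
  have h' : Tendsto (fun R : ℝ => eLpNorm (fun y => cosInt f y - cosTrunc f R y) 2 ν₀)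
      atTop (𝓝 0) := by
    refine (tendsto_truncate f (Lp.memLp f)).congr fun R => ?_
    rw [cosTrunc_eq_cosInt]
    have e := cosInt_sub hf (integrableOn_indicator_Iio (Lp.memLp f) R)
    rw [← e]
    exact (eLpNorm_cosInt (hf.sub (integrableOn_indicator_Iio (Lp.memLp f) R))
      ((Lp.memLp f).sub (memLp_indicator_Iio (Lp.memLp f) R))).symm
  have hm := memLp_cosInt hf (Lp.memLp f)
  have : IsCosineTransform f (hm.toLp _) := by
    refine h'.congr fun R => eLpNorm_congr_ae ?_
    filter_upwards [hm.coeFn_toLp] with y hy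
    rw [hy]
  rw [h.unique this]
  exact hm.coeFn_toLp

theorem inner_L2_eq (f g : HalfLineL2) :
    ⟪f, g⟫ = ∫ x in Ioi (0 : ℝ), g x * conj (f x) := by
  rw [L2.inner_def]
  rfl

/-- The truncation `f 1_{(-∞,R)}` as an element of `L²(0,∞)`. -/
def truncL2 (f : HalfLineL2) (R : ℝ) : HalfLineL2 :=
  (memLp_indicator_Iio (Lp.memLp f) R).toLp _

theorem truncL2_ae_eq (f : HalfLineL2) (R : ℝ) : truncL2 f R =ᵐ[ν₀] (Iio R).indicator f :=
  (memLp_indicator_Iio (Lp.memLp f) R).coeFn_toLp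

theorem integrableOn_truncL2 (f : HalfLineL2) (R : ℝ) : IntegrableOn (truncL2 f R) (Ioi 0) :=
  (integrableOn_indicator_Iio (Lp.memLp f) R).congr (truncL2_ae_eq f R).symm

theorem tendsto_truncL2 (f : HalfLineL2) : Tendsto (truncL2 f) atTop (𝓝 f) := by
  rw [tendsto_iff_edist_tendsto_0]
  refine (tendsto_truncate f (Lp.memLp f)).congr fun R => ?_
  rw [edist_comm, Lp.edist_def]
  refine eLpNorm_congr_ae ?_
  filter_upwards [truncL2_ae_eq f R] with x hx
  simp only [Pi.sub_apply, hx]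

/-- The cosine transform is symmetric; the kernel is symmetric and bounded, so on integrable
functions this is Fubini's theorem. -/
theorem inner_cosT_left (f g : HalfLineL2) : ⟪cosT f, g⟫ = ⟪f, cosT g⟫ := by
  have key : ∀ f g : HalfLineL2, IntegrableOn f (Ioi 0) → IntegrableOn g (Ioi 0) →
      ⟪cosT f, g⟫ = ⟪f, cosT g⟫ := by
    intro f g hf hg
    rw [inner_L2_eq, inner_L2_eq]
    have e1 : ∫ y in Ioi (0 : ℝ), g y * conj (cosT f y)
        = ∫ y in Ioi (0 : ℝ), ∫ x in Ioi (0 : ℝ),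
          (cosKernel x y : ℂ) * (conj (f x) * g y) := by
      refine integral_congr_ae ?_
      filter_upwards [cosT_ae_eq f hf] with y hy
      rw [hy, cosInt, ← integral_conj, ← integral_const_mul]
      congr 1
      ext x
      simp only [map_mul, Complex.conj_ofReal]
      ring
    have e2 : ∫ x in Ioi (0 : ℝ), cosT g x * conj (f x)
        = ∫ x in Ioi (0 : ℝ), ∫ y in Ioi (0 : ℝ),
          (cosKernel x y : ℂ) * (conj (f x) * g y) := by
      refine integral_congr_ae ?_
      filter_upwards [cosT_ae_eq g hg] with x hx
      rw [hx, cosInt, ← integral_mul_const]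
      congr 1
      ext y
      rw [cosKernel_comm]
      ring
    rw [e1, e2]
    refine integral_integral_swap ?_
    have hfi : Integrable (fun x => conj (f x)) ν₀ :=
      (Complex.conjCLE.toContinuousLinearMap).integrable_comp hf
    have h1 : Integrable (fun p : ℝ × ℝ => conj (f p.2) * g p.1) (Measure.prod ν₀ ν₀) := by
      refine (hg.mul_prod hfi).congr (Eventually.of_forall fun p => ?_)
      simp only
      ring
    refine h1.bdd_mul (c := 2) ?_ (Eventually.of_forall fun p => ?_)
    · exact (Complex.continuous_ofReal.comp
        (continuous_cosKernel.comp continuous_swap)).aestronglyMeasurable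
    · rw [Complex.norm_real]
      exact abs_cosKernel_le _ _
  have h1 : Tendsto (fun R => ⟪cosT (truncL2 f R), truncL2 g R⟫) atTop (𝓝 ⟪cosT f, g⟫) :=
    ((cosT.continuous.tendsto f).comp (tendsto_truncL2 f)).inner (tendsto_truncL2 g)
  have h2 : Tendsto (fun R => ⟪truncL2 f R, cosT (truncL2 g R)⟫) atTop (𝓝 ⟪f, cosT g⟫) :=
    (tendsto_truncL2 f).inner ((cosT.continuous.tendsto g).comp (tendsto_truncL2 g))
  refine tendsto_nhds_unique h1 (h2.congr fun R => ?_)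
  exact (key _ _ (integrableOn_truncL2 f R) (integrableOn_truncL2 g R)).symm

theorem cosT_cosT (f : HalfLineL2) : cosT (cosT f) = f := by
  refine ext_inner_right ℂ fun g => ?_
  rw [inner_cosT_left, cosT.inner_map_map]

theorem cosT_mem_K {a : ℝ} {f : HalfLineL2} (hf : f ∈ K a) : cosT f ∈ K a := by
  rw [mem_K_iff] at hf ⊢
  rw [cosT_cosT]
  exact ⟨hf.2, hf.1⟩

/-! ### Absolutely continuous complex functions -/

theorem AbsolutelyContinuousOnInterval.of_dist_le {X Y : Type*} [PseudoMetricSpace X]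
    [PseudoMetricSpace Y] {F : ℝ → X} {f g : ℝ → Y} {a b : ℝ}
    (hf : AbsolutelyContinuousOnInterval f a b) (hg : AbsolutelyContinuousOnInterval g a b)
    (h : ∀ x y, dist (F x) (F y) ≤ dist (f x) (f y) + dist (g x) (g y)) :
    AbsolutelyContinuousOnInterval F a b := by
  have hs := Tendsto.add (id hf : Tendsto _ _ _) (id hg : Tendsto _ _ _)
  rw [add_zero] at hs
  refine squeeze_zero (fun E => Finset.sum_nonneg fun _ _ => dist_nonneg) (fun E => ?_) hs
  rw [← Finset.sum_add_distrib]
  exact Finset.sum_le_sum fun i _ => h _ _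

theorem ac_re {F : ℝ → ℂ} {a b : ℝ} (hF : AbsolutelyContinuousOnInterval F a b) :
    AbsolutelyContinuousOnInterval (fun x => (F x).re) a b :=
  AbsolutelyContinuousOnInterval.of_dist_le hF hF fun x y => by
    have h1 : dist (F x).re (F y).re ≤ dist (F x) (F y) := by
      rw [Real.dist_eq, dist_eq_norm, ← Complex.sub_re]
      exact Complex.abs_re_le_norm _
    linarith [dist_nonneg (x := F x) (y := F y)]

theorem ac_im {F : ℝ → ℂ} {a b : ℝ} (hF : AbsolutelyContinuousOnInterval F a b) :
    AbsolutelyContinuousOnInterval (fun x => (F x).im) a b :=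
  AbsolutelyContinuousOnInterval.of_dist_le hF hF fun x y => by
    have h1 : dist (F x).im (F y).im ≤ dist (F x) (F y) := by
      rw [Real.dist_eq, dist_eq_norm, ← Complex.sub_im]
      exact Complex.abs_im_le_norm _
    linarith [dist_nonneg (x := F x) (y := F y)]

theorem ac_of_re_im {F : ℝ → ℂ} {a b : ℝ}
    (h1 : AbsolutelyContinuousOnInterval (fun x => (F x).re) a b)
    (h2 : AbsolutelyContinuousOnInterval (fun x => (F x).im) a b) :
    AbsolutelyContinuousOnInterval F a b :=
  AbsolutelyContinuousOnInterval.of_dist_le h1 h2 fun x y => by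
    rw [Real.dist_eq, Real.dist_eq, dist_eq_norm, ← Complex.sub_re, ← Complex.sub_im]
    exact Complex.norm_le_abs_re_add_abs_im _

theorem intervalIntegrable_ofReal {f : ℝ → ℝ} {a b : ℝ} (h : IntervalIntegrable f volume a b) :
    IntervalIntegrable (fun x => (f x : ℂ)) volume a b :=
  ⟨h.1.ofReal, h.2.ofReal⟩

/-- The fundamental theorem of calculus for absolutely continuous complex functions. -/
theorem ac_ftc {F : ℝ → ℂ} {a b : ℝ} (hF : AbsolutelyContinuousOnInterval F a b) :
    IntervalIntegrable (deriv F) volume a b ∧ ∫ t in a..b, deriv F t = F b - F a := by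
  have hr := ac_re hF
  have hi := ac_im hF
  have hd : ∀ᵐ x, x ∈ uIcc a b → deriv F x =
      ((deriv (fun x => (F x).re) x : ℝ) : ℂ) + ((deriv (fun x => (F x).im) x : ℝ) : ℂ)
        * Complex.I := by
    filter_upwards [hF.boundedVariationOn.ae_differentiableAt_of_mem_uIcc] with x hx hxm
    have hh := (hx hxm).hasDerivAt
    have h1 : HasDerivAt (fun x => (F x).re) (deriv F x).re x :=
      (Complex.reCLM.hasFDerivAt.comp_hasDerivAt x hh)
    have h2 : HasDerivAt (fun x => (F x).im) (deriv F x).im x :=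
      (Complex.imCLM.hasFDerivAt.comp_hasDerivAt x hh)
    rw [h1.deriv, h2.deriv, Complex.re_add_im]
  have hir : IntervalIntegrable (fun x => ((deriv (fun x => (F x).re) x : ℝ) : ℂ)) volume a b :=
    intervalIntegrable_ofReal hr.intervalIntegrable_deriv
  have hii : IntervalIntegrable (fun x => ((deriv (fun x => (F x).im) x : ℝ) : ℂ)
      * Complex.I) volume a b :=
    (intervalIntegrable_ofReal hi.intervalIntegrable_deriv).mul_const _
  constructor
  · refine (hir.add hii).congr_ae ?_
    rw [EventuallyEq, ae_restrict_iff' measurableSet_uIoc]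
    filter_upwards [hd] with x hx hm
    rw [hx (uIoc_subset_uIcc hm)]
  · have e : ∫ t in a..b, deriv F t = ∫ t in a..b,
      (((deriv (fun x => (F x).re) t : ℝ) : ℂ) + ((deriv (fun x => (F x).im) t : ℝ) : ℂ)
        * Complex.I) := by
      refine intervalIntegral.integral_congr_ae ?_
      filter_upwards [hd] with x hx hm
      exact hx (uIoc_subset_uIcc hm)
    rw [e, intervalIntegral.integral_add hir hii, intervalIntegral.integral_mul_const,
      intervalIntegral.integral_ofReal, intervalIntegral.integral_ofReal,
      hr.integral_deriv_eq_sub, hi.integral_deriv_eq_sub]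
    apply Complex.ext <;> simp

theorem ac_integral {g : ℝ → ℂ} {a b c : ℝ} (h : IntervalIntegrable g volume a b)
    (hc : c ∈ uIcc a b) :
    AbsolutelyContinuousOnInterval (fun x => ∫ v in c..x, g v) a b := by
  have hcx : ∀ x ∈ uIcc a b, IntervalIntegrable g volume c x := fun x hx =>
    h.mono_set (uIcc_subset_uIcc hc hx)
  have hr : IntervalIntegrable (fun x => (g x).re) volume a b :=
    ⟨h.1.re, h.2.re⟩
  have hi : IntervalIntegrable (fun x => (g x).im) volume a b :=
    ⟨h.1.im, h.2.im⟩
  have h1 := hr.absolutelyContinuousOnInterval_intervalIntegral hc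
  have h2 := hi.absolutelyContinuousOnInterval_intervalIntegral hc
  have key : ∀ x ∈ uIcc a b, ∫ v in c..x, g v =
      ((∫ v in c..x, (g v).re : ℝ) : ℂ) + ((∫ v in c..x, (g v).im : ℝ) : ℂ) * Complex.I := by
    intro x hx
    have hg := hcx x hx
    have hgr : IntervalIntegrable (fun x => ((g x).re : ℂ)) volume c x :=
      intervalIntegrable_ofReal ⟨hg.1.re, hg.2.re⟩
    have hgi : IntervalIntegrable (fun x => ((g x).im : ℂ)) volume c x :=
      intervalIntegrable_ofReal ⟨hg.1.im, hg.2.im⟩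
    rw [← intervalIntegral.integral_ofReal, ← intervalIntegral.integral_ofReal,
      ← intervalIntegral.integral_mul_const,
      ← intervalIntegral.integral_add hgr (hgi.mul_const _)]
    simp only [Complex.re_add_im]
  have hA : AbsolutelyContinuousOnInterval (fun x => ((∫ v in c..x, (g v).re : ℝ) : ℂ) +
      ((∫ v in c..x, (g v).im : ℝ) : ℂ) * Complex.I) a b :=
    ac_of_re_im (by simpa using h1) (by simpa using h2)
  rw [absolutelyContinuousOnInterval_iff] at hA ⊢
  intro ε hε
  obtain ⟨δ, hδ, H⟩ := hA ε hε
  refine ⟨δ, hδ, fun E hE hE' => ?_⟩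
  refine lt_of_eq_of_lt (Finset.sum_congr rfl fun i hi => ?_) (H E hE hE')
  rw [key _ (hE.1 i hi).1, key _ (hE.1 i hi).2]

theorem LocallyAC.ftc {F : ℝ → ℂ} {s : Set ℝ} (hF : LocallyAC F s) {x y : ℝ} (hxy : x ≤ y)
    (hs : Icc x y ⊆ s) :
    IntervalIntegrable (deriv F) volume x y ∧ ∫ t in x..y, deriv F t = F y - F x :=
  ac_ftc (hF x y hxy hs)

theorem locallyAC_of_integral {F g : ℝ → ℂ} {s : Set ℝ}
    (h : ∀ x y, x ≤ y → Icc x y ⊆ s →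
      IntervalIntegrable g volume x y ∧ F y - F x = ∫ t in x..y, g t) : LocallyAC F s := by
  intro x y hxy hs
  have h1 := ac_integral (h x y hxy hs).1 left_mem_uIcc
  rw [absolutelyContinuousOnInterval_iff] at h1 ⊢
  intro ε hε
  obtain ⟨δ, hδ, H⟩ := h1 ε hε
  refine ⟨δ, hδ, fun E hE hE' => ?_⟩
  refine lt_of_eq_of_lt (Finset.sum_congr rfl fun i hi => ?_) (H E hE hE')
  have key : ∀ z ∈ uIcc x y, F z = F x + ∫ t in x..z, g t := by
    intro z hz
    rw [uIcc_of_le hxy] at hz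
    rw [← (h x z hz.1 ((Icc_subset_Icc_right hz.2).trans hs)).2]
    ring
  rw [key _ (hE.1 i hi).1, key _ (hE.1 i hi).2, dist_add_left]

theorem ae_Ioi_of_Ioo {P : ℝ → Prop} {c : ℝ}
    (h : ∀ p q, c < p → p < q → ∀ᵐ x : ℝ, x ∈ Ioo p q → P x) :
    ∀ᵐ x ∂(volume.restrict (Ioi c)), P x := by
  rw [ae_restrict_iff' measurableSet_Ioi]
  have h' : ∀ n : ℕ, ∀ᵐ x : ℝ, x ∈ Ioo (c + 1 / (n + 1 : ℝ)) (c + 2 + n) → P x := by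
    intro n
    have h1 : 1 / (n + 1 : ℝ) ≤ 1 := by
      rw [div_le_one (by positivity)]
      linarith [(Nat.cast_nonneg n : (0 : ℝ) ≤ n)]
    have h2 : (0 : ℝ) < 1 / (n + 1 : ℝ) := by positivity
    exact h _ _ (by linarith) (by linarith [(Nat.cast_nonneg n : (0 : ℝ) ≤ n)])
  rw [← ae_all_iff] at h'
  filter_upwards [h'] with x hx hxc
  obtain ⟨n, hn⟩ := exists_nat_one_div_lt (sub_pos.mpr hxc : 0 < x - c)
  obtain ⟨m, hm⟩ := exists_nat_ge (x - c)
  refine hx (max n m) ⟨?_, ?_⟩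
  · have h1 : (1 : ℝ) / ((max n m : ℕ) + 1) ≤ 1 / (n + 1) := by
      apply one_div_le_one_div_of_le (by positivity)
      have : (n : ℝ) ≤ (max n m : ℕ) := by exact_mod_cast le_max_left n m
      linarith
    linarith
  · have h2 : (m : ℝ) ≤ (max n m : ℕ) := by exact_mod_cast le_max_right n m
    linarith

theorem ae_hasDerivAt_of_integral {F g : ℝ → ℂ} {c : ℝ}
    (h : ∀ x y, c < x → x ≤ y →
      IntervalIntegrable g volume x y ∧ F y - F x = ∫ t in x..y, g t) :
    ∀ᵐ x ∂(volume.restrict (Ioi c)), HasDerivAt F (g x) x := by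
  refine ae_Ioi_of_Ioo fun p q hp hpq => ?_
  filter_upwards [(h p q hp hpq.le).1.ae_hasDerivAt_integral] with x hx hxm
  have h1 := (hx (by rw [uIcc_of_le hpq.le]; exact Ioo_subset_Icc_self hxm) p left_mem_uIcc)
  refine (h1.const_add (F p)).congr_of_eventuallyEq ?_
  filter_upwards [isOpen_Ioo.mem_nhds hxm] with z hz
  rw [← (h p z hp hz.1.le).2]
  ring

/-- Integration by parts for absolutely continuous complex functions. -/
theorem ac_integral_mul {F G : ℝ → ℂ} {a b : ℝ} (hF : AbsolutelyContinuousOnInterval F a b)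
    (hG : AbsolutelyContinuousOnInterval G a b) :
    IntervalIntegrable (fun x => deriv F x * G x + F x * deriv G x) volume a b ∧
    ∫ x in a..b, (deriv F x * G x + F x * deriv G x) = F b * G b - F a * G a := by
  have hFG : AbsolutelyContinuousOnInterval (fun x => F x * G x) a b := hF.smul hG
  constructor
  · exact ((ac_ftc hF).1.mul_continuousOn hG.continuousOn).add
      ((ac_ftc hG).1.continuousOn_mul hF.continuousOn)
  · rw [← (ac_ftc hFG).2]
    apply intervalIntegral.integral_congr_ae
    filter_upwards [hF.boundedVariationOn.ae_differentiableAt_of_mem_uIcc,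
      hG.boundedVariationOn.ae_differentiableAt_of_mem_uIcc] with x h1 h2 hm
    have hm' := uIoc_subset_uIcc hm
    exact ((h1 hm').hasDerivAt.mul (h2 hm').hasDerivAt).deriv.symm

theorem LocallyAC.mul {F G : ℝ → ℂ} {s : Set ℝ} (hF : LocallyAC F s) (hG : LocallyAC G s) :
    LocallyAC (fun x => F x * G x) s := fun x y h hs => (hF x y h hs).smul (hG x y h hs)

theorem LocallyAC.of_contDiff {F : ℝ → ℂ} {s : Set ℝ} (h : ContDiffOn ℝ 1 F s) :
    LocallyAC F s := fun x y hxy hs =>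
  (h.mono (by rwa [uIcc_of_le hxy])).absolutelyContinuousOnInterval

/-! ### The truncated cosine kernel does not have the eigenvalues `±1` -/

theorem integrable_Ioo_of_continuous {f : ℝ → ℂ} (hf : Continuous f) (p q : ℝ) :
    IntegrableOn f (Ioo p q) :=
  (hf.integrableOn_Icc (a := p) (b := q)).mono_set Ioo_subset_Icc_self

/-- The cosine integral over a bounded interval extends to an entire function. -/
theorem differentiable_cosIntegral {d : ℝ → ℂ} {b : ℝ} (hd : IntegrableOn d (Ioo 0 b)) :
    Differentiable ℂ fun z : ℂ => ∫ x in Ioo 0 b, 2 * Complex.cos (2 * π * x * z) * d x := by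
  intro z₀
  have hmeas : ∀ z : ℂ, Continuous fun x : ℝ => 2 * Complex.cos (2 * π * x * z) :=
    fun z => by fun_prop
  have hmeas' : ∀ z : ℂ, Continuous fun x : ℝ =>
      -(2 * Complex.sin (2 * π * x * z) * (2 * π * x)) := fun z => by fun_prop
  obtain ⟨C, hC⟩ : ∃ C : ℝ, ∀ p ∈ Icc (0 : ℝ) b ×ˢ Metric.closedBall z₀ 1,
      ‖-(2 * Complex.sin (2 * π * p.1 * p.2) * (2 * π * p.1))‖ ≤ C :=
    (isCompact_Icc.prod (isCompact_closedBall z₀ 1)).exists_bound_of_continuousOn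
      (f := fun p : ℝ × ℂ => -(2 * Complex.sin (2 * π * p.1 * p.2) * (2 * π * p.1)))
      (by fun_prop)
  have hb : ∀ z : ℂ, Integrable (fun x : ℝ => 2 * Complex.cos (2 * π * x * z) * d x)
      (volume.restrict (Ioo 0 b)) := by
    intro z
    obtain ⟨C', hC'⟩ := isCompact_Icc.exists_bound_of_continuousOn (s := Icc (0 : ℝ) b)
      (hmeas z).continuousOn
    refine hd.bdd_mul (c := C') (hmeas z).aestronglyMeasurable ?_
    filter_upwards [ae_restrict_mem measurableSet_Ioo] with x hx
    exact hC' x (Ioo_subset_Icc_self hx)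
  refine (hasDerivAt_integral_of_dominated_loc_of_deriv_le (F' := fun z x =>
    -(2 * Complex.sin (2 * π * x * z) * (2 * π * x)) * d x)
    (bound := fun x => C * ‖d x‖) (Metric.closedBall_mem_nhds z₀ one_pos)
    (Eventually.of_forall fun z => (hb z).aestronglyMeasurable) (hb z₀)
    ((hmeas' z₀).aestronglyMeasurable.mul hd.aestronglyMeasurable) ?_
    (hd.norm.const_mul C) ?_).2.differentiableAt
  · filter_upwards [ae_restrict_mem measurableSet_Ioo] with x hx z hz
    rw [norm_mul]
    exact mul_le_mul_of_nonneg_right (hC (x, z) ⟨Ioo_subset_Icc_self hx, hz⟩) (norm_nonneg _)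
  · refine Eventually.of_forall fun x z _ => ?_
    refine HasDerivAt.mul_const ?_ _
    have h1 : HasDerivAt (fun z : ℂ => 2 * π * x * z) (2 * π * x) z := by
      simpa using (hasDerivAt_id z).const_mul (2 * π * x : ℂ)
    convert (h1.ccos.const_mul 2) using 1
    ring

/-- The identity theorem for the entire function of `differentiable_cosIntegral`. -/
theorem cosIntegral_eq_zero {d : ℝ → ℂ} {b : ℝ} (hd : IntegrableOn d (Ioo 0 b))
    (h : ∀ y > b, ∫ x in Ioo 0 b, (cosKernel x y : ℂ) * d x = 0) (y : ℝ) :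
    ∫ x in Ioo 0 b, (cosKernel x y : ℂ) * d x = 0 := by
  set H : ℂ → ℂ := fun z => ∫ x in Ioo 0 b, 2 * Complex.cos (2 * π * x * z) * d x with hH
  have hreal : ∀ y : ℝ, ∫ x in Ioo 0 b, (cosKernel x y : ℂ) * d x = H y := by
    intro y
    simp only [hH, cosKernel]
    push_cast
    rfl
  have hA : AnalyticOnNhd ℂ H univ := fun z _ =>
    (differentiable_cosIntegral hd).differentiableOn.analyticAt univ_mem
  have hfr : ∃ᶠ z in 𝓝[≠] ((b + 1 : ℝ) : ℂ), H z = 0 := by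
    have ht : Tendsto (fun t : ℝ => (t : ℂ)) (𝓝[≠] (b + 1)) (𝓝[≠] ((b + 1 : ℝ) : ℂ)) := by
      refine tendsto_nhdsWithin_of_tendsto_nhds_of_eventually_within _
        (Complex.continuous_ofReal.continuousAt.tendsto.mono_left nhdsWithin_le_nhds) ?_
      filter_upwards [self_mem_nhdsWithin] with t ht
      intro h
      exact ht (Complex.ofReal_injective h)
    refine ht.frequently (Eventually.frequently ?_)
    filter_upwards [mem_nhdsWithin_of_mem_nhds (isOpen_Ioi.mem_nhds
      (show b + 1 ∈ Ioi b by simp))] with t ht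
    rw [← hreal]
    exact h t ht
  rw [hreal]
  exact hA.eqOn_zero_of_preconnected_of_frequently_eq_zero isPreconnected_univ (mem_univ _) hfr
    (mem_univ _)

theorem lintegral_sq_eq_of_norm_eq {f g : HalfLineL2} (h : ‖f‖ = ‖g‖) :
    ∫⁻ x in Ioi (0 : ℝ), ‖f x‖ₑ ^ (2 : ℝ) = ∫⁻ x in Ioi (0 : ℝ), ‖g x‖ₑ ^ (2 : ℝ) := by
  rw [Lp.norm_def, Lp.norm_def, ENNReal.toReal_eq_toReal_iff' (Lp.eLpNorm_ne_top _)
    (Lp.eLpNorm_ne_top _), eLpNorm_eq_lintegral_rpow_enorm_toReal (by norm_num) (by norm_num),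
    eLpNorm_eq_lintegral_rpow_enorm_toReal (by norm_num) (by norm_num)] at h
  have := congrArg (fun t : ℝ≥0∞ => t ^ (2 : ℝ)) h
  simp only [← ENNReal.rpow_mul] at this
  simpa using this

/-- A function on `(0,b)` which is an eigenfunction of the truncated cosine kernel for the
eigenvalue `±1` vanishes: its cosine transform has the same norm on `(0,b)` as on `(0,∞)`, hence
vanishes beyond `b`, while it is the restriction of an entire function. -/
theorem eq_zero_of_cosKernel_eigen {ε b : ℝ} (hε : ε * ε = 1) {d : ℝ → ℝ}
    (hd : Continuous d)
    (h : ∀ x ∈ Ioo 0 b, d x + ε * ∫ y in Ioo 0 b, cosKernel x y * d y = 0) :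
    ∀ x ∈ Ioo 0 b, d x = 0 := by
  have hdc : Continuous fun x => (d x : ℂ) := Complex.continuous_ofReal.comp hd
  have hdI := integrable_Ioo_of_continuous hdc 0 b
  set f : ℝ → ℂ := (Iio b).indicator fun x => (d x : ℂ) with hf
  have hb' : ∀ x ∈ Ioo 0 b, (d x : ℂ) = -ε * ∫ y in Ioo 0 b, (cosKernel y x : ℂ) * d y := by
    intro x hx
    have h1 := h x hx
    have e1 : ∫ y in Ioo 0 b, (cosKernel y x : ℂ) * d y
        = ((∫ y in Ioo 0 b, cosKernel x y * d y : ℝ) : ℂ) := by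
      rw [← integral_complex_ofReal]
      congr 1
      ext y
      rw [cosKernel_comm]
      push_cast
      rfl
    rw [e1, eq_neg_of_add_eq_zero_left h1]
    push_cast
    ring
  have hm : MemLp f 2 ν₀ := by
    rw [hf, memLp_indicator_iff_restrict measurableSet_Iio,
      Measure.restrict_restrict measurableSet_Iio, inter_comm, Ioi_inter_Iio]
    obtain ⟨C, hC⟩ := (isCompact_Icc (a := (0 : ℝ)) (b := b)).exists_bound_of_continuousOn
      hdc.continuousOn
    refine MemLp.of_bound hdc.aestronglyMeasurable C ?_
    filter_upwards [ae_restrict_mem measurableSet_Ioo] with x hx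
    exact hC x (Ioo_subset_Icc_self hx)
  have hi : IntegrableOn f (Ioi 0) := by
    rw [IntegrableOn, hf, integrable_indicator_iff measurableSet_Iio, IntegrableOn,
      Measure.restrict_restrict measurableSet_Iio, inter_comm, Ioi_inter_Iio]
    exact hdI
  set F : HalfLineL2 := hm.toLp f with hF
  have hFf : F =ᵐ[ν₀] f := hm.coeFn_toLp
  have hcI : cosInt f = fun y => ∫ x in Ioo 0 b, (cosKernel x y : ℂ) * d x := by
    rw [hf, ← cosTrunc_eq_cosInt]
    rfl
  have hCF : cosT F =ᵐ[ν₀] cosInt f := by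
    refine (cosT_ae_eq F (hi.congr hFf.symm)).trans (Eventually.of_forall fun y => ?_)
    refine integral_congr_ae ?_
    filter_upwards [hFf] with x hx
    rw [hx]
  have hcont := continuous_cosInt hi
  have hn := lintegral_sq_eq_of_norm_eq (cosT.norm_map F)
  have h1 : ∫⁻ x in Ioi (0 : ℝ), ‖cosT F x‖ₑ ^ (2 : ℝ)
      = ∫⁻ x in Ioi (0 : ℝ), ‖cosInt f x‖ₑ ^ (2 : ℝ) :=
    lintegral_congr_ae (by filter_upwards [hCF] with x hx; rw [hx])
  have h2 : ∫⁻ x in Ioi (0 : ℝ), ‖F x‖ₑ ^ (2 : ℝ)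
      = ∫⁻ x in Ioi (0 : ℝ), (Iio b).indicator (fun x => ‖cosInt f x‖ₑ ^ (2 : ℝ)) x := by
    refine lintegral_congr_ae ?_
    filter_upwards [hFf, ae_restrict_mem measurableSet_Ioi] with x hx hx0
    rw [hx, hf]
    by_cases hxb : x ∈ Iio b
    · rw [indicator_of_mem hxb, indicator_of_mem hxb, ← hf, hcI, hb' x ⟨hx0, hxb⟩]
      rw [enorm_mul]
      have : ‖(-ε : ℂ)‖ₑ = 1 := by
        rw [← ofReal_norm, norm_neg, Complex.norm_real, Real.norm_eq_abs]
        have : |ε| = 1 := by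
          have := abs_mul_abs_self ε
          nlinarith [abs_nonneg ε]
        simp [this]
      rw [this, one_mul]
    · rw [indicator_of_notMem hxb, indicator_of_notMem hxb]
      simp
  -- the norm of `C F` is exhausted by `(0,b)`, where `|C F| = |F|`
  have h3 : ∫⁻ x in Ioi (0 : ℝ), (Iio b)ᶜ.indicator (fun x => ‖cosInt f x‖ₑ ^ (2 : ℝ)) x = 0 := by
    have hsplit : ∫⁻ x in Ioi (0 : ℝ), ‖cosInt f x‖ₑ ^ (2 : ℝ) =
        (∫⁻ x in Ioi (0 : ℝ), (Iio b).indicator (fun x => ‖cosInt f x‖ₑ ^ (2 : ℝ)) x) +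
        ∫⁻ x in Ioi (0 : ℝ), (Iio b)ᶜ.indicator (fun x => ‖cosInt f x‖ₑ ^ (2 : ℝ)) x := by
      rw [lintegral_indicator measurableSet_Iio, lintegral_indicator measurableSet_Iio.compl,
        lintegral_add_compl _ measurableSet_Iio]
    have hfin : ∫⁻ x in Ioi (0 : ℝ), (Iio b).indicator (fun x => ‖cosInt f x‖ₑ ^ (2 : ℝ)) x
        ≠ ⊤ := by
      rw [← h2]
      have := (Lp.memLp F).2
      rw [eLpNorm_lt_top_iff_lintegral_rpow_enorm_lt_top (by norm_num) (by norm_num)] at this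
      simpa using this.ne
    rw [← h1, hn, h2] at hsplit
    exact (ENNReal.add_right_inj hfin).1 (hsplit.symm.trans (add_zero _).symm)
  have h4 : ∀ᵐ x ∂ν₀, x ∉ Iio b → cosInt f x = 0 := by
    rw [lintegral_eq_zero_iff' ((hcont.enorm.measurable.pow_const _).indicator
      measurableSet_Iio.compl).aemeasurable] at h3
    filter_upwards [h3] with x hx hxb
    rw [indicator_of_mem (show x ∈ (Iio b)ᶜ from hxb)] at hx
    simpa using hx
  have h5 : ∀ y > max b 0, cosInt f y = 0 := by
    have : ∀ᵐ x ∂volume.restrict (Ioi (max b 0)), cosInt f x = (fun _ => (0 : ℂ)) x := by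
      have h4' := ae_mono (Measure.restrict_mono (Ioi_subset_Ioi (le_max_right b 0)) le_rfl) h4
      filter_upwards [h4', ae_restrict_mem measurableSet_Ioi] with x hx hxm
      exact hx (not_lt.2 ((le_max_left b 0).trans (le_of_lt hxm)))
    exact fun y hy => Measure.eqOn_open_of_ae_eq this isOpen_Ioi hcont.continuousOn
      continuousOn_const hy
  intro x hx
  have hb0 : max b 0 = b := max_eq_left (hx.1.trans hx.2).le
  have h6 := cosIntegral_eq_zero hdI (fun y hy => by
    have := h5 y (by rwa [hb0]); rw [hcI] at this; exact this) x
  have := hb' x hx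
  rw [h6, mul_zero] at this
  exact_mod_cast this

section

/-! ### The cosine kernel on `C([0,1])` and the functions `φ_b^±` -/

open scoped unitInterval

local notation "𝓒₁" => ContinuousMap I ℝ
local notation "𝓒₂" => ContinuousMap (I × I) ℝ

theorem integrable_unitInterval (g : 𝓒₁) : Integrable (fun t => g t) (volume : Measure I) :=
  g.continuous.integrable_of_hasCompactSupport (HasCompactSupport.of_compactSpace _)

theorem norm_integral_unitInterval_le {g : I → ℝ} {M : ℝ} (h : ∀ t, ‖g t‖ ≤ M) :
    ‖∫ t : I, g t‖ ≤ M := by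
  have := norm_integral_le_of_norm_le_const (μ := (volume : Measure I))
    (Eventually.of_forall h)
  simpa using this

/-- The integral over `[0,1]` as a continuous linear functional. -/
def unitIntegral : 𝓒₁ →L[ℝ] ℝ :=
  LinearMap.mkContinuous
    { toFun := fun g => ∫ t : I, g t
      map_add' := fun f g => integral_add (integrable_unitInterval f) (integrable_unitInterval g)
      map_smul' := fun c g => integral_const_mul c _ } 1 fun g => by
    rw [one_mul]
    exact norm_integral_unitInterval_le fun t => g.norm_coe_le_norm t

/-- The integral operator `ψ ↦ ∫_0^1 κ(s,t) ψ(t) dt` on `C([0,1])` with continuous kernel `κ`,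
as a function of `κ`. -/
def kernelOp : 𝓒₂ →L[ℝ] 𝓒₁ →L[ℝ] 𝓒₁ :=
  LinearMap.mkContinuous₂
    (LinearMap.mk₂ ℝ (fun κ ψ => (⟨fun s => unitIntegral (κ.curry s * ψ),
        unitIntegral.continuous.comp ((map_continuous κ.curry).mul continuous_const)⟩ : 𝓒₁))
      (fun κ κ' ψ => by
        ext s
        change unitIntegral _ = unitIntegral _ + unitIntegral _
        rw [← map_add]
        congr 1
        ext t
        exact add_mul _ _ _)
      (fun c κ ψ => by
        ext s
        change unitIntegral _ = c • unitIntegral _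
        rw [← map_smul]
        congr 1
        ext t
        exact mul_assoc _ _ _)
      (fun κ ψ ψ' => by
        ext s
        change unitIntegral _ = unitIntegral _ + unitIntegral _
        rw [← map_add]
        congr 1
        ext t
        exact mul_add _ _ _)
      (fun c κ ψ => by
        ext s
        change unitIntegral _ = c • unitIntegral _
        rw [← map_smul]
        congr 1
        ext t
        exact mul_left_comm _ _ _)) 1
    (fun κ ψ => by
      rw [one_mul, ContinuousMap.norm_le _ (by positivity)]
      intro s
      refine norm_integral_unitInterval_le fun t => ?_
      rw [ContinuousMap.mul_apply, norm_mul]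
      exact mul_le_mul (κ.norm_coe_le_norm (s, t)) (ψ.norm_coe_le_norm t) (norm_nonneg _)
        (norm_nonneg _))

theorem kernelOp_apply (κ : 𝓒₂) (ψ : 𝓒₁) (s : I) :
    kernelOp κ ψ s = ∫ t : I, κ (s, t) * ψ t := rfl

theorem contDiff_kernelOp : ContDiff ℝ 1 fun κ : 𝓒₂ => kernelOp κ := by
  refine IsBoundedLinearMap.contDiff (IsLinearMap.with_bound
    ⟨fun κ κ' => map_add kernelOp κ κ', fun c κ => map_smul kernelOp c κ⟩ 1 fun κ => ?_)
  rw [one_mul]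
  refine ContinuousLinearMap.opNorm_le_bound _ (norm_nonneg _) fun ψ => ?_
  rw [ContinuousMap.norm_le _ (by positivity)]
  refine fun s => norm_integral_unitInterval_le fun t => ?_
  rw [ContinuousMap.mul_apply, norm_mul]
  exact mul_le_mul (κ.norm_coe_le_norm (s, t)) (ψ.norm_coe_le_norm t) (norm_nonneg _)
    (norm_nonneg _)

/-- For a compact space `X` and continuous `m : X → ℝ`, the function `2 cos (2π c m)`. -/
def cosMap {X : Type*} [TopologicalSpace X] (m : C(X, ℝ)) (c : ℝ) : C(X, ℝ) :=
  ⟨fun x => 2 * Real.cos (2 * π * c * m x), by fun_prop⟩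

/-- The map `c ↦ 2 cos (2π c m)` is smooth for the supremum norm, being the real part of an
exponential in the Banach algebra of complex functions. -/
theorem contDiff_cosMap {X : Type*} [TopologicalSpace X] [CompactSpace X] (m : C(X, ℝ)) :
    ContDiff ℝ 1 (cosMap m) := by
  set M : C(X, ℂ) := ⟨fun x => 2 * π * m x * Complex.I, by fun_prop⟩ with hM
  have h1 : ContDiff ℝ 1 fun c : ℝ => NormedSpace.exp (c • M) := by
    have he : ContDiff ℝ 1 (NormedSpace.exp : C(X, ℂ) → C(X, ℂ)) :=
      contDiff_iff_contDiffAt.2 fun x => (NormedSpace.exp_analytic (𝕂 := ℝ) x).contDiffAt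
    exact he.comp (contDiff_id.smul contDiff_const)
  have h2 := (((2 : ℝ) • Complex.reCLM).compLeftContinuous ℝ X).contDiff.comp h1 (n := 1)
  convert h2 using 1
  ext c x
  have h3 : (NormedSpace.exp (c • M)) x = NormedSpace.exp ((c • M) x) :=
    NormedSpace.map_exp (ContinuousMap.evalAlgHom ℂ ℂ x)
      (continuous_eval_const x) _
  simp only [cosMap, Function.comp]
  change 2 * Real.cos (2 * π * c * m x) = 2 * ((NormedSpace.exp (c • M)) x).re
  rw [h3, ← Complex.exp_eq_exp_ℂ]
  have : (c • M) x = ((2 * π * c * m x : ℝ) : ℂ) * Complex.I := by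
    simp only [ContinuousMap.smul_apply, hM, ContinuousMap.coe_mk, Complex.real_smul]
    push_cast
    ring
  rw [this, Complex.exp_ofReal_mul_I_re]

/-- The coordinate function on `[0,1]`. -/
def coordMap : 𝓒₁ := ⟨fun t => (t : ℝ), continuous_subtype_val⟩

/-- The product of the coordinates on `[0,1]²`. -/
def prodMap : 𝓒₂ := ⟨fun p => (p.1 : ℝ) * p.2, by fun_prop⟩

/-- The cosine series: the kernel is a limit of sums of products of functions of one variable, so
that its operator is compact. -/
theorem hasSum_cosMap_prodMap (c : ℝ) :
    HasSum (fun n : ℕ => (2 * ((-1) ^ n * (2 * π * c) ^ (2 * n) / (2 * n).factorial : ℝ)) •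
      prodMap ^ (2 * n)) (cosMap prodMap c) := by
  have hle : ‖prodMap‖ ≤ 1 := by
    rw [ContinuousMap.norm_le _ zero_le_one]
    rintro ⟨s, t⟩
    simp only [prodMap, ContinuousMap.coe_mk, norm_mul, Real.norm_eq_abs]
    rw [abs_of_nonneg s.2.1, abs_of_nonneg t.2.1]
    exact mul_le_one₀ s.2.2 t.2.1 t.2.2
  have hs : Summable (fun n : ℕ =>
      (2 * ((-1) ^ n * (2 * π * c) ^ (2 * n) / (2 * n).factorial : ℝ)) •
      prodMap ^ (2 * n)) := by
    have hs' := ((Real.summable_pow_div_factorial (|2 * π * c|)).comp_injective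
      (mul_right_injective₀ (two_ne_zero (α := ℕ)))).mul_left 2
    refine Summable.of_norm_bounded hs' fun n => ?_
    rw [norm_smul]
    have h1 : ‖prodMap ^ (2 * n)‖ ≤ 1 :=
      (norm_pow_le _ _).trans (pow_le_one₀ (norm_nonneg _) hle)
    refine (mul_le_of_le_one_right (norm_nonneg _) h1).trans (le_of_eq ?_)
    simp [abs_mul]
  obtain ⟨S, hS⟩ := hs
  have : S = cosMap prodMap c := by
    ext p
    have h1 := ContinuousMap.hasSum_apply hS p
    have h2 := (Real.hasSum_cos (2 * π * c * prodMap p)).mul_left 2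
    have e : ∀ n : ℕ, ((2 * ((-1) ^ n * (2 * π * c) ^ (2 * n) / (2 * n).factorial : ℝ)) •
        prodMap ^ (2 * n)) p
        = 2 * ((-1) ^ n * (2 * π * c * prodMap p) ^ (2 * n) / (2 * n).factorial) := by
      intro n
      rw [ContinuousMap.smul_apply, ContinuousMap.pow_apply, smul_eq_mul,
        mul_pow (2 * π * c)]
      ring
    simp only [e] at h1
    exact HasSum.unique h1 h2
  rwa [← this]

theorem isCompactOperator_kernelOp_pow (n : ℕ) : IsCompactOperator (kernelOp (prodMap ^ n)) := by
  have h : kernelOp (prodMap ^ n) = (ContinuousLinearMap.toSpanSingleton ℝ (coordMap ^ n)).comp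
      (unitIntegral.comp (ContinuousLinearMap.mul ℝ 𝓒₁ (coordMap ^ n))) := by
    ext ψ s
    rw [kernelOp_apply]
    simp only [ContinuousLinearMap.comp_apply, ContinuousLinearMap.toSpanSingleton_apply,
      ContinuousMap.smul_apply, smul_eq_mul, ContinuousLinearMap.mul_apply']
    change _ = (∫ t : I, _) * _
    rw [← integral_mul_const]
    congr 1
    ext t
    simp only [ContinuousMap.pow_apply, ContinuousMap.mul_apply, prodMap, coordMap,
      ContinuousMap.coe_mk]
    ring
  rw [h]
  have hc : IsCompactOperator (unitIntegral.comp (ContinuousLinearMap.mul ℝ 𝓒₁ (coordMap ^ n))) :=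
    isCompactOperator_of_locallyCompactSpace_dom _
  exact hc.clm_comp (ContinuousLinearMap.toSpanSingleton ℝ (coordMap ^ n) : ℝ →L[ℝ] 𝓒₁)

theorem isCompactOperator_kernelOp_cosMap (c : ℝ) :
    IsCompactOperator (kernelOp (cosMap prodMap c)) := by
  have h := (hasSum_cosMap_prodMap c).mapL kernelOp
  refine isCompactOperator_of_tendsto h (Eventually.of_forall fun s => ?_)
  induction s using Finset.induction_on with
  | empty => simpa using isCompactOperator_zero
  | insert n s hn ih =>
    rw [Finset.sum_insert hn, map_smul]
    exact ((isCompactOperator_kernelOp_pow (2 * n)).smul _).add ih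

theorem integral_unitInterval_eq (F : ℝ → ℝ) :
    ∫ t : I, F t = ∫ t in Ioo (0 : ℝ) 1, F t := by
  rw [← integral_Icc_eq_integral_Ioo]
  exact integral_subtype_comap measurableSet_Icc F

theorem integral_Ioo_scale {E : Type*} [NormedAddCommGroup E] [NormedSpace ℝ E] {b : ℝ}
    (hb : 0 < b) (F : ℝ → E) :
    ∫ y in Ioo 0 b, F y = b • ∫ t in Ioo (0 : ℝ) 1, F (b * t) := by
  rw [← integral_Ioc_eq_integral_Ioo, ← integral_Ioc_eq_integral_Ioo,
    ← intervalIntegral.integral_of_le hb.le, ← intervalIntegral.integral_of_le zero_le_one,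
    intervalIntegral.smul_integral_comp_mul_left, mul_zero, mul_one]

/-- The operator `1 + ε C_b`, transported to `C([0,1])` by scaling. -/
def scaledOp (ε b : ℝ) : 𝓒₁ →L[ℝ] 𝓒₁ :=
  1 + kernelOp ((ε * b) • cosMap prodMap (b ^ 2))

theorem integral_scaled {b : ℝ} (hb : 0 < b) (x : ℝ) (ψ : 𝓒₁) {d : ℝ → ℝ}
    (hd : ∀ t : I, d (b * t) = ψ t) :
    ∫ y in Ioo 0 b, cosKernel x y * d y = b * unitIntegral (cosMap coordMap (x * b) * ψ) := by
  rw [integral_Ioo_scale hb, smul_eq_mul,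
    ← integral_unitInterval_eq (fun t => cosKernel x (b * t) * d (b * t))]
  congr 1
  change _ = ∫ t : I, _
  congr 1
  ext t
  simp only [hd, cosKernel, cosMap, coordMap, ContinuousMap.mul_apply, ContinuousMap.coe_mk]
  ring_nf

/-- By compactness it suffices that `1 + ε C_b` is injective. -/
theorem isUnit_scaledOp {ε b : ℝ} (hε : ε * ε = 1) (hb : 0 < b) : IsUnit (scaledOp ε b) := by
  set T : 𝓒₁ →L[ℝ] 𝓒₁ := b • kernelOp (cosMap prodMap (b ^ 2)) with hT
  have hε0 : ε ≠ 0 := by rintro rfl; norm_num at hε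
  have hTc : IsCompactOperator T := (isCompactOperator_kernelOp_cosMap (b ^ 2)).smul b
  rcases hTc.hasEigenvalue_or_mem_resolventSet (neg_ne_zero.2 hε0) with h | h
  · exfalso
    obtain ⟨ψ, hψ⟩ := h.exists_hasEigenvector
    have hψ1 : T ψ = (-ε) • ψ := hψ.apply_eq_smul
    apply hψ.2
    -- the eigenvector equation extends `ψ`, after scaling, to a function `d` on the line
    set d : ℝ → ℝ := fun x => -ε * (b * unitIntegral (cosMap coordMap (x * b) * ψ)) with hd
    have hdc : Continuous d := by
      refine continuous_const.mul (continuous_const.mul (unitIntegral.continuous.comp ?_))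
      exact ((contDiff_cosMap coordMap).continuous.comp (continuous_id.mul continuous_const)).mul
        continuous_const
    have hdψ : ∀ t : I, d (b * t) = ψ t := by
      intro t
      have h1 := congrArg (fun g : 𝓒₁ => g t) hψ1
      have h2 : T ψ t = b * unitIntegral (cosMap coordMap (b * t * b) * ψ) := by
        change b * (∫ s : I, _) = b * (∫ s : I, _)
        congr 2
        ext s
        simp only [cosMap, coordMap, prodMap, ContinuousMap.mul_apply, ContinuousMap.coe_mk,
          ContinuousMap.curry_apply]
        ring_nf
      simp only [ContinuousMap.smul_apply, smul_eq_mul] at h1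
      simp only [hd]
      rw [← h2, h1, ← mul_assoc, neg_mul_neg, hε, one_mul]
    have hz := eq_zero_of_cosKernel_eigen (b := b) hε hdc (fun x _ => by
      rw [integral_scaled hb x ψ hdψ]
      simp only [hd]
      ring)
    have hz' : ∀ x ∈ Icc 0 b, d x = 0 := by
      have h1 : EqOn d (fun _ => 0) (closure (Ioo 0 b)) :=
        EqOn.closure (fun x hx => hz x hx) hdc continuous_const
      rw [closure_Ioo hb.ne] at h1
      exact h1
    ext t
    rw [← hdψ t, ContinuousMap.zero_apply]
    exact hz' _ ⟨mul_nonneg hb.le t.2.1, mul_le_of_le_one_right hb.le t.2.2⟩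
  · rw [spectrum.mem_resolventSet_iff] at h
    have h2 := (isUnit_iff_ne_zero.2 (neg_ne_zero.2 hε0)).map
      (algebraMap ℝ (𝓒₁ →L[ℝ] 𝓒₁))
    have h3 := h2.mul h
    convert h3 using 1
    ext ψ s
    rw [scaledOp, map_smul, mul_smul, ← hT]
    change ψ s + ε * T ψ s = -ε * (-ε * ψ s - T ψ s)
    linear_combination (-ψ s) * hε

/-- The solution `φ_b` of the integral equation on `(0,b)`, rescaled to `[0,1]`. -/
def scaledPhi (ε b : ℝ) : 𝓒₁ :=
  Ring.inverse (scaledOp ε b) (cosMap coordMap (b ^ 2))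

/-- The function `φ_b^ε`, obtained from its values on `(0,b)` by the integral equation. -/
def phiFun (ε b x : ℝ) : ℝ :=
  cosKernel b x - ε * (b * unitIntegral (cosMap coordMap (x * b) * scaledPhi ε b))

theorem phiFun_scaled {ε b : ℝ} (hε : ε * ε = 1) (hb : 0 < b) (t : I) :
    phiFun ε b (b * t) = scaledPhi ε b t := by
  have h1 : scaledOp ε b (scaledPhi ε b) = cosMap coordMap (b ^ 2) := by
    have := Ring.mul_inverse_cancel _ (isUnit_scaledOp hε hb)
    have h2 := congrArg (fun T : 𝓒₁ →L[ℝ] 𝓒₁ => T (cosMap coordMap (b ^ 2))) this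
    exact h2
  have h2 := congrArg (fun g : 𝓒₁ => g t) h1
  have h3 : (kernelOp (cosMap prodMap (b ^ 2)) (scaledPhi ε b)) t =
      unitIntegral (cosMap coordMap (b * t * b) * scaledPhi ε b) := by
    change (∫ s : I, _) = (∫ s : I, _)
    congr 1
    ext s
    simp only [cosMap, coordMap, prodMap, ContinuousMap.mul_apply, ContinuousMap.coe_mk,
      ContinuousMap.curry_apply]
    ring_nf
  have h4 : scaledOp ε b (scaledPhi ε b) t = scaledPhi ε b t + ε * b *
      (kernelOp (cosMap prodMap (b ^ 2)) (scaledPhi ε b)) t := by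
    rw [scaledOp, map_smul]
    rfl
  rw [h4, h3] at h2
  have h5 : cosMap coordMap (b ^ 2) t = cosKernel b (b * t) := by
    simp only [cosMap, coordMap, ContinuousMap.coe_mk, cosKernel]
    ring_nf
  rw [phiFun, ← h5, ← h2]
  ring

theorem contDiffAt_phiFun {ε : ℝ} (hε : ε * ε = 1) {p : ℝ × ℝ} (hp : 0 < p.1) :
    ContDiffAt ℝ 1 (fun p : ℝ × ℝ => phiFun ε p.1 p.2) p := by
  have hop : ContDiff ℝ 1 fun b : ℝ => scaledOp ε b := by
    have h1 : ContDiff ℝ 1 fun b : ℝ => (ε * b) • cosMap prodMap (b ^ 2) :=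
      ContDiff.smul (f := fun b : ℝ => ε * b) (g := fun b : ℝ => cosMap prodMap (b ^ 2))
        (contDiff_const.mul contDiff_id) ((contDiff_cosMap prodMap).comp (contDiff_id.pow 2))
    exact contDiff_const.add (contDiff_kernelOp.comp h1)
  have hinv : ContDiffAt ℝ 1 (fun b : ℝ => Ring.inverse (scaledOp ε b)) p.1 := by
    obtain ⟨u, hu⟩ := isUnit_scaledOp hε hp
    have h1 : ContDiffAt ℝ 1 Ring.inverse (scaledOp ε p.1) := by
      rw [← hu]
      exact contDiffAt_ringInverse (R := 𝓒₁ →L[ℝ] 𝓒₁) ℝ u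
    exact ContDiffAt.comp p.1 h1 hop.contDiffAt
  have hpsi : ContDiffAt ℝ 1 (fun b : ℝ => scaledPhi ε b) p.1 :=
    hinv.clm_apply ((contDiff_cosMap coordMap).comp (contDiff_id.pow 2)).contDiffAt
  have hpsi' : ContDiffAt ℝ 1 (fun p : ℝ × ℝ => scaledPhi ε p.1) p :=
    ContDiffAt.comp p hpsi contDiffAt_fst
  have hcos : ContDiffAt ℝ 1 (fun p : ℝ × ℝ => cosMap coordMap (p.2 * p.1)) p :=
    ((contDiff_cosMap coordMap).comp (contDiff_snd.mul contDiff_fst)).contDiffAt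
  unfold phiFun
  refine ContDiffAt.sub ?_ (contDiffAt_const.mul (contDiffAt_fst.mul ?_))
  · unfold cosKernel
    fun_prop
  · exact ContDiffAt.comp p unitIntegral.contDiff.contDiffAt (hcos.mul hpsi')

theorem isPhi_phiFun {ε b : ℝ} (hε : ε * ε = 1) (hb : 0 < b) : IsPhi ε b (phiFun ε b) := by
  constructor
  · refine continuous_iff_continuousAt.2 fun x => ?_
    exact ((contDiffAt_phiFun hε (p := (b, x)) hb).continuousAt).comp
      (f := fun x : ℝ => (b, x)) (by fun_prop)
  · intro x
    rw [integral_scaled hb x (scaledPhi ε b) (phiFun_scaled hε hb), phiFun]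
    ring

/-- Uniqueness for the homogeneous integral equation, on the whole line. -/
theorem eq_zero_of_integral_equation {ε b : ℝ} (hε : ε * ε = 1) {d : ℝ → ℝ} (hd : Continuous d)
    (h : ∀ x, d x + ε * ∫ y in Ioo 0 b, cosKernel x y * d y = 0) (x : ℝ) : d x = 0 := by
  have h1 := eq_zero_of_cosKernel_eigen hε hd (fun x _ => h x)
  have h2 := h x
  rw [setIntegral_congr_fun measurableSet_Ioo (g := fun _ => (0 : ℝ))
    (fun y hy => by simp [h1 y hy])] at h2
  simpa using h2

theorem IsPhi.unique {ε b : ℝ} (hε : ε * ε = 1) {φ φ' : ℝ → ℝ} (h : IsPhi ε b φ)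
    (h' : IsPhi ε b φ') : φ = φ' := by
  have hi : ∀ {g : ℝ → ℝ}, Continuous g → ∀ x, IntegrableOn (fun y => cosKernel x y * g y)
      (Ioo 0 b) := fun {g} hg x => by
    have : Continuous fun y => cosKernel x y * g y :=
      (continuous_cosKernel.comp (by fun_prop : Continuous fun y : ℝ => (x, y))).mul hg
    exact (this.integrableOn_Icc (a := (0 : ℝ)) (b := b)).mono_set Ioo_subset_Icc_self
  funext x
  refine sub_eq_zero.1 (eq_zero_of_integral_equation (b := b) hε (h.1.sub h'.1) (fun x => ?_) x)
  have h1 := h.2 x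
  have h2 := h'.2 x
  simp only [Pi.sub_apply, mul_sub]
  rw [integral_sub (hi h.1 x) (hi h'.1 x)]
  linarith

theorem isPhi_phi {ε b : ℝ} (hε : ε * ε = 1) (hb : 0 < b) : IsPhi ε b (phi ε b) :=
  Classical.epsilon_spec ⟨_, isPhi_phiFun hε hb⟩

theorem phi_eq_phiFun {ε b : ℝ} (hε : ε * ε = 1) (hb : 0 < b) : phi ε b = phiFun ε b :=
  (isPhi_phi hε hb).unique hε (isPhi_phiFun hε hb)

theorem contDiffAt_phi {ε : ℝ} (hε : ε * ε = 1) {p : ℝ × ℝ} (hp : 0 < p.1) :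
    ContDiffAt ℝ 1 (fun p : ℝ × ℝ => phi ε p.1 p.2) p := by
  refine (contDiffAt_phiFun hε hp).congr_of_eventuallyEq ?_
  filter_upwards [(isOpen_Ioi.preimage continuous_fst).mem_nhds (show p ∈ Prod.fst ⁻¹' Ioi 0
    from hp)] with q hq
  rw [phi_eq_phiFun hε hq]

end

/-! ### Hadamard's bound and the convergence of Fredholm's series -/

/-- A form of Hadamard's inequality: the arithmetic-geometric mean inequality for the eigenvalues
of `Aᵀ A`, whose trace is the sum of the squares of the entries of `A`. -/
theorem det_sq_le_of_abs_le {n : ℕ} (A : Matrix (Fin n) (Fin n) ℝ) {B : ℝ}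
    (hA : ∀ i j, |A i j| ≤ B) : A.det ^ 2 ≤ (n * B ^ 2) ^ n := by
  rcases Nat.eq_zero_or_pos n with rfl | hn
  · simp
  have hn' : (0 : ℝ) < n := by exact_mod_cast hn
  have hps := Matrix.posSemidef_conjTranspose_mul_self A
  have hH := hps.isHermitian
  set l := hH.eigenvalues with hl
  have hl0 : ∀ i, 0 ≤ l i := fun i => hps.eigenvalues_nonneg i
  have h1 : A.det ^ 2 = ∏ i, l i := by
    have := hH.det_eq_prod_eigenvalues
    rw [Matrix.det_mul, Matrix.det_conjTranspose] at this
    simp only [star_trivial] at this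
    rw [pow_two, this]
    rfl
  have h2 : ∑ i, l i ≤ n * (n * B ^ 2) := by
    have := hH.trace_eq_sum_eigenvalues
    have h3 : (A.conjTranspose * A).trace = ∑ i, ∑ j, A j i ^ 2 := by
      simp [Matrix.trace, Matrix.mul_apply, pow_two]
    have h4 : ∑ i, l i = ∑ i, ∑ j, A j i ^ 2 := by
      rw [← h3, this]
      simp [hl]
    rw [h4]
    have h5 : ∀ i ∈ (Finset.univ : Finset (Fin n)), ∑ j, A j i ^ 2 ≤ n * B ^ 2 := fun i _ => by
      have : ∀ j ∈ (Finset.univ : Finset (Fin n)), A j i ^ 2 ≤ B ^ 2 := fun j _ =>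
        sq_le_sq' (neg_le_of_abs_le (hA j i)) (le_of_abs_le (hA j i))
      simpa using Finset.sum_le_card_nsmul _ _ _ this
    simpa using Finset.sum_le_card_nsmul _ _ _ h5
  have h3 := Real.geom_mean_le_arith_mean_weighted Finset.univ (fun _ : Fin n => (1 / n : ℝ)) l
    (fun _ _ => by positivity) (by simp [hn'.ne']) (fun i _ => hl0 i)
  rw [Real.finsetProd_rpow _ _ (fun i _ => hl0 i), ← h1, ← Finset.mul_sum] at h3
  have h4 : (A.det ^ 2) ^ (1 / n : ℝ) ≤ n * B ^ 2 := by
    refine h3.trans ?_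
    rw [one_div, inv_mul_le_iff₀ hn']
    exact h2
  have h5 := pow_le_pow_left₀ (by positivity) h4 n
  rwa [← Real.rpow_natCast, ← Real.rpow_mul (by positivity), one_div_mul_cancel hn'.ne',
    Real.rpow_one] at h5

theorem abs_det_le {n : ℕ} (A : Matrix (Fin n) (Fin n) ℝ) (hA : ∀ i j, |A i j| ≤ 2) :
    |A.det| ≤ sqrt ((n * 4) ^ n) := by
  refine Real.abs_le_sqrt ?_
  have := det_sq_le_of_abs_le A hA
  norm_num at this
  exact this

/-- The growth of Hadamard's bound is beaten by the factorials. -/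
theorem sqrt_pow_div_factorial_le (L : ℝ) (n : ℕ) :
    sqrt ((n * 4) ^ n) * L ^ n / n.factorial ≤
      exp (32 * L ^ 2 * exp 1) * (1 / 4) ^ n := by
  set q := 64 * L ^ 2 * exp 1 with hq
  have hq0 : 0 ≤ q := by positivity
  have hf : (0 : ℝ) < n.factorial := by exact_mod_cast n.factorial_pos
  refine le_of_sq_le_sq ?_ (by positivity)
  have h1 := Real.pow_div_factorial_le_exp (n : ℝ) (by positivity) n
  have h2 := Real.pow_div_factorial_le_exp q hq0 n
  have e1 : (sqrt ((n * 4) ^ n) * L ^ n / n.factorial) ^ 2 =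
      ((n : ℝ) ^ n / n.factorial) * ((4 * L ^ 2) ^ n / n.factorial) := by
    rw [div_pow, mul_pow, Real.sq_sqrt (by positivity), mul_pow, mul_pow 4, ← pow_mul L,
      ← pow_mul L, mul_comm 2 n]
    field_simp
  have e2 : (exp (32 * L ^ 2 * exp 1) * (1 / 4) ^ n) ^ 2 = exp q * (1 / 16) ^ n := by
    rw [mul_pow, ← Real.exp_nat_mul, ← pow_mul, mul_comm n 2, pow_mul, hq]
    norm_num
    ring
  rw [e1, e2]
  have e3 : exp n * ((4 * L ^ 2) ^ n / n.factorial) = q ^ n / n.factorial * (1 / 16) ^ n := by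
    have : exp n = exp 1 ^ n := by rw [← Real.exp_nat_mul, mul_one]
    rw [this, hq, mul_div_assoc', ← mul_pow, div_mul_eq_mul_div, ← mul_pow]
    ring_nf
  calc _ ≤ exp n * ((4 * L ^ 2) ^ n / n.factorial) :=
        mul_le_mul_of_nonneg_right h1 (by positivity)
    _ = _ := e3
    _ ≤ _ := mul_le_mul_of_nonneg_right h2 (by positivity)

/-! ### Integrals over cubes -/

/-- The cube `(0,c)ⁿ`. -/
def cube (n : ℕ) (c : ℝ) : Set (Fin n → ℝ) := Set.pi univ fun _ => Ioo 0 c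

theorem mem_cube {n : ℕ} {c : ℝ} {t : Fin n → ℝ} : t ∈ cube n c ↔ ∀ i, t i ∈ Ioo 0 c := by
  simp [cube, Set.mem_pi]

theorem measurableSet_cube (n : ℕ) (c : ℝ) : MeasurableSet (cube n c) :=
  MeasurableSet.univ_pi fun _ => measurableSet_Ioo

theorem volume_real_cube (n : ℕ) {c : ℝ} (hc : 0 ≤ c) : volume.real (cube n c) = c ^ n := by
  have := Real.volume_pi_Ioo_toReal (ι := Fin n) (a := fun _ => 0) (b := fun _ => c)
    (fun _ => hc)
  simpa [Measure.real, cube] using this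

theorem volume_cube_lt_top (n : ℕ) (c : ℝ) : volume (cube n c) < ⊤ := by
  rw [cube, Real.volume_pi_Ioo]
  exact ENNReal.prod_lt_top fun _ _ => ENNReal.ofReal_lt_top

theorem integrableOn_cube {n : ℕ} {F : (Fin n → ℝ) → ℝ} (hF : Continuous F) (c : ℝ) :
    IntegrableOn F (cube n c) := by
  refine (hF.continuousOn.integrableOn_compact
    (isCompact_univ_pi fun _ : Fin n => isCompact_Icc (a := (0 : ℝ)) (b := c))).mono_set ?_
  exact Set.pi_mono fun _ _ => Ioo_subset_Icc_self

theorem integral_eq_integral_insertNth {n : ℕ} (i : Fin (n + 1)) {F : (Fin (n + 1) → ℝ) → ℝ}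
    (hF : Integrable F) :
    ∫ x, F x = ∫ s : ℝ, ∫ t : Fin n → ℝ, F (i.insertNth s t) := by
  have hem : MeasurePreserving (MeasurableEquiv.piFinSuccAbove (fun _ : Fin (n + 1) => ℝ) i).symm :=
    (volume_preserving_piFinSuccAbove (fun _ : Fin (n + 1) => ℝ) i).symm _
  have hi := (hem.integrable_comp_emb (MeasurableEquiv.measurableEmbedding _)).2 hF
  rw [← hem.integral_comp' F, Measure.volume_eq_prod]
  exact integral_prod _ hi

theorem insertNth_mem_cube {n : ℕ} (i : Fin (n + 1)) {c s : ℝ} {t : Fin n → ℝ} :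
    i.insertNth (α := fun _ => ℝ) s t ∈ cube (n + 1) c ↔ s ∈ Ioo 0 c ∧ t ∈ cube n c := by
  rw [mem_cube, mem_cube, Fin.forall_iff_succAbove i]
  simp

theorem setIntegral_cube_insertNth {n : ℕ} (i : Fin (n + 1)) {F : (Fin (n + 1) → ℝ) → ℝ}
    (hF : Continuous F) (c : ℝ) :
    ∫ x in cube (n + 1) c, F x = ∫ s in Ioo 0 c, ∫ t in cube n c, F (i.insertNth s t) := by
  rw [← integral_indicator (measurableSet_cube _ _), integral_eq_integral_insertNth i
    ((integrable_indicator_iff (measurableSet_cube _ _)).2 (integrableOn_cube hF c)),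
    ← integral_indicator measurableSet_Ioo]
  congr 1
  ext s
  by_cases hs : s ∈ Ioo 0 c
  · rw [indicator_of_mem hs, ← integral_indicator (measurableSet_cube _ _)]
    congr 1
    ext t
    by_cases ht : t ∈ cube n c
    · rw [indicator_of_mem ht, indicator_of_mem ((insertNth_mem_cube i).2 ⟨hs, ht⟩)]
    · rw [indicator_of_notMem ht, indicator_of_notMem fun h => ht ((insertNth_mem_cube i).1 h).2]
  · rw [indicator_of_notMem hs]
    refine (integral_congr_ae (Eventually.of_forall fun t => ?_)).trans (integral_zero _ _)
    exact indicator_of_notMem (fun h => hs ((insertNth_mem_cube i).1 h).1) _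

theorem volume_eq_coord_zero {n : ℕ} {i j : Fin n} (hij : i ≠ j) :
    volume {x : Fin n → ℝ | x i = x j} = 0 := by
  have h := Measure.addHaar_submodule (volume : Measure (Fin n → ℝ))
    (LinearMap.ker (LinearMap.proj (R := ℝ) (φ := fun _ : Fin n => ℝ) i - LinearMap.proj j)) ?_
  · convert h using 2
    ext x
    simp [sub_eq_zero]
  · intro h
    have : (Pi.single i 1 : Fin n → ℝ) ∈ (⊤ : Submodule ℝ (Fin n → ℝ)) := trivial
    rw [← h] at this
    simp [hij.symm] at this

/-- The integral of a symmetric function over a cube, decomposed by the largest coordinate. -/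
theorem setIntegral_cube_of_symm {n : ℕ} {F : (Fin (n + 1) → ℝ) → ℝ} (hF : Continuous F)
    (hs : ∀ (i : Fin (n + 1)) (s : ℝ) (t : Fin n → ℝ), F (i.insertNth s t) = F (Matrix.vecCons s t))
    (b : ℝ) :
    ∫ x in cube (n + 1) b, F x =
      (n + 1) * ∫ s in Ioo 0 b, ∫ t in cube n s, F (Matrix.vecCons s t) := by
  -- `S i` is the part of the cube where the largest coordinate is the `i`-th; up to a null set the
  -- `S i` partition the cube
  set S : Fin (n + 1) → Set (Fin (n + 1) → ℝ) := fun i =>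
    {x | x ∈ cube (n + 1) b ∧ ∀ j, x (i.succAbove j) < x i} with hS
  have hSm : ∀ i, MeasurableSet (S i) := fun i => by
    have : S i = cube (n + 1) b ∩ ⋂ j, {x | x (i.succAbove j) < x i} := by
      ext x
      simp [hS]
    rw [this]
    exact (measurableSet_cube _ _).inter (MeasurableSet.iInter fun j =>
      measurableSet_lt (measurable_pi_apply _) (measurable_pi_apply _))
  have hSd : Pairwise (Function.onFun Disjoint S) := by
    intro i j hij
    rw [Function.onFun, Set.disjoint_left]
    intro x hx hx'
    obtain ⟨k, hk⟩ := Fin.exists_succAbove_eq hij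
    obtain ⟨l, hl⟩ := Fin.exists_succAbove_eq hij.symm
    have h1 := hx'.2 k
    have h2 := hx.2 l
    rw [hk] at h1
    rw [hl] at h2
    exact lt_asymm h1 h2
  have hSc : (cube (n + 1) b : Set (Fin (n + 1) → ℝ)) =ᵐ[volume] ⋃ i, S i := by
    have hne : ∀ᵐ x : Fin (n + 1) → ℝ, ∀ i j, i ≠ j → x i ≠ x j := by
      refine ae_all_iff.2 fun i => ae_all_iff.2 fun j => ?_
      by_cases hij : i = j
      · simp [hij]
      · have := volume_eq_coord_zero hij
        filter_upwards [measure_eq_zero_iff_ae_notMem.1 this] with x hx _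
        exact hx
    filter_upwards [hne] with x hx
    refine propext ⟨fun h => ?_, fun h => ?_⟩
    · obtain ⟨i, -, hi⟩ := Finset.exists_max_image Finset.univ x Finset.univ_nonempty
      refine mem_iUnion.2 ⟨i, h, fun j => ?_⟩
      exact lt_of_le_of_ne (hi _ (Finset.mem_univ _)) (hx _ _ (Fin.succAbove_ne i j))
    · obtain ⟨i, hi⟩ := mem_iUnion.1 h
      exact hi.1
  have hFi : ∀ i, IntegrableOn F (S i) := fun i =>
    (integrableOn_cube hF b).mono_set fun x hx => hx.1
  rw [setIntegral_congr_set hSc, integral_iUnion_fintype hSm hSd hFi]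
  have key : ∀ i, ∫ x in S i, F x = ∫ s in Ioo 0 b, ∫ t in cube n s, F (Matrix.vecCons s t) := by
    intro i
    have hmem : ∀ s (t : Fin n → ℝ), i.insertNth (α := fun _ => ℝ) s t ∈ S i ↔
        s ∈ Ioo 0 b ∧ t ∈ cube n s := by
      intro s t
      change (i.insertNth (α := fun _ => ℝ) s t ∈ cube (n + 1) b ∧ _) ↔ _
      rw [insertNth_mem_cube]
      simp only [Fin.insertNth_apply_succAbove, Fin.insertNth_apply_same, mem_cube]
      constructor
      · rintro ⟨⟨h1, h2⟩, h3⟩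
        exact ⟨h1, fun j => ⟨(h2 j).1, h3 j⟩⟩
      · rintro ⟨h1, h2⟩
        exact ⟨⟨h1, fun j => ⟨(h2 j).1, (h2 j).2.trans h1.2⟩⟩, fun j => (h2 j).2⟩
    rw [← integral_indicator (hSm i), integral_eq_integral_insertNth i
      ((integrable_indicator_iff (hSm i)).2 (hFi i)), ← integral_indicator measurableSet_Ioo]
    congr 1
    ext s
    by_cases hs' : s ∈ Ioo 0 b
    · rw [indicator_of_mem hs', ← integral_indicator (measurableSet_cube _ _)]
      congr 1
      ext t
      by_cases ht : t ∈ cube n s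
      · rw [indicator_of_mem ht, indicator_of_mem ((hmem s t).2 ⟨hs', ht⟩), hs]
      · rw [indicator_of_notMem ht, indicator_of_notMem fun h => ht ((hmem s t).1 h).2]
    · rw [indicator_of_notMem hs']
      refine (integral_congr_ae (Eventually.of_forall fun t => ?_)).trans (integral_zero _ _)
      exact indicator_of_notMem (fun h => hs' ((hmem s t).1 h).1) _
  simp only [key]
  simp

/-! ### Fredholm's minors for the cosine kernel -/

/-- The matrix with entries `2 cos (2π x_i y_j)`. -/
def cosMatrix {n : ℕ} (x y : Fin n → ℝ) : Matrix (Fin n) (Fin n) ℝ :=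
  Matrix.of fun i j => cosKernel (x i) (y j)

/-- The coefficients of Fredholm's determinant of the cosine kernel on `(0,c)`. -/
def detCoeff (n : ℕ) (c : ℝ) : ℝ := ∫ t in cube n c, (cosMatrix t t).det

/-- The coefficients of Fredholm's first minor of the cosine kernel on `(0,c)`. -/
def minorCoeff (n : ℕ) (c x y : ℝ) : ℝ :=
  ∫ t in cube n c, (cosMatrix (Matrix.vecCons x t) (Matrix.vecCons y t)).det

theorem abs_det_cosMatrix_le {n : ℕ} (x y : Fin n → ℝ) :
    |(cosMatrix x y).det| ≤ sqrt ((n * 4) ^ n) :=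
  abs_det_le _ fun _ _ => abs_cosKernel_le _ _

theorem continuous_det_cosMatrix {n : ℕ} {X : Type*} [TopologicalSpace X] {f g : X → Fin n → ℝ}
    (hf : Continuous f) (hg : Continuous g) :
    Continuous fun p => (cosMatrix (f p) (g p)).det := by
  refine Continuous.matrix_det (continuous_matrix fun i j => ?_)
  exact continuous_cosKernel.comp (((continuous_apply i).comp hf).prodMk
    ((continuous_apply j).comp hg))

theorem continuous_cons {n : ℕ} : Continuous fun p : ℝ × (Fin n → ℝ) =>
    (Matrix.vecCons p.1 p.2) := by
  refine continuous_pi fun i => ?_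
  refine Fin.cases ?_ (fun j => ?_) i
  · exact continuous_fst
  · exact (continuous_apply j).comp continuous_snd

theorem cosMatrix_insertNth {n : ℕ} (i : Fin (n + 1)) (s : ℝ) (t : Fin n → ℝ)
    (y : Fin (n + 1) → ℝ) :
    (cosMatrix (i.insertNth (α := fun _ => ℝ) s t) y).det =
      (-1) ^ (i : ℕ) * (cosMatrix (Matrix.vecCons s t) y).det := by
  have h : (i.insertNth (α := fun _ => ℝ) s t) = (Matrix.vecCons s t) ∘ i.cycleRange := by
    funext j
    revert j
    rw [Fin.forall_iff_succAbove i]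
    refine ⟨?_, fun j => ?_⟩
    · rw [Fin.insertNth_apply_same, Function.comp_apply, Fin.cycleRange_self,
        Matrix.cons_val_zero]
    · rw [Fin.insertNth_apply_succAbove, Function.comp_apply, Fin.cycleRange_succAbove,
        Matrix.cons_val_succ]
  have h2 : cosMatrix (i.insertNth (α := fun _ => ℝ) s t) y =
      (cosMatrix (Matrix.vecCons s t) y).submatrix i.cycleRange id := by
    ext a b
    simp [cosMatrix, h]
  rw [h2, Matrix.det_permute, Fin.sign_cycleRange]
  simp

theorem det_cosMatrix_transpose {n : ℕ} (x y : Fin n → ℝ) :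
    (cosMatrix x y).det = (cosMatrix y x).det := by
  rw [← Matrix.det_transpose]
  congr 1
  ext i j
  exact cosKernel_comm _ _

theorem cosMatrix_insertNth_insertNth {n : ℕ} (i : Fin (n + 1)) (s : ℝ) (t : Fin n → ℝ) :
    (cosMatrix (i.insertNth (α := fun _ => ℝ) s t) (i.insertNth (α := fun _ => ℝ) s t)).det =
      (cosMatrix (Matrix.vecCons s t) (Matrix.vecCons s t)).det := by
  rw [cosMatrix_insertNth, det_cosMatrix_transpose, cosMatrix_insertNth, ← mul_assoc, ← pow_add,
    ← two_mul, pow_mul]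
  simp

theorem detCoeff_succ (n : ℕ) (b : ℝ) :
    detCoeff (n + 1) b = (n + 1) * ∫ c in Ioo 0 b, minorCoeff n c c c :=
  setIntegral_cube_of_symm (continuous_det_cosMatrix continuous_id continuous_id)
    (fun i s t => cosMatrix_insertNth_insertNth i s t) b

theorem continuous_minorCoeff (n : ℕ) (c y : ℝ) : Continuous fun x => minorCoeff n c x y := by
  unfold minorCoeff
  have hc : Continuous fun p : ℝ × (Fin n → ℝ) =>
      (cosMatrix (Matrix.vecCons p.1 p.2) (Matrix.vecCons y p.2)).det :=
    continuous_det_cosMatrix (f := fun p : ℝ × (Fin n → ℝ) => Matrix.vecCons p.1 p.2)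
      (g := fun p : ℝ × (Fin n → ℝ) => Matrix.vecCons y p.2) continuous_cons
      (continuous_cons.comp (f := fun p : ℝ × (Fin n → ℝ) => (y, p.2))
        (continuous_const.prodMk continuous_snd))
  refine continuous_of_dominated (bound := fun _ => sqrt (((n + 1 : ℕ) * 4) ^ (n + 1)))
    (fun x => ?_) (fun x => Eventually.of_forall fun t => ?_) ?_
    (Eventually.of_forall fun t => ?_)
  · exact (hc.comp (f := fun t : Fin n → ℝ => (x, t))
      (continuous_const.prodMk continuous_id)).aestronglyMeasurable
  · rw [Real.norm_eq_abs]
    exact abs_det_cosMatrix_le (Matrix.vecCons x t) (Matrix.vecCons y t)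
  · have : IsFiniteMeasure (volume.restrict (cube n c)) := ⟨by
      simpa using volume_cube_lt_top n c⟩
    exact integrable_const _
  · exact hc.comp (f := fun x : ℝ => (x, t)) (continuous_id.prodMk continuous_const)

/-- Expansion of a bordered determinant along its first row. -/
theorem det_cosMatrix_vecCons (n : ℕ) (x y : ℝ) (t : Fin (n + 1) → ℝ) :
    (cosMatrix (Matrix.vecCons x t) (Matrix.vecCons y t)).det =
      cosKernel x y * (cosMatrix t t).det + ∑ j : Fin (n + 1), (-1) ^ ((j : ℕ) + 1) *
        (cosKernel x (t j) * (cosMatrix t (Matrix.vecCons y (j.removeNth t))).det) := by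
  rw [Matrix.det_succ_row_zero, Fin.sum_univ_succ]
  congr 1
  · simp only [Fin.val_zero, pow_zero, one_mul]
    congr 1
  · refine Finset.sum_congr rfl fun j _ => ?_
    rw [mul_assoc, Fin.val_succ]
    congr 2
    congr 1
    ext a b
    refine Fin.cases ?_ (fun b => ?_) b
    · simp [cosMatrix]
    · simp [cosMatrix, Fin.removeNth]

theorem continuous_rowTerm (n : ℕ) (x y : ℝ) (j : Fin (n + 1)) :
    Continuous fun t : Fin (n + 1) → ℝ => (-1) ^ ((j : ℕ) + 1) *
      (cosKernel x (t j) * (cosMatrix t (Matrix.vecCons y (j.removeNth t))).det) := by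
  refine continuous_const.mul (Continuous.mul ?_ ?_)
  · exact continuous_cosKernel.comp (f := fun t : Fin (n + 1) → ℝ => (x, t j))
      (continuous_const.prodMk (continuous_apply j))
  · exact continuous_det_cosMatrix (f := fun t => t)
      (g := fun t : Fin (n + 1) → ℝ => Matrix.vecCons y (j.removeNth t)) continuous_id
      (continuous_cons.comp (f := fun t : Fin (n + 1) → ℝ => (y, j.removeNth t))
        (continuous_const.prodMk (continuous_pi fun i => continuous_apply _)))

theorem setIntegral_rowTerm (n : ℕ) (c x y : ℝ) (j : Fin (n + 1)) :
    ∫ t in cube (n + 1) c, (-1) ^ ((j : ℕ) + 1) *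
        (cosKernel x (t j) * (cosMatrix t (Matrix.vecCons y (j.removeNth t))).det) =
      - ∫ s in Ioo 0 c, cosKernel x s * minorCoeff n c s y := by
  rw [setIntegral_cube_insertNth j (continuous_rowTerm n x y j), ← integral_neg]
  congr 1
  ext s
  rw [minorCoeff, ← integral_const_mul, ← integral_neg]
  congr 1
  ext t
  rw [cosMatrix_insertNth, Fin.insertNth_apply_same, Fin.removeNth_insertNth]
  have : ((-1 : ℝ) ^ (j : ℕ)) * (-1) ^ (j : ℕ) = 1 := by
    rw [← pow_add, ← two_mul, pow_mul]
    simp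
  rw [pow_succ]
  linear_combination
    (-(cosKernel x s * (cosMatrix (Matrix.vecCons s t) (Matrix.vecCons y t)).det)) * this

/-- The recursion for the first minors, from the expansion along the first row. -/
theorem minorCoeff_succ (n : ℕ) (c x y : ℝ) :
    minorCoeff (n + 1) c x y = cosKernel x y * detCoeff (n + 1) c -
      (n + 1) * ∫ s in Ioo 0 c, cosKernel x s * minorCoeff n c s y := by
  have hd : IntegrableOn (fun t : Fin (n + 1) → ℝ => (cosMatrix t t).det) (cube (n + 1) c) :=
    integrableOn_cube (continuous_det_cosMatrix continuous_id continuous_id) c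
  rw [minorCoeff]
  simp only [det_cosMatrix_vecCons]
  rw [integral_add (hd.const_mul _)
    (integrable_finsetSum _ fun j _ => integrableOn_cube (continuous_rowTerm n x y j) c),
    integral_const_mul,
    integral_finsetSum _ fun j _ => integrableOn_cube (continuous_rowTerm n x y j) c]
  simp only [setIntegral_rowTerm]
  simp [detCoeff]
  ring

theorem minorCoeff_zero (c x y : ℝ) : minorCoeff 0 c x y = cosKernel x y * detCoeff 0 c := by
  rw [minorCoeff, detCoeff, ← integral_const_mul]
  congr 1
  ext t
  simp [cosMatrix]

theorem abs_detCoeff_le (n : ℕ) {c L : ℝ} (hc : 0 ≤ c) (hL : c ≤ L) :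
    |detCoeff n c| ≤ sqrt ((n * 4) ^ n) * L ^ n := by
  have := norm_setIntegral_le_of_norm_le_const (f := fun t => (cosMatrix t t).det)
    (volume_cube_lt_top n c) (fun t _ => abs_det_cosMatrix_le t t)
  rw [volume_real_cube n hc] at this
  exact this.trans (mul_le_mul_of_nonneg_left (pow_le_pow_left₀ hc hL n) (Real.sqrt_nonneg _))

theorem abs_minorCoeff_le (n : ℕ) {c L : ℝ} (hc : 0 ≤ c) (hL : c ≤ L) (x y : ℝ) :
    |minorCoeff n c x y| ≤ sqrt (((n + 1 : ℕ) * 4) ^ (n + 1)) * L ^ n := by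
  have := norm_setIntegral_le_of_norm_le_const
    (f := fun t => (cosMatrix (Matrix.vecCons x t) (Matrix.vecCons y t)).det)
    (volume_cube_lt_top n c) (fun t _ => abs_det_cosMatrix_le _ _)
  rw [volume_real_cube n hc] at this
  exact this.trans (mul_le_mul_of_nonneg_left (pow_le_pow_left₀ hc hL n) (Real.sqrt_nonneg _))

theorem exists_bound_minorCoeff (L : ℝ) (hL : 1 ≤ L) : ∃ M : ℝ, ∀ n : ℕ, ∀ c ∈ Icc 0 L, ∀ x y : ℝ,
    |detCoeff n c| / n.factorial ≤ M * (1 / 2) ^ n ∧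
      |minorCoeff n c x y| / n.factorial ≤ M * (1 / 2) ^ n := by
  refine ⟨exp (32 * L ^ 2 * exp 1), fun n c hc x y => ⟨?_, ?_⟩⟩
  · refine (div_le_div_of_nonneg_right (abs_detCoeff_le n hc.1 hc.2) (by positivity)).trans
      ((sqrt_pow_div_factorial_le L n).trans ?_)
    gcongr
    norm_num
  · refine (div_le_div_of_nonneg_right (abs_minorCoeff_le n hc.1 hc.2 x y) (by positivity)).trans ?_
    have h1 := sqrt_pow_div_factorial_le L (n + 1)
    set s := sqrt (((n + 1 : ℕ) * 4) ^ (n + 1)) with hs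
    have h2 : s * L ^ n / n.factorial ≤ (n + 1) * (s * L ^ (n + 1) / (n + 1).factorial) := by
      rw [Nat.factorial_succ]
      push_cast
      rw [← mul_div_assoc, mul_div_mul_left _ _ (by positivity)]
      refine div_le_div_of_nonneg_right ?_ (by positivity)
      rw [pow_succ, ← mul_assoc]
      exact le_mul_of_one_le_right (by positivity) hL
    have h3 : ((n : ℝ) + 1) * (1 / 4) ^ (n + 1) ≤ (1 / 2) ^ n := by
      have : (n : ℝ) + 1 ≤ 2 ^ (n + 1) := by exact_mod_cast (Nat.lt_two_pow_self (n := n + 1)).le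
      calc ((n : ℝ) + 1) * (1 / 4) ^ (n + 1) ≤ 2 ^ (n + 1) * (1 / 4) ^ (n + 1) := by gcongr
        _ = (1 / 2) ^ (n + 1) := by rw [← mul_pow]; norm_num
        _ ≤ (1 / 2) ^ n := pow_le_pow_of_le_one (by norm_num) (by norm_num) (by omega)
    calc _ ≤ (n + 1) * (s * L ^ (n + 1) / (n + 1).factorial) := h2
      _ ≤ (n + 1) * (exp (32 * L ^ 2 * exp 1) * (1 / 4) ^ (n + 1)) := by gcongr
      _ = exp (32 * L ^ 2 * exp 1) * ((n + 1) * (1 / 4) ^ (n + 1)) := by ring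
      _ ≤ _ := by gcongr

/-! ### The logarithmic derivative of the determinants -/

/-- Fredholm's first minor `∑ εⁿ/n! ∫_{(0,c)ⁿ} det (…)` with second argument at the end point
`c`; it solves the integral equation of `φ_c^ε` up to the factor `det (1 + ε C_c)`. -/
def minorSum (ε c x : ℝ) : ℝ :=
  ∑' n : ℕ, ε ^ n / (n.factorial : ℝ) * minorCoeff n c x c

theorem abs_pow_of_sq {ε : ℝ} (hε : ε * ε = 1) (n : ℕ) : |ε ^ n| = 1 := by
  rw [abs_pow, (abs_eq_one_iff_sq_eq_one ε).2 (by rw [pow_two, hε]), one_pow]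
where
  abs_eq_one_iff_sq_eq_one (ε : ℝ) : |ε| = 1 ↔ ε ^ 2 = 1 := by
    rw [← sq_abs]
    exact ⟨fun h => by rw [h, one_pow], fun h => (pow_eq_one_iff_of_nonneg (abs_nonneg _)
      two_ne_zero).1 h⟩

theorem exists_bound_fredholm {ε : ℝ} (hε : ε * ε = 1) (L : ℝ) (hL : 1 ≤ L) :
    ∃ M : ℝ, ∀ n : ℕ, ∀ c ∈ Icc 0 L, ∀ x : ℝ,
    ‖ε ^ n / (n.factorial : ℝ) * detCoeff n c‖ ≤ M * (1 / 2) ^ n ∧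
      ‖ε ^ n / (n.factorial : ℝ) * minorCoeff n c x c‖ ≤ M * (1 / 2) ^ n := by
  obtain ⟨M, hM⟩ := exists_bound_minorCoeff L hL
  refine ⟨M, fun n c hc x => ?_⟩
  have e : ∀ d : ℝ, ‖ε ^ n / (n.factorial : ℝ) * d‖ = |d| / n.factorial := fun d => by
    rw [norm_mul, norm_div, Real.norm_eq_abs, abs_pow_of_sq hε, Real.norm_eq_abs,
      Real.norm_eq_abs, abs_of_pos (by positivity : (0 : ℝ) < n.factorial)]
    ring
  rw [e, e]
  exact hM n c hc x c

theorem summable_geom_half (M : ℝ) : Summable fun n : ℕ => M * (1 / 2 : ℝ) ^ n :=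
  (summable_geometric_of_lt_one (by norm_num) (by norm_num)).mul_left M

theorem hasSum_fredholmDet {ε : ℝ} (hε : ε * ε = 1) {c : ℝ} (hc : 0 ≤ c) :
    HasSum (fun n : ℕ => ε ^ n / (n.factorial : ℝ) * detCoeff n c) (fredholmDet cosKernel c ε) := by
  obtain ⟨M, hM⟩ := exists_bound_fredholm hε (max c 1) (le_max_right _ _)
  exact (Summable.of_norm_bounded (summable_geom_half M)
    fun n => (hM n c ⟨hc, le_max_left _ _⟩ 0).1).hasSum

theorem hasSum_minorSum {ε : ℝ} (hε : ε * ε = 1) {c : ℝ} (hc : 0 ≤ c) (x : ℝ) :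
    HasSum (fun n : ℕ => ε ^ n / (n.factorial : ℝ) * minorCoeff n c x c) (minorSum ε c x) := by
  obtain ⟨M, hM⟩ := exists_bound_fredholm hε (max c 1) (le_max_right _ _)
  exact (Summable.of_norm_bounded (summable_geom_half M)
    fun n => (hM n c ⟨hc, le_max_left _ _⟩ x).2).hasSum

theorem continuous_minorSum {ε : ℝ} (hε : ε * ε = 1) {c : ℝ} (hc : 0 ≤ c) :
    Continuous (minorSum ε c) := by
  obtain ⟨M, hM⟩ := exists_bound_fredholm hε (max c 1) (le_max_right _ _)
  exact continuous_tsum (fun n => continuous_const.mul (continuous_minorCoeff n c c))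
    (summable_geom_half M) fun n x => (hM n c ⟨hc, le_max_left _ _⟩ x).2

/-- Fredholm's identity for the first minor. -/
theorem minorSum_integral_equation {ε : ℝ} (hε : ε * ε = 1) {c : ℝ} (hc : 0 ≤ c) (x : ℝ) :
    minorSum ε c x + ε * ∫ s in Ioo 0 c, cosKernel x s * minorSum ε c s =
      fredholmDet cosKernel c ε * cosKernel c x := by
  obtain ⟨M, hM⟩ := exists_bound_fredholm hε (max c 1) (le_max_right _ _)
  set F : ℕ → ℝ → ℝ := fun n s => cosKernel x s * (ε ^ n / (n.factorial : ℝ) * minorCoeff n c s c)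
    with hF
  have hFc : ∀ n, Continuous (F n) := fun n =>
    (continuous_cosKernel.comp (f := fun s : ℝ => (x, s)) (by fun_prop)).mul
      (continuous_const.mul (continuous_minorCoeff n c c))
  have hFi : ∀ n, IntegrableOn (F n) (Ioo 0 c) := fun n =>
    ((hFc n).integrableOn_Icc (a := 0) (b := c)).mono_set Ioo_subset_Icc_self
  have hFb : ∀ n s, ‖F n s‖ ≤ 2 * M * (1 / 2) ^ n := fun n s => by
    rw [hF, norm_mul, mul_assoc]
    exact mul_le_mul (abs_cosKernel_le x s) (hM n c ⟨hc, le_max_left _ _⟩ s).2 (norm_nonneg _)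
      (by norm_num)
  have h1 : HasSum (fun n => ∫ s in Ioo 0 c, F n s) (∫ s in Ioo 0 c, ∑' n, F n s) := by
    refine hasSum_integral_of_summable_integral_norm hFi ?_
    refine Summable.of_nonneg_of_le (fun n => integral_nonneg fun s => norm_nonneg _)
      (fun n => ?_) (summable_geom_half (2 * M * c))
    have := norm_setIntegral_le_of_norm_le_const (f := fun s => ‖F n s‖) (s := Ioo 0 c)
      (μ := volume) (C := 2 * M * (1 / 2) ^ n) (by simp)
      (fun s _ => by rw [norm_norm]; exact hFb n s)
    rw [Real.volume_real_Ioo_of_le hc] at this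
    refine (le_abs_self _).trans (this.trans (le_of_eq ?_))
    ring
  have h2 : (∫ s in Ioo 0 c, ∑' n, F n s) = ∫ s in Ioo 0 c, cosKernel x s * minorSum ε c s := by
    congr 1
    ext s
    exact ((hasSum_minorSum hε hc s).mul_left _).tsum_eq
  rw [h2] at h1
  have h3 := (hasSum_minorSum hε hc x)
  have h4 := (hasSum_fredholmDet hε hc).mul_right (cosKernel c x)
  rw [← hasSum_nat_add_iff' 1] at h3 h4
  have h5 := h3.add (h1.mul_left ε)
  -- the recursion `minorCoeff_succ`, term by term
  have e : ∀ n : ℕ, ε ^ (n + 1) / ((n + 1).factorial : ℝ) * minorCoeff (n + 1) c x c +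
      ε * ∫ s in Ioo 0 c, F n s =
      ε ^ (n + 1) / ((n + 1).factorial : ℝ) * detCoeff (n + 1) c * cosKernel c x := by
    intro n
    have : ∫ s in Ioo 0 c, F n s = ε ^ n / (n.factorial : ℝ) *
        ∫ s in Ioo 0 c, cosKernel x s * minorCoeff n c s c := by
      rw [← integral_const_mul]
      congr 1
      ext s
      simp only [hF]
      ring
    rw [this, minorCoeff_succ, Nat.factorial_succ, cosKernel_comm x c]
    push_cast
    field_simp
    ring
  simp only [e] at h5
  have h6 := h5.unique h4
  simp only [Finset.sum_range_one] at h6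
  rw [minorCoeff_zero, cosKernel_comm x c] at h6
  linarith

theorem minorSum_eq {ε : ℝ} (hε : ε * ε = 1) {c : ℝ} (hc : 0 < c) (x : ℝ) :
    minorSum ε c x = fredholmDet cosKernel c ε * phi ε c x := by
  have hphi := isPhi_phi hε hc
  have hi : ∀ {g : ℝ → ℝ}, Continuous g → ∀ x, IntegrableOn (fun y => cosKernel x y * g y)
      (Ioo 0 c) := fun {g} hg x => by
    have : Continuous fun y => cosKernel x y * g y :=
      (continuous_cosKernel.comp (by fun_prop : Continuous fun y : ℝ => (x, y))).mul hg
    exact (this.integrableOn_Icc (a := (0 : ℝ)) (b := c)).mono_set Ioo_subset_Icc_self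
  have hm := continuous_minorSum hε hc.le
  set D := fredholmDet cosKernel c ε
  refine sub_eq_zero.1 (eq_zero_of_integral_equation (b := c) hε
    (d := fun x => minorSum ε c x - D * phi ε c x)
    (hm.sub (continuous_const.mul hphi.1)) (fun x => ?_) x)
  have h1 := minorSum_integral_equation hε hc.le x
  have h2 := hphi.2 x
  simp only [mul_sub]
  have h3 : ∀ y, cosKernel x y * (D * phi ε c y) = D * (cosKernel x y * phi ε c y) :=
    fun y => by ring
  simp only [h3]
  rw [integral_sub (hi hm x) ((hi hphi.1 x).const_mul D), integral_const_mul]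
  linear_combination h1 - D * h2

theorem aestronglyMeasurable_minorCoeff_diag (n : ℕ) (μ : Measure ℝ) :
    AEStronglyMeasurable (fun c => minorCoeff n c c c) μ := by
  have h : (fun c => minorCoeff n c c c) = fun c => ∫ t : Fin n → ℝ,
      ({p : ℝ × (Fin n → ℝ) | ∀ i, 0 < p.2 i ∧ p.2 i < p.1}).indicator
        (fun p => (cosMatrix (Matrix.vecCons p.1 p.2) (Matrix.vecCons p.1 p.2)).det) (c, t) := by
    funext c
    rw [minorCoeff, ← integral_indicator (measurableSet_cube _ _)]
    congr 1
    ext t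
    by_cases ht : t ∈ cube n c
    · rw [indicator_of_mem ht, indicator_of_mem]
      exact fun i => mem_cube.1 ht i
    · rw [indicator_of_notMem ht, indicator_of_notMem]
      exact fun h => ht (mem_cube.2 fun i => h i)
  rw [h]
  refine (StronglyMeasurable.integral_prod_right' (f :=
    ({p : ℝ × (Fin n → ℝ) | ∀ i, 0 < p.2 i ∧ p.2 i < p.1}).indicator
        (fun p => (cosMatrix (Matrix.vecCons p.1 p.2) (Matrix.vecCons p.1 p.2)).det))
    (StronglyMeasurable.indicator ?_ ?_)).aestronglyMeasurable
  · exact (continuous_det_cosMatrix continuous_cons continuous_cons).stronglyMeasurable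
  · have : {p : ℝ × (Fin n → ℝ) | ∀ i, 0 < p.2 i ∧ p.2 i < p.1} =
        ⋂ i, ({p | 0 < p.2 i} ∩ {p | p.2 i < p.1}) := by
      ext p
      simp
    rw [this]
    exact MeasurableSet.iInter fun i =>
      (measurableSet_lt measurable_const ((measurable_pi_apply i).comp measurable_snd)).inter
        (measurableSet_lt ((measurable_pi_apply i).comp measurable_snd) measurable_fst)

theorem detCoeff_zero (c : ℝ) (hc : 0 ≤ c) : detCoeff 0 c = 1 := by
  simp [detCoeff, volume_real_cube 0 hc]

/-- The determinant as an integral of the diagonal of the minor. -/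
theorem fredholmDet_eq_integral {ε : ℝ} (hε : ε * ε = 1) {b : ℝ} (hb : 0 ≤ b) :
    IntegrableOn (fun c => minorSum ε c c) (Ioo 0 b) ∧
    fredholmDet cosKernel b ε = 1 + ε * ∫ c in Ioo 0 b, minorSum ε c c := by
  obtain ⟨M, hM⟩ := exists_bound_fredholm hε (max b 1) (le_max_right _ _)
  have hmem : ∀ c ∈ Ioo 0 b, c ∈ Icc 0 (max b 1) := fun c hc =>
    ⟨hc.1.le, hc.2.le.trans (le_max_left _ _)⟩
  set F : ℕ → ℝ → ℝ := fun n c => ε ^ n / (n.factorial : ℝ) * minorCoeff n c c c with hF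
  have hFm : ∀ n, AEStronglyMeasurable (F n) (volume.restrict (Ioo 0 b)) := fun n =>
    (aestronglyMeasurable_minorCoeff_diag n _).const_mul _
  have hFi : ∀ n, IntegrableOn (F n) (Ioo 0 b) := fun n =>
    IntegrableOn.of_bound (by simp) (hFm n) (M * (1 / 2) ^ n)
      ((ae_restrict_iff' measurableSet_Ioo).2 (Eventually.of_forall fun c hc =>
        (hM n c (hmem c hc) c).2))
  have h1 : HasSum (fun n => ∫ c in Ioo 0 b, F n c) (∫ c in Ioo 0 b, ∑' n, F n c) := by
    refine hasSum_integral_of_summable_integral_norm hFi ?_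
    refine Summable.of_nonneg_of_le (fun n => integral_nonneg fun s => norm_nonneg _)
      (fun n => ?_) (summable_geom_half (M * b))
    have := norm_setIntegral_le_of_norm_le_const (f := fun s => ‖F n s‖) (s := Ioo 0 b)
      (μ := volume) (C := M * (1 / 2) ^ n) (by simp)
      (fun c hc => by rw [norm_norm]; exact (hM n c (hmem c hc) c).2)
    rw [Real.volume_real_Ioo_of_le hb] at this
    refine (le_abs_self _).trans (this.trans (le_of_eq ?_))
    ring
  have hms : ∀ c ∈ Ioo 0 b, HasSum (fun n => F n c) (minorSum ε c c) := fun c hc =>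
    hasSum_minorSum hε hc.1.le c
  have h2 : (∫ c in Ioo 0 b, ∑' n, F n c) = ∫ c in Ioo 0 b, minorSum ε c c := rfl
  refine ⟨?_, ?_⟩
  · refine IntegrableOn.of_bound (by simp) ?_ (M * 2) ((ae_restrict_iff' measurableSet_Ioo).2
      (Eventually.of_forall fun c hc => ?_))
    · refine aestronglyMeasurable_of_tendsto_ae atTop (f := fun N c => ∑ n ∈ Finset.range N, F n c)
        (fun N => ?_) ((ae_restrict_iff' measurableSet_Ioo).2
          (Eventually.of_forall fun c hc => (hms c hc).tendsto_sum_nat))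
      exact Finset.aestronglyMeasurable_fun_sum _ fun n _ => hFm n
    · have h3 : HasSum (fun n : ℕ => M * (1 / 2 : ℝ) ^ n) (M * 2) := by
        simpa using hasSum_geometric_two.mul_left M
      exact (hms c hc).norm_le_of_bounded h3 (fun n => (hM n c (hmem c hc) c).2)
  · rw [h2] at h1
    have h4 := hasSum_fredholmDet hε hb
    rw [← hasSum_nat_add_iff' 1] at h4
    have e : ∀ n : ℕ, ε ^ (n + 1) / ((n + 1).factorial : ℝ) * detCoeff (n + 1) b =
        ε * ∫ c in Ioo 0 b, F n c := by
      intro n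
      simp only [hF]
      rw [integral_const_mul, detCoeff_succ, Nat.factorial_succ]
      push_cast
      field_simp
      ring
    simp only [e] at h4
    have h5 := h4.unique (h1.mul_left ε)
    simp only [Finset.sum_range_one, detCoeff_zero b hb] at h5
    simp at h5
    linarith

theorem contDiffAt_phi_diag {ε : ℝ} (hε : ε * ε = 1) {b : ℝ} (hb : 0 < b) :
    ContDiffAt ℝ 1 (fun b => phi ε b b) b :=
  ContDiffAt.comp (g := fun p : ℝ × ℝ => phi ε p.1 p.2) (f := fun b : ℝ => (b, b)) b
    (contDiffAt_phi hε hb) (contDiffAt_id.prodMk contDiffAt_id)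

/-- `b ↦ det (1 + ε C_b)` tends to `1` at `0`, and its logarithmic derivative is `ε φ_b^ε(b)`. -/
theorem fredholmDet_deriv {ε : ℝ} (hε : ε * ε = 1) :
    Tendsto (fun b => fredholmDet cosKernel b ε) (𝓝[>] 0) (𝓝 1) ∧ ∀ b > 0,
    HasDerivAt (fun b => fredholmDet cosKernel b ε)
      (ε * (fredholmDet cosKernel b ε * phi ε b b)) b := by
  set D : ℝ → ℝ := fun b => fredholmDet cosKernel b ε with hD
  have hDi : ∀ b, 0 ≤ b → D b = 1 + ε * ∫ c in (0 : ℝ)..b, minorSum ε c c := fun b hb => by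
    rw [intervalIntegral.integral_of_le hb, integral_Ioc_eq_integral_Ioo]
    exact (fredholmDet_eq_integral hε hb).2
  have hii : ∀ b, 0 ≤ b → IntervalIntegrable (fun c => minorSum ε c c) volume 0 b := fun b hb => by
    rw [intervalIntegrable_iff_integrableOn_Ioo_of_le hb]
    exact (fredholmDet_eq_integral hε hb).1
  have hcont : ∀ L > 0, ContinuousOn D (Icc 0 L) := fun L hL => by
    have h1 := intervalIntegral.continuousOn_primitive_interval
      (f := fun c => minorSum ε c c) (a := 0) (b := L) (μ := volume) (by
        rw [uIcc_of_le hL.le, integrableOn_Icc_iff_integrableOn_Ioo]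
        exact (fredholmDet_eq_integral hε hL.le).1)
    rw [uIcc_of_le hL.le] at h1
    exact (continuousOn_const.add (continuousOn_const.mul h1)).congr fun b hb => hDi b hb.1
  constructor
  · have h1 := (hcont 1 one_pos) 0 ⟨le_rfl, zero_le_one⟩
    have h2 : D 0 = 1 := by simp [hDi 0 le_rfl]
    rw [ContinuousWithinAt, h2] at h1
    refine h1.mono_left ?_
    rw [← nhdsWithin_Ioo_eq_nhdsGT (zero_lt_one (α := ℝ))]
    exact nhdsWithin_mono _ Ioo_subset_Icc_self
  · intro b hb
    have hDc : ∀ x > 0, ContinuousAt D x := fun x hx =>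
      (hcont (x + 1) (by linarith)).continuousAt (Icc_mem_nhds hx (by linarith))
    have hev : (fun c => minorSum ε c c) =ᶠ[𝓝 b] fun c => D c * phi ε c c := by
      filter_upwards [lt_mem_nhds hb] with c hc
      exact minorSum_eq hε hc c
    have hmc : ∀ x > 0, ContinuousAt (fun c => D c * phi ε c c) x := fun x hx =>
      (hDc x hx).mul (contDiffAt_phi_diag hε hx).continuousAt
    have h1 : HasDerivAt (fun u => ∫ c in (0 : ℝ)..u, minorSum ε c c) (minorSum ε b b) b := by
      refine intervalIntegral.integral_hasDerivAt_right (hii b hb.le) ?_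
        ((hmc b hb).congr hev.symm)
      refine ⟨Ioi 0, Ioi_mem_nhds hb, ?_⟩
      have : ContinuousOn (fun c => minorSum ε c c) (Ioi 0) := fun x hx => by
        refine ContinuousAt.continuousWithinAt ((hmc x hx).congr ?_)
        filter_upwards [lt_mem_nhds (show 0 < x from hx)] with c hc
        exact (minorSum_eq hε hc c).symm
      exact this.aestronglyMeasurable measurableSet_Ioi
    have h2 := (h1.const_mul ε).const_add 1
    rw [minorSum_eq hε hb b] at h2
    refine h2.congr_of_eventuallyEq ?_
    filter_upwards [lt_mem_nhds hb] with c hc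
    exact hDi c hc.le

theorem fredholmDet_ne_zero {ε : ℝ} (hε : ε * ε = 1) {b : ℝ} (hb : 0 < b) :
    fredholmDet cosKernel b ε ≠ 0 := by
  intro h0
  obtain ⟨hlim, hder⟩ := fredholmDet_deriv hε
  set D : ℝ → ℝ := fun b => fredholmDet cosKernel b ε with hD
  set G : ℝ → ℝ := fun c => D c * exp (-∫ t in b..c, ε * phi ε t t) with hG
  have hc : ContinuousOn (fun t => ε * phi ε t t) (Ioi 0) := fun x hx =>
    (continuousAt_const.mul (contDiffAt_phi_diag hε hx).continuousAt).continuousWithinAt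
  have hGd : ∀ c ∈ Ioi (0 : ℝ), HasDerivAt G 0 c := by
    intro c hc'
    have h1 : HasDerivAt (fun u => ∫ t in b..u, ε * phi ε t t) (ε * phi ε c c) c := by
      refine intervalIntegral.integral_hasDerivAt_right ?_
        ⟨Ioi 0, Ioi_mem_nhds hc', hc.aestronglyMeasurable measurableSet_Ioi⟩
        (hc.continuousAt (Ioi_mem_nhds hc'))
      refine (hc.mono ?_).intervalIntegrable
      exact (convex_Ioi (0 : ℝ)).ordConnected.uIcc_subset hb hc'
    have h2 := (hder c hc').mul (h1.neg.exp)
    refine h2.congr_deriv ?_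
    simp only [Pi.neg_apply]
    ring
  have hconst : ∀ c ∈ Ioi (0 : ℝ), G c = G b := fun c hc' =>
    isOpen_Ioi.is_const_of_deriv_eq_zero isPreconnected_Ioi
      (fun x hx => (hGd x hx).differentiableAt.differentiableWithinAt)
      (fun x hx => (hGd x hx).deriv) hc' hb
  have hGb : G b = 0 := by
    simp only [hG]
    rw [show D b = 0 from h0, zero_mul]
  have hD0 : ∀ c ∈ Ioi (0 : ℝ), D c = 0 := fun c hc' => by
    have := hconst c hc'
    rw [hGb] at this
    exact (mul_eq_zero.1 this).resolve_right (Real.exp_ne_zero _)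
  have : Tendsto D (𝓝[>] 0) (𝓝 0) :=
    tendsto_const_nhds.congr' (by filter_upwards [self_mem_nhdsWithin] with c hc' using (hD0 c hc').symm)
  exact one_ne_zero (tendsto_nhds_unique hlim this)

/-- The potential in terms of the functions `φ_b^±`. -/
theorem potential_eq (u : ℝ) : potential u =
    exp u * (phi 1 (exp u) (exp u) + phi (-1) (exp u) (exp u)) := by
  have hb := Real.exp_pos u
  have h1 : (1 : ℝ) * 1 = 1 := by norm_num
  have h2 : (-1 : ℝ) * -1 = 1 := by norm_num
  have n1 := fredholmDet_ne_zero h1 hb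
  have n2 := fredholmDet_ne_zero h2 hb
  have d1 := (fredholmDet_deriv h1).2 _ hb
  have d2 := (fredholmDet_deriv h2).2 _ hb
  rw [potential]
  congr 1
  have := ((d1.div d2 n2).log (div_ne_zero n1 n2)).deriv
  refine Eq.trans this ?_
  simp only [Pi.div_apply]
  field_simp
  ring

theorem continuous_potential : Continuous potential := by
  rw [funext potential_eq, continuous_iff_continuousAt]
  intro u
  have hb := Real.exp_pos u
  refine Real.continuous_exp.continuousAt.mul (ContinuousAt.add ?_ ?_)
  · exact ContinuousAt.comp (f := exp) (g := fun b => phi 1 b b)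
      (contDiffAt_phi_diag (by norm_num) hb).continuousAt Real.continuous_exp.continuousAt
  · exact ContinuousAt.comp (f := exp) (g := fun b => phi (-1) b b)
      (contDiffAt_phi_diag (by norm_num) hb).continuousAt Real.continuous_exp.continuousAt

/-! ### Differentiation of integrals with a parameter -/

theorem hasDerivAt_fst_of_contDiffAt {g : ℝ × ℝ → ℝ} {x b : ℝ} (h : ContDiffAt ℝ 1 g (x, b)) :
    HasDerivAt (fun x => g (x, b)) (fderiv ℝ g (x, b) (1, 0)) x :=
  (h.differentiableAt (by norm_num)).hasFDerivAt.comp_hasDerivAt x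
    ((hasDerivAt_id x).prodMk (hasDerivAt_const x b))

theorem hasDerivAt_snd_of_contDiffAt {g : ℝ × ℝ → ℝ} {x b : ℝ} (h : ContDiffAt ℝ 1 g (x, b)) :
    HasDerivAt (fun b => g (x, b)) (fderiv ℝ g (x, b) (0, 1)) b :=
  (h.differentiableAt (by norm_num)).hasFDerivAt.comp_hasDerivAt b
    ((hasDerivAt_const b x).prodMk (hasDerivAt_id b))

theorem continuousAt_fderiv_apply {g : ℝ × ℝ → ℝ} {p : ℝ × ℝ} (h : ContDiffAt ℝ 1 g p)
    (v : ℝ × ℝ) : ContinuousAt (fun q => fderiv ℝ g q v) p :=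
  (h.continuousAt_fderiv (by norm_num)).clm_apply continuousAt_const

section Leibniz

variable {g : ℝ × ℝ → ℝ} {U V : Set ℝ}

theorem hasDerivAt_integral_param (hU : IsOpen U) (hV : V.OrdConnected)
    (hg : ∀ x ∈ U, ∀ b ∈ V, ContDiffAt ℝ 1 g (x, b)) {c d x : ℝ} (hc : c ∈ V) (hd : d ∈ V)
    (hx : x ∈ U) :
    HasDerivAt (fun x => ∫ b in c..d, g (x, b)) (∫ b in c..d, fderiv ℝ g (x, b) (1, 0)) x := by
  obtain ⟨r, hr, hrU⟩ := Metric.nhds_basis_closedBall.mem_iff.1 (hU.mem_nhds hx)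
  have hcd : uIcc c d ⊆ V := hV.uIcc_subset hc hd
  have hcont : ContinuousOn (fun p : ℝ × ℝ => fderiv ℝ g p (1, 0))
      (Metric.closedBall x r ×ˢ uIcc c d) := fun p hp =>
    (continuousAt_fderiv_apply (hg p.1 (hrU hp.1) p.2 (hcd hp.2)) _).continuousWithinAt
  obtain ⟨M, hM⟩ := ((isCompact_closedBall x r).prod isCompact_uIcc).exists_bound_of_continuousOn
    hcont
  have hgc : ∀ y ∈ U, ContinuousOn (fun b => g (y, b)) (uIcc c d) := fun y hy b hb =>
    ((hg y hy b (hcd hb)).continuousAt.comp (f := fun b => (y, b))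
      (by fun_prop)).continuousWithinAt
  have hg'c : ContinuousOn (fun b => fderiv ℝ g (x, b) (1, 0)) (uIcc c d) := fun b hb =>
    ((continuousAt_fderiv_apply (hg x hx b (hcd hb)) (1, 0)).comp (f := fun b => (x, b))
      (by fun_prop)).continuousWithinAt
  refine (intervalIntegral.hasDerivAt_integral_of_dominated_loc_of_deriv_le
    (F := fun x b => g (x, b)) (F' := fun x b => fderiv ℝ g (x, b) (1, 0)) (bound := fun _ => M)
    (s := Metric.closedBall x r) (Metric.closedBall_mem_nhds x hr) ?_
    (hgc x hx).intervalIntegrable ?_ ?_ (by simp) ?_).2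
  · filter_upwards [hU.mem_nhds hx] with y hy
    exact ((hgc y hy).mono uIoc_subset_uIcc).aestronglyMeasurable measurableSet_uIoc
  · exact (hg'c.mono uIoc_subset_uIcc).aestronglyMeasurable measurableSet_uIoc
  · exact Eventually.of_forall fun b hb y hy => hM (y, b) ⟨hy, uIoc_subset_uIcc hb⟩
  · exact Eventually.of_forall fun b hb y hy =>
      hasDerivAt_fst_of_contDiffAt (hg y (hrU hy) b (hcd (uIoc_subset_uIcc hb)))

/-- Leibniz's rule for an integral whose upper limit is the parameter. -/
theorem hasDerivAt_integral_param_right (hU : IsOpen U) (hV : V.OrdConnected) (hVo : IsOpen V)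
    (hg : ∀ x ∈ U, ∀ b ∈ V, ContDiffAt ℝ 1 g (x, b)) {c x : ℝ} (hc : c ∈ V) (hx : x ∈ U)
    (hxV : x ∈ V) :
    HasDerivAt (fun x => ∫ b in c..x, g (x, b))
      (g (x, x) + ∫ b in c..x, fderiv ℝ g (x, b) (1, 0)) x := by
  have h1 := hasDerivAt_integral_param hU hV hg hc hxV hx
  have h2 : HasDerivAt (fun z => ∫ b in x..z, g (z, b)) (g (x, x)) x := by
    rw [hasDerivAt_iff_isLittleO, Asymptotics.isLittleO_iff]
    intro ε hε
    have hc := (hg x hx x hxV).continuousAt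
    rw [Metric.continuousAt_iff] at hc
    obtain ⟨δ, hδ, h⟩ := hc ε hε
    filter_upwards [Metric.ball_mem_nhds x hδ, hU.mem_nhds hx, hVo.mem_nhds hxV] with z hz hzU hzV
    have hint : IntervalIntegrable (fun b => g (z, b)) volume x z := by
      refine ContinuousOn.intervalIntegrable fun b hb => ?_
      exact ((hg z hzU b (hV.uIcc_subset hxV hzV hb)).continuousAt.comp (f := fun b => (z, b))
        (by fun_prop)).continuousWithinAt
    have e : (∫ b in x..z, g (z, b)) - (∫ b in x..x, g (x, b)) - (z - x) • g (x, x) =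
        ∫ b in x..z, (g (z, b) - g (x, x)) := by
      rw [intervalIntegral.integral_sub hint (by simp), intervalIntegral.integral_same]
      simp
    rw [e]
    refine (intervalIntegral.norm_integral_le_of_norm_le_const fun b hb => ?_)
    have hb' : |b - x| ≤ |z - x| := by
      have := uIoc_subset_uIcc hb
      exact abs_sub_left_of_mem_uIcc this
    have := h (x := (z, b)) (by
      rw [Prod.dist_eq]
      refine max_lt hz ?_
      exact lt_of_le_of_lt hb' (by simpa [Real.dist_eq] using hz))
    exact this.le
  have h3 := (h1.add h2).congr_deriv (add_comm _ _)
  refine h3.congr_of_eventuallyEq ?_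
  filter_upwards [hU.mem_nhds hx, hVo.mem_nhds hxV] with z hzU hzV
  have hint : ∀ p ∈ V, ∀ q ∈ V, IntervalIntegrable (fun b => g (z, b)) volume p q :=
    fun p hp q hq => ContinuousOn.intervalIntegrable fun b hb =>
      ((hg z hzU b (hV.uIcc_subset hp hq hb)).continuousAt.comp (f := fun b => (z, b))
        (by fun_prop)).continuousWithinAt
  exact (intervalIntegral.integral_add_adjacent_intervals (hint c hc x hxV)
    (hint x hxV z hzV)).symm

end Leibniz

/-! ### The differential equations and quadratic identities for `φ_b^±` -/

/-- The partial derivative of `φ_b^ε(x)` in `b`. -/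
def phiB (ε b x : ℝ) : ℝ := fderiv ℝ (fun p : ℝ × ℝ => phi ε p.1 p.2) (b, x) (1, 0)

/-- The partial derivative of `φ_b^ε(x)` in `x`. -/
def phiX (ε b x : ℝ) : ℝ := fderiv ℝ (fun p : ℝ × ℝ => phi ε p.1 p.2) (b, x) (0, 1)

section Phi

variable {ε b : ℝ} (hε : ε * ε = 1) (hb : 0 < b)
include hε hb

theorem continuous_phi : Continuous (phi ε b) := (isPhi_phi hε hb).1

theorem phi_eq (x : ℝ) : phi ε b x + ε * ∫ y in (0 : ℝ)..b, cosKernel x y * phi ε b y =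
    cosKernel b x := by
  rw [intervalIntegral.integral_of_le hb.le, integral_Ioc_eq_integral_Ioo]
  exact (isPhi_phi hε hb).2 x

theorem hasDerivAt_phiB (x : ℝ) : HasDerivAt (fun b => phi ε b x) (phiB ε b x) b :=
  hasDerivAt_fst_of_contDiffAt (g := fun p => phi ε p.1 p.2) (contDiffAt_phi hε hb)

theorem hasDerivAt_phiX (x : ℝ) : HasDerivAt (fun x => phi ε b x) (phiX ε b x) x :=
  hasDerivAt_snd_of_contDiffAt (g := fun p => phi ε p.1 p.2) (contDiffAt_phi hε hb)

theorem continuousAt_phi₂ (x : ℝ) : ContinuousAt (fun p : ℝ × ℝ => phi ε p.1 p.2) (b, x) :=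
  (contDiffAt_phi hε (p := (b, x)) hb).continuousAt

theorem continuousAt_phiB (x : ℝ) : ContinuousAt (fun p : ℝ × ℝ => phiB ε p.1 p.2) (b, x) :=
  continuousAt_fderiv_apply (contDiffAt_phi hε (p := (b, x)) hb) (1, 0)

theorem continuousAt_phiX (x : ℝ) : ContinuousAt (fun p : ℝ × ℝ => phiX ε p.1 p.2) (b, x) :=
  continuousAt_fderiv_apply (contDiffAt_phi hε (p := (b, x)) hb) (0, 1)

theorem continuous_phiB : Continuous (phiB ε b) := continuous_iff_continuousAt.2 fun x =>
  (continuousAt_phiB hε hb x).comp (f := fun x : ℝ => (b, x)) (by fun_prop)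

theorem continuous_phiX : Continuous (phiX ε b) := continuous_iff_continuousAt.2 fun x =>
  (continuousAt_phiX hε hb x).comp (f := fun x : ℝ => (b, x)) (by fun_prop)

omit hε hb in
theorem hasDerivAt_cosKernel_left (x y : ℝ) : HasDerivAt (fun x => cosKernel x y)
    (-(4 * π * y) * Real.sin (2 * π * x * y)) x := by
  have h1 : HasDerivAt (fun x => 2 * π * x * y) (2 * π * 1 * y) x :=
    ((hasDerivAt_id x).const_mul _).mul_const _
  refine (h1.cos.const_mul 2).congr_deriv ?_
  ring

/-- `x ∂_x φ^{-ε} + φ^{-ε}/2` solves the integral equation with sign `ε`. -/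
theorem integral_equation_phiX (x : ℝ) :
    (x * phiX (-ε) b x + phi (-ε) b x / 2) +
      ε * ∫ y in (0 : ℝ)..b, cosKernel x y * (y * phiX (-ε) b y + phi (-ε) b y / 2) =
    x * (-(4 * π * b) * Real.sin (2 * π * x * b)) +
      ε * b * phi (-ε) b b * cosKernel x b + cosKernel x b / 2 := by
  have hε' : -ε * -ε = 1 := by rw [neg_mul_neg, hε]
  have hψ := continuous_phi hε' hb
  have hψ' := continuous_phiX hε' hb
  have hk : Continuous fun y => cosKernel x y := by unfold cosKernel; fun_prop
  set s : ℝ → ℝ := fun y => -(4 * π * y) * Real.sin (2 * π * x * y) with hs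
  have hsc : Continuous s := by fun_prop
  -- differentiate the integral equation in `x` in two ways
  have d1 : HasDerivAt (fun x => phi (-ε) b x + -ε * ∫ y in (0 : ℝ)..b,
      cosKernel x y * phi (-ε) b y) (phiX (-ε) b x + -ε * ∫ y in (0 : ℝ)..b,
        s y * phi (-ε) b y) x := by
    refine (hasDerivAt_phiX hε' hb x).add (HasDerivAt.const_mul _ ?_)
    have hint : ∀ x, IntervalIntegrable (fun y => cosKernel x y * phi (-ε) b y) volume 0 b :=
      fun x => (Continuous.intervalIntegrable (by unfold cosKernel; fun_prop) _ _)
    refine (intervalIntegral.hasDerivAt_integral_of_dominated_loc_of_deriv_le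
      (F := fun x y => cosKernel x y * phi (-ε) b y)
      (F' := fun x y => -(4 * π * y) * Real.sin (2 * π * x * y) * phi (-ε) b y)
      (bound := fun y => |4 * π * y| * |phi (-ε) b y|) univ_mem
      (Eventually.of_forall fun x => (by
        unfold cosKernel
        exact (by fun_prop : Continuous fun y => 2 * Real.cos (2 * π * x * y) *
          phi (-ε) b y).aestronglyMeasurable)) (hint x) ?_ ?_ ?_ ?_).2
    · exact (by fun_prop : Continuous fun y =>
        -(4 * π * y) * Real.sin (2 * π * x * y) * phi (-ε) b y).aestronglyMeasurable
    · refine Eventually.of_forall fun y _ z _ => ?_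
      rw [norm_mul, norm_mul, norm_neg]
      refine mul_le_mul_of_nonneg_right ?_ (norm_nonneg _)
      exact mul_le_of_le_one_right (norm_nonneg _) (Real.abs_sin_le_one _)
    · exact Continuous.intervalIntegrable (by fun_prop) _ _
    · exact Eventually.of_forall fun y _ z _ => (hasDerivAt_cosKernel_left z y).mul_const _
  have d2 : HasDerivAt (fun x => phi (-ε) b x + -ε * ∫ y in (0 : ℝ)..b,
      cosKernel x y * phi (-ε) b y) (-(4 * π * b) * Real.sin (2 * π * x * b)) x := by
    have : (fun x => phi (-ε) b x + -ε * ∫ y in (0 : ℝ)..b,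
      cosKernel x y * phi (-ε) b y) = fun x => cosKernel x b := by
      funext x
      rw [phi_eq hε' hb x, cosKernel_comm]
    rw [this]
    exact hasDerivAt_cosKernel_left x b
  have e1 := d1.unique d2
  have hi1 : IntervalIntegrable (fun y => cosKernel x y * phi (-ε) b y) volume 0 b :=
    (hk.mul hψ).intervalIntegrable _ _
  have hi2 : IntervalIntegrable (fun y => cosKernel x y * (y * phiX (-ε) b y)) volume 0 b :=
    (hk.mul (continuous_id.mul hψ')).intervalIntegrable _ _
  have hi3 : IntervalIntegrable (fun y => x * (s y * phi (-ε) b y)) volume 0 b :=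
    (continuous_const.mul (hsc.mul hψ)).intervalIntegrable _ _
  -- integration by parts, using that `x ∂_x` and `y ∂_y` agree on the kernel
  have e2 : x * ∫ y in (0 : ℝ)..b, s y * phi (-ε) b y = cosKernel x b * (b * phi (-ε) b b) -
      (∫ y in (0 : ℝ)..b, cosKernel x y * phi (-ε) b y) -
      ∫ y in (0 : ℝ)..b, cosKernel x y * (y * phiX (-ε) b y) := by
    have hd : ∀ y ∈ uIcc 0 b, HasDerivAt (fun y => cosKernel x y * (y * phi (-ε) b y))
        (x * (s y * phi (-ε) b y) + cosKernel x y * phi (-ε) b y +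
          cosKernel x y * (y * phiX (-ε) b y)) y := by
      intro y _
      have h1 : HasDerivAt (fun y => cosKernel x y)
          (-(4 * π * x) * Real.sin (2 * π * y * x)) y := by
        have := hasDerivAt_cosKernel_left y x
        simpa only [cosKernel_comm] using this
      have h2 := h1.mul ((hasDerivAt_id y).mul (hasDerivAt_phiX hε' hb y))
      refine h2.congr_deriv ?_
      simp only [hs, id, Pi.mul_apply]
      rw [show 2 * π * y * x = 2 * π * x * y by ring]
      ring
    have := intervalIntegral.integral_eq_sub_of_hasDerivAt hd ((hi3.add hi1).add hi2)
    rw [intervalIntegral.integral_add (hi3.add hi1) hi2, intervalIntegral.integral_add hi3 hi1,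
      intervalIntegral.integral_const_mul] at this
    rw [zero_mul, mul_zero, sub_zero] at this
    linarith
  have e3 := phi_eq hε' hb x
  rw [cosKernel_comm b x] at e3
  have e4 : ∫ y in (0 : ℝ)..b, cosKernel x y * (y * phiX (-ε) b y + phi (-ε) b y / 2) =
      (∫ y in (0 : ℝ)..b, cosKernel x y * (y * phiX (-ε) b y)) +
      (∫ y in (0 : ℝ)..b, cosKernel x y * phi (-ε) b y) / 2 := by
    rw [← intervalIntegral.integral_div, ← intervalIntegral.integral_add hi2 (hi1.div_const 2)]
    congr 1
    ext y
    ring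
  rw [e4]
  linear_combination x * e1 + e3 / 2 + ε * e2

/-- `b ∂_b φ^ε + φ^ε/2` solves the integral equation with sign `ε`. -/
theorem integral_equation_phiB (x : ℝ) :
    (b * phiB ε b x + phi ε b x / 2) +
      ε * ∫ y in (0 : ℝ)..b, cosKernel x y * (b * phiB ε b y + phi ε b y / 2) =
    x * (-(4 * π * b) * Real.sin (2 * π * x * b)) -
      ε * b * phi ε b b * cosKernel x b + cosKernel x b / 2 := by
  have hφ := continuous_phi hε hb
  have hφ' := continuous_phiB hε hb
  have hk : Continuous fun y => cosKernel x y := by unfold cosKernel; fun_prop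
  set g : ℝ × ℝ → ℝ := fun p => cosKernel x p.2 * phi ε p.1 p.2 with hg
  have hgd : ∀ b ∈ Ioi (0 : ℝ), ∀ y ∈ (univ : Set ℝ), ContDiffAt ℝ 1 g (b, y) := fun b hb y _ => by
    refine ContDiffAt.mul ?_ (contDiffAt_phi hε hb)
    unfold cosKernel
    fun_prop
  have hg1 : ∀ y, fderiv ℝ g (b, y) (1, 0) = cosKernel x y * phiB ε b y := fun y =>
    (hasDerivAt_fst_of_contDiffAt (hgd b hb y trivial)).unique
      ((hasDerivAt_phiB hε hb y).const_mul (cosKernel x y))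
  have d1 := (hasDerivAt_phiB hε hb x).add ((hasDerivAt_integral_param_right isOpen_Ioi
    ordConnected_univ isOpen_univ hgd (c := 0) trivial hb trivial).const_mul ε)
  simp only [hg1] at d1
  have d2 : HasDerivAt (fun b => phi ε b x + ε * ∫ y in (0 : ℝ)..b, g (b, y))
      (-(4 * π * x) * Real.sin (2 * π * b * x)) b := by
    refine (hasDerivAt_cosKernel_left b x).congr_of_eventuallyEq ?_
    filter_upwards [lt_mem_nhds hb] with c hc
    exact phi_eq hε hc x
  have e1 := d1.unique d2
  have e3 := phi_eq hε hb x
  rw [cosKernel_comm b x] at e3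
  have hi1 : IntervalIntegrable (fun y => cosKernel x y * phi ε b y) volume 0 b :=
    (hk.mul hφ).intervalIntegrable _ _
  have hi2 : IntervalIntegrable (fun y => b * (cosKernel x y * phiB ε b y)) volume 0 b :=
    (continuous_const.mul (hk.mul hφ')).intervalIntegrable _ _
  have e4 : ∫ y in (0 : ℝ)..b, cosKernel x y * (b * phiB ε b y + phi ε b y / 2) =
      b * (∫ y in (0 : ℝ)..b, cosKernel x y * phiB ε b y) +
      (∫ y in (0 : ℝ)..b, cosKernel x y * phi ε b y) / 2 := by
    rw [← intervalIntegral.integral_const_mul, ← intervalIntegral.integral_div,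
      ← intervalIntegral.integral_add hi2 (hi1.div_const 2)]
    congr 1
    ext y
    ring
  rw [e4]
  simp only [hg] at e1
  rw [show 2 * π * b * x = 2 * π * x * b by ring] at e1
  linear_combination b * e1 + e3 / 2

/-- The first-order system linking `φ_b^+` and `φ_b^-`: both sides solve the same integral
equation. -/
theorem phi_system (x : ℝ) :
    x * phiX (-ε) b x + phi (-ε) b x / 2 = b * phiB ε b x + phi ε b x / 2 +
      ε * (b * (phi ε b b + phi (-ε) b b)) * phi ε b x := by
  have hε' : -ε * -ε = 1 := by rw [neg_mul_neg, hε]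
  have c1 := continuous_phi hε hb
  have c2 := continuous_phi hε' hb
  have c3 := continuous_phiB hε hb
  have c4 := continuous_phiX hε' hb
  set m := ε * (b * (phi ε b b + phi (-ε) b b)) with hm
  set p : ℝ → ℝ := fun x => x * phiX (-ε) b x + phi (-ε) b x / 2 with hp
  set q : ℝ → ℝ := fun x => b * phiB ε b x + phi ε b x / 2 with hq
  have hpc : Continuous p := by fun_prop
  have hqc : Continuous q := by fun_prop
  have key := eq_zero_of_integral_equation (b := b) hε (d := fun x => p x - (q x + m * phi ε b x))
    (hpc.sub (hqc.add (continuous_const.mul c1))) (fun x => ?_) x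
  · exact sub_eq_zero.1 key
  · have hk : Continuous fun y => cosKernel x y := by unfold cosKernel; fun_prop
    have e1 := integral_equation_phiX hε hb x
    have e2 := integral_equation_phiB hε hb x
    have e3 := phi_eq hε hb x
    rw [cosKernel_comm b x] at e3
    rw [← integral_Ioc_eq_integral_Ioo, ← intervalIntegral.integral_of_le hb.le]
    have e4 : ∫ y in (0 : ℝ)..b, cosKernel x y * (p y - (q y + m * phi ε b y)) =
        (∫ y in (0 : ℝ)..b, cosKernel x y * p y) - ((∫ y in (0 : ℝ)..b, cosKernel x y * q y) +
          m * ∫ y in (0 : ℝ)..b, cosKernel x y * phi ε b y) := by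
      have i1 : IntervalIntegrable (fun y => cosKernel x y * p y) volume 0 b :=
        (hk.mul hpc).intervalIntegrable _ _
      have i2 : IntervalIntegrable (fun y => cosKernel x y * q y) volume 0 b :=
        (hk.mul hqc).intervalIntegrable _ _
      have i3 : IntervalIntegrable (fun y => m * (cosKernel x y * phi ε b y)) volume 0 b :=
        (continuous_const.mul (hk.mul c1)).intervalIntegrable _ _
      rw [← intervalIntegral.integral_const_mul, ← intervalIntegral.integral_add i2 i3,
        ← intervalIntegral.integral_sub i1 (i2.add i3)]
      congr 1
      ext y
      ring
    rw [e4]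
    simp only [hp, hq] at e1 e2 ⊢
    linear_combination e1 - e2 - m * e3 + hm * cosKernel x b

end Phi

/-! ### Volterra operators built from `φ_b^±` -/

theorem ae_prod_Ioo_mem (l c l' c' : ℝ) : ∀ᵐ p ∂(Measure.prod (volume.restrict (Ioo l c))
    (volume.restrict (Ioo l' c'))), p ∈ Ioo l c ×ˢ Ioo l' c' := by
  rw [Measure.prod_restrict]
  exact ae_restrict_mem (measurableSet_Ioo.prod measurableSet_Ioo)

theorem exists_bound_Icc_prod {P : ℝ × ℝ → ℂ} (hP : Continuous P) (l c l' c' : ℝ) :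
    ∃ M, ∀ x ∈ Icc l c, ∀ y ∈ Icc l' c', ‖P (x, y)‖ ≤ M := by
  obtain ⟨M, hM⟩ := (isCompact_Icc.prod isCompact_Icc).exists_bound_of_continuousOn
    (hP.continuousOn (s := Icc l c ×ˢ Icc l' c'))
  exact ⟨M, fun x hx y hy => hM (x, y) ⟨hx, hy⟩⟩

/-- Fubini's theorem on a triangle. -/
theorem integral_triangle_swap {l c : ℝ} {P : ℝ × ℝ → ℂ} (hP : Continuous P) {g R : ℝ → ℂ}
    (hg : IntegrableOn g (Ioo l c)) (hR : IntegrableOn R (Ioo l c)) :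
    IntegrableOn (fun x => g x * ∫ b in Ioo x c, P (b, x) * R b) (Ioo l c) ∧
    IntegrableOn (fun b => R b * ∫ x in Ioo l b, P (b, x) * g x) (Ioo l c) ∧
    ∫ x in Ioo l c, g x * ∫ b in Ioo x c, P (b, x) * R b =
      ∫ b in Ioo l c, R b * ∫ x in Ioo l b, P (b, x) * g x := by
  obtain ⟨M, hM⟩ := exists_bound_Icc_prod hP l c l c
  set μ := volume.restrict (Ioo l c) with hμ
  set T : Set (ℝ × ℝ) := {p | p.1 < p.2} with hT
  have hTm : MeasurableSet T := measurableSet_lt measurable_fst measurable_snd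
  set Q : ℝ × ℝ → ℂ := T.indicator fun p => P (p.2, p.1) with hQ
  have hQm : AEStronglyMeasurable Q (Measure.prod μ μ) :=
    ((hP.comp (f := fun p : ℝ × ℝ => (p.2, p.1)) (by fun_prop)).stronglyMeasurable.indicator
      hTm).aestronglyMeasurable
  have hint : Integrable (fun p : ℝ × ℝ => Q p * (g p.1 * R p.2)) (Measure.prod μ μ) := by
    refine (Integrable.mul_prod hg hR).bdd_mul (c := max M 0) hQm ?_
    filter_upwards [ae_prod_Ioo_mem l c l c] with p hp
    by_cases h : p ∈ T
    · rw [hQ, indicator_of_mem h]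
      exact (hM _ (Ioo_subset_Icc_self hp.2) _ (Ioo_subset_Icc_self hp.1)).trans (le_max_left _ _)
    · rw [hQ, indicator_of_notMem h, norm_zero]
      exact le_max_right _ _
  have e1 : ∀ x ∈ Ioo l c, ∫ b, Q (x, b) * (g x * R b) ∂μ =
      g x * ∫ b in Ioo x c, P (b, x) * R b := by
    intro x hx
    rw [← integral_const_mul, ← inter_eq_right.2 (Ioo_subset_Ioo_left hx.1.le : Ioo x c ⊆ Ioo l c),
      ← Ioo_inter_Ioi_aux hx, ← setIntegral_indicator measurableSet_Ioi]
    refine setIntegral_congr_fun measurableSet_Ioo fun b _ => ?_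
    by_cases h : x < b
    · have h' : (x, b) ∈ T := h
      simp only [hQ, indicator_of_mem h']
      rw [indicator_of_mem (show b ∈ Ioi x from h)]
      ring
    · have h' : (x, b) ∉ T := h
      simp only [hQ, indicator_of_notMem h']
      rw [indicator_of_notMem (show b ∉ Ioi x from h), zero_mul]
  have e2 : ∀ b ∈ Ioo l c, ∫ x, Q (x, b) * (g x * R b) ∂μ =
      R b * ∫ x in Ioo l b, P (b, x) * g x := by
    intro b hb
    have hi : Ioo l b = Ioo l c ∩ Iio b := by
      ext z
      simp only [mem_Ioo, mem_inter_iff, mem_Iio]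
      exact ⟨fun h => ⟨⟨h.1, h.2.trans hb.2⟩, h.2⟩, fun h => ⟨h.1.1, h.2⟩⟩
    rw [← integral_const_mul, hi, ← setIntegral_indicator measurableSet_Iio]
    refine setIntegral_congr_fun measurableSet_Ioo fun x _ => ?_
    by_cases h : x < b
    · have h' : (x, b) ∈ T := h
      simp only [hQ, indicator_of_mem h']
      rw [indicator_of_mem (show x ∈ Iio b from h)]
      ring
    · have h' : (x, b) ∉ T := h
      simp only [hQ, indicator_of_notMem h']
      rw [indicator_of_notMem (show x ∉ Iio b from h), zero_mul]
  refine ⟨?_, ?_, ?_⟩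
  · exact hint.integral_prod_left.congr
      ((ae_restrict_iff' measurableSet_Ioo).2 (Eventually.of_forall e1))
  · exact hint.integral_prod_right.congr
      ((ae_restrict_iff' measurableSet_Ioo).2 (Eventually.of_forall e2))
  · rw [← setIntegral_congr_fun measurableSet_Ioo e1, ← setIntegral_congr_fun measurableSet_Ioo e2]
    exact integral_integral_swap hint
where
  Ioo_inter_Ioi_aux {l c x : ℝ} (hx : x ∈ Ioo l c) : Ioo l c ∩ Ioi x = Ioo l c ∩ Ioo x c := by
    ext z
    simp only [mem_Ioo, mem_inter_iff, mem_Ioi]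
    exact ⟨fun h => ⟨h.1, h.2, h.1.2⟩, fun h => ⟨h.1, h.2.1⟩⟩

/-- The quadratic identity behind the inversion of the Volterra operators. -/
theorem integral_phi_mul_phi {ε y b : ℝ} (hε : ε * ε = 1) (hy : 0 < y) (hyb : y ≤ b) :
    ∫ x in y..b, phi ε b x * phi ε y x = ε * (phi ε y b - phi ε b y) := by
  have hb := hy.trans_le hyb
  have c1 := continuous_phi hε hb
  have c2 := continuous_phi hε hy
  have hkc : ∀ x, Continuous fun t => cosKernel x t := fun x => by unfold cosKernel; fun_prop
  have hF : Continuous fun p : ℝ × ℝ => phi ε y p.1 * (cosKernel p.1 p.2 * phi ε b p.2) := by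
    have := continuous_cosKernel
    fun_prop
  -- evaluate `∫_0^y ∫_0^b φ_y(x) 2cos(2πxt) φ_b(t) dt dx` by the equation of `φ_b` and by that of `φ_y`
  have hswap : ∫ x in (0 : ℝ)..y, ∫ t in (0 : ℝ)..b, phi ε y x * (cosKernel x t * phi ε b t) =
      ∫ t in (0 : ℝ)..b, ∫ x in (0 : ℝ)..y, phi ε y x * (cosKernel x t * phi ε b t) := by
    simp only [intervalIntegral.integral_of_le hy.le, intervalIntegral.integral_of_le hb.le]
    refine integral_integral_swap ?_
    have : Integrable (fun p : ℝ × ℝ => phi ε y p.1 * (cosKernel p.1 p.2 * phi ε b p.2))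
        (Measure.prod (volume.restrict (Ioc 0 y)) (volume.restrict (Ioc 0 b))) := by
      rw [Measure.prod_restrict]
      exact (hF.continuousOn.integrableOn_compact (isCompact_Icc.prod isCompact_Icc)).mono_set
        (prod_mono Ioc_subset_Icc_self Ioc_subset_Icc_self)
    exact this
  have e1 : ∀ x, ε * ∫ t in (0 : ℝ)..b, phi ε y x * (cosKernel x t * phi ε b t) =
      phi ε y x * cosKernel b x - phi ε b x * phi ε y x := fun x => by
    rw [intervalIntegral.integral_const_mul]
    linear_combination phi ε y x * phi_eq hε hb x
  have e2 : ∀ t, ε * ∫ x in (0 : ℝ)..y, phi ε y x * (cosKernel x t * phi ε b t) =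
      phi ε b t * cosKernel y t - phi ε b t * phi ε y t := fun t => by
    have : ∀ x, phi ε y x * (cosKernel x t * phi ε b t) =
        phi ε b t * (cosKernel t x * phi ε y x) := fun x => by rw [cosKernel_comm x t]; ring
    simp only [this]
    rw [intervalIntegral.integral_const_mul]
    linear_combination phi ε b t * phi_eq hε hy t
  have h1 := congrArg (fun z => ε * z) hswap
  simp only [← intervalIntegral.integral_const_mul, e1, e2] at h1
  have hii : ∀ {f : ℝ → ℝ} (_ : Continuous f) (p q : ℝ), IntervalIntegrable f volume p q :=
    fun hf p q => hf.intervalIntegrable p q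
  have i1 : ∀ p q, IntervalIntegrable (fun x => phi ε b x * phi ε y x) volume p q :=
    hii (c1.mul c2)
  have i2 : ∀ p q, IntervalIntegrable (fun x => phi ε y x * cosKernel b x) volume p q :=
    hii (c2.mul (hkc b))
  have i3 : ∀ p q, IntervalIntegrable (fun x => phi ε b x * cosKernel y x) volume p q :=
    hii (c1.mul (hkc y))
  rw [intervalIntegral.integral_sub (i2 _ _) (i1 _ _),
    intervalIntegral.integral_sub (i3 _ _) (i1 _ _)] at h1
  have h2 := phi_eq hε hy b
  have h3 := phi_eq hε hb y
  have h4 := intervalIntegral.integral_add_adjacent_intervals (i1 0 y) (i1 y b)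
  have h5 : ∫ x in (0 : ℝ)..y, phi ε y x * cosKernel b x =
      ∫ x in (0 : ℝ)..y, cosKernel b x * phi ε y x := by simp only [mul_comm]
  have h6 : ∫ x in (0 : ℝ)..b, phi ε b x * cosKernel y x =
      ∫ x in (0 : ℝ)..b, cosKernel y x * phi ε b x := by simp only [mul_comm]
  rw [h5, h6] at h1
  rw [cosKernel_comm b y] at h3
  linear_combination h4 + h1 - ε * h2 + ε * h3 + (∫ x in (0 : ℝ)..y, cosKernel b x * phi ε y x) * hε
    - (∫ x in (0 : ℝ)..b, cosKernel y x * phi ε b x) * hε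

/-- The kernel `(b, x) ↦ φ_b^ε(x)`, frozen for `b ≤ a` so as to be continuous on the plane. -/
def phiC (ε a : ℝ) (p : ℝ × ℝ) : ℂ := (phi ε (max a p.1) p.2 : ℝ)

theorem phiC_of_le {ε a b : ℝ} (h : a ≤ b) (x : ℝ) : phiC ε a (b, x) = (phi ε b x : ℝ) := by
  rw [phiC, max_eq_right h]

theorem conj_phiC (ε a : ℝ) (p : ℝ × ℝ) : conj (phiC ε a p) = phiC ε a p :=
  Complex.conj_ofReal _

theorem continuous_phiC {ε a : ℝ} (hε : ε * ε = 1) (ha : 0 < a) : Continuous (phiC ε a) := by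
  refine Complex.continuous_ofReal.comp (continuous_iff_continuousAt.2 fun p => ?_)
  exact ContinuousAt.comp (f := fun p : ℝ × ℝ => (max a p.1, p.2))
    (g := fun p : ℝ × ℝ => phi ε p.1 p.2)
    (continuousAt_phi₂ hε (lt_max_of_lt_left ha) p.2) (by fun_prop)

/-- The Volterra operator `g ↦ g(b) - ε ∫_a^b φ_b^ε(x) g(x) dx`. -/
def volterra (ε a : ℝ) (g : ℝ → ℂ) (b : ℝ) : ℂ :=
  g b - ε * ∫ x in Ioo a b, phiC ε a (b, x) * g x

/-- The transposed Volterra operator `R ↦ R(x) - ε ∫_x^c φ_b^ε(x) R(b) db`. -/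
def volterraT (ε a c : ℝ) (R : ℝ → ℂ) (x : ℝ) : ℂ :=
  R x - ε * ∫ b in Ioo x c, phiC ε a (b, x) * R b

/-- Square integrable functions carried by `(a,c)`. -/
structure CarriedBy (a c : ℝ) (R : ℝ → ℂ) : Prop where
  memLp : MemLp R 2 volume
  eq_zero : ∀ x ∉ Ioo a c, R x = 0

theorem CarriedBy.integrable {a c : ℝ} {R : ℝ → ℂ} (h : CarriedBy a c R) : Integrable R := by
  have h1 : IntegrableOn R (Ioo a c) :=
    (h.memLp.mono_measure Measure.restrict_le_self).integrable (by norm_num)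
  rw [← integrable_indicator_iff measurableSet_Ioo] at h1
  refine h1.congr (Eventually.of_forall fun x => ?_)
  by_cases hx : x ∈ Ioo a c
  · rw [indicator_of_mem hx]
  · rw [indicator_of_notMem hx, h.eq_zero x hx]

section Volterra

variable {ε a c : ℝ} (hε : ε * ε = 1) (ha : 0 < a) {R : ℝ → ℂ} (hR : CarriedBy a c R)
include hε ha hR

theorem memLp_volterraT : MemLp (volterraT ε a c R) 2 ν₀ ∧
    IntegrableOn (volterraT ε a c R) (Ioi 0) ∧ ∀ x, c ≤ x → volterraT ε a c R x = 0 := by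
  have hP := continuous_phiC hε ha
  have hz : ∀ x, c ≤ x → ∫ b in Ioo x c, phiC ε a (b, x) * R b = 0 := fun x hx => by
    rw [Ioo_eq_empty (not_lt.2 hx), setIntegral_empty]
  have hz' : ∀ x, c ≤ x → volterraT ε a c R x = 0 := fun x hx => by
    rw [volterraT, hz x hx, hR.eq_zero x fun h => absurd h.2 (not_lt.2 hx)]
    simp
  have h1 : IntegrableOn (fun _ : ℝ => (1 : ℂ)) (Ioo 0 c) := by simp [integrableOn_const_iff]
  have h2 := (integral_triangle_swap hP h1 hR.integrable.integrableOn).1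
  simp only [one_mul] at h2
  obtain ⟨M, hM⟩ := exists_bound_Icc_prod hP 0 c 0 c
  have h3 : MemLp (fun x => ∫ b in Ioo x c, phiC ε a (b, x) * R b) 2
      (volume.restrict (Ioo 0 c)) := by
    refine MemLp.of_bound h2.aestronglyMeasurable (M * ∫ b, ‖R b‖) ?_
    refine (ae_restrict_iff' measurableSet_Ioo).2 (Eventually.of_forall fun x hx => ?_)
    have h4 : ‖∫ b in Ioo x c, phiC ε a (b, x) * R b‖ ≤ ∫ b in Ioo x c, M * ‖R b‖ := by
      refine norm_integral_le_of_norm_le (hR.integrable.integrableOn.norm.const_mul M)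
        ((ae_restrict_iff' measurableSet_Ioo).2 (Eventually.of_forall fun b hb => ?_))
      rw [norm_mul]
      exact mul_le_mul_of_nonneg_right (hM b ⟨(hx.1.trans hb.1).le, hb.2.le⟩ x
        ⟨hx.1.le, hx.2.le⟩) (norm_nonneg _)
    refine h4.trans ?_
    have hM0 : 0 ≤ M := (norm_nonneg _).trans (hM x ⟨hx.1.le, hx.2.le⟩ x ⟨hx.1.le, hx.2.le⟩)
    rw [integral_const_mul]
    exact mul_le_mul_of_nonneg_left (setIntegral_le_integral hR.integrable.norm
      (Eventually.of_forall fun _ => norm_nonneg _)) hM0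
  have h5 : MemLp (volterraT ε a c R) 2 (volume.restrict (Ioo 0 c)) :=
    (hR.memLp.mono_measure Measure.restrict_le_self).sub (h3.const_mul (ε : ℂ))
  have h6 : (Ioo 0 c).indicator (volterraT ε a c R) =ᵐ[ν₀] volterraT ε a c R := by
    refine (ae_restrict_iff' measurableSet_Ioi).2 (Eventually.of_forall fun x hx => ?_)
    by_cases hxc : x < c
    · rw [indicator_of_mem (show x ∈ Ioo 0 c from ⟨hx, hxc⟩)]
    · rw [indicator_of_notMem (fun h => hxc h.2), hz' x (not_lt.1 hxc)]
  refine ⟨?_, ?_, hz'⟩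
  · have h7 : MemLp ((Ioo 0 c).indicator (volterraT ε a c R)) 2 volume :=
      (memLp_indicator_iff_restrict measurableSet_Ioo).2 h5
    exact (memLp_congr_ae h6).1 (h7.mono_measure Measure.restrict_le_self)
  · have h7 : Integrable ((Ioo 0 c).indicator (volterraT ε a c R)) :=
      (integrable_indicator_iff measurableSet_Ioo).2 (h5.integrable (by norm_num))
    exact (h7.mono_measure Measure.restrict_le_self).congr h6

/-- The cosine transform of `R - ε ∫_x^c φ_b(x) R(b) db`: by the integral equation for `φ_b`. -/
theorem cosInt_volterraT (y : ℝ) :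
    cosInt (volterraT ε a c R) y = ∫ b in Ioo a c, phiC ε a (b, y) * R b := by
  obtain ⟨-, hi, hz⟩ := memLp_volterraT hε ha hR
  have hP := continuous_phiC hε ha
  have hk : IntegrableOn (fun x => (cosKernel x y : ℂ)) (Ioo 0 c) := by
    have : Continuous fun x => (cosKernel x y : ℂ) := by unfold cosKernel; fun_prop
    exact (this.integrableOn_Icc (a := 0) (b := c)).mono_set Ioo_subset_Icc_self
  obtain ⟨t1, t2, t3⟩ := integral_triangle_swap hP hk hR.integrable.integrableOn
  have hkR : IntegrableOn (fun x => (cosKernel x y : ℂ) * R x) (Ioo 0 c) :=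
    integrable_cosKernel_mul hR.integrable.integrableOn y
  have e1 : cosInt (volterraT ε a c R) y =
      ∫ x in Ioo 0 c, (cosKernel x y : ℂ) * volterraT ε a c R x := by
    rw [cosInt]
    refine (setIntegral_eq_of_subset_of_forall_sdiff_eq_zero measurableSet_Ioi
      (fun x hx => hx.1) fun x hx => ?_)
    rw [hz x (not_lt.1 fun h => hx.2 ⟨hx.1, h⟩), mul_zero]
  have e2 : ∀ x, (cosKernel x y : ℂ) * volterraT ε a c R x = (cosKernel x y : ℂ) * R x -
      ε * ((cosKernel x y : ℂ) * ∫ b in Ioo x c, phiC ε a (b, x) * R b) := fun x => by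
    rw [volterraT]
    ring
  simp only [e1, e2]
  rw [integral_sub hkR (t1.const_mul _), integral_const_mul, t3, ← integral_const_mul,
    ← integral_sub hkR (t2.const_mul _)]
  refine setIntegral_eq_of_subset_of_forall_sdiff_eq_zero measurableSet_Ioo
      (Ioo_subset_Ioo_left ha.le) (fun x hx => ?_) |>.trans ?_
  · rw [hR.eq_zero x hx.2]
    ring
  · refine setIntegral_congr_fun measurableSet_Ioo fun b hb => ?_
    have hb0 := ha.trans hb.1
    have h1 := (isPhi_phi hε hb0).2 y
    have h2 : ∫ x in Ioo 0 b, phiC ε a (b, x) * (cosKernel x y : ℂ) =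
        ((∫ x in Ioo 0 b, cosKernel y x * phi ε b x : ℝ) : ℂ) := by
      rw [← integral_complex_ofReal]
      congr 1
      ext x
      rw [phiC_of_le hb.1.le, cosKernel_comm]
      push_cast
      ring
    rw [h2, phiC_of_le hb.1.le, ← h1]
    push_cast
    ring

/-- The element `(1 + ε C) (R - ε ∫_x^c φ_b(x) R(b) db)` of `K_a`. -/
def transmuted (hε : ε * ε = 1) (ha : 0 < a) (hR : CarriedBy a c R) : HalfLineL2 :=
  (memLp_volterraT hε ha hR).1.toLp _ + (ε : ℂ) • cosT ((memLp_volterraT hε ha hR).1.toLp _)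

omit hε ha hR in
theorem ofReal_mul_self_eq_one (hε : ε * ε = 1) : (ε : ℂ) * ε = 1 := by exact_mod_cast hε

theorem cosT_transmuted : cosT (transmuted hε ha hR) = (ε : ℂ) • transmuted hε ha hR := by
  rw [transmuted, map_add, map_smul, cosT_cosT, smul_add, smul_smul, ofReal_mul_self_eq_one hε,
    one_smul, add_comm]

theorem transmuted_ae_eq : ∀ᵐ x ∂ν₀, transmuted hε ha hR x =
    R x + ε * ∫ b in Ioo a x, phiC ε a (b, x) * R b := by
  obtain ⟨h1, hi, hz⟩ := memLp_volterraT hε ha hR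
  have hP := continuous_phiC hε ha
  have hic : IntegrableOn (h1.toLp _) (Ioi 0) := hi.congr h1.coeFn_toLp.symm
  have hsub : ∀ x (p q : ℝ), IntegrableOn (fun b => phiC ε a (b, x) * R b) (Ioo p q) := by
    intro x p q
    obtain ⟨M, hM⟩ := exists_bound_Icc_prod hP p q x x
    refine Integrable.bdd_mul (c := M) hR.integrable.integrableOn
      (hP.comp (f := fun b : ℝ => (b, x)) (by fun_prop)).aestronglyMeasurable
      ((ae_restrict_iff' measurableSet_Ioo).2 (Eventually.of_forall fun b hb => ?_))
    exact hM b ⟨hb.1.le, hb.2.le⟩ x ⟨le_rfl, le_rfl⟩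
  filter_upwards [Lp.coeFn_add (h1.toLp _) ((ε : ℂ) • cosT (h1.toLp _)),
    Lp.coeFn_smul (ε : ℂ) (cosT (h1.toLp _)), h1.coeFn_toLp, cosT_ae_eq _ hic] with x e1 e2 e3 e4
  have e5 : cosInt (h1.toLp _) x = cosInt (volterraT ε a c R) x := by
    rw [cosInt, cosInt]
    refine integral_congr_ae ?_
    filter_upwards [h1.coeFn_toLp] with z hz
    rw [hz]
  have e0 : transmuted hε ha hR x = (h1.toLp _ + (ε : ℂ) • cosT (h1.toLp _)) x := rfl
  rw [e0, e1, Pi.add_apply, e2, Pi.smul_apply, e3, e4, e5, cosInt_volterraT hε ha hR, volterraT,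
    smul_eq_mul]
  -- the integral over `(x,c)` cancels, leaving the one over `(a,x)`
  have key : ∫ b in Ioo a c, phiC ε a (b, x) * R b =
      (∫ b in Ioo a x, phiC ε a (b, x) * R b) + ∫ b in Ioo x c, phiC ε a (b, x) * R b := by
    have hRz : ∀ b ∉ Ioo a c, phiC ε a (b, x) * R b = 0 := fun b hb => by
      rw [hR.eq_zero b hb, mul_zero]
    have f1 : ∀ p q : ℝ, ∫ b in Ioo p q, phiC ε a (b, x) * R b =
        ∫ b in Ioo p q ∩ Ioo a c, phiC ε a (b, x) * R b := fun p q =>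
      (setIntegral_eq_of_subset_of_forall_sdiff_eq_zero measurableSet_Ioo inter_subset_left
        fun b hb => hRz b fun h => hb.2 ⟨hb.1, h⟩)
    rw [f1 a x, f1 x c, Ioo_inter_Ioo, Ioo_inter_Ioo]
    rcases le_total x a with hxa | hxa
    · rw [sup_idem, sup_of_le_right hxa, Ioo_eq_empty (a := a) (b := x ⊓ c)
        (not_lt.2 (inf_le_left.trans hxa)), setIntegral_empty, zero_add, inf_idem]
    · rw [sup_idem, sup_of_le_left hxa, inf_idem]
      rcases le_total x c with hxc | hxc
      · rw [inf_of_le_left hxc]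
        have h5 := hsub x a c
        rw [← integral_Ioc_eq_integral_Ioo, ← integral_Ioc_eq_integral_Ioo,
          ← integral_Ioc_eq_integral_Ioo, ← setIntegral_union (Ioc_disjoint_Ioc_of_le le_rfl)
          measurableSet_Ioc, Ioc_union_Ioc_eq_Ioc hxa hxc]
        · exact (integrableOn_Ioc_iff_integrableOn_Ioo).2 (hsub x a x)
        · exact (integrableOn_Ioc_iff_integrableOn_Ioo).2 (hsub x x c)
      · rw [inf_of_le_right hxc, Ioo_eq_empty (not_lt.2 hxc), setIntegral_empty, add_zero]
  rw [key]
  ring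

theorem transmuted_mem_K : transmuted hε ha hR ∈ K a := by
  have h1 : VanishesBelow a (transmuted hε ha hR) := by
    filter_upwards [transmuted_ae_eq hε ha hR] with x hx hxa
    rw [hx, hR.eq_zero x fun h => absurd h.1 (not_lt.2 hxa.le), Ioo_eq_empty (not_lt.2 hxa.le),
      setIntegral_empty]
    simp
  rw [mem_K_iff, cosT_transmuted]
  exact ⟨h1, h1.smul _⟩

end Volterra

/-! ### Inversion of the transmutation -/

theorem integrableOn_Ioo_of_L2 (g : HalfLineL2) {p q : ℝ} (hp : 0 ≤ p) :
    IntegrableOn g (Ioo p q) :=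
  ((Lp.memLp g).mono_measure (Measure.restrict_mono (fun _ hx => hp.trans_lt hx.1)
    le_rfl)).integrable (by norm_num)

theorem ae_restrict_Ioi_mono {p : ℝ → Prop} {a b : ℝ} (hab : b ≤ a)
    (h : ∀ᵐ x ∂(volume.restrict (Ioi b)), p x) : ∀ᵐ x ∂(volume.restrict (Ioi a)), p x :=
  ae_mono (Measure.restrict_mono (Ioi_subset_Ioi hab) le_rfl) h

section Volterra

variable {ε a c : ℝ} (hε : ε * ε = 1) (ha : 0 < a)
include hε ha

/-- The transposed Volterra operator is adjoint to the Volterra operator. -/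
theorem integral_mul_volterraT {R : ℝ → ℂ} (hR : IntegrableOn R (Ioo a c)) {g : ℝ → ℂ}
    (hg : IntegrableOn g (Ioo a c)) (hgR : IntegrableOn (fun x => g x * R x) (Ioo a c)) :
    IntegrableOn (fun x => g x * volterraT ε a c R x) (Ioo a c) ∧
    IntegrableOn (fun b => R b * volterra ε a g b) (Ioo a c) ∧
    ∫ x in Ioo a c, g x * volterraT ε a c R x = ∫ b in Ioo a c, R b * volterra ε a g b := by
  obtain ⟨t1, t2, t3⟩ := integral_triangle_swap (continuous_phiC hε ha) hg hR
  have e1 : ∀ x, g x * volterraT ε a c R x = g x * R x -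
      ε * (g x * ∫ b in Ioo x c, phiC ε a (b, x) * R b) := fun x => by rw [volterraT]; ring
  have e2 : ∀ b, R b * volterra ε a g b = g b * R b -
      ε * (R b * ∫ x in Ioo a b, phiC ε a (b, x) * g x) := fun x => by rw [volterra]; ring
  simp only [e1, e2]
  refine ⟨hgR.sub (t1.const_mul _), hgR.sub (t2.const_mul _), ?_⟩
  rw [integral_sub hgR (t1.const_mul _), integral_sub hgR (t2.const_mul _), integral_const_mul,
    integral_const_mul, t3]

omit hε ha in
theorem conj_volterraT (R : ℝ → ℂ) (x : ℝ) : conj (volterraT ε a c R x) =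
    volterraT ε a c (fun b => conj (R b)) x := by
  rw [volterraT, volterraT, map_sub, map_mul, ← integral_conj, Complex.conj_ofReal]
  simp only [map_mul, conj_phiC]

theorem inner_transmuted_eq {R : ℝ → ℂ} (hR : CarriedBy a c R) {g : HalfLineL2}
    (hg : cosT g = (ε : ℂ) • g) :
    ⟪transmuted hε ha hR, g⟫ = 2 * ⟪(memLp_volterraT hε ha hR).1.toLp _, g⟫ := by
  rw [transmuted, inner_add_left, inner_smul_left, inner_cosT_left, hg, inner_smul_right,
    Complex.conj_ofReal, ← mul_assoc, ofReal_mul_self_eq_one hε]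
  ring

/-- On the `ε`-eigenspace of `K_a` the adjoint of `transmuted` is twice the Volterra operator. -/
theorem inner_transmuted {R : ℝ → ℂ} (hR : CarriedBy a c R) {g : HalfLineL2}
    (hg : cosT g = (ε : ℂ) • g) (hga : VanishesBelow a g) :
    ⟪transmuted hε ha hR, g⟫ = 2 * ∫ b in Ioo a c, conj (R b) * volterra ε a g b := by
  obtain ⟨h1, hi, hz⟩ := memLp_volterraT hε ha hR
  have e1 := inner_transmuted_eq hε ha hR hg
  have hRc : MemLp (fun b => conj (R b)) 2 volume := hR.memLp.star
  have hga' : MemLp g 2 (volume.restrict (Ioo a c)) :=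
    (Lp.memLp g).mono_measure (Measure.restrict_mono (fun _ hx => ha.trans hx.1) le_rfl)
  have t := (integral_mul_volterraT (c := c) hε ha (R := fun b => conj (R b)) (g := g)
    (((hRc.mono_measure Measure.restrict_le_self).integrable (by norm_num)))
    (hga'.integrable (by norm_num))
    (hga'.integrable_mul (hRc.mono_measure Measure.restrict_le_self))).2.2
  rw [e1, ← t, inner_L2_eq]
  congr 1
  have hae : ∀ᵐ x ∂ν₀, g x * conj (h1.toLp _ x) =
      (Ioo a c).indicator (fun x => g x * volterraT ε a c (fun b => conj (R b)) x) x := by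
    filter_upwards [h1.coeFn_toLp, hga, volume_restrict_ne_aux a] with x hx hxa hne
    rw [hx, conj_volterraT]
    by_cases hxm : x ∈ Ioo a c
    · rw [indicator_of_mem hxm]
    · rw [indicator_of_notMem hxm]
      rcases lt_or_gt_of_ne hne with h | h
      · rw [hxa h, zero_mul]
      · have := hz x (not_lt.1 fun h' => hxm ⟨h, h'⟩)
        rw [← conj_volterraT, this, map_zero, mul_zero]
  rw [integral_congr_ae hae, setIntegral_indicator measurableSet_Ioo,
    inter_eq_right.2 (show Ioo a c ⊆ Ioi 0 from fun x hx => ha.trans hx.1)]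
where
  volume_restrict_ne_aux (a : ℝ) : ∀ᵐ x ∂ν₀, x ≠ a := by
    refine ae_restrict_of_ae ?_
    simp [ae_iff]

/-- The Volterra operator inverts the construction of `transmuted`. -/
theorem volterra_transmuted {R : ℝ → ℂ} (hR : CarriedBy a c R) :
    ∀ᵐ b ∂(volume.restrict (Ioi a)), volterra ε a (transmuted hε ha hR) b = R b := by
  have hP := continuous_phiC hε ha
  have hT := transmuted_ae_eq hε ha hR
  filter_upwards [ae_restrict_Ioi_mono ha.le hT, ae_restrict_mem measurableSet_Ioi] with b hb hba
  have hba' : a < b := hba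
  have e1 : ∫ x in Ioo a b, phiC ε a (b, x) * transmuted hε ha hR x =
      ∫ x in Ioo a b, (phiC ε a (b, x) * R x +
        ε * (phiC ε a (b, x) * ∫ y in Ioo a x, phiC ε a (y, x) * R y)) := by
    refine integral_congr_ae ?_
    filter_upwards [ae_mono (Measure.restrict_mono (fun x hx => ha.trans hx.1 : Ioo a b ⊆ Ioi 0)
      le_rfl) hT] with x hx
    rw [hx]
    ring
  have hRi : IntegrableOn R (Ioo a b) := hR.integrable.integrableOn
  have hbc : Continuous fun x => phiC ε a (b, x) := hP.comp (by fun_prop)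
  have hbi : IntegrableOn (fun x => phiC ε a (b, x)) (Ioo a b) :=
    (hbc.integrableOn_Icc (a := a) (b := b)).mono_set Ioo_subset_Icc_self
  obtain ⟨t1, t2, t3⟩ := integral_triangle_swap (l := a) (c := b)
    (P := fun p : ℝ × ℝ => phiC ε a (p.2, p.1)) (hP.comp (by fun_prop)) hRi hbi
  simp only at t1 t2 t3
  have hPR : IntegrableOn (fun x => phiC ε a (b, x) * R x) (Ioo a b) := by
    obtain ⟨M, hM⟩ := exists_bound_Icc_prod hP b b a b
    refine hRi.bdd_mul (c := M) hbc.aestronglyMeasurable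
      ((ae_restrict_iff' measurableSet_Ioo).2 (Eventually.of_forall fun x hx => ?_))
    exact hM b ⟨le_rfl, le_rfl⟩ x ⟨hx.1.le, hx.2.le⟩
  have hbR : IntegrableOn (fun y => phiC ε a (y, b) * R y) (Ioo a b) := by
    obtain ⟨M, hM⟩ := exists_bound_Icc_prod hP a b b b
    refine hRi.bdd_mul (c := M) (hP.comp (f := fun y : ℝ => (y, b)) (by fun_prop)).aestronglyMeasurable
      ((ae_restrict_iff' measurableSet_Ioo).2 (Eventually.of_forall fun x hx => ?_))
    exact hM x ⟨hx.1.le, hx.2.le⟩ b ⟨le_rfl, le_rfl⟩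
  -- after interchanging the integrals, the inner one is given by the quadratic identity
  have e2 : ∫ y in Ioo a b, R y * ∫ x in Ioo y b, phiC ε a (y, x) * phiC ε a (b, x) =
      ∫ y in Ioo a b, ((ε : ℂ) * (phiC ε a (y, b) * R y) - ε * (phiC ε a (b, y) * R y)) := by
    refine setIntegral_congr_fun measurableSet_Ioo fun y hy => ?_
    have h1 := integral_phi_mul_phi hε (ha.trans hy.1) hy.2.le
    rw [intervalIntegral.integral_of_le hy.2.le, integral_Ioc_eq_integral_Ioo] at h1
    have h2 : ∫ x in Ioo y b, phiC ε a (y, x) * phiC ε a (b, x) =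
        ((∫ x in Ioo y b, phi ε b x * phi ε y x : ℝ) : ℂ) := by
      rw [← integral_complex_ofReal]
      congr 1
      ext x
      rw [phiC_of_le hy.1.le, phiC_of_le hba'.le]
      push_cast
      ring
    rw [h2, h1, phiC_of_le hy.1.le, phiC_of_le hba'.le]
    push_cast
    ring
  rw [volterra, e1, integral_add hPR (t2.const_mul _), integral_const_mul, ← t3, e2,
    integral_sub (hbR.const_mul _) (hPR.const_mul _), integral_const_mul, integral_const_mul, hb]
  linear_combination (-(ε : ℂ) * (∫ y in Ioo a b, phiC ε a (y, b) * R y) +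
    ε * (∫ x in Ioo a b, phiC ε a (b, x) * R x)) * ofReal_mul_self_eq_one hε

/-- Injectivity of the Volterra operator, by Grönwall's inequality. -/
theorem eq_zero_of_volterra_eq_zero {g : HalfLineL2}
    (h : ∀ᵐ b ∂(volume.restrict (Ioi a)), volterra ε a g b = 0) :
    ∀ᵐ b ∂(volume.restrict (Ioi a)), g b = 0 := by
  refine ae_Ioi_of_Ioo fun p c hp hpc => ?_
  have hac : a < c := hp.trans hpc
  have hP := continuous_phiC hε ha
  obtain ⟨M, hM⟩ := exists_bound_Icc_prod hP a c a c
  have hM0 : 0 ≤ M := (norm_nonneg _).trans (hM a ⟨le_rfl, hac.le⟩ a ⟨le_rfl, hac.le⟩)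
  have hgi : IntegrableOn g (Ioo a c) := integrableOn_Ioo_of_L2 g ha.le
  have hgi' : IntegrableOn (fun x => ‖g x‖) (Icc a c) := by
    rw [integrableOn_Icc_iff_integrableOn_Ioo]
    exact hgi.norm
  set G : ℝ → ℝ := fun t => ∫ x in a..t, ‖g x‖ with hG
  have hGc : ContinuousOn G (Icc a c) := by
    have := intervalIntegral.continuousOn_primitive_interval (f := fun x => ‖g x‖) (a := a) (b := c)
      (μ := volume) (by rwa [uIcc_of_le hac.le])
    rwa [uIcc_of_le hac.le] at this
  have hG0 : ∀ t, a ≤ t → 0 ≤ G t := fun t ht =>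
    intervalIntegral.integral_nonneg ht fun _ _ => norm_nonneg _
  -- `G(b) = ∫_a^b |g|` satisfies `|g(b)| ≤ M G(b)`; Grönwall is applied to a primitive of `G`, which
  -- is differentiable since `G` is continuous
  have hgb : ∀ᵐ b ∂(volume.restrict (Ioo a c)), ‖g b‖ ≤ M * G b := by
    filter_upwards [ae_mono (Measure.restrict_mono (fun x hx => hx.1 : Ioo a c ⊆ Ioi a) le_rfl) h,
      ae_restrict_mem measurableSet_Ioo] with b hb hbm
    have h1 : g b = ε * ∫ x in Ioo a b, phiC ε a (b, x) * g x := sub_eq_zero.1 hb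
    have hε1 : ‖(ε : ℂ)‖ = 1 := by
      have := congrArg norm (ofReal_mul_self_eq_one hε)
      rw [norm_mul, norm_one] at this
      exact (mul_self_eq_one_iff.1 this).resolve_right
        (fun h => by linarith [norm_nonneg (ε : ℂ)])
    rw [h1, norm_mul, hε1, one_mul, hG]
    simp only
    rw [intervalIntegral.integral_of_le hbm.1.le, integral_Ioc_eq_integral_Ioo,
      ← integral_const_mul]
    refine norm_integral_le_of_norm_le ((hgi.mono_set (Ioo_subset_Ioo_right hbm.2.le)).norm.const_mul
      M) ((ae_restrict_iff' measurableSet_Ioo).2 (Eventually.of_forall fun x hx => ?_))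
    rw [norm_mul]
    exact mul_le_mul_of_nonneg_right (hM b ⟨hbm.1.le, hbm.2.le⟩ x ⟨hx.1.le, (hx.2.trans hbm.2).le⟩)
      (norm_nonneg _)
  set F : ℝ → ℝ := fun t => ∫ b in a..t, G b with hF
  have hFc : ContinuousOn F (Icc a c) := by
    have := intervalIntegral.continuousOn_primitive_interval (f := G) (a := a) (b := c)
      (μ := volume) (by rw [uIcc_of_le hac.le]; exact hGc.integrableOn_Icc)
    rwa [uIcc_of_le hac.le] at this
  have hGF : ∀ t ∈ Icc a c, G t ≤ M * F t := by
    intro t ht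
    rw [hG, hF]
    simp only
    rw [← intervalIntegral.integral_const_mul]
    refine intervalIntegral.integral_mono_ae_restrict ht.1 ?_ ?_ ?_
    · rw [intervalIntegrable_iff_integrableOn_Icc_of_le ht.1]
      exact hgi'.mono_set (Icc_subset_Icc_right ht.2)
    · rw [intervalIntegrable_iff_integrableOn_Icc_of_le ht.1]
      exact (hGc.mono (Icc_subset_Icc_right ht.2)).integrableOn_Icc.const_mul M
    · rw [Measure.restrict_congr_set Ioo_ae_eq_Icc.symm]
      exact ae_mono (Measure.restrict_mono (Ioo_subset_Ioo_right ht.2) le_rfl) hgb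
  have hFd : ∀ t ∈ Ico a c, HasDerivWithinAt F (G t) (Ici t) t := by
    intro t ht
    have h1 : IntervalIntegrable G volume a t := by
      rw [intervalIntegrable_iff_integrableOn_Icc_of_le ht.1]
      exact (hGc.mono (Icc_subset_Icc_right ht.2.le)).integrableOn_Icc
    have h2 : ContinuousWithinAt G (Ioi t) t :=
      ((hGc t ⟨ht.1, ht.2.le⟩).mono_of_mem_nhdsWithin
        (mem_of_superset (Ioo_mem_nhdsGT ht.2) fun x hx => ⟨ht.1.trans hx.1.le, hx.2.le⟩))
    refine intervalIntegral.integral_hasDerivWithinAt_right (t := Ioi t) h1 ?_ h2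
    refine ⟨Ioo t c, Ioo_mem_nhdsGT ht.2, ?_⟩
    exact (hGc.mono fun x hx => ⟨ht.1.trans hx.1.le, hx.2.le⟩).aestronglyMeasurable
      measurableSet_Ioo
  have hF0 : ∀ t, a ≤ t → t ≤ c → 0 ≤ F t := fun t ht _ =>
    intervalIntegral.integral_nonneg ht fun x hx => hG0 x hx.1
  have hgr := norm_le_gronwallBound_of_norm_deriv_right_le (f := F) (f' := G) (δ := 0) (K := M)
    (ε := 0) hFc hFd (by simp [hF]) (fun t ht => by
      rw [Real.norm_of_nonneg (hG0 t ht.1), Real.norm_of_nonneg (hF0 t ht.1 ht.2.le), add_zero]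
      exact hGF t ⟨ht.1, ht.2.le⟩) c ⟨hac.le, le_rfl⟩
  rw [gronwallBound_ε0, zero_mul] at hgr
  have hFc0 : F c = 0 := norm_eq_zero.1 (le_antisymm hgr (norm_nonneg _))
  have hGc0 : G c = 0 := le_antisymm ((hGF c ⟨hac.le, le_rfl⟩).trans (by rw [hFc0, mul_zero]))
    (hG0 c hac.le)
  have h3 : ∫ x in Ioo a c, ‖g x‖ = 0 := by
    refine Eq.trans ?_ hGc0
    rw [hG]
    simp only
    rw [intervalIntegral.integral_of_le hac.le, integral_Ioc_eq_integral_Ioo]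
  rw [integral_eq_zero_iff_of_nonneg (fun _ => norm_nonneg _) hgi.norm] at h3
  have h4 := ae_mono (Measure.restrict_mono (Ioo_subset_Ioo_left hp.le : Ioo p c ⊆ Ioo a c) le_rfl) h3
  filter_upwards [(ae_restrict_iff' measurableSet_Ioo).1 h4] with x hx hxm
  exact norm_eq_zero.1 (hx hxm)

theorem memLp_volterra_Ioo (g : HalfLineL2) :
    MemLp (volterra ε a g) 2 (volume.restrict (Ioo a c)) := by
  have hP := continuous_phiC hε ha
  obtain ⟨M, hM⟩ := exists_bound_Icc_prod hP a c a c
  have hgi : IntegrableOn g (Ioo a c) := integrableOn_Ioo_of_L2 g ha.le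
  have h1 : IntegrableOn (fun _ : ℝ => (1 : ℂ)) (Ioo a c) := by simp [integrableOn_const_iff]
  have h2 := (integral_triangle_swap hP hgi h1).2.1
  simp only [one_mul] at h2
  refine ((Lp.memLp g).mono_measure (Measure.restrict_mono (fun _ hx => ha.trans hx.1) le_rfl)).sub
    (MemLp.const_mul ?_ (ε : ℂ))
  refine MemLp.of_bound h2.aestronglyMeasurable (M * ∫ x in Ioo a c, ‖g x‖) ?_
  refine (ae_restrict_iff' measurableSet_Ioo).2 (Eventually.of_forall fun b hb => ?_)
  have hM0 : 0 ≤ M := (norm_nonneg _).trans (hM b ⟨hb.1.le, hb.2.le⟩ b ⟨hb.1.le, hb.2.le⟩)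
  have h4 : ‖∫ x in Ioo a b, phiC ε a (b, x) * g x‖ ≤ ∫ x in Ioo a b, M * ‖g x‖ := by
    refine norm_integral_le_of_norm_le
      ((hgi.mono_set (Ioo_subset_Ioo_right hb.2.le)).norm.const_mul M)
      ((ae_restrict_iff' measurableSet_Ioo).2 (Eventually.of_forall fun x hx => ?_))
    rw [norm_mul]
    exact mul_le_mul_of_nonneg_right (hM b ⟨hb.1.le, hb.2.le⟩ x ⟨hx.1.le, (hx.2.trans hb.2).le⟩)
      (norm_nonneg _)
  refine h4.trans ?_
  rw [integral_const_mul]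
  exact mul_le_mul_of_nonneg_left (setIntegral_mono_set hgi.norm
    (Eventually.of_forall fun _ => norm_nonneg _)
    (LE.le.eventuallyLE (Ioo_subset_Ioo_right hb.2.le))) hM0

omit hε ha in
theorem integral_normSq_eq {μ : Measure ℝ} {h : ℝ → ℂ} :
    ∫ x, conj (h x) * h x ∂μ = ((∫ x, ‖h x‖ ^ 2 ∂μ : ℝ) : ℂ) := by
  rw [← integral_complex_ofReal]
  congr 1
  ext x
  rw [mul_comm, Complex.mul_conj, Complex.normSq_eq_norm_sq]

/-- The transmutation is isometric up to the factor `√2`. -/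
theorem norm_sq_transmuted {R : ℝ → ℂ} (hR : CarriedBy a c R) :
    ‖transmuted hε ha hR‖ ^ 2 = 2 * ∫ b in Ioo a c, ‖R b‖ ^ 2 := by
  have h := inner_transmuted hε ha hR (cosT_transmuted hε ha hR)
    (mem_K_iff.1 (transmuted_mem_K hε ha hR)).1
  have e : ∫ b in Ioo a c, conj (R b) * volterra ε a (transmuted hε ha hR) b =
      ∫ b in Ioo a c, conj (R b) * R b := by
    refine integral_congr_ae ?_
    filter_upwards [ae_mono (Measure.restrict_mono (fun x hx => hx.1 : Ioo a c ⊆ Ioi a) le_rfl)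
      (volterra_transmuted hε ha hR)] with b hb
    rw [hb]
  rw [e, integral_normSq_eq, inner_self_eq_norm_sq_to_K] at h
  have h' : ((‖transmuted hε ha hR‖ ^ 2 : ℝ) : ℂ) = ((2 * ∫ b in Ioo a c, ‖R b‖ ^ 2 : ℝ) : ℂ) := by
    push_cast
    exact h
  exact Complex.ofReal_injective h'

/-- The Volterra operator is bounded on the `ε`-eigenspace of the cosine transform in `K_a`. -/
theorem integral_norm_sq_volterra_le {g : HalfLineL2} (hg : cosT g = (ε : ℂ) • g)
    (hga : VanishesBelow a g) : ∫ b in Ioo a c, ‖volterra ε a g b‖ ^ 2 ≤ ‖g‖ ^ 2 := by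
  set R := (Ioo a c).indicator (volterra ε a g) with hRdef
  have hR : CarriedBy a c R :=
    ⟨(memLp_indicator_iff_restrict measurableSet_Ioo).2 (memLp_volterra_Ioo hε ha g),
      fun x hx => indicator_of_notMem hx _⟩
  set I := ∫ b in Ioo a c, ‖volterra ε a g b‖ ^ 2 with hI

  have h1 := norm_sq_transmuted hε ha hR
  have h1' : ∫ b in Ioo a c, ‖R b‖ ^ 2 = I :=
    setIntegral_congr_fun measurableSet_Ioo fun b hb => by rw [hRdef, indicator_of_mem hb]
  have h2 := inner_transmuted hε ha hR hg hga
  have h2' : ∫ b in Ioo a c, conj (R b) * volterra ε a g b = (I : ℂ) := by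
    rw [hI, ← integral_normSq_eq]
    exact setIntegral_congr_fun measurableSet_Ioo fun b hb => by rw [hRdef, indicator_of_mem hb]
  rw [h1'] at h1
  rw [h2'] at h2
  have h3 := norm_inner_le_norm (𝕜 := ℂ) (transmuted hε ha hR) g
  have hI0 : 0 ≤ I := integral_nonneg fun _ => by positivity
  rw [h2, norm_mul, Complex.norm_real, Real.norm_of_nonneg hI0] at h3
  norm_num at h3
  nlinarith [norm_nonneg (transmuted hε ha hR), norm_nonneg g,
    sq_nonneg (‖transmuted hε ha hR‖ - ‖g‖)]

omit hε in
theorem stronglyMeasurable_volterra (hε : ε * ε = 1) {g : ℝ → ℂ} (hg : StronglyMeasurable g) :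
    StronglyMeasurable (volterra ε a g) := by
  refine hg.sub (stronglyMeasurable_const.mul ?_)
  have h : (fun b => ∫ x in Ioo a b, phiC ε a (b, x) * g x) = fun b => ∫ x,
      ({p : ℝ × ℝ | p.2 ∈ Ioo a p.1}).indicator (fun p => phiC ε a p * g p.2) (b, x) := by
    funext b
    rw [← integral_indicator measurableSet_Ioo]
    congr 1
  rw [h]
  refine StronglyMeasurable.integral_prod_right' (StronglyMeasurable.indicator ?_ ?_)
  · exact (continuous_phiC hε ha).stronglyMeasurable.mul (hg.comp_measurable measurable_snd)
  · have : {p : ℝ × ℝ | p.2 ∈ Ioo a p.1} = {p | a < p.2} ∩ {p | p.2 < p.1} := by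
      ext p
      simp
    rw [this]
    exact (measurableSet_lt measurable_const measurable_snd).inter
      (measurableSet_lt measurable_snd measurable_fst)

theorem memLp_volterra {g : HalfLineL2} (hg : cosT g = (ε : ℂ) • g)
    (hga : VanishesBelow a g) : MemLp (volterra ε a g) 2 (volume.restrict (Ioi a)) := by
  have hm := stronglyMeasurable_volterra ha hε (Lp.stronglyMeasurable g)
  rw [memLp_two_iff_integrable_sq_norm hm.aestronglyMeasurable]
  refine integrableOn_Ioi_of_intervalIntegral_norm_bounded (‖g‖ ^ 2) a (b := fun n : ℕ => (n : ℝ))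
    (l := atTop) (fun n => ?_) tendsto_natCast_atTop_atTop ?_
  · rw [integrableOn_Ioc_iff_integrableOn_Ioo]
    exact (memLp_two_iff_integrable_sq_norm hm.aestronglyMeasurable).1
      (memLp_volterra_Ioo (c := (n : ℝ)) hε ha g)
  · filter_upwards [tendsto_natCast_atTop_atTop.eventually_ge_atTop a] with n hn
    rw [intervalIntegral.integral_of_le hn, integral_Ioc_eq_integral_Ioo]
    simp only [norm_pow, norm_norm]
    exact integral_norm_sq_volterra_le hε ha hg hga

end Volterra

/-! ### The unitary map from `K_a` to pairs of functions of `u = log b` -/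

/-- A linear map between Hilbert spaces is unitary if it is injective and if it has, on a dense set
of vectors `d`, right inverses `w` which represent `⟪d, U ·⟫`. -/
theorem exists_unitary_of_dense {X Y : Type*} [NormedAddCommGroup X] [InnerProductSpace ℂ X]
    [CompleteSpace X] [NormedAddCommGroup Y] [InnerProductSpace ℂ Y] [CompleteSpace Y]
    (U : X →ₗ[ℂ] Y) {D : Set Y} (hD : Dense D)
    (hv : ∀ d ∈ D, ∃ w : X, U w = d ∧ ∀ f, ⟪w, f⟫ = ⟪d, U f⟫) (hinj : ∀ f, U f = 0 → f = 0) :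
    ∃ V : X ≃ₗᵢ[ℂ] Y, ∀ f, V f = U f := by
  have hnorm : ∀ d ∈ D, ∀ f, ‖⟪d, U f⟫‖ ≤ ‖d‖ * ‖f‖ := by
    intro d hd f
    obtain ⟨w, hw, hwf⟩ := hv d hd
    have h1 : ‖w‖ = ‖d‖ := by
      have := hwf w
      rw [hw, inner_self_eq_norm_sq_to_K, inner_self_eq_norm_sq_to_K] at this
      have h2 : ‖w‖ ^ 2 = ‖d‖ ^ 2 := by exact_mod_cast this
      exact (pow_left_inj₀ (norm_nonneg _) (norm_nonneg _) two_ne_zero).1 h2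
    rw [← hwf f, ← h1]
    exact norm_inner_le_norm w f
  have hnorm' : ∀ d : Y, ∀ f, ‖⟪d, U f⟫‖ ≤ ‖d‖ * ‖f‖ := by
    intro d f
    have hcl : IsClosed {d : Y | ‖⟪d, U f⟫‖ ≤ ‖d‖ * ‖f‖} :=
      isClosed_le (by fun_prop) (by fun_prop)
    exact hcl.closure_subset_iff.2 (fun d hd => hnorm d hd f) (hD d)
  have hb : ∀ f, ‖U f‖ ≤ 1 * ‖f‖ := by
    intro f
    have := hnorm' (U f) f
    rw [inner_self_eq_norm_sq_to_K] at this
    norm_cast at this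
    rw [abs_of_nonneg (by positivity), pow_two] at this
    rcases (norm_nonneg (U f)).eq_or_lt with h0 | h0
    · rw [← h0]
      positivity
    · rw [one_mul]
      exact le_of_mul_le_mul_left this h0
  set T : X →L[ℂ] Y := U.mkContinuous 1 hb with hT
  have hTU : ∀ f, T f = U f := fun _ => rfl
  have h1 : ∀ d : Y, T (ContinuousLinearMap.adjoint T d) = d := by
    intro d
    have hcl : IsClosed {d : Y | T (ContinuousLinearMap.adjoint T d) = d} :=
      isClosed_eq (by fun_prop) continuous_id
    refine hcl.closure_subset_iff.2 (fun d hd => ?_) (hD d)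
    obtain ⟨w, hw, hwf⟩ := hv d hd
    have : ContinuousLinearMap.adjoint T d = w := ext_inner_right ℂ fun f => by
      rw [ContinuousLinearMap.adjoint_inner_left, hwf f, hTU]
    change T (ContinuousLinearMap.adjoint T d) = d
    rw [this, hTU, hw]
  have h2 : ∀ f, ContinuousLinearMap.adjoint T (T f) = f := by
    intro f
    refine sub_eq_zero.1 (hinj _ ?_)
    rw [← hTU, map_sub, h1, sub_self]
  have h3 : ∀ f, ‖U f‖ = ‖f‖ := by
    intro f
    have : ⟪T f, T f⟫ = ⟪f, f⟫ := by
      rw [← ContinuousLinearMap.adjoint_inner_left, h2]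
    rw [inner_self_eq_norm_sq_to_K, inner_self_eq_norm_sq_to_K] at this
    have h2 : ‖T f‖ ^ 2 = ‖f‖ ^ 2 := by exact_mod_cast this
    exact (pow_left_inj₀ (norm_nonneg _) (norm_nonneg _) two_ne_zero).1 h2
  refine ⟨LinearIsometryEquiv.ofSurjective ⟨U, h3⟩ fun d => ⟨_, h1 d⟩, fun f => rfl⟩

/-! ### Change of variables `b = exp u` -/

theorem exp_image_Ioi {a : ℝ} (ha : 0 < a) : exp '' Ioi (log a) = Ioi a := by
  ext b
  constructor
  · rintro ⟨u, hu, rfl⟩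
    exact (Real.log_lt_iff_lt_exp ha).1 hu
  · intro hb
    exact ⟨log b, Real.log_lt_log ha hb, Real.exp_log (ha.trans hb)⟩

theorem ae_exp_of_ae {a : ℝ} (ha : 0 < a) {p : ℝ → Prop}
    (h : ∀ᵐ b ∂(volume.restrict (Ioi a)), p b) :
    ∀ᵐ u ∂(volume.restrict (Ioi (log a))), p (exp u) := by
  rw [ae_restrict_iff' measurableSet_Ioi] at h ⊢
  rw [ae_iff] at h ⊢
  refine measure_mono_null ?_ (addHaar_image_eq_zero_of_differentiableOn_of_addHaar_eq_zero volume
    (f := log) (s := {b | ¬(b ∈ Ioi a → p b)}) ?_ h)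
  · intro u hu
    refine ⟨exp u, fun h' => hu fun hua => h' ?_, Real.log_exp u⟩
    exact (Real.log_lt_iff_lt_exp ha).1 hua
  · intro b hb
    have hb' : a < b := by
      by_contra hn
      exact hb fun h => absurd h hn
    exact (Real.differentiableAt_log (ha.trans hb').ne').differentiableWithinAt

theorem ae_log_of_ae {a : ℝ} (ha : 0 < a) {p : ℝ → Prop}
    (h : ∀ᵐ u ∂(volume.restrict (Ioi (log a))), p u) :
    ∀ᵐ b ∂(volume.restrict (Ioi a)), p (log b) := by
  rw [ae_restrict_iff' measurableSet_Ioi] at h ⊢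
  rw [ae_iff] at h ⊢
  refine measure_mono_null ?_ (addHaar_image_eq_zero_of_differentiableOn_of_addHaar_eq_zero volume
    (f := exp) (s := {u | ¬(u ∈ Ioi (log a) → p u)})
    Real.differentiable_exp.differentiableOn h)
  intro b hb
  have hb' : a < b := by
    by_contra hn
    exact hb fun h => absurd h hn
  refine ⟨log b, fun h' => hb fun _ => h' (Real.log_lt_log ha hb'), Real.exp_log (ha.trans hb')⟩

theorem integral_exp_image {S : Set ℝ} (hS : MeasurableSet S) {E : Type*} [NormedAddCommGroup E]
    [NormedSpace ℝ E] (F : ℝ → E) :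
    ∫ b in exp '' S, F b = ∫ u in S, exp u • F (exp u) := by
  simpa only [Real.abs_exp] using integral_image_eq_integral_abs_deriv_smul hS
    (fun x _ => (Real.hasDerivAt_exp x).hasDerivWithinAt) Real.exp_injective.injOn F

theorem integrableOn_exp_image {S : Set ℝ} (hS : MeasurableSet S) {E : Type*}
    [NormedAddCommGroup E] [NormedSpace ℝ E] (F : ℝ → E) :
    IntegrableOn F (exp '' S) ↔ IntegrableOn (fun u => exp u • F (exp u)) S := by
  simpa only [Real.abs_exp] using integrableOn_image_iff_integrableOn_abs_deriv_smul hS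
    (fun x _ => (Real.hasDerivAt_exp x).hasDerivWithinAt) Real.exp_injective.injOn F

theorem integral_exp_comp {a : ℝ} (ha : 0 < a) {E : Type*} [NormedAddCommGroup E] [NormedSpace ℝ E]
    (F : ℝ → E) : ∫ b in Ioi a, F b = ∫ u in Ioi (log a), exp u • F (exp u) := by
  rw [← integral_exp_image measurableSet_Ioi, exp_image_Ioi ha]

theorem integrableOn_exp_comp {a : ℝ} (ha : 0 < a) {E : Type*} [NormedAddCommGroup E]
    [NormedSpace ℝ E] (F : ℝ → E) : IntegrableOn F (Ioi a) ↔
      IntegrableOn (fun u => exp u • F (exp u)) (Ioi (log a)) := by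
  rw [← integrableOn_exp_image measurableSet_Ioi, exp_image_Ioi ha]

theorem exp_half_sq (u : ℝ) : exp (u / 2) ^ 2 = exp u := by
  rw [← Real.exp_nat_mul]
  congr 1
  push_cast
  ring

theorem memLp_exp_comp {a : ℝ} (ha : 0 < a) {h : ℝ → ℂ} (hm : StronglyMeasurable h)
    (hh : MemLp h 2 (volume.restrict (Ioi a))) :
    MemLp (fun u => (exp (u / 2) : ℂ) * h (exp u)) 2
      (volume.restrict (Ioi (log a))) := by
  have hm' : StronglyMeasurable (fun u => (exp (u / 2) : ℂ) * h (exp u)) := by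
    refine StronglyMeasurable.mul ?_ (hm.comp_measurable Real.measurable_exp)
    exact (by fun_prop : Continuous fun u : ℝ => (exp (u / 2) : ℂ)).stronglyMeasurable
  rw [memLp_two_iff_integrable_sq_norm hm'.aestronglyMeasurable]
  have h1 := (memLp_two_iff_integrable_sq_norm hm.aestronglyMeasurable).1 hh
  refine ((integrableOn_exp_comp ha _).1 h1).congr (Eventually.of_forall fun u => ?_)
  simp only [norm_mul, mul_pow, smul_eq_mul, Complex.norm_real, Real.norm_eq_abs, Real.abs_exp,
    exp_half_sq]

/-! ### Pairs of functions -/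

section Pairs

variable {u₀ : ℝ}

theorem memLp_pair {α β : ℝ → ℂ} (hα : MemLp α 2 (volume.restrict (Ioi u₀)))
    (hβ : MemLp β 2 (volume.restrict (Ioi u₀))) :
    MemLp (fun u => !₂[α u, β u]) 2 ((2⁻¹ : ℝ≥0∞) • volume.restrict (Ioi u₀)) := by
  refine MemLp.smul_measure ?_ (by simp)
  have h0 := (ContinuousLinearMap.toSpanSingleton ℂ
    (EuclideanSpace.single (0 : Fin 2) (1 : ℂ))).comp_memLp' hα
  have h1 := (ContinuousLinearMap.toSpanSingleton ℂ
    (EuclideanSpace.single (1 : Fin 2) (1 : ℂ))).comp_memLp' hβ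
  refine (memLp_congr_ae (Eventually.of_forall fun u => ?_)).1 (h0.add h1)
  ext i
  fin_cases i <;> simp

theorem memLp_pair_apply (T : PairL2 u₀) (i : Fin 2) :
    MemLp (fun u => T u i) 2 (volume.restrict (Ioi u₀)) := by
  have h := (EuclideanSpace.proj i : EuclideanSpace ℂ (Fin 2) →L[ℂ] ℂ).comp_memLp' (Lp.memLp T)
  refine MemLp.of_measure_le_smul (c := 2) (by simp) ?_ h
  rw [smul_smul, ENNReal.mul_inv_cancel (by simp) (by simp), one_smul]

theorem inner_pair_eq (T S : PairL2 u₀) : ⟪T, S⟫ =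
    (1 / 2) * ∫ u in Ioi u₀, (S u 0 * conj (T u 0) + S u 1 * conj (T u 1)) := by
  rw [L2.inner_def, integral_smul_measure]
  simp only [PiLp.inner_apply, Fin.sum_univ_two]
  rw [← Complex.coe_smul]
  simp

theorem pair_ext {T S : PairL2 u₀}
    (h : ∀ᵐ u ∂(volume.restrict (Ioi u₀)), T u 0 = S u 0 ∧ T u 1 = S u 1) : T = S := by
  refine Lp.ext (ae_half_of_ae ?_)
  filter_upwards [h] with u hu
  ext i
  fin_cases i
  · exact hu.1
  · exact hu.2

theorem pair_add_apply (T S : PairL2 u₀) : ∀ᵐ u ∂(volume.restrict (Ioi u₀)),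
    ∀ i, (T + S) u i = T u i + S u i := by
  filter_upwards [ae_of_ae_half (Lp.coeFn_add T S)] with u hu i
  rw [hu]
  rfl

theorem pair_smul_apply (c : ℂ) (T : PairL2 u₀) : ∀ᵐ u ∂(volume.restrict (Ioi u₀)),
    ∀ i, (c • T) u i = c * T u i := by
  filter_upwards [ae_of_ae_half (Lp.coeFn_smul c T)] with u hu i
  rw [hu]
  rfl

/-- The pairs with components `α` and `β`. -/
def mkPair {α β : ℝ → ℂ} (hα : MemLp α 2 (volume.restrict (Ioi u₀)))
    (hβ : MemLp β 2 (volume.restrict (Ioi u₀))) : PairL2 u₀ := (memLp_pair hα hβ).toLp _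

theorem mkPair_apply {α β : ℝ → ℂ} (hα : MemLp α 2 (volume.restrict (Ioi u₀)))
    (hβ : MemLp β 2 (volume.restrict (Ioi u₀))) : ∀ᵐ u ∂(volume.restrict (Ioi u₀)),
    mkPair hα hβ u 0 = α u ∧ mkPair hα hβ u 1 = β u := by
  filter_upwards [ae_of_ae_half (memLp_pair hα hβ).coeFn_toLp] with u hu
  rw [mkPair, hu]
  simp

/-- The pairs vanishing for large `u`. -/
def boundedPairs (u₀ : ℝ) : Set (PairL2 u₀) :=
  {T | ∃ n : ℝ, ∀ᵐ u ∂(volume.restrict (Ioi u₀)), n ≤ u → T u = 0}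

/-- The truncation of a pair at `n`. -/
def truncPair (T : PairL2 u₀) (n : ℝ) : PairL2 u₀ :=
  ((Lp.memLp T).indicator (s := Iio n) measurableSet_Iio).toLp _

theorem truncPair_apply (T : PairL2 u₀) (n : ℝ) : ∀ᵐ u ∂(volume.restrict (Ioi u₀)),
    truncPair T n u = (Iio n).indicator T u :=
  ae_of_ae_half ((Lp.memLp T).indicator (s := Iio n) measurableSet_Iio).coeFn_toLp

theorem truncPair_mem (T : PairL2 u₀) (n : ℝ) : truncPair T n ∈ boundedPairs u₀ := by
  refine ⟨n, ?_⟩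
  filter_upwards [truncPair_apply T n] with u hu hn
  rw [hu, indicator_of_notMem (fun h : u ∈ Iio n => absurd h (not_lt.2 hn))]

theorem tendsto_truncPair (T : PairL2 u₀) : Tendsto (truncPair T) atTop (𝓝 T) := by
  rw [tendsto_iff_edist_tendsto_0]
  refine (tendsto_truncate T (Lp.memLp T)).congr fun R => ?_
  rw [edist_comm, Lp.edist_def]
  refine eLpNorm_congr_ae ?_
  filter_upwards [ae_half_of_ae (truncPair_apply T R)] with x hx
  simp only [Pi.sub_apply, hx]

theorem dense_boundedPairs : Dense (boundedPairs u₀) := fun T =>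
  mem_closure_of_tendsto (tendsto_truncPair T) (Eventually.of_forall fun n => truncPair_mem T n)

end Pairs

/-! ### Even and odd parts for the cosine transform -/

/-- The component `(f + ε C f)/2` of `f`. -/
def parity (ε : ℝ) : HalfLineL2 →L[ℂ] HalfLineL2 :=
  (1 / 2 : ℂ) • (ContinuousLinearMap.id ℂ HalfLineL2 + (ε : ℂ) • cosT.toContinuousLinearMap)

theorem parity_apply (ε : ℝ) (f : HalfLineL2) :
    parity ε f = (1 / 2 : ℂ) • (f + (ε : ℂ) • cosT f) := rfl

theorem cosT_parity {ε : ℝ} (hε : ε * ε = 1) (f : HalfLineL2) :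
    cosT (parity ε f) = (ε : ℂ) • parity ε f := by
  rw [parity_apply, map_smul, map_add, map_smul, cosT_cosT, smul_comm (ε : ℂ) (1 / 2 : ℂ),
    smul_add (ε : ℂ), smul_smul (ε : ℂ), ofReal_mul_self_eq_one hε, one_smul,
    add_comm ((ε : ℂ) • f)]

theorem parity_of_cosT_eq {ε : ℝ} (hε : ε * ε = 1) {f : HalfLineL2} (h : cosT f = (ε : ℂ) • f) :
    parity ε f = f := by
  rw [parity_apply, h, smul_smul, ofReal_mul_self_eq_one hε, one_smul, ← two_smul ℂ f, smul_smul]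
  norm_num

theorem parity_neg_of_cosT_eq {ε : ℝ} (hε : ε * ε = 1) {f : HalfLineL2} (h : cosT f = (ε : ℂ) • f) :
    parity (-ε) f = 0 := by
  rw [parity_apply, h, smul_smul, Complex.ofReal_neg, neg_mul, ofReal_mul_self_eq_one hε]
  simp

theorem parity_add_parity (f : HalfLineL2) : parity 1 f + parity (-1) f = f := by
  rw [parity_apply, parity_apply, ← smul_add]
  have : f + ((1 : ℝ) : ℂ) • cosT f + (f + ((-1 : ℝ) : ℂ) • cosT f) = (2 : ℂ) • f := by
    push_cast
    module
  rw [this, smul_smul]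
  norm_num

theorem parity_mem_K {ε a : ℝ} {f : HalfLineL2} (hf : f ∈ K a) : parity ε f ∈ K a :=
  (K a).smul_mem _ ((K a).add_mem hf ((K a).smul_mem _ (cosT_mem_K hf)))

theorem vanishesBelow_parity {ε a : ℝ} {f : HalfLineL2} (hf : f ∈ K a) :
    VanishesBelow a (parity ε f) := (mem_K_iff.1 (parity_mem_K hf)).1

theorem inner_parity {ε : ℝ} (hε : ε * ε = 1) {x : HalfLineL2} (hx : cosT x = (ε : ℂ) • x)
    (f : HalfLineL2) : ⟪x, parity ε f⟫ = ⟪x, f⟫ := by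
  rw [parity_apply, inner_smul_right, inner_add_right, inner_smul_right, ← inner_cosT_left, hx,
    inner_smul_left, Complex.conj_ofReal, ← mul_assoc, ofReal_mul_self_eq_one hε]
  ring

theorem isClosed_K (a : ℝ) : IsClosed (K a : Set HalfLineL2) := by
  have h : IsClosed {f : HalfLineL2 | VanishesBelow a f} := by
    refine isClosed_of_closure_subset fun f hf => ?_
    obtain ⟨x, hx, hxf⟩ := mem_closure_iff_seq_limit.1 hf
    have h1 := tendstoInMeasure_of_tendsto_Lp hxf
    obtain ⟨ns, -, hns⟩ := h1.exists_seq_tendsto_ae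
    have h2 : ∀ᵐ y ∂ν₀, ∀ n, y < a → x n y = 0 := ae_all_iff.2 fun n => hx n
    change ∀ᵐ y ∂ν₀, y < a → f y = 0
    filter_upwards [hns, h2] with y hy hy2 hya
    refine tendsto_nhds_unique hy ?_
    simp only [fun i => hy2 (ns i) hya]
    exact tendsto_const_nhds
  have : (K a : Set HalfLineL2) = {f | VanishesBelow a f} ∩ cosT ⁻¹' {f | VanishesBelow a f} := by
    ext f
    exact mem_K_iff
  rw [this]
  exact h.inter (h.preimage cosT.continuous)

noncomputable instance (a : ℝ) : CompleteSpace (K a) := (isClosed_K a).completeSpace_coe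

theorem one_mul_one_real : (1 : ℝ) * 1 = 1 := one_mul 1

theorem neg_one_mul_neg_one_real : (-1 : ℝ) * -1 = 1 := by norm_num

section UMap

variable {a : ℝ} (ha : 0 < a)
include ha

theorem volterra_add {ε : ℝ} (hε : ε * ε = 1) (f g : HalfLineL2) :
    ∀ᵐ b ∂(volume.restrict (Ioi a)),
      volterra ε a (f + g : HalfLineL2) b = volterra ε a f b + volterra ε a g b := by
  have hP := continuous_phiC hε ha
  have h := Lp.coeFn_add f g
  filter_upwards [ae_restrict_Ioi_mono ha.le h] with b hb
  have hi : ∀ f : HalfLineL2, IntegrableOn (fun x => phiC ε a (b, x) * f x) (Ioo a b) := by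
    intro f
    obtain ⟨M, hM⟩ := exists_bound_Icc_prod hP b b a b
    refine (integrableOn_Ioo_of_L2 f ha.le).bdd_mul (c := M)
      (hP.comp (f := fun x : ℝ => (b, x)) (by fun_prop)).aestronglyMeasurable
      ((ae_restrict_iff' measurableSet_Ioo).2 (Eventually.of_forall fun x hx => ?_))
    exact hM b ⟨le_rfl, le_rfl⟩ x ⟨hx.1.le, hx.2.le⟩
  have e : ∫ x in Ioo a b, phiC ε a (b, x) * (f + g : HalfLineL2) x =
      (∫ x in Ioo a b, phiC ε a (b, x) * f x) + ∫ x in Ioo a b, phiC ε a (b, x) * g x := by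
    rw [← integral_add (hi f) (hi g)]
    refine integral_congr_ae ?_
    filter_upwards [ae_mono (Measure.restrict_mono (fun x hx => ha.trans hx.1 : Ioo a b ⊆ Ioi 0)
      le_rfl) h] with x hx
    rw [hx, Pi.add_apply, mul_add]
  rw [volterra, e, hb, Pi.add_apply, volterra, volterra]
  ring

theorem volterra_smul {ε : ℝ} (c : ℂ) (f : HalfLineL2) :
    ∀ᵐ b ∂(volume.restrict (Ioi a)),
      volterra ε a (c • f : HalfLineL2) b = c * volterra ε a f b := by
  have h := Lp.coeFn_smul c f
  filter_upwards [ae_restrict_Ioi_mono ha.le h] with b hb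
  have e : ∫ x in Ioo a b, phiC ε a (b, x) * (c • f : HalfLineL2) x =
      c * ∫ x in Ioo a b, phiC ε a (b, x) * f x := by
    rw [← integral_const_mul]
    refine integral_congr_ae ?_
    filter_upwards [ae_mono (Measure.restrict_mono (fun x hx => ha.trans hx.1 : Ioo a b ⊆ Ioi 0)
      le_rfl) h] with x hx
    rw [hx, Pi.smul_apply, smul_eq_mul]
    ring
  rw [volterra, e, hb, Pi.smul_apply, volterra, smul_eq_mul]
  ring

theorem memLp_uComponent {ε : ℝ} (hε : ε * ε = 1) (z : ℂ) (f : K a) :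
    MemLp (fun u => z * ((exp (u / 2) : ℂ) * volterra ε a (parity ε f) (exp u))) 2
      (volume.restrict (Ioi (log a))) :=
  (memLp_exp_comp ha (stronglyMeasurable_volterra ha hε (Lp.stronglyMeasurable _))
    (memLp_volterra hε ha (cosT_parity hε _) (vanishesBelow_parity f.2))).const_mul z

/-- The map `f ↦ (α, β)` with `α(u) = 2 e^{u/2} W⁺f₊(eᵘ)` and `β(u) = -2i e^{u/2} W⁻f₋(eᵘ)`, where
`W^±` are the Volterra operators and `f₊`, `f₋` the parts of `f` on which `C = ±1`. -/
def uMap (ha : 0 < a) : K a →ₗ[ℂ] PairL2 (log a) where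
  toFun f := mkPair (memLp_uComponent ha one_mul_one_real 2 f)
    (memLp_uComponent ha neg_one_mul_neg_one_real (-2 * Complex.I) f)
  map_add' f g := by
    refine pair_ext ?_
    filter_upwards [mkPair_apply (memLp_uComponent ha one_mul_one_real 2 f)
        (memLp_uComponent ha neg_one_mul_neg_one_real (-2 * Complex.I) f),
      mkPair_apply (memLp_uComponent ha one_mul_one_real 2 g)
        (memLp_uComponent ha neg_one_mul_neg_one_real (-2 * Complex.I) g),
      mkPair_apply (memLp_uComponent ha one_mul_one_real 2 (f + g))
        (memLp_uComponent ha neg_one_mul_neg_one_real (-2 * Complex.I) (f + g)),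
      pair_add_apply (mkPair (memLp_uComponent ha one_mul_one_real 2 f)
        (memLp_uComponent ha neg_one_mul_neg_one_real (-2 * Complex.I) f))
        (mkPair (memLp_uComponent ha one_mul_one_real 2 g)
        (memLp_uComponent ha neg_one_mul_neg_one_real (-2 * Complex.I) g)),
      ae_exp_of_ae ha (volterra_add ha one_mul_one_real (parity 1 f) (parity 1 g)),
      ae_exp_of_ae ha (volterra_add ha neg_one_mul_neg_one_real (parity (-1) f) (parity (-1) g))]
      with u h1 h2 h3 h4 h5 h6
    rw [h3.1, h3.2, h4, h4, h1.1, h1.2, h2.1, h2.2, Submodule.coe_add, map_add, map_add, h5, h6]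
    constructor <;> ring
  map_smul' c f := by
    refine pair_ext ?_
    filter_upwards [mkPair_apply (memLp_uComponent ha one_mul_one_real 2 f)
        (memLp_uComponent ha neg_one_mul_neg_one_real (-2 * Complex.I) f),
      mkPair_apply (memLp_uComponent ha one_mul_one_real 2 (c • f))
        (memLp_uComponent ha neg_one_mul_neg_one_real (-2 * Complex.I) (c • f)),
      pair_smul_apply c (mkPair (memLp_uComponent ha one_mul_one_real 2 f)
        (memLp_uComponent ha neg_one_mul_neg_one_real (-2 * Complex.I) f)),
      ae_exp_of_ae ha (volterra_smul ha (ε := 1) c (parity 1 f)),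
      ae_exp_of_ae ha (volterra_smul ha (ε := -1) c (parity (-1) f))]
      with u h1 h3 h4 h5 h6
    rw [RingHom.id_apply, h3.1, h3.2, h4, h4, h1.1, h1.2, Submodule.coe_smul, map_smul, map_smul,
      h5, h6]
    constructor <;> ring

theorem uMap_apply (f : K a) : ∀ᵐ u ∂(volume.restrict (Ioi (log a))),
    uMap ha f u 0 = 2 * ((exp (u / 2) : ℂ) * volterra 1 a (parity 1 f) (exp u)) ∧
    uMap ha f u 1 =
      -2 * Complex.I * ((exp (u / 2) : ℂ) * volterra (-1) a (parity (-1) f) (exp u)) :=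
  mkPair_apply (memLp_uComponent ha one_mul_one_real 2 f)
    (memLp_uComponent ha neg_one_mul_neg_one_real (-2 * Complex.I) f)

theorem uMap_injective (f : K a) (hf : uMap ha f = 0) : f = 0 := by
  have h0 := ae_of_ae_half (Lp.coeFn_zero (EuclideanSpace ℂ (Fin 2)) 2
      ((2⁻¹ : ℝ≥0∞) • volume.restrict (Ioi (log a))))
  have hexp : ∀ u : ℝ, (exp (u / 2) : ℂ) ≠ 0 := fun u => by exact_mod_cast (Real.exp_ne_zero _)
  have hz : ∀ᵐ u ∂(volume.restrict (Ioi (log a))),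
      volterra 1 a (parity 1 f) (exp u) = 0 ∧
        volterra (-1) a (parity (-1) f) (exp u) = 0 := by
    filter_upwards [uMap_apply ha f, h0] with u h1 h2
    rw [hf, h2] at h1
    have e1 := h1.1.symm
    have e2 := h1.2.symm
    simp only [Pi.zero_apply, PiLp.zero_apply, mul_eq_zero, hexp u] at e1 e2
    simpa using And.intro e1 e2
  have hz' := ae_log_of_ae ha hz
  have key : ∀ ε : ℝ, (hε : ε * ε = 1) → (∀ᵐ u ∂(volume.restrict (Ioi a)),
      volterra ε a (parity ε f) u = 0) → parity ε (f : HalfLineL2) = 0 := by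
    intro ε hε h
    have h1 := eq_zero_of_volterra_eq_zero hε ha h
    refine Lp.ext ?_
    have h2 := vanishesBelow_parity (ε := ε) f.2
    filter_upwards [Lp.coeFn_zero ℂ 2 ν₀, h2, ae_restrict_of_ae
      ((ae_restrict_iff' measurableSet_Ioi).1 h1),
      ae_restrict_of_ae (measure_eq_zero_iff_ae_notMem.1 (Real.volume_singleton (a := a)))]
      with x e0 e1 e2 e3
    rw [e0, Pi.zero_apply]
    rcases lt_trichotomy x a with h | h | h
    · exact e1 h
    · exact absurd h e3
    · exact e2 h
  have h1 := key 1 one_mul_one_real (by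
    filter_upwards [hz', ae_restrict_mem measurableSet_Ioi] with b hb hba
    rw [Real.exp_log (ha.trans hba)] at hb
    exact hb.1)
  have h2 := key (-1) neg_one_mul_neg_one_real (by
    filter_upwards [hz', ae_restrict_mem measurableSet_Ioi] with b hb hba
    rw [Real.exp_log (ha.trans hba)] at hb
    exact hb.2)
  apply Subtype.ext
  rw [← parity_add_parity (f : HalfLineL2), h1, h2, add_zero]
  rfl

/-- The pair `d` corresponds to the functions `R^±` on `(a,c)`. -/
def Represents (Rp Rm : ℝ → ℂ) (d : PairL2 (log a)) : Prop :=
  ∀ᵐ u ∂(volume.restrict (Ioi (log a))),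
    d u 0 = 2 * ((exp (u / 2) : ℂ) * Rp (exp u)) ∧
    d u 1 = -2 * Complex.I * ((exp (u / 2) : ℂ) * Rm (exp u))

variable {c : ℝ} {Rp Rm : ℝ → ℂ} (hp : CarriedBy a c Rp) (hm : CarriedBy a c Rm)

/-- The element of `K_a` whose `u`-picture is the pair represented by `R^±`. -/
def fromPair (ha : 0 < a) (hp : CarriedBy a c Rp) (hm : CarriedBy a c Rm) : K a :=
  ⟨transmuted one_mul_one_real ha hp + transmuted neg_one_mul_neg_one_real ha hm,
    (K a).add_mem (transmuted_mem_K _ ha hp) (transmuted_mem_K _ ha hm)⟩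

theorem parity_fromPair :
    parity 1 (fromPair ha hp hm : HalfLineL2) = transmuted one_mul_one_real ha hp ∧
    parity (-1) (fromPair ha hp hm : HalfLineL2) = transmuted neg_one_mul_neg_one_real ha hm := by
  have e1 := cosT_transmuted one_mul_one_real ha hp
  have e2 := cosT_transmuted neg_one_mul_neg_one_real ha hm
  constructor
  · rw [fromPair, map_add, parity_of_cosT_eq one_mul_one_real e1]
    have := parity_neg_of_cosT_eq neg_one_mul_neg_one_real e2
    rw [neg_neg] at this
    rw [this, add_zero]
  · rw [fromPair, map_add, parity_of_cosT_eq neg_one_mul_neg_one_real e2,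
      parity_neg_of_cosT_eq one_mul_one_real e1, zero_add]

theorem uMap_fromPair {d : PairL2 (log a)} (hd : Represents Rp Rm d) :
    uMap ha (fromPair ha hp hm) = d := by
  refine pair_ext ?_
  filter_upwards [uMap_apply ha (fromPair ha hp hm), hd,
    ae_exp_of_ae ha (volterra_transmuted one_mul_one_real ha hp),
    ae_exp_of_ae ha (volterra_transmuted neg_one_mul_neg_one_real ha hm)] with u h1 h2 h3 h4
  rw [(parity_fromPair ha hp hm).1, (parity_fromPair ha hp hm).2, h3, h4] at h1
  rw [h1.1, h1.2, h2.1, h2.2]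
  exact ⟨rfl, rfl⟩

theorem inner_fromPair {d : PairL2 (log a)} (hd : Represents Rp Rm d) (f : K a) :
    ⟪fromPair ha hp hm, f⟫ = ⟪d, uMap ha f⟫ := by
  have key : ∀ ε : ℝ, (hε : ε * ε = 1) → ∀ {R : ℝ → ℂ} (hR : CarriedBy a c R),
      ⟪transmuted hε ha hR, (f : HalfLineL2)⟫ = ∫ u in Ioi (log a), 2 * ((exp u : ℂ) *
        (conj (R (exp u)) * volterra ε a (parity ε f) (exp u))) ∧
      IntegrableOn (fun u => 2 * ((exp u : ℂ) *
        (conj (R (exp u)) * volterra ε a (parity ε f) (exp u))))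
        (Ioi (log a)) := by
    intro ε hε R hR
    have e : ∫ b in Ioo a c, conj (R b) * volterra ε a (parity ε f) b =
        ∫ b in Ioi a, conj (R b) * volterra ε a (parity ε f) b := by
      refine (setIntegral_eq_of_subset_of_forall_sdiff_eq_zero measurableSet_Ioi
        (fun x hx => hx.1) fun x hx => ?_).symm
      rw [hR.eq_zero x hx.2, map_zero, zero_mul]
    have hi : IntegrableOn (fun b => conj (R b) * volterra ε a (parity ε f) b)
        (Ioi a) := by
      have h1 : MemLp (fun b => conj (R b)) 2 (volume.restrict (Ioi a)) :=
        hR.memLp.star.mono_measure Measure.restrict_le_self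
      exact h1.integrable_mul (memLp_volterra hε ha (cosT_parity hε _) (vanishesBelow_parity f.2))
    constructor
    · rw [← inner_parity hε (cosT_transmuted hε ha hR), inner_transmuted hε ha hR
        (cosT_parity hε _) (vanishesBelow_parity f.2), e, integral_exp_comp ha,
        ← integral_const_mul]
      simp only [Complex.real_smul]
    · have := ((integrableOn_exp_comp ha _).1 hi).const_mul 2
      refine this.congr (Eventually.of_forall fun u => ?_)
      simp only [Complex.real_smul]
  obtain ⟨k1, k1'⟩ := key 1 one_mul_one_real hp
  obtain ⟨k2, k2'⟩ := key (-1) neg_one_mul_neg_one_real hm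
  change ⟪transmuted one_mul_one_real ha hp + transmuted neg_one_mul_neg_one_real ha hm,
    (f : HalfLineL2)⟫ = _
  rw [inner_add_left, k1, k2, ← integral_add k1' k2', inner_pair_eq, ← integral_const_mul]
  refine integral_congr_ae ?_
  filter_upwards [hd, uMap_apply ha f] with u h1 h2
  rw [h1.1, h1.2, h2.1, h2.2]
  have e : (exp u : ℂ) = (exp (u / 2) : ℂ) ^ 2 := by
    rw [← exp_half_sq]
    push_cast
    rfl
  simp only [map_mul, map_neg, Complex.conj_ofReal, Complex.conj_I, map_ofNat, e]
  ring_nf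
  rw [Complex.I_sq]
  ring

omit hp hm in
theorem exists_represents {d : PairL2 (log a)} (hd : d ∈ boundedPairs (log a)) :
    ∃ c, ∃ Rp Rm : ℝ → ℂ, CarriedBy a c Rp ∧ CarriedBy a c Rm ∧ Represents Rp Rm d := by
  obtain ⟨n, hn⟩ := hd
  have key : ∀ (z : ℂ) (i : Fin 2), CarriedBy a (exp n) ((Ioo a (exp n)).indicator
      fun b => z * ((sqrt b : ℂ)⁻¹ * d (log b) i)) := by
    intro z i
    refine ⟨?_, fun x hx => indicator_of_notMem hx _⟩
    rw [memLp_indicator_iff_restrict measurableSet_Ioo]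
    refine MemLp.const_mul ?_ z
    have hsm : StronglyMeasurable fun b => (sqrt b : ℂ)⁻¹ * d (log b) i := by
      refine StronglyMeasurable.mul ?_ ?_
      · exact (by fun_prop : Measurable fun b : ℝ => (sqrt b : ℂ)⁻¹).stronglyMeasurable
      · have h1 := (Lp.stronglyMeasurable d).comp_measurable Real.measurable_log
        exact (EuclideanSpace.proj i : EuclideanSpace ℂ (Fin 2) →L[ℂ] ℂ
          ).continuous.comp_stronglyMeasurable h1
    have h2 : MemLp (fun b => (sqrt b : ℂ)⁻¹ * d (log b) i) 2
        (volume.restrict (Ioi a)) := by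
      rw [memLp_two_iff_integrable_sq_norm hsm.aestronglyMeasurable]
      refine (integrableOn_exp_comp ha _).2 ?_
      have h3 := (memLp_two_iff_integrable_sq_norm (memLp_pair_apply d i).1).1 (memLp_pair_apply d i)
      refine h3.congr (Eventually.of_forall fun u => ?_)
      simp only [norm_mul, norm_inv, Complex.norm_real, Real.norm_eq_abs, Real.log_exp, mul_pow,
        smul_eq_mul, inv_pow, sq_abs, Real.sq_sqrt (Real.exp_pos u).le]
      rw [← mul_assoc, mul_inv_cancel₀ (Real.exp_ne_zero u), one_mul]
    exact h2.mono_measure (Measure.restrict_mono (fun x hx => hx.1) le_rfl)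
  refine ⟨exp n, _, _, key (1 / 2) 0, key (Complex.I / 2) 1, ?_⟩
  filter_upwards [hn, ae_restrict_mem measurableSet_Ioi] with u hu hua
  have hs : sqrt (exp u) = exp (u / 2) := by
    rw [← exp_half_sq, Real.sqrt_sq (Real.exp_pos _).le]
  have hne : (exp (u / 2) : ℂ) ≠ 0 := by exact_mod_cast Real.exp_ne_zero _
  have hua' : a < exp u := (Real.log_lt_iff_lt_exp ha).1 hua
  by_cases hun : u < n
  · have hmem : exp u ∈ Ioo a (exp n) := ⟨hua', Real.exp_lt_exp.2 hun⟩
    rw [indicator_of_mem hmem, indicator_of_mem hmem, Real.log_exp, hs]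
    constructor
    · field_simp
    · field_simp
      rw [Complex.I_sq]
      ring
  · have hmem : exp u ∉ Ioo a (exp n) := fun h => hun (Real.exp_lt_exp.1 h.2)
    rw [indicator_of_notMem hmem, indicator_of_notMem hmem, hu (not_lt.1 hun)]
    simp

/-- `uMap` is unitary: on the dense set of pairs vanishing for large `u`, the transmutation is a right
inverse and the adjoint of `uMap`. -/
theorem exists_uMap_unitary : ∃ U : K a ≃ₗᵢ[ℂ] PairL2 (log a), ∀ f, U f = uMap ha f := by
  refine exists_unitary_of_dense (uMap ha) dense_boundedPairs (fun d hd => ?_) (uMap_injective ha)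
  obtain ⟨c, Rp, Rm, hp, hm, hr⟩ := exists_represents ha hd
  exact ⟨fromPair ha hp hm, uMap_fromPair ha hp hm hr, inner_fromPair ha hp hm hr⟩

end UMap

/-! ### Test functions and weak derivatives -/

/-- Real test functions on `(l,∞)`: smooth, with compact support in `(l,∞)`. -/
structure IsTest (l : ℝ) (φ : ℝ → ℝ) : Prop where
  contDiff : ContDiff ℝ ∞ φ
  bounds : ∃ p q, l < p ∧ p < q ∧ ∀ x ∉ Ioo p q, φ x = 0

theorem deriv_eq_zero_of_notMem_Icc {E : Type*} [NormedAddCommGroup E] [NormedSpace ℝ E]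
    {φ : ℝ → E} {p q : ℝ} (h : ∀ x ∉ Ioo p q, φ x = 0)
    {x : ℝ} (hx : x ∉ Icc p q) : deriv φ x = 0 := by
  have : φ =ᶠ[𝓝 x] fun _ => 0 := by
    filter_upwards [isClosed_Icc.isOpen_compl.mem_nhds hx] with y hy
    exact h y fun hy' => hy (Ioo_subset_Icc_self hy')
  rw [this.deriv_eq, deriv_const]

namespace IsTest

variable {l : ℝ} {φ : ℝ → ℝ} (h : IsTest l φ)
include h

theorem hasDerivAt (x : ℝ) : HasDerivAt φ (deriv φ x) x :=
  (h.contDiff.differentiable (by simp) x).hasDerivAt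

theorem continuous : Continuous φ := h.contDiff.continuous

theorem deriv : IsTest l (deriv φ) := by
  obtain ⟨p, q, h1, h2, h3⟩ := h.bounds
  refine ⟨(contDiff_infty_iff_deriv.1 h.contDiff).2, (l + p) / 2, q + 1, by linarith, by linarith,
    fun x hx => deriv_eq_zero_of_notMem_Icc h3 fun hx' => hx ⟨?_, ?_⟩⟩
  · linarith [hx'.1]
  · linarith [hx'.2]

theorem mul {g : ℝ → ℝ} (hg : ContDiff ℝ ∞ g) : IsTest l (fun x => g x * φ x) := by
  obtain ⟨p, q, h1, h2, h3⟩ := h.bounds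
  exact ⟨hg.mul h.contDiff, p, q, h1, h2, fun x hx => by rw [h3 x hx, mul_zero]⟩

theorem add {ψ : ℝ → ℝ} (h' : IsTest l ψ) : IsTest l (fun x => φ x + ψ x) := by
  obtain ⟨p, q, h1, h2, h3⟩ := h.bounds
  obtain ⟨p', q', h1', h2', h3'⟩ := h'.bounds
  refine ⟨h.contDiff.add h'.contDiff, min p p', max q q', lt_min h1 h1',
    (min_le_left _ _).trans_lt (h2.trans_le (le_max_left _ _)), fun x hx => ?_⟩
  rw [h3 x fun hx' => hx ⟨(min_le_left _ _).trans_lt hx'.1, hx'.2.trans_le (le_max_left _ _)⟩,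
    h3' x fun hx' => hx ⟨(min_le_right _ _).trans_lt hx'.1, hx'.2.trans_le (le_max_right _ _)⟩,
    add_zero]

theorem eq_zero_of_le {x : ℝ} (hx : x ≤ l) : φ x = 0 := by
  obtain ⟨p, q, h1, h2, h3⟩ := h.bounds
  exact h3 x fun hx' => absurd hx'.1 (by linarith)

theorem memLp : MemLp (fun x => (φ x : ℂ)) 2 volume := by
  obtain ⟨p, q, h1, h2, h3⟩ := h.bounds
  refine (Complex.continuous_ofReal.comp h.continuous).memLp_of_hasCompactSupport
    (HasCompactSupport.of_support_subset_isCompact (isCompact_Icc (a := p) (b := q)) fun x hx => ?_)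
  by_contra hx'
  exact hx (by simp [h3 x fun hx'' => hx' (Ioo_subset_Icc_self hx'')])

omit h in
theorem setIntegral_eq {p q : ℝ} (hlp : l ≤ p) (hpq : p ≤ q) (h3 : ∀ x ∉ Ioo p q, φ x = 0)
    (f : ℝ → ℂ) : ∫ x in Ioi l, (φ x : ℂ) * f x = ∫ x in p..q, (φ x : ℂ) * f x := by
  rw [intervalIntegral.integral_of_le hpq]
  refine setIntegral_eq_of_subset_of_forall_sdiff_eq_zero measurableSet_Ioi
    (fun x hx => hlp.trans_lt hx.1) fun x hx => ?_
  rw [h3 x fun hx' => hx.2 ⟨hx'.1, hx'.2.le⟩, Complex.ofReal_zero, zero_mul]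

theorem integrableOn_mul {f : ℝ → ℂ} (hf : ∀ x y, l < x → x ≤ y → IntervalIntegrable f volume x y) :
    IntegrableOn (fun x => (φ x : ℂ) * f x) (Ioi l) := by
  obtain ⟨p, q, h1, h2, h3⟩ := h.bounds
  have h4 : IntegrableOn (fun x => (φ x : ℂ) * f x) (Ioc p q) := by
    have := (hf p q h1 h2.le).continuousOn_mul
      (Complex.continuous_ofReal.comp h.continuous).continuousOn
    exact (intervalIntegrable_iff_integrableOn_Ioc_of_le h2.le).1 this
  refine h4.of_forall_sdiff_eq_zero measurableSet_Ioi fun x hx => ?_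
  rw [h3 x fun hx' => hx.2 ⟨hx'.1, hx'.2.le⟩, Complex.ofReal_zero, zero_mul]

end IsTest

theorem exists_isTest_integral_eq_one (l : ℝ) : ∃ χ, IsTest l χ ∧ ∫ x in Ioi l, χ x = 1 := by
  let b : ContDiffBump (l + 2) := ⟨1 / 2, 1, by norm_num, by norm_num⟩
  have hz : ∀ x ∉ Ioo (l + 1) (l + 3), b.normed volume x = 0 := fun x hx => by
    have : x ∉ Function.support (b.normed volume) := by
      rw [b.support_normed_eq, Real.ball_eq_Ioo]
      convert hx using 2
      change Ioo (l + 2 - 1) (l + 2 + 1) = _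
      ring_nf
    simpa using this
  refine ⟨b.normed volume, ⟨b.contDiff_normed, l + 1, l + 3, by linarith, by linarith, hz⟩, ?_⟩
  rw [← b.integral_normed (μ := volume)]
  refine setIntegral_eq_integral_of_forall_compl_eq_zero fun x hx => hz x fun h => hx ?_
  exact show l < x by linarith [h.1]

/-- A test function with integral zero is the derivative of a test function. -/
theorem IsTest.exists_primitive {l : ℝ} {ψ : ℝ → ℝ} (h : IsTest l ψ)
    (h0 : ∫ x in Ioi l, ψ x = 0) : ∃ φ, IsTest l φ ∧ _root_.deriv φ = ψ := by
  obtain ⟨p, q, h1, h2, h3⟩ := h.bounds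
  have hd : ∀ x, HasDerivAt (fun x => ∫ t in p..x, ψ t) (ψ x) x := fun x =>
    intervalIntegral.integral_hasDerivAt_right (h.continuous.intervalIntegrable _ _)
      h.continuous.aestronglyMeasurable.stronglyMeasurableAtFilter h.continuous.continuousAt
  have hd' : _root_.deriv (fun x => ∫ t in p..x, ψ t) = ψ := funext fun x => (hd x).deriv
  refine ⟨fun x => ∫ t in p..x, ψ t, ⟨?_, p, q, h1, h2, fun x hx => ?_⟩, hd'⟩
  · rw [contDiff_infty_iff_deriv, hd']
    exact ⟨fun x => (hd x).differentiableAt, h.contDiff⟩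
  · rcases le_or_gt x p with hx' | hx'
    · rw [intervalIntegral.integral_symm, intervalIntegral.integral_of_le hx',
        setIntegral_eq_zero_of_forall_eq_zero, neg_zero]
      intro y hy
      exact h3 y fun hy' => absurd hy'.1 (not_lt.2 hy.2)
    · have hqx : q ≤ x := not_lt.1 fun hq => hx ⟨hx', hq⟩
      rw [intervalIntegral.integral_of_le hx'.le, ← h0]
      refine (setIntegral_eq_of_subset_of_forall_sdiff_eq_zero measurableSet_Ioi
        (fun y hy => h1.trans hy.1) fun y hy => h3 y fun hy' => hy.2 ?_).symm
      exact ⟨hy'.1, (hy'.2.trans_le hqx).le⟩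

theorem locallyIntegrableOn_Ioi {l : ℝ} {f : ℝ → ℂ}
    (hf : ∀ x y, l < x → x ≤ y → IntervalIntegrable f volume x y) :
    LocallyIntegrableOn f (Ioi l) := by
  intro x hx
  have hx' : l < x := hx
  refine ⟨Ioc ((l + x) / 2) (x + 1), mem_nhdsWithin_of_mem_nhds
    (Ioc_mem_nhds (by linarith) (by linarith)), ?_⟩
  exact (intervalIntegrable_iff_integrableOn_Ioc_of_le (by linarith)).1
    (hf _ _ (by linarith) (by linarith))

theorem isTest_of_tsupport_subset {l : ℝ} {ψ : ℝ → ℝ} (hψ : ContDiff ℝ ∞ ψ)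
    (hs : HasCompactSupport ψ) (ht : tsupport ψ ⊆ Ioi l) : IsTest l ψ := by
  obtain ⟨p, q, hp, hpq, hsub⟩ : ∃ p q, l < p ∧ p < q ∧ tsupport ψ ⊆ Ioo p q := by
    rcases (tsupport ψ).eq_empty_or_nonempty with he | hne
    · exact ⟨l + 1, l + 2, by linarith, by linarith, by rw [he]; exact empty_subset _⟩
    · obtain ⟨p, hp⟩ := hs.isCompact.exists_isLeast hne
      obtain ⟨q, hq⟩ := hs.isCompact.exists_isGreatest hne
      have h3 : l < p := ht hp.1
      have h4 : p ≤ q := hp.2 hq.1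
      exact ⟨(l + p) / 2, q + 1, by linarith, by linarith, fun x hx =>
        ⟨by linarith [hp.2 hx], by linarith [hq.2 hx]⟩⟩
  refine ⟨hψ, p, q, hp, hpq, fun x hx => ?_⟩
  by_contra hx'
  exact hx (hsub (subset_tsupport _ hx'))

theorem ae_eq_zero_of_integral_test_mul {l : ℝ} {r : ℝ → ℂ}
    (hr : ∀ x y, l < x → x ≤ y → IntervalIntegrable r volume x y)
    (h : ∀ φ, IsTest l φ → ∫ x in Ioi l, (φ x : ℂ) * r x = 0) :
    ∀ᵐ x ∂(volume.restrict (Ioi l)), r x = 0 := by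
  rw [ae_restrict_iff' measurableSet_Ioi]
  refine isOpen_Ioi.ae_eq_zero_of_integral_contDiff_smul_eq_zero (locallyIntegrableOn_Ioi hr)
    fun ψ hψ hs ht => ?_
  have hψt := isTest_of_tsupport_subset hψ hs ht
  simp only [Complex.real_smul]
  rw [← h ψ hψt]
  refine (setIntegral_eq_integral_of_forall_compl_eq_zero fun x hx => ?_).symm
  rw [hψt.eq_zero_of_le (not_lt.1 hx), Complex.ofReal_zero, zero_mul]

/-- The lemma of du Bois-Reymond: a function with vanishing weak derivative is constant. -/
theorem exists_const_of_integral_deriv_mul {l : ℝ} {r : ℝ → ℂ}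
    (hr : ∀ x y, l < x → x ≤ y → IntervalIntegrable r volume x y)
    (h : ∀ φ, IsTest l φ → ∫ x in Ioi l, ((deriv φ x : ℝ) : ℂ) * r x = 0) :
    ∃ c : ℂ, ∀ᵐ x ∂(volume.restrict (Ioi l)), r x = c := by
  obtain ⟨χ, hχ, hχ1⟩ := exists_isTest_integral_eq_one l
  set c : ℂ := ∫ x in Ioi l, (χ x : ℂ) * r x with hc
  refine ⟨c, ?_⟩
  have hrc : ∀ x y, l < x → x ≤ y → IntervalIntegrable (fun x => r x - c) volume x y :=
    fun x y hx hy => (hr x y hx hy).sub (by simp)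
  have h1 : ∀ x y, l < x → x ≤ y → IntervalIntegrable (fun _ : ℝ => (1 : ℂ)) volume x y :=
    fun x y _ _ => by simp
  have key : ∀ ψ, IsTest l ψ → ∫ x in Ioi l, (ψ x : ℂ) * (r x - c) = 0 := by
    intro ψ hψt
    set s : ℝ := ∫ x in Ioi l, ψ x with hs
    have hdiff : IsTest l (fun x => ψ x + (-s) * χ x) := hψt.add (hχ.mul contDiff_const)
    have hψi : IntegrableOn (fun x => (ψ x : ℂ)) (Ioi l) := by simpa using hψt.integrableOn_mul h1
    have hχi : IntegrableOn (fun x => (χ x : ℂ)) (Ioi l) := by simpa using hχ.integrableOn_mul h1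
    have hψi' : IntegrableOn ψ (Ioi l) := by
      have := hψi.re
      exact this
    have hχi' : IntegrableOn χ (Ioi l) := by
      have := hχi.re
      exact this
    obtain ⟨φ, hφ, hφ'⟩ := hdiff.exists_primitive (by
      rw [integral_add hψi' (hχi'.const_mul _), integral_const_mul, hχ1]
      ring)
    have h2 := h φ hφ
    rw [hφ'] at h2
    have e1 : ∫ x in Ioi l, ((ψ x + (-s) * χ x : ℝ) : ℂ) * r x =
        (∫ x in Ioi l, (ψ x : ℂ) * r x) - s * c := by
      rw [hc, ← integral_const_mul, ← integral_sub (hψt.integrableOn_mul hr)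
        ((hχ.integrableOn_mul hr).const_mul _)]
      congr 1
      ext x
      push_cast
      ring
    simp only [mul_sub]
    rw [integral_sub (hψt.integrableOn_mul hr) (hψi.mul_const c), integral_mul_const,
      integral_complex_ofReal, ← hs, ← h2, e1]
  filter_upwards [ae_eq_zero_of_integral_test_mul hrc key] with x hx
  exact sub_eq_zero.1 hx

/-- If `q` is the weak derivative of `p` on `(l,∞)`, then `p` has a locally absolutely continuous
representative, on any interval `s` with end point `l` on which `q` is locally integrable. -/
theorem exists_locallyAC_of_weak {l : ℝ} {p q : ℝ → ℂ} {s : Set ℝ} (hs : Ioi l ⊆ s)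
    (hp : ∀ x y, l < x → x ≤ y → IntervalIntegrable p volume x y)
    (hq : ∀ x ∈ s, ∀ y ∈ s, IntervalIntegrable q volume x y)
    (h : ∀ φ, IsTest l φ → ∫ x in Ioi l, (((deriv φ x : ℝ) : ℂ) * p x + (φ x : ℂ) * q x) = 0) :
    ∃ F : ℝ → ℂ, LocallyAC F s ∧ (∀ x ∈ s, ∀ y ∈ s, F y - F x = ∫ t in x..y, q t) ∧
      ∀ᵐ x ∂(volume.restrict (Ioi l)), p x = F x ∧ HasDerivAt F (q x) x := by
  have hl1 : l + 1 ∈ s := hs (show l < l + 1 by linarith)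
  set Q : ℝ → ℂ := fun x => ∫ t in (l + 1)..x, q t with hQ
  have hQd : ∀ x ∈ s, ∀ y ∈ s, Q y - Q x = ∫ t in x..y, q t := fun x hx y hy =>
    intervalIntegral.integral_interval_sub_left (hq _ hl1 _ hy) (hq _ hl1 _ hx)
  have hac : ∀ c : ℂ, LocallyAC (fun x => Q x + c) s := fun c =>
    locallyAC_of_integral fun x y hxy hsub =>
      ⟨hq x (hsub ⟨le_rfl, hxy⟩) y (hsub ⟨hxy, le_rfl⟩), by
        rw [← hQd x (hsub ⟨le_rfl, hxy⟩) y (hsub ⟨hxy, le_rfl⟩)]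
        ring⟩
  have hQac : LocallyAC Q s := by simpa using hac 0
  have hQder : ∀ᵐ x ∂(volume.restrict (Ioi l)), HasDerivAt Q (q x) x :=
    ae_hasDerivAt_of_integral fun x y hx hxy =>
      ⟨hq x (hs hx) y (hs (hx.trans_le hxy)), hQd x (hs hx) y (hs (hx.trans_le hxy))⟩
  have hQi : ∀ x y, l < x → x ≤ y → IntervalIntegrable Q volume x y := fun x y hx hxy => by
    refine ContinuousOn.intervalIntegrable (AbsolutelyContinuousOnInterval.continuousOn ?_)
    exact hQac x y hxy fun z hz => hs (hx.trans_le hz.1)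
  have hqi : ∀ x y, l < x → x ≤ y → IntervalIntegrable q volume x y := fun x y hx hxy =>
    hq x (hs hx) y (hs (hx.trans_le hxy))
  obtain ⟨c, hc⟩ := exists_const_of_integral_deriv_mul (r := fun x => p x - Q x)
    (fun x y hx hxy => (hp x y hx hxy).sub (hQi x y hx hxy)) (fun φ hφ => by
      obtain ⟨u, v, h1, h2, h3⟩ := hφ.bounds
      have e1 := h φ hφ
      rw [integral_add (hφ.deriv.integrableOn_mul hp) (hφ.integrableOn_mul hqi)] at e1
      simp only [mul_sub]
      rw [integral_sub (hφ.deriv.integrableOn_mul hp) (hφ.deriv.integrableOn_mul hQi)]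
      have hu : l < (l + u) / 2 := by linarith
      have huv : (l + u) / 2 ≤ v + 1 := by linarith
      have h3' : ∀ x ∉ Ioo ((l + u) / 2) (v + 1), x ∉ Icc u v := fun x hx hx' =>
        hx ⟨by linarith [hx'.1], by linarith [hx'.2]⟩
      have h4 : ∀ x ∉ Ioo ((l + u) / 2) (v + 1), φ x = 0 := fun x hx =>
        h3 x fun hx' => h3' x hx (Ioo_subset_Icc_self hx')
      have h5 : ∀ x ∉ Ioo ((l + u) / 2) (v + 1), deriv φ x = 0 := fun x hx =>
        deriv_eq_zero_of_notMem_Icc h3 (h3' x hx)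
      rw [IsTest.setIntegral_eq hu.le huv h5 Q]
      rw [IsTest.setIntegral_eq hu.le huv h4 q] at e1
      have hφc : ∀ x, HasDerivAt (fun x => (φ x : ℂ)) ((deriv φ x : ℝ) : ℂ) x := fun x =>
        (hφ.hasDerivAt x).ofReal_comp
      have hA : AbsolutelyContinuousOnInterval (fun x => (φ x : ℂ)) ((l + u) / 2) (v + 1) := by
        refine LocallyAC.of_contDiff (s := univ) ?_ _ _ huv (subset_univ _)
        exact (Complex.ofRealCLM.contDiff.comp (hφ.contDiff.of_le (by simp))).contDiffOn
      have e2 := (ac_integral_mul hA (hQac _ _ huv fun z hz => hs (hu.trans_le hz.1))).2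
      have e3 : ∫ x in ((l + u) / 2)..(v + 1),
          (deriv (fun x => (φ x : ℂ)) x * Q x + (φ x : ℂ) * deriv Q x) =
          (∫ x in ((l + u) / 2)..(v + 1), ((deriv φ x : ℝ) : ℂ) * Q x) +
            ∫ x in ((l + u) / 2)..(v + 1), (φ x : ℂ) * q x := by
        rw [← intervalIntegral.integral_add]
        · refine intervalIntegral.integral_congr_ae ?_
          rw [ae_restrict_iff' measurableSet_Ioi] at hQder
          filter_upwards [hQder] with x hx hxm
          rw [uIoc_of_le huv] at hxm
          rw [(hφc x).deriv, (hx (hu.trans hxm.1)).deriv]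
        · exact (hQi _ _ hu huv).continuousOn_mul
            (Complex.continuous_ofReal.comp hφ.deriv.continuous).continuousOn
        · exact (hqi _ _ hu huv).continuousOn_mul
            (Complex.continuous_ofReal.comp hφ.continuous).continuousOn
      rw [e3, h4 _ fun hx => lt_irrefl _ hx.2, h4 _ fun hx => lt_irrefl _ hx.1] at e2
      simp only [Complex.ofReal_zero, zero_mul, sub_zero] at e2
      rw [← e1, ← sub_eq_zero]
      linear_combination -e2)
  refine ⟨fun x => Q x + c, hac c, fun x hx y hy => ?_, ?_⟩
  · rw [← hQd x hx y hy]
    ring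
  · filter_upwards [hc, hQder] with x hx hx'
    exact ⟨by rw [← hx]; ring, hx'.add_const c⟩

/-! ### The operator `H_0` and the cosine transform -/

theorem LocallyAC.conj {F : ℝ → ℂ} {s : Set ℝ} (hF : LocallyAC F s) :
    LocallyAC (fun x => conj (F x)) s := fun x y hxy hs =>
  AbsolutelyContinuousOnInterval.of_dist_le (hF x y hxy hs) (hF x y hxy hs) fun u v => by
    rw [dist_eq_norm, ← map_sub, RCLike.norm_conj, ← dist_eq_norm]
    linarith [dist_nonneg (x := F u) (y := F v)]

/-- If `w G` is integrable while `w` is not integrable near the point approached by `l`, then `G`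
can only have the limit zero along `l`. -/
theorem eq_zero_of_tendsto_of_integrableOn {l : Filter ℝ} {G : ℝ → ℂ} {w : ℝ → ℝ} {L : ℂ}
    {S : Set ℝ} (hw : Measurable w) (h : IntegrableOn (fun x => (w x : ℂ) * G x) S)
    (hlim : Tendsto G l (𝓝 L))
    (hl : ∀ s ∈ l, ∃ t ⊆ s ∩ S, MeasurableSet t ∧ ¬ IntegrableOn w t) : L = 0 := by
  by_contra hL
  have hpos : 0 < ‖L‖ / 2 := by positivity
  have hev : ∀ᶠ x in l, ‖L‖ / 2 < ‖G x‖ := by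
    refine hlim.norm.eventually (lt_mem_nhds ?_)
    linarith
  obtain ⟨t, ht, htm, hnot⟩ := hl _ hev
  refine hnot ?_
  have h1 : IntegrableOn (fun x => (w x : ℂ) * G x) t := h.mono_set fun x hx => (ht hx).2
  have h2 := h1.norm.const_mul (2 / ‖L‖)
  refine h2.mono' hw.aestronglyMeasurable ?_
  rw [ae_restrict_iff' htm]
  refine Eventually.of_forall fun x hx => ?_
  have h3 : ‖L‖ / 2 < ‖G x‖ := (ht hx).1
  rw [norm_mul, Complex.norm_real]
  have h4 : (1 : ℝ) ≤ 2 / ‖L‖ * ‖G x‖ := by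
    rw [div_mul_eq_mul_div, le_div_iff₀ (by linarith)]
    linarith
  calc ‖w x‖ = ‖w x‖ * 1 := (mul_one _).symm
    _ ≤ ‖w x‖ * (2 / ‖L‖ * ‖G x‖) := by gcongr
    _ = _ := by ring

theorem integrable_mul_conj {μ : Measure ℝ} {f h : ℝ → ℂ} (hf : MemLp f 2 μ) (hh : MemLp h 2 μ) :
    Integrable (fun x => f x * conj (h x)) μ := hf.integrable_mul hh.star

/-- The boundary terms `x f(x) conj (h(x))` vanish at `0` and `∞`, so `H_0` is symmetric. -/
theorem FreeRel.inner_eq {f g h k : HalfLineL2} (hfg : FreeRel f g) (hhk : FreeRel h k) :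
    ⟪h, g⟫ = ⟪k, f⟫ := by
  obtain ⟨F, hF, hfF, hgF⟩ := hfg
  obtain ⟨H, hH, hhH, hkH⟩ := hhk
  set G : ℝ → ℂ := fun x => (x : ℂ) * F x * conj (H x) with hG
  set D : ℝ → ℂ := (Ioi (0 : ℝ)).indicator
    fun x => Complex.I * (g x * conj (h x) - f x * conj (k x)) with hD
  have hi1 := integrable_mul_conj (Lp.memLp g) (Lp.memLp h)
  have hi2 := integrable_mul_conj (Lp.memLp f) (Lp.memLp k)
  have hDi : Integrable D := (integrable_indicator_iff measurableSet_Ioi).2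
    ((hi1.sub hi2).const_mul Complex.I)
  have hxac : LocallyAC (fun x : ℝ => (x : ℂ)) (Ioi 0) :=
    LocallyAC.of_contDiff Complex.ofRealCLM.contDiff.contDiffOn
  have hGac : LocallyAC G (Ioi 0) := (hxac.mul hF).mul hH.conj
  have hGd : ∀ᵐ x ∂ν₀, deriv G x = D x := by
    filter_upwards [hfF, hgF, hhH, hkH, hF.ae_differentiableAt, hH.ae_differentiableAt,
      ae_restrict_mem measurableSet_Ioi] with x h1 h2 h3 h4 h5 h6 h7
    have d2 : HasDerivAt (fun x => conj (H x)) (conj (deriv H x)) x :=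
      h6.hasDerivAt.star
    have d := ((Complex.ofRealCLM.hasDerivAt (x := x)).mul h5.hasDerivAt).mul d2
    have d' : deriv G x = _ := d.deriv
    rw [d', hD, indicator_of_mem h7, h1, h2, h3, h4]
    simp only [Complex.ofRealCLM_apply, map_mul, map_neg, map_add, Complex.conj_I,
      Complex.conj_ofReal, map_div₀, map_ofNat, Complex.ofReal_one, Pi.mul_apply]
    linear_combination -(-(x * deriv F x + F x / 2) * conj (H x) -
      F x * (x * conj (deriv H x) + conj (H x) / 2)) * Complex.I_sq
  have hGint : ∀ x y, 0 < x → x ≤ y → ∫ t in x..y, D t = G y - G x := fun x y hx hxy => by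
    rw [← (hGac.ftc hxy fun z hz => hx.trans_le hz.1).2]
    refine intervalIntegral.integral_congr_ae ?_
    rw [ae_restrict_iff' measurableSet_Ioi] at hGd
    filter_upwards [hGd] with t ht htm
    rw [uIoc_of_le hxy] at htm
    exact (ht (hx.trans htm.1)).symm
  have hDii : ∀ x y, IntervalIntegrable D volume x y := fun x y => hDi.intervalIntegrable
  set P : ℝ → ℂ := fun x => ∫ t in (0 : ℝ)..x, D t with hP
  have hPc : Continuous P := intervalIntegral.continuous_primitive hDii 0
  have hGP : ∀ x, 0 < x → G x = (G 1 - P 1) + P x := fun x hx => by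
    have h1 : P x - P 1 = ∫ t in (1 : ℝ)..x, D t :=
      intervalIntegral.integral_interval_sub_left (hDii _ _) (hDii _ _)
    rcases le_total 1 x with h | h
    · rw [hGint 1 x one_pos h] at h1
      linear_combination -h1
    · rw [intervalIntegral.integral_symm, hGint x 1 hx h] at h1
      linear_combination -h1
  -- `G / x` is integrable while `1 / x` is not, so the limits of `G` at `0` and `∞` vanish
  have hwG : IntegrableOn (fun x : ℝ => ((x⁻¹ : ℝ) : ℂ) * G x) (Ioi 0) := by
    refine (integrable_mul_conj (Lp.memLp f) (Lp.memLp h)).congr ?_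
    filter_upwards [hfF, hhH, ae_restrict_mem measurableSet_Ioi] with x h1 h2 h3
    have : (x : ℂ) ≠ 0 := by exact_mod_cast (ne_of_gt h3)
    rw [h1, h2, hG]
    push_cast
    field_simp
  have l0 : Tendsto G (𝓝[>] 0) (𝓝 (G 1 - P 1)) := by
    have h1 : Tendsto (fun x => (G 1 - P 1) + P x) (𝓝[>] 0) (𝓝 ((G 1 - P 1) + P 0)) :=
      ((continuous_const.add hPc).tendsto 0).mono_left nhdsWithin_le_nhds
    rw [hP] at h1
    simp only [intervalIntegral.integral_same, add_zero] at h1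
    refine h1.congr' ?_
    filter_upwards [self_mem_nhdsWithin] with x hx
    exact (hGP x hx).symm
  have e0 : G 1 - P 1 = 0 := by
    refine eq_zero_of_tendsto_of_integrableOn measurable_inv hwG l0 fun s hs => ?_
    obtain ⟨u, hu, hus⟩ := mem_nhdsGT_iff_exists_Ioo_subset.1 hs
    refine ⟨Ioo 0 u, fun x hx => ⟨hus hx, hx.1⟩, measurableSet_Ioo, fun hn => ?_⟩
    rw [← integrableOn_Ioc_iff_integrableOn_Ioo,
      ← intervalIntegrable_iff_integrableOn_Ioc_of_le (le_of_lt hu), intervalIntegrable_inv_iff] at hn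
    rcases hn with hn | hn
    · exact absurd hn (ne_of_lt hu)
    · exact hn left_mem_uIcc
  have l1 : Tendsto G atTop (𝓝 (∫ t in Ioi (0 : ℝ), D t)) := by
    have h1 : Tendsto P atTop (𝓝 (∫ t in Ioi (0 : ℝ), D t)) :=
      intervalIntegral_tendsto_integral_Ioi 0 hDi.integrableOn tendsto_id
    refine h1.congr' ?_
    filter_upwards [eventually_gt_atTop 0] with x hx
    rw [hGP x hx, e0, zero_add]
  have e1 : ∫ t in Ioi (0 : ℝ), D t = 0 := by
    refine eq_zero_of_tendsto_of_integrableOn measurable_inv hwG l1 fun s hs => ?_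
    obtain ⟨u, hu⟩ := mem_atTop_sets.1 hs
    refine ⟨Ioi (max u 0), fun x hx => ⟨hu x ((le_max_left _ _).trans (le_of_lt hx)),
      (le_max_right u 0).trans_lt hx⟩, measurableSet_Ioi, not_integrableOn_Ioi_inv⟩
  rw [hD, setIntegral_indicator measurableSet_Ioi, inter_self, integral_const_mul,
    integral_sub hi1 hi2] at e1
  have e2 := (mul_eq_zero.1 e1).resolve_left Complex.I_ne_zero
  rw [inner_L2_eq, inner_L2_eq]
  exact sub_eq_zero.1 e2

theorem IsTest.memLp_half {η : ℝ → ℝ} (h : IsTest 0 η) : MemLp (fun x => (η x : ℂ)) 2 ν₀ :=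
  h.memLp.mono_measure Measure.restrict_le_self

/-- `H_0 η`, for a test function `η`. -/
def freeTest (η : ℝ → ℝ) (x : ℝ) : ℂ := -Complex.I * (x * deriv η x + η x / 2 : ℝ)

theorem IsTest.freeTest_aux {η : ℝ → ℝ} (h : IsTest 0 η) :
    IsTest 0 (fun x => x * _root_.deriv η x + η x / 2) := by
  have := (h.deriv.mul contDiff_id).add (h.mul (contDiff_const (c := (1 / 2 : ℝ))))
  convert this using 2
  simp only [id]
  ring

theorem IsTest.memLp_freeTest {η : ℝ → ℝ} (h : IsTest 0 η) : MemLp (freeTest η) 2 ν₀ :=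
  h.freeTest_aux.memLp_half.const_mul _

theorem L2_intervalIntegrable (f : HalfLineL2) (x y : ℝ) (hx : 0 < x) (hxy : x ≤ y) :
    IntervalIntegrable f volume x y := by
  rw [intervalIntegrable_iff_integrableOn_Ioc_of_le hxy, integrableOn_Ioc_iff_integrableOn_Ioo]
  exact integrableOn_Ioo_of_L2 f hx.le

theorem inner_toLp_left {η : ℝ → ℂ} (h : MemLp η 2 ν₀) (f : HalfLineL2) :
    ⟪h.toLp η, f⟫ = ∫ x in Ioi (0 : ℝ), f x * conj (η x) := by
  rw [inner_L2_eq]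
  refine integral_congr_ae ?_
  filter_upwards [h.coeFn_toLp] with x hx
  rw [hx]

/-- `H_0` is the adjoint of its restriction to test functions. -/
theorem FreeRel.of_weak {f g : HalfLineL2}
    (h : ∀ η (hη : IsTest 0 η), ⟪hη.memLp_freeTest.toLp _, f⟫ = ⟪hη.memLp_half.toLp _, g⟫) :
    FreeRel f g := by
  have hcont : ContinuousOn (fun x : ℝ => Complex.I * (x : ℂ)) univ := by fun_prop
  -- `P = i x f` has the weak derivative `(i/2) f - g`
  obtain ⟨P, hP, -, hPa⟩ := exists_locallyAC_of_weak (l := 0)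
    (p := fun x => Complex.I * x * f x) (q := fun x => Complex.I / 2 * f x - g x)
    (subset_refl _)
    (fun x y hx hxy => (L2_intervalIntegrable f x y hx hxy).continuousOn_mul
      (hcont.mono (subset_univ _)))
    (fun x hx y hy => by
      rcases le_total x y with hxy | hxy
      · exact ((L2_intervalIntegrable f x y hx hxy).const_mul _).sub
          (L2_intervalIntegrable g x y hx hxy)
      · exact (((L2_intervalIntegrable f y x hy hxy).const_mul _).sub
          (L2_intervalIntegrable g y x hy hxy)).symm)
    (fun φ hφ => by
      have h1 := h φ hφ
      rw [inner_toLp_left, inner_toLp_left, ← sub_eq_zero, ← integral_sub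
        (integrable_mul_conj (Lp.memLp f) hφ.memLp_freeTest)
        (integrable_mul_conj (Lp.memLp g) hφ.memLp_half)] at h1
      rw [← h1]
      congr 1
      ext x
      rw [freeTest, map_mul, map_neg, Complex.conj_I, Complex.conj_ofReal, Complex.conj_ofReal]
      push_cast
      ring)
  have hinv : LocallyAC (fun x : ℝ => -Complex.I * ((x⁻¹ : ℝ) : ℂ)) (Ioi 0) := by
    refine (LocallyAC.of_contDiff ?_).const_mul _
    refine Complex.ofRealCLM.contDiff.comp_contDiffOn ?_
    exact contDiffOn_id.inv fun x hx => ne_of_gt hx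
  refine ⟨_, hinv.mul hP, ?_, ?_⟩
  · filter_upwards [hPa, ae_restrict_mem measurableSet_Ioi] with x hx hx0
    have : (x : ℂ) ≠ 0 := by exact_mod_cast (ne_of_gt hx0)
    rw [← hx.1]
    push_cast
    field_simp
    rw [Complex.I_sq]
    ring
  · filter_upwards [hPa, ae_restrict_mem measurableSet_Ioi] with x hx hx0
    have hx1 : (x : ℝ) ≠ 0 := ne_of_gt hx0
    have hx2 : (x : ℂ) ≠ 0 := by exact_mod_cast (ne_of_gt hx0)
    have d := (((hasDerivAt_inv hx1).ofReal_comp).const_mul (-Complex.I)).mul hx.2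
    have d' : deriv (fun x : ℝ => -Complex.I * ((x⁻¹ : ℝ) : ℂ) * P x) x = _ := d.deriv
    rw [d', ← hx.1]
    push_cast
    field_simp
    linear_combination 2 * g x * Complex.I_sq

/-- Integration by parts turns `y ∂_y` under the cosine integral into `-(x ∂_x + 1)`. -/
theorem hasDerivAt_cosInt_test {η : ℝ → ℝ} (h : IsTest 0 η) (y : ℝ) (hy : y ≠ 0) :
    HasDerivAt (cosInt fun x => (η x : ℂ))
      (-(y : ℂ)⁻¹ * cosInt (fun x => ((x * deriv η x + η x : ℝ) : ℂ)) y) y := by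
  obtain ⟨p, q, h1, h2, h3⟩ := h.bounds
  have hpq : p / 2 ≤ q + 1 := by linarith
  have h3' : ∀ x ∉ Ioo (p / 2) (q + 1), x ∉ Icc p q := fun x hx hx' =>
    hx ⟨by linarith [hx'.1], by linarith [hx'.2]⟩
  have h4 : ∀ x ∉ Ioo (p / 2) (q + 1), η x = 0 := fun x hx =>
    h3 x fun hx' => h3' x hx (Ioo_subset_Icc_self hx')
  have h5 : ∀ x ∉ Ioo (p / 2) (q + 1), deriv η x = 0 := fun x hx =>
    deriv_eq_zero_of_notMem_Icc h3 (h3' x hx)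
  have hcos : ∀ ψ : ℝ → ℝ, (∀ x ∉ Ioo (p / 2) (q + 1), ψ x = 0) → ∀ y,
      cosInt (fun x => (ψ x : ℂ)) y = ((∫ x in (p / 2)..(q + 1), ψ x * cosKernel x y : ℝ) : ℂ) := by
    intro ψ hψ y
    have e := IsTest.setIntegral_eq (l := 0) (by linarith) hpq hψ (fun x => (cosKernel x y : ℂ))
    rw [← intervalIntegral.integral_ofReal, cosInt]
    simp only [Complex.ofReal_mul]
    rw [← e]
    simp only [mul_comm]
  set g : ℝ × ℝ → ℝ := fun z => η z.2 * cosKernel z.2 z.1 with hg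
  have hgc : ContDiff ℝ 1 g := by
    have := h.contDiff.of_le (m := 1) (by simp)
    unfold g cosKernel
    fun_prop
  have hfd : ∀ x, fderiv ℝ g (y, x) (1, 0) =
      η x * (-(4 * π * x) * Real.sin (2 * π * x * y)) := fun x => by
    refine (hasDerivAt_fst_of_contDiffAt hgc.contDiffAt).unique ?_
    have h6 := (hasDerivAt_cosKernel_left y x).const_mul (η x)
    rw [show 2 * π * y * x = 2 * π * x * y by ring] at h6
    refine h6.congr_of_eventuallyEq (Eventually.of_forall fun z => ?_)
    simp only [hg]
    rw [cosKernel_comm]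
  have hd := hasDerivAt_integral_param (g := g) isOpen_univ (V := univ) ordConnected_univ
    (fun x _ b _ => hgc.contDiffAt) (mem_univ (p / 2)) (mem_univ (q + 1)) (mem_univ y)
  rw [show cosInt (fun x => (η x : ℂ)) = fun y => ((∫ x in (p / 2)..(q + 1), g (y, x) : ℝ) : ℂ) from
    funext fun y => hcos η h4 y, hcos (fun x => x * deriv η x + η x) (fun x hx => by
      rw [h4 x hx, h5 x hx]; ring)]
  convert hd.ofReal_comp using 1
  rw [← Complex.ofReal_inv, ← Complex.ofReal_neg, ← Complex.ofReal_mul]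
  congr 1
  rw [intervalIntegral.integral_congr (fun x _ => hfd x)]
  have hk : ∀ x, HasDerivAt (fun x => cosKernel x y)
      (-(4 * π * y) * Real.sin (2 * π * x * y)) x := fun x => hasDerivAt_cosKernel_left x y
  have hu : ∀ x, HasDerivAt (fun x => x * η x) (x * deriv η x + η x) x := fun x => by
    have h6 := (hasDerivAt_id x).mul (h.hasDerivAt x)
    rw [show x * deriv η x + η x = 1 * η x + id x * deriv η x by rw [id]; ring]
    exact h6
  have hparts := intervalIntegral.integral_mul_deriv_eq_deriv_mul (a := p / 2) (b := q + 1)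
    (fun x _ => hu x) (fun x _ => hk x)
    (by
      have c1 := h.deriv.continuous
      have c2 := h.continuous
      exact (by fun_prop : Continuous fun x => x * deriv η x + η x).intervalIntegrable _ _)
    (by exact (by fun_prop : Continuous fun x =>
      -(4 * π * y) * Real.sin (2 * π * x * y)).intervalIntegrable _ _)
  rw [h4 _ fun hx => lt_irrefl _ hx.2, h4 _ fun hx => lt_irrefl _ hx.1] at hparts
  have e : ∫ x in (p / 2)..(q + 1), x * η x * (-(4 * π * y) * Real.sin (2 * π * x * y)) =
      y * ∫ x in (p / 2)..(q + 1), η x * (-(4 * π * x) * Real.sin (2 * π * x * y)) := by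
    rw [← intervalIntegral.integral_const_mul]
    congr 1
    ext x
    ring
  rw [e] at hparts
  have hI : ∫ x in (p / 2)..(q + 1), (x * deriv η x + η x) * cosKernel x y =
      -(y * ∫ x in (p / 2)..(q + 1), η x * (-(4 * π * x) * Real.sin (2 * π * x * y))) := by
    rw [hparts]
    ring
  rw [hI, neg_mul_neg, inv_mul_cancel_left₀ hy]

theorem cosT_toLp_ae {η : ℝ → ℂ} (h : MemLp η 2 ν₀) (hi : IntegrableOn η (Ioi 0)) :
    cosT (h.toLp η) =ᵐ[ν₀] cosInt η := by
  have h1 := cosT_ae_eq (h.toLp η) (hi.congr h.coeFn_toLp.symm)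
  refine h1.trans (Eventually.of_forall fun y => integral_congr_ae ?_)
  filter_upwards [h.coeFn_toLp] with x hx
  rw [hx]

theorem IsTest.integrableOn_Ioi {l : ℝ} {η : ℝ → ℝ} (h : IsTest l η) :
    IntegrableOn (fun x => (η x : ℂ)) (Ioi l) := by
  simpa using h.integrableOn_mul (f := fun _ => 1) fun x y _ _ => by simp

/-- `C H_0 η = -H_0 C η` for test functions `η`. -/
theorem freeRel_cosT_test {η : ℝ → ℝ} (h : IsTest 0 η) :
    FreeRel (cosT (h.memLp_half.toLp _)) (-cosT (h.memLp_freeTest.toLp _)) := by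
  have hψ : IsTest 0 (fun x => x * deriv η x + η x) := by
    have := (h.deriv.mul contDiff_id).add h
    simpa using this
  have hc : Continuous (cosInt fun x => ((x * deriv η x + η x : ℝ) : ℂ)) :=
    continuous_cosInt hψ.integrableOn_Ioi
  have hfi : IntegrableOn (freeTest η) (Ioi 0) :=
    (h.freeTest_aux.integrableOn_Ioi).const_mul _
  refine ⟨cosInt fun x => (η x : ℂ), ?_, cosT_toLp_ae _ h.integrableOn_Ioi, ?_⟩
  · refine locallyAC_of_integral (g := fun y : ℝ =>
      -(y : ℂ)⁻¹ * cosInt (fun x => ((x * deriv η x + η x : ℝ) : ℂ)) y) fun x y hxy hs => ?_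
    have hpos : ∀ z ∈ uIcc x y, z ≠ 0 := fun z hz => by
      rw [uIcc_of_le hxy] at hz
      exact ne_of_gt (hs hz)
    have hii : IntervalIntegrable (fun y : ℝ =>
        -(y : ℂ)⁻¹ * cosInt (fun x => ((x * deriv η x + η x : ℝ) : ℂ)) y) volume x y := by
      refine ContinuousOn.intervalIntegrable (ContinuousOn.mul (ContinuousOn.neg ?_) hc.continuousOn)
      exact Complex.continuous_ofReal.continuousOn.inv₀ fun z hz => by exact_mod_cast hpos z hz
    exact ⟨hii, (intervalIntegral.integral_eq_sub_of_hasDerivAt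
      (fun z hz => hasDerivAt_cosInt_test h z (hpos z hz)) hii).symm⟩
  · filter_upwards [Lp.coeFn_neg (cosT (h.memLp_freeTest.toLp _)),
      cosT_toLp_ae h.memLp_freeTest hfi, ae_restrict_mem measurableSet_Ioi] with y h1 h2 h3
    have hy : y ≠ 0 := ne_of_gt h3
    have hy' : (y : ℂ) ≠ 0 := by exact_mod_cast hy
    rw [h1, Pi.neg_apply, h2, (hasDerivAt_cosInt_test h y hy).deriv]
    have e : cosInt (freeTest η) y = -Complex.I * (cosInt (fun x =>
        ((x * deriv η x + η x : ℝ) : ℂ)) y - cosInt (fun x => (η x : ℂ)) y / 2) := by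
      simp only [cosInt]
      rw [← integral_div, ← integral_sub (integrable_cosKernel_mul hψ.integrableOn_Ioi y)
        ((integrable_cosKernel_mul h.integrableOn_Ioi y).div_const 2), ← integral_const_mul]
      congr 1
      ext x
      rw [freeTest]
      push_cast
      ring
    rw [e]
    field_simp
    ring

/-- `H_0` anticommutes with the cosine transform. -/
theorem FreeRel.cosT {f g : HalfLineL2} (h : FreeRel f g) : FreeRel (cosT f) (-cosT g) := by
  refine FreeRel.of_weak fun η hη => ?_
  have e := h.inner_eq (freeRel_cosT_test hη)
  rw [inner_neg_left, inner_cosT_left, inner_cosT_left] at e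
  rw [inner_neg_right, e, neg_neg]

theorem LocallyAC.eqOn_zero_of_vanishesBelow {a : ℝ} {f : HalfLineL2} {F : ℝ → ℂ}
    (hF : LocallyAC F (Ioi 0)) (hfF : f =ᵐ[ν₀] F) (hf : VanishesBelow a f) :
    EqOn F (fun _ => 0) (Ioo 0 a) := by
  refine Measure.eqOn_open_of_ae_eq ?_ isOpen_Ioo
    (hF.continuousOn_Ioi.mono fun x hx => hx.1) continuousOn_const (μ := volume)
  have h1 : ∀ᵐ x ∂ν₀, x < a → F x = 0 := by
    filter_upwards [hfF, hf] with x h1 h2 hx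
    rw [← h1, h2 hx]
  filter_upwards [ae_mono (Measure.restrict_mono (fun x hx => hx.1 : Ioo 0 a ⊆ Ioi 0) le_rfl) h1,
    ae_restrict_mem measurableSet_Ioo] with x hx hx'
  exact hx hx'.2

/-- `H_0` is a local operator. -/
theorem FreeRel.vanishesBelow {a : ℝ} {f g : HalfLineL2} (h : FreeRel f g)
    (hf : VanishesBelow a f) : VanishesBelow a g := by
  obtain ⟨F, hF, hfF, hgF⟩ := h
  have h0 := hF.eqOn_zero_of_vanishesBelow hfF hf
  filter_upwards [hgF, ae_restrict_mem measurableSet_Ioi] with x hx hx0 hxa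
  have hx1 : x ∈ Ioo 0 a := ⟨hx0, hxa⟩
  have : F =ᶠ[𝓝 x] fun _ => 0 := by
    filter_upwards [isOpen_Ioo.mem_nhds hx1] with y hy using h0 hy
  rw [hx, this.deriv_eq, h0 hx1, deriv_const]
  simp

theorem FreeRel.mem_K {a : ℝ} {f g : HalfLineL2} (h : FreeRel f g) (hf : f ∈ K a) : g ∈ K a := by
  rw [mem_K_iff] at hf ⊢
  refine ⟨h.vanishesBelow hf.1, ?_⟩
  have h1 := h.cosT.vanishesBelow hf.2
  have h2 := h1.smul (-1)
  simpa using h2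

theorem freeOp_mem_K {a : ℝ} (f : freeOp.domain) (hf : (f : HalfLineL2) ∈ K a) :
    freeOp f ∈ K a := by
  have h : ((f : HalfLineL2), freeOp f) ∈ freeOp.graph := freeOp.mem_graph f
  rw [freeOp_graph] at h
  exact FreeRel.mem_K h hf

/-! ### Self-adjointness of the Dirac operator -/

/-- Continuous real functions vanishing for large arguments. -/
structure EventuallyZero (f : ℝ → ℝ) : Prop where
  continuous : Continuous f
  eq_zero : ∃ n, ∀ u, n ≤ u → f u = 0

theorem EventuallyZero.memLp {f : ℝ → ℝ} (h : EventuallyZero f) (u₀ : ℝ) :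
    MemLp (fun u => (f u : ℂ)) 2 (volume.restrict (Ioi u₀)) := by
  obtain ⟨n, hn⟩ := h.eq_zero
  have hc : Continuous (fun u => (f u : ℂ)) := Complex.continuous_ofReal.comp h.continuous
  obtain ⟨C, hC⟩ := (isCompact_Icc (a := u₀) (b := n)).exists_bound_of_continuousOn hc.continuousOn
  have e : (fun u => (f u : ℂ)) = (Iio n).indicator fun u => (f u : ℂ) := by
    ext u
    by_cases hu : u < n
    · rw [indicator_of_mem (show u ∈ Iio n from hu)]
    · rw [indicator_of_notMem (fun h : u ∈ Iio n => hu h), hn u (not_lt.1 hu), Complex.ofReal_zero]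
  rw [e, memLp_indicator_iff_restrict measurableSet_Iio, Measure.restrict_restrict measurableSet_Iio]
  have hsub : Iio n ∩ Ioi u₀ = Ioo u₀ n := by rw [inter_comm]; rfl
  rw [hsub]
  refine MemLp.of_bound hc.aestronglyMeasurable C ?_
  exact (ae_restrict_iff' measurableSet_Ioo).2 (Eventually.of_forall fun u hu =>
    hC u (Ioo_subset_Icc_self hu))

/-- `C¹` functions on the line vanishing for large arguments: test functions on a half-line
`[u₀,∞)` with no condition at `u₀`. -/
structure IsRightTest (η : ℝ → ℝ) : Prop where
  contDiff : ContDiff ℝ 1 η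
  eq_zero : ∃ n, ∀ u, n ≤ u → η u = 0

theorem IsRightTest.hasDerivAt {η : ℝ → ℝ} (h : IsRightTest η) (u : ℝ) :
    HasDerivAt η (deriv η u) u := (h.contDiff.differentiable (by simp) u).hasDerivAt

theorem IsRightTest.eventuallyZero {η : ℝ → ℝ} (h : IsRightTest η) : EventuallyZero η :=
  ⟨h.contDiff.continuous, h.eq_zero⟩

theorem IsRightTest.eventuallyZero_deriv {η : ℝ → ℝ} (h : IsRightTest η) {m : ℝ → ℝ}
    (hm : Continuous m) (z : ℝ) : EventuallyZero (fun u => z * deriv η u - m u * η u) := by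
  have h1 := h.contDiff.continuous_deriv_one
  have h2 := h.contDiff.continuous
  obtain ⟨n, hn⟩ := h.eq_zero
  refine ⟨by fun_prop, n + 1, fun u hu => ?_⟩
  have : η =ᶠ[𝓝 u] fun _ => 0 := by
    filter_upwards [lt_mem_nhds (show n < u by linarith)] with y hy using hn y (le_of_lt hy)
  rw [this.deriv_eq, deriv_const, hn u (by linarith)]
  ring

theorem IsTest.isRightTest {l : ℝ} {η : ℝ → ℝ} (h : IsTest l η) : IsRightTest η := by
  obtain ⟨p, q, h1, h2, h3⟩ := h.bounds
  exact ⟨h.contDiff.of_le (by simp), q, fun u hu => h3 u fun hu' => absurd hu'.2 (not_lt.2 hu)⟩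

/-- A smooth cutoff: it is `1` at `u₀`. -/
theorem exists_isRightTest_eq_one (u₀ : ℝ) : ∃ χ, IsRightTest χ ∧ χ u₀ = 1 := by
  let b : ContDiffBump u₀ := ⟨1 / 2, 1, by norm_num, by norm_num⟩
  refine ⟨b, ⟨b.contDiff, u₀ + 1, fun u hu => b.zero_of_le_dist ?_⟩, ?_⟩
  · change 1 ≤ dist u u₀
    rw [Real.dist_eq]
    exact le_trans (by linarith) (le_abs_self _)
  · exact b.one_of_mem_closedBall (Metric.mem_closedBall_self (by norm_num [b]))

section Dirac

variable {u₀ : ℝ}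

/-- The pair `(f, 0)`. -/
def leftPair (u₀ : ℝ) {f : ℝ → ℝ} (h : EventuallyZero f) : PairL2 u₀ :=
  mkPair (h.memLp u₀) (MemLp.zero (ε := ℂ))

/-- The pair `(0, f)`. -/
def rightPair (u₀ : ℝ) {f : ℝ → ℝ} (h : EventuallyZero f) : PairL2 u₀ :=
  mkPair (MemLp.zero (ε := ℂ)) (h.memLp u₀)

theorem leftPair_apply {f : ℝ → ℝ} (h : EventuallyZero f) : ∀ᵐ u ∂(volume.restrict (Ioi u₀)),
    leftPair u₀ h u 0 = f u ∧ leftPair u₀ h u 1 = 0 := mkPair_apply (h.memLp u₀) (MemLp.zero (ε := ℂ))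

theorem rightPair_apply {f : ℝ → ℝ} (h : EventuallyZero f) : ∀ᵐ u ∂(volume.restrict (Ioi u₀)),
    rightPair u₀ h u 0 = 0 ∧ rightPair u₀ h u 1 = f u :=
  mkPair_apply (MemLp.zero (ε := ℂ)) (h.memLp u₀)

theorem inner_leftPair {f : ℝ → ℝ} (h : EventuallyZero f) (z : PairL2 u₀) :
    ⟪leftPair u₀ h, z⟫ = (1 / 2) * ∫ u in Ioi u₀, (f u : ℂ) * z u 0 := by
  rw [inner_pair_eq]
  congr 1
  refine integral_congr_ae ?_
  filter_upwards [leftPair_apply h] with u hu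
  rw [hu.1, hu.2, Complex.conj_ofReal, map_zero, mul_zero, add_zero, mul_comm]

theorem inner_rightPair {f : ℝ → ℝ} (h : EventuallyZero f) (z : PairL2 u₀) :
    ⟪rightPair u₀ h, z⟫ = (1 / 2) * ∫ u in Ioi u₀, (f u : ℂ) * z u 1 := by
  rw [inner_pair_eq]
  congr 1
  refine integral_congr_ae ?_
  filter_upwards [rightPair_apply h] with u hu
  rw [hu.1, hu.2, Complex.conj_ofReal, map_zero, mul_zero, zero_add, mul_comm]

/-- `T = (α, β)` with locally absolutely continuous components, and
`S = (β' - m β, -α' - m α)`: the maximal Dirac operator, without boundary condition. -/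
structure DiracAC (m : ℝ → ℝ) (u₀ : ℝ) (α β : ℝ → ℂ) (T S : PairL2 u₀) : Prop where
  left : LocallyAC α (Ici u₀)
  right : LocallyAC β (Ici u₀)
  eq : ∀ᵐ u ∂(volume.restrict (Ioi u₀)), T u 0 = α u ∧ T u 1 = β u ∧
    S u 0 = deriv β u - m u * β u ∧ S u 1 = -deriv α u - m u * α u

variable {m : ℝ → ℝ} (hm : Continuous m)

theorem diracAC_leftPair {η : ℝ → ℝ} (h : IsRightTest η) :
    DiracAC m u₀ (fun u => (η u : ℂ)) (fun _ => 0) (leftPair u₀ h.eventuallyZero)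
      (rightPair u₀ (h.eventuallyZero_deriv hm (-1))) := by
  refine ⟨LocallyAC.of_contDiff (Complex.ofRealCLM.contDiff.comp h.contDiff).contDiffOn,
    LocallyAC.zero _, ?_⟩
  filter_upwards [leftPair_apply (u₀ := u₀) h.eventuallyZero,
    rightPair_apply (u₀ := u₀) (h.eventuallyZero_deriv hm (-1))] with u h1 h2
  rw [h1.1, h1.2, h2.1, h2.2, ((h.hasDerivAt u).ofReal_comp).deriv, deriv_const]
  refine ⟨rfl, rfl, by ring, ?_⟩
  push_cast
  ring

theorem diracAC_rightPair {η : ℝ → ℝ} (h : IsRightTest η) :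
    DiracAC m u₀ (fun _ => 0) (fun u => (η u : ℂ)) (rightPair u₀ h.eventuallyZero)
      (leftPair u₀ (h.eventuallyZero_deriv hm 1)) := by
  refine ⟨LocallyAC.zero _,
    LocallyAC.of_contDiff (Complex.ofRealCLM.contDiff.comp h.contDiff).contDiffOn, ?_⟩
  filter_upwards [rightPair_apply (u₀ := u₀) h.eventuallyZero,
    leftPair_apply (u₀ := u₀) (h.eventuallyZero_deriv hm 1)] with u h1 h2
  rw [h1.1, h1.2, h2.1, h2.2, ((h.hasDerivAt u).ofReal_comp).deriv, deriv_const]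
  refine ⟨rfl, rfl, ?_, by ring⟩
  push_cast
  ring

omit hm in
/-- Green's formula. The boundary form vanishes at infinity since it is integrable together with
its derivative. -/
theorem DiracAC.green {α β α' β' : ℝ → ℂ} {T S T' S' : PairL2 u₀} (h : DiracAC m u₀ α β T S)
    (h' : DiracAC m u₀ α' β' T' S') : ⟪S, T'⟫ - ⟪T, S'⟫ =
      -(1 / 2) * (α' u₀ * conj (β u₀) - β' u₀ * conj (α u₀)) := by
  set W : ℝ → ℂ := fun u => α' u * conj (β u) + -1 * (β' u * conj (α u)) with hW
  set D : ℝ → ℂ := fun u => (T' u 0 * conj (S u 0) + T' u 1 * conj (S u 1)) -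
    (S' u 0 * conj (T u 0) + S' u 1 * conj (T u 1)) with hD
  have hi : ∀ (T S : PairL2 u₀) (i j : Fin 2), Integrable
      (fun u => T u i * conj (S u j)) (volume.restrict (Ioi u₀)) := fun T S i j =>
    integrable_mul_conj (memLp_pair_apply T i) (memLp_pair_apply S j)
  have hDi : IntegrableOn D (Ioi u₀) :=
    ((hi T' S 0 0).add (hi T' S 1 1)).sub ((hi S' T 0 0).add (hi S' T 1 1))
  have hWac : LocallyAC W (Ici u₀) :=
    (h'.left.mul h.right.conj).add ((h'.right.mul h.left.conj).const_mul (-1))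
  have hWd : ∀ᵐ u ∂(volume.restrict (Ioi u₀)), deriv W u = D u := by
    filter_upwards [h.eq, h'.eq, h.left.of_Ici.ae_differentiableAt,
      h.right.of_Ici.ae_differentiableAt, h'.left.of_Ici.ae_differentiableAt,
      h'.right.of_Ici.ae_differentiableAt] with u h1 h2 d1 d2 d3 d4
    obtain ⟨a1, a2, a3, a4⟩ := h1
    obtain ⟨b1, b2, b3, b4⟩ := h2
    have c1 : HasDerivAt (fun u => conj (α u)) (conj (deriv α u)) u :=
      d1.hasDerivAt.star
    have c2 : HasDerivAt (fun u => conj (β u)) (conj (deriv β u)) u :=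
      d2.hasDerivAt.star
    have d : deriv W u = _ := ((d3.hasDerivAt.mul c2).add
      ((d4.hasDerivAt.mul c1).const_mul (-1))).deriv
    rw [d, hD]
    simp only [a1, a2, a3, a4, b1, b2, b3, b4, map_sub, map_neg, map_mul, Complex.conj_ofReal]
    ring
  have hWi : ∀ x, u₀ ≤ x → W x = W u₀ + ∫ t in u₀..x, D t := fun x hx => by
    have h1 := (hWac.ftc hx fun z hz => hz.1).2
    have h2 : ∫ t in u₀..x, deriv W t = ∫ t in u₀..x, D t := by
      refine intervalIntegral.integral_congr_ae ?_
      rw [ae_restrict_iff' measurableSet_Ioi] at hWd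
      filter_upwards [hWd] with t ht htm
      rw [uIoc_of_le hx] at htm
      exact ht htm.1
    rw [← h2, h1]
    ring
  have hlim : Tendsto W atTop (𝓝 (W u₀ + ∫ t in Ioi u₀, D t)) := by
    refine (tendsto_const_nhds.add
      (intervalIntegral_tendsto_integral_Ioi u₀ hDi tendsto_id)).congr' ?_
    filter_upwards [eventually_ge_atTop u₀] with x hx
    exact (hWi x hx).symm
  -- `W` has a limit at infinity and is integrable, so the limit is zero
  have hWint : IntegrableOn (fun u => ((1 : ℝ) : ℂ) * W u) (Ioi u₀) := by
    refine ((hi T' T 0 1).add ((hi T' T 1 0).const_mul (-1))).congr ?_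
    filter_upwards [h.eq, h'.eq] with u h1 h2
    simp only [hW, Pi.add_apply, h1.1, h1.2.1, h2.1, h2.2.1, Complex.ofReal_one, one_mul]
  have e0 := eq_zero_of_tendsto_of_integrableOn (w := fun _ => 1) measurable_const hWint hlim
    fun s hs => by
      obtain ⟨v, hv⟩ := mem_atTop_sets.1 hs
      refine ⟨Ioi (max v u₀), fun x hx => ⟨hv x ((le_max_left _ _).trans (le_of_lt hx)),
        (le_max_right v u₀).trans_lt hx⟩, measurableSet_Ioi, fun hn => ?_⟩
      rw [integrableOn_const_iff (by simp)] at hn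
      simp at hn
  have e1 := integral_sub ((hi T' S 0 0).add (hi T' S 1 1)) ((hi S' T 0 0).add (hi S' T 1 1))
  simp only [Pi.add_apply] at e1
  rw [inner_pair_eq, inner_pair_eq, ← mul_sub, ← e1]
  have e2 : ∫ t in Ioi u₀, D t = -W u₀ := by linear_combination e0
  rw [hD] at e2
  rw [e2, hW]
  ring

omit hm in
theorem pair_intervalIntegrable (T : PairL2 u₀) (i : Fin 2) (x y : ℝ) (hx : u₀ ≤ x) (hxy : x ≤ y) :
    IntervalIntegrable (fun u => T u i) volume x y := by
  rw [intervalIntegrable_iff_integrableOn_Ioc_of_le hxy]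
  exact ((memLp_pair_apply T i).mono_measure (Measure.restrict_mono
    (fun z hz => hx.trans_lt hz.1) le_rfl)).integrable (by norm_num)

include hm in
/-- Weak solutions of the Dirac system have locally absolutely continuous components. -/
theorem DiracAC.of_weak {z y : PairL2 u₀}
    (h0 : ∀ η (hη : IsTest u₀ η), ⟪rightPair u₀ (hη.isRightTest.eventuallyZero_deriv hm (-1)), z⟫ =
      ⟪leftPair u₀ hη.isRightTest.eventuallyZero, y⟫)
    (h1 : ∀ η (hη : IsTest u₀ η), ⟪leftPair u₀ (hη.isRightTest.eventuallyZero_deriv hm 1), z⟫ =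
      ⟪rightPair u₀ hη.isRightTest.eventuallyZero, y⟫) :
    ∃ α β : ℝ → ℂ, DiracAC m u₀ α β z y := by
  have hmz : ∀ i, ∀ x ∈ Ici u₀, ∀ y ∈ Ici u₀,
      IntervalIntegrable (fun u => (m u : ℂ) * z u i) volume x y := fun i x hx y hy => by
    have hc : Continuous fun u => (m u : ℂ) := Complex.continuous_ofReal.comp hm
    rcases le_total x y with h | h
    · exact (pair_intervalIntegrable z i x y hx h).continuousOn_mul hc.continuousOn
    · exact ((pair_intervalIntegrable z i y x hy h).continuousOn_mul hc.continuousOn).symm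
  have hii : ∀ (T : PairL2 u₀) i, ∀ x ∈ Ici u₀, ∀ y ∈ Ici u₀,
      IntervalIntegrable (fun u => T u i) volume x y := fun T i x hx y hy => by
    rcases le_total x y with h | h
    · exact pair_intervalIntegrable T i x y hx h
    · exact (pair_intervalIntegrable T i y x hy h).symm
  have hmi : ∀ (T : PairL2 u₀) i {φ : ℝ → ℝ} (_ : EventuallyZero φ),
      IntegrableOn (fun u => (φ u : ℂ) * T u i) (Ioi u₀) := fun T i φ hφ =>
    (hφ.memLp u₀).integrable_mul (memLp_pair_apply T i)
  obtain ⟨β, hβ, -, hβa⟩ := exists_locallyAC_of_weak (l := u₀) (s := Ici u₀)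
    (p := fun u => z u 1) (q := fun u => (m u : ℂ) * z u 1 + y u 0) Ioi_subset_Ici_self
    (fun x y hx hxy => pair_intervalIntegrable z 1 x y (le_of_lt hx) hxy)
    (fun x hx w hw => (hmz 1 x hx w hw).add (hii y 0 x hx w hw))
    (fun φ hφ => by
      have e := h0 φ hφ
      rw [inner_rightPair, inner_leftPair] at e
      have e' := mul_left_cancel₀ (by norm_num) e
      rw [← sub_eq_zero, ← integral_sub (hmi z 1 (hφ.isRightTest.eventuallyZero_deriv hm (-1)))
        (hmi y 0 hφ.isRightTest.eventuallyZero)] at e'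
      rw [← neg_eq_zero, ← integral_neg, ← e']
      congr 1
      ext u
      push_cast
      ring)
  obtain ⟨α, hα, -, hαa⟩ := exists_locallyAC_of_weak (l := u₀) (s := Ici u₀)
    (p := fun u => z u 0) (q := fun u => -((m u : ℂ) * z u 0) - y u 1) Ioi_subset_Ici_self
    (fun x y hx hxy => pair_intervalIntegrable z 0 x y (le_of_lt hx) hxy)
    (fun x hx w hw => (hmz 0 x hx w hw).neg.sub (hii y 1 x hx w hw))
    (fun φ hφ => by
      have e := h1 φ hφ
      rw [inner_rightPair, inner_leftPair] at e
      have e' := mul_left_cancel₀ (by norm_num) e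
      rw [← sub_eq_zero, ← integral_sub (hmi z 0 (hφ.isRightTest.eventuallyZero_deriv hm 1))
        (hmi y 1 hφ.isRightTest.eventuallyZero)] at e'
      rw [← e']
      congr 1
      ext u
      push_cast
      ring)
  refine ⟨α, β, hα, hβ, ?_⟩
  filter_upwards [hαa, hβa] with u h1 h2
  rw [h1.2.deriv, h2.2.deriv, ← h1.1, ← h2.1]
  refine ⟨rfl, rfl, ?_, ?_⟩ <;> ring

omit hm in
theorem mem_diracOp_iff {T S : PairL2 u₀} : (T, S) ∈ (diracOp m u₀).graph ↔
    ∃ α β : ℝ → ℂ, DiracAC m u₀ α β T S ∧ α u₀ = 0 := by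
  rw [diracOp_graph]
  constructor
  · rintro ⟨α, β, h1, h2, h3, h4⟩
    exact ⟨α, β, ⟨h1, h2, h4⟩, h3⟩
  · rintro ⟨α, β, ⟨h1, h2, h4⟩, h3⟩
    exact ⟨α, β, h1, h2, h3, h4⟩

omit hm in
/-- A pair orthogonal to all pairs of test functions is zero. -/
theorem pair_eq_zero_of_inner_test {z : PairL2 u₀}
    (h0 : ∀ η (hη : IsTest u₀ η), ⟪leftPair u₀ hη.isRightTest.eventuallyZero, z⟫ = 0)
    (h1 : ∀ η (hη : IsTest u₀ η), ⟪rightPair u₀ hη.isRightTest.eventuallyZero, z⟫ = 0) : z = 0 := by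
  have key : ∀ i, (∀ φ, IsTest u₀ φ → ∫ u in Ioi u₀, (φ u : ℂ) * z u i = 0) →
      ∀ᵐ u ∂(volume.restrict (Ioi u₀)), z u i = 0 := fun i h =>
    ae_eq_zero_of_integral_test_mul
      (fun x y hx hxy => pair_intervalIntegrable z i x y (le_of_lt hx) hxy) h
  refine pair_ext ?_
  filter_upwards [key 0 fun φ hφ => by simpa [inner_leftPair] using h0 φ hφ,
    key 1 fun φ hφ => by simpa [inner_rightPair] using h1 φ hφ,
    ae_of_ae_half (Lp.coeFn_zero (EuclideanSpace ℂ (Fin 2)) 2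
      ((2⁻¹ : ℝ≥0∞) • volume.restrict (Ioi u₀)))] with u e0 e1 e2
  rw [e0, e1, e2]
  simp

include hm in
theorem leftPair_mem_graph {η : ℝ → ℝ} (h : IsRightTest η) (h0 : η u₀ = 0) :
    (leftPair u₀ h.eventuallyZero, rightPair u₀ (h.eventuallyZero_deriv hm (-1))) ∈
      (diracOp m u₀).graph :=
  mem_diracOp_iff.2 ⟨_, _, diracAC_leftPair hm h, by rw [h0, Complex.ofReal_zero]⟩

include hm in
theorem rightPair_mem_graph {η : ℝ → ℝ} (h : IsRightTest η) :
    (rightPair u₀ h.eventuallyZero, leftPair u₀ (h.eventuallyZero_deriv hm 1)) ∈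
      (diracOp m u₀).graph :=
  mem_diracOp_iff.2 ⟨_, _, diracAC_rightPair hm h, rfl⟩

omit hm in
theorem diracOp_isFormalAdjoint : (diracOp m u₀).IsFormalAdjoint (diracOp m u₀) := by
  intro x y
  obtain ⟨α, β, h, h0⟩ := mem_diracOp_iff.1 ((diracOp m u₀).mem_graph x)
  obtain ⟨α', β', h', h0'⟩ := mem_diracOp_iff.1 ((diracOp m u₀).mem_graph y)
  have := h.green h'
  rw [h0, h0', map_zero, zero_mul, mul_zero, sub_zero, mul_zero] at this
  exact sub_eq_zero.1 this

include hm in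
theorem dense_diracOp_domain : Dense ((diracOp m u₀).domain : Set (PairL2 u₀)) := by
  rw [Submodule.dense_iff_topologicalClosure_eq_top, Submodule.topologicalClosure_eq_top_iff,
    Submodule.eq_bot_iff]
  intro z hz
  rw [Submodule.mem_orthogonal] at hz
  refine pair_eq_zero_of_inner_test (fun η hη => hz _ ?_) (fun η hη => hz _ ?_)
  · exact LinearPMap.mem_domain_of_mem_graph
      (leftPair_mem_graph hm hη.isRightTest (hη.eq_zero_of_le le_rfl))
  · exact LinearPMap.mem_domain_of_mem_graph (rightPair_mem_graph hm hη.isRightTest)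

include hm in
/-- The adjoint domain consists of weak solutions, and testing against `(0,χ)` with `χ(u₀) = 1`
gives the boundary condition. -/
theorem isSelfAdjoint_diracOp : IsSelfAdjoint (diracOp m u₀) := by
  have hd := dense_diracOp_domain (u₀ := u₀) hm
  have hle := diracOp_isFormalAdjoint (m := m) (u₀ := u₀).le_adjoint hd
  rw [LinearPMap.isSelfAdjoint_def]
  refine (LinearPMap.eq_of_le_of_domain_eq hle (le_antisymm hle.1 fun z hz => ?_)).symm
  set y := (diracOp m u₀).adjoint ⟨z, hz⟩ with hy
  have hadj : ∀ {d e : PairL2 u₀}, (d, e) ∈ (diracOp m u₀).graph → ⟪e, z⟫ = ⟪d, y⟫ := by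
    intro d e hde
    obtain ⟨x, hx1, hx2⟩ := (LinearPMap.mem_graph_iff _).1 hde
    simp only at hx1 hx2
    rw [← hx1, ← hx2]
    exact (LinearPMap.adjoint_isFormalAdjoint hd).symm x ⟨z, hz⟩
  obtain ⟨α, β, h⟩ := DiracAC.of_weak hm
    (fun η hη => hadj (leftPair_mem_graph hm hη.isRightTest (hη.eq_zero_of_le le_rfl)))
    (fun η hη => hadj (rightPair_mem_graph hm hη.isRightTest))
  obtain ⟨χ, hχ, hχ1⟩ := exists_isRightTest_eq_one u₀
  have e := (diracAC_rightPair (u₀ := u₀) hm hχ).green h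
  rw [hadj (rightPair_mem_graph hm hχ), sub_self] at e
  simp only [hχ1, map_zero, mul_zero, sub_zero, Complex.ofReal_one, map_one, mul_one] at e
  have h0 : α u₀ = 0 := by linear_combination 2 * e
  exact LinearPMap.mem_domain_of_mem_graph (mem_diracOp_iff.2 ⟨α, β, h, h0⟩)

end Dirac

/-! ### Transmutation intertwines `H_0` with a differential operator in `b` -/

/-- The transposed Volterra operator `R ↦ R(x) - ε ∫_x^c φ_b^ε(x) R(b) db` on real functions on
`(0,∞)`. -/
def coreT (ε c : ℝ) (R : ℝ → ℝ) (x : ℝ) : ℝ :=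
  R x + ε * ∫ b in c..x, phi ε b x * R b

/-- The differential expression `(b ∂_b + 1/2 + ε μ) R`. -/
def dirGen (ε : ℝ) (R : ℝ → ℝ) (b : ℝ) : ℝ :=
  b * deriv R b + R b / 2 + ε * (b * (phi ε b b + phi (-ε) b b)) * R b

section Core

variable {ε c : ℝ} (hε : ε * ε = 1) (hc : 0 < c)
include hε hc

theorem continuousOn_coreT {R : ℝ → ℝ} (hR : ContinuousOn R (Ioi 0)) :
    ContinuousOn (coreT ε c R) (Ioi 0) := by
  refine hR.add (continuousOn_const.mul fun x hx => ContinuousAt.continuousWithinAt ?_)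
  have hx' : 0 < x := hx
  set δ := min c x / 2 with hδ
  have hmin : 0 < min c x := lt_min hc hx'
  have hδ0 : 0 < δ := by positivity
  have hδc : δ < c := by linarith [min_le_left c x]
  have hδx : δ < x := by linarith [min_le_right c x]
  have hF : Continuous (Function.uncurry fun x b : ℝ => phi ε (max δ b) x * R (max δ b)) := by
    refine Continuous.mul (continuous_iff_continuousAt.2 fun p => ?_) ?_
    · exact ContinuousAt.comp (f := fun p : ℝ × ℝ => (max δ p.2, p.1))
        (g := fun p : ℝ × ℝ => phi ε p.1 p.2)
        (continuousAt_phi₂ hε (lt_max_of_lt_left hδ0) p.1) (by fun_prop)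
    · exact hR.comp_continuous (by fun_prop) fun p => lt_max_of_lt_left hδ0
  have h1 := (intervalIntegral.continuous_parametric_intervalIntegral_of_continuous
    (a₀ := c) (μ := volume) hF continuous_id).continuousAt (x := x)
  refine h1.congr ?_
  filter_upwards [lt_mem_nhds hδx] with y hy
  refine intervalIntegral.integral_congr fun b hb => ?_
  have : δ ≤ b := (le_min hδc.le (le_of_lt hy)).trans hb.1
  simp only [max_eq_right this]

/-- The differential system for `φ_b^±` says that `x ∂_x + 1/2` passes through the transposed
Volterra operator, exchanging the signs `±`. -/
theorem hasDerivAt_coreT {R : ℝ → ℝ} (hR : ∀ b, 0 < b → ContDiffAt ℝ 1 R b) (hRc : R c = 0)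
    (hh : ContinuousOn (dirGen ε R) (Ioi 0)) {x : ℝ} (hx : 0 < x) :
    HasDerivAt (coreT ε c R) (x⁻¹ * (coreT (-ε) c (dirGen ε R) x - coreT ε c R x / 2)) x := by
  have hε' : -ε * -ε = 1 := by rw [neg_mul_neg, hε]
  set g : ℝ × ℝ → ℝ := fun p => phi ε p.2 p.1 * R p.2 with hg
  have hgc : ∀ y ∈ (univ : Set ℝ), ∀ b ∈ Ioi (0 : ℝ), ContDiffAt ℝ 1 g (y, b) := fun y _ b hb => by
    have h1 : ContDiffAt ℝ 1 (fun p : ℝ × ℝ => phi ε p.2 p.1) (y, b) :=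
      ContDiffAt.comp (f := fun p : ℝ × ℝ => (p.2, p.1)) (g := fun p : ℝ × ℝ => phi ε p.1 p.2) _
        (contDiffAt_phi hε hb) (contDiffAt_snd.prodMk contDiffAt_fst)
    exact h1.mul (ContDiffAt.comp (f := fun p : ℝ × ℝ => p.2) (g := R) _ (hR b hb) contDiffAt_snd)
  have hsub : uIcc c x ⊆ Ioi 0 := fun b hb => (lt_min hc hx).trans_le hb.1
  have hfd : ∀ b ∈ uIcc c x, fderiv ℝ g (x, b) (1, 0) = phiX ε b x * R b := fun b hb =>
    (hasDerivAt_fst_of_contDiffAt (hgc x (mem_univ _) b (hsub hb))).unique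
      ((hasDerivAt_phiX hε (hsub hb) x).mul_const (R b))
  have hRd : ∀ b, 0 < b → HasDerivAt R (deriv R b) b := fun b hb =>
    ((hR b hb).differentiableAt (by simp)).hasDerivAt
  have hd := (hRd x hx).add ((hasDerivAt_integral_param_right isOpen_univ ordConnected_Ioi
    isOpen_Ioi hgc hc (mem_univ x) hx).const_mul ε)
  rw [intervalIntegral.integral_congr hfd] at hd
  have hRc' : ContinuousOn R (uIcc c x) := fun b hb =>
    (hR b (hsub hb)).continuousAt.continuousWithinAt
  have hpc : ∀ {F : ℝ → ℝ → ℝ → ℝ} {e : ℝ}, (∀ b, 0 < b →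
      ContinuousAt (fun p : ℝ × ℝ => F e p.1 p.2) (b, x)) → ContinuousOn (fun b => F e b x) (uIcc c x) :=
    fun h b hb => (ContinuousAt.comp (f := fun b : ℝ => (b, x)) (h b (hsub hb))
      (by fun_prop)).continuousWithinAt
  have iA : IntervalIntegrable (fun b => phiX ε b x * R b) volume c x :=
    ((hpc fun b hb => continuousAt_phiX hε hb x).mul hRc').intervalIntegrable
  have iB : IntervalIntegrable (fun b => phi ε b x * R b) volume c x :=
    ((hpc fun b hb => continuousAt_phi₂ hε hb x).mul hRc').intervalIntegrable
  have iC : IntervalIntegrable (fun b => phi (-ε) b x * dirGen ε R b) volume c x :=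
    ((hpc fun b hb => continuousAt_phi₂ hε' hb x).mul (hh.mono hsub)).intervalIntegrable
  -- by the differential system, the integrand is a derivative in `b`
  have hk : ∀ b ∈ uIcc c x, HasDerivAt (fun b => b * phi (-ε) b x * R b)
      (x * (phiX ε b x * R b) + (phi ε b x * R b) / 2 + phi (-ε) b x * dirGen ε R b) b := by
    intro b hb
    have hb0 : 0 < b := hsub hb
    have d := ((hasDerivAt_id b).mul (hasDerivAt_phiB hε' hb0 x)).mul (hRd b hb0)
    refine d.congr_deriv ?_
    have := phi_system hε' hb0 x
    rw [neg_neg] at this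
    simp only [dirGen, id, Pi.mul_apply]
    linear_combination -(R b) * this
  have hint := intervalIntegral.integral_eq_sub_of_hasDerivAt hk
    (((iA.const_mul x).add (iB.div_const 2)).add iC)
  rw [intervalIntegral.integral_add ((iA.const_mul x).add (iB.div_const 2)) iC,
    intervalIntegral.integral_add (iA.const_mul x) (iB.div_const 2),
    intervalIntegral.integral_const_mul, intervalIntegral.integral_div, hRc] at hint
  refine hd.congr_deriv ?_
  rw [eq_inv_mul_iff_mul_eq₀ hx.ne', coreT, coreT]
  simp only [hg]
  simp only [dirGen] at hint ⊢
  linear_combination ε * hint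

theorem locallyAC_coreT {R : ℝ → ℝ} (hR : ∀ b, 0 < b → ContDiffAt ℝ 1 R b) (hRc : R c = 0)
    (hh : ContinuousOn (dirGen ε R) (Ioi 0)) : LocallyAC (fun x => (coreT ε c R x : ℂ)) (Ioi 0) := by
  have hε' : -ε * -ε = 1 := by rw [neg_mul_neg, hε]
  have c1 : ContinuousOn (coreT ε c R) (Ioi 0) := continuousOn_coreT hε hc fun b hb =>
    (hR b hb).continuousAt.continuousWithinAt
  have c2 := continuousOn_coreT hε' hc hh
  have hd := fun x (hx : x ∈ Ioi (0 : ℝ)) => hasDerivAt_coreT hε hc hR hRc hh hx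
  have h1 : ContDiffOn ℝ (0 + 1) (coreT ε c R) (Ioi 0) := by
    rw [contDiffOn_succ_iff_deriv_of_isOpen isOpen_Ioi]
    refine ⟨fun x hx => (hd x hx).differentiableAt.differentiableWithinAt, by simp, ?_⟩
    rw [contDiffOn_zero]
    refine ContinuousOn.congr ?_ fun x hx => (hd x hx).deriv
    exact (continuousOn_id.inv₀ fun x hx => ne_of_gt hx).mul (c2.sub (c1.div_const 2))
  rw [zero_add] at h1
  exact LocallyAC.of_contDiff (Complex.ofRealCLM.contDiff.comp_contDiffOn h1)
omit hε hc in
/-- The restriction of `R` to `(a,c)`. -/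
def cut (a c : ℝ) (R : ℝ → ℝ) : ℝ → ℂ := (Ioo a c).indicator fun b => (R b : ℂ)

omit hε hc in
theorem volterraT_eq_coreT {a x : ℝ} {R : ℝ → ℝ} (hRc : R c = 0)
    (h : ∀ b, x ≤ b → b ≤ a → R b = 0) (hx : x ≤ c) :
    volterraT ε a c (cut a c R) x = coreT ε c R x := by
  have e : ∀ b, x ≤ b → b ≤ c → cut a c R b = R b := fun b hb hbc => by
    by_cases hm : b ∈ Ioo a c
    · rw [cut, indicator_of_mem hm]
    · rw [cut, indicator_of_notMem hm]
      rcases hbc.lt_or_eq with h1 | h1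
      · rw [h b hb (not_lt.1 fun h2 => hm ⟨h2, h1⟩), Complex.ofReal_zero]
      · rw [h1, hRc, Complex.ofReal_zero]
  rw [volterraT, coreT, e x le_rfl hx, intervalIntegral.integral_symm,
    intervalIntegral.integral_of_le hx, integral_Ioc_eq_integral_Ioo]
  push_cast
  rw [← integral_complex_ofReal, mul_neg, sub_eq_add_neg]
  congr 3
  refine setIntegral_congr_fun measurableSet_Ioo fun b hb => ?_
  rw [e b hb.1.le hb.2.le]
  by_cases hba : b ≤ a
  · rw [h b hb.1.le hba]
    simp
  · rw [phiC_of_le (not_le.1 hba).le]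
    push_cast
    rfl

end Core

section Transmuted

variable {ε a c : ℝ} (hε : ε * ε = 1) (ha : 0 < a)

theorem FreeRel.add {f g f' g' : HalfLineL2} (h : FreeRel f g) (h' : FreeRel f' g') :
    FreeRel (f + f') (g + g') := freeGraph.add_mem (x := (f, g)) (y := (f', g')) h h'

theorem FreeRel.smul {f g : HalfLineL2} (c : ℂ) (h : FreeRel f g) : FreeRel (c • f) (c • g) :=
  freeGraph.smul_mem (x := (f, g)) c h

theorem FreeRel.parity {ε : ℝ} {f g : HalfLineL2} (h : FreeRel f g) :
    FreeRel (parity ε f) (parity (-ε) g) := by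
  have := (h.add (h.cosT.smul (ε : ℂ))).smul (1 / 2)
  rw [parity_apply, parity_apply, Complex.ofReal_neg, neg_smul, ← smul_neg]
  exact this

variable {R : ℝ → ℝ} (hac : a < c) (hR : ∀ b, 0 < b → ContDiffAt ℝ 1 R b) (hRc : R c = 0)
  (hh : ContinuousOn (dirGen ε R) (Ioi 0))
include hac

omit hac in
theorem carriedBy_cut (ha : 0 < a) (hR : ContinuousOn R (Ioi 0)) : CarriedBy a c (cut a c R) := by
  refine ⟨?_, fun x hx => indicator_of_notMem hx _⟩
  have hsub : Icc a c ⊆ Ioi 0 := fun x hx => ha.trans_le hx.1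
  have hRC : ContinuousOn (fun b => (R b : ℂ)) (Icc a c) :=
    Complex.continuous_ofReal.comp_continuousOn (hR.mono hsub)
  obtain ⟨M, hM⟩ := (isCompact_Icc (a := a) (b := c)).exists_bound_of_continuousOn hRC
  rw [cut, memLp_indicator_iff_restrict measurableSet_Ioo]
  refine MemLp.of_bound ((hRC.mono Ioo_subset_Icc_self).aestronglyMeasurable measurableSet_Ioo) M ?_
  exact (ae_restrict_iff' measurableSet_Ioo).2 (Eventually.of_forall fun u hu =>
    hM u (Ioo_subset_Icc_self hu))

include hR hRc hh

/-- For `R` supported inside `(a,c)`, the transmuted function is in the domain of `H_0`. -/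
theorem freeRel_transmuted (hRa : ∀ b, 0 < b → b ≤ a → R b = 0) (hRc' : ∀ b, c ≤ b → R b = 0)
    (hha : ∀ b, 0 < b → b ≤ a → dirGen ε R b = 0) (hhc : dirGen ε R c = 0)
    (h1 : CarriedBy a c (cut a c R)) (h2 : CarriedBy a c (cut a c (dirGen ε R)))
    (hε' : -ε * -ε = 1) :
    FreeRel (transmuted hε ha h1) (-Complex.I • transmuted hε' ha h2) := by
  obtain ⟨m1, i1, z1⟩ := memLp_volterraT hε ha h1
  obtain ⟨m2, i2, z2⟩ := memLp_volterraT hε' ha h2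
  have hc : 0 < c := ha.trans hac
  have hz : ∀ x, c ≤ x → coreT ε c R x = 0 := fun x hx => by
    rw [coreT, hRc' x hx, intervalIntegral.integral_congr (g := fun _ => 0) fun b hb => by
      rw [uIcc_of_le hx] at hb
      simp only [hRc' b hb.1, mul_zero]]
    simp
  have e1 : ∀ x, 0 < x → volterraT ε a c (cut a c R) x = coreT ε c R x := fun x hx0 => by
    rcases le_total x c with hx | hx
    · exact volterraT_eq_coreT hRc (fun b hb' hb => hRa b (hx0.trans_le hb') hb) hx
    · rw [z1 x hx, hz x hx, Complex.ofReal_zero]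
  have hw : FreeRel (m1.toLp _) (-Complex.I • m2.toLp _) := by
    refine ⟨fun x => (coreT ε c R x : ℂ), locallyAC_coreT hε hc hR hRc hh, ?_, ?_⟩
    · filter_upwards [m1.coeFn_toLp, ae_restrict_mem measurableSet_Ioi] with x hx hx0
      rw [hx, e1 x hx0]
    · filter_upwards [m2.coeFn_toLp, Lp.coeFn_smul (-Complex.I) (m2.toLp _),
        ae_restrict_mem measurableSet_Ioi,
        Measure.ae_ne (μ := ν₀) c] with x hx hx' hx0 hxc
      have hd := hasDerivAt_coreT hε hc hR hRc hh hx0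
      have hx0' : (x : ℂ) ≠ 0 := by exact_mod_cast ne_of_gt hx0
      rw [hx', Pi.smul_apply, hx, smul_eq_mul, hd.ofReal_comp.deriv]
      congr 1
      rcases lt_or_gt_of_ne hxc with hx1 | hx1
      · rw [volterraT_eq_coreT hhc (fun b hb' hb => hha b (hx0.trans_le hb') hb) hx1.le]
        push_cast
        field_simp
        ring
      · have : (fun x => coreT ε c R x) =ᶠ[𝓝 x] fun _ => 0 := by
          filter_upwards [lt_mem_nhds hx1] with y hy using hz y (le_of_lt hy)
        have hd' := hd.deriv
        rw [show coreT ε c R = fun x => coreT ε c R x from rfl, this.deriv_eq, deriv_const] at hd'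
        rw [z2 x (le_of_lt hx1), ← hd', hz x (le_of_lt hx1)]
        simp
  have := hw.add (hw.cosT.smul (ε : ℂ))
  have e : -Complex.I • m2.toLp _ + (ε : ℂ) • -cosT (-Complex.I • m2.toLp _) =
      -Complex.I • transmuted hε' ha h2 := by
    rw [transmuted, map_smul]
    push_cast
    module
  rw [e] at this
  exact this

/-- Integration by parts against the transmuted functions, for `R` with no condition at `a`: the
boundary terms vanish since functions in `K_a ∩ dom H_0` vanish at `a`. -/
theorem inner_transmuted_freeRel (hhc : dirGen ε R c = 0)
    (h1 : CarriedBy a c (cut a c R)) (h2 : CarriedBy a c (cut a c (dirGen ε R)))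
    (hε' : -ε * -ε = 1) {f g : HalfLineL2} (hfg : FreeRel f g) (hf : f ∈ K a) :
    ⟪transmuted hε ha h1, g⟫ = Complex.I * ⟪transmuted hε' ha h2, f⟫ := by
  have hc : 0 < c := ha.trans hac
  have hfg' := hfg.parity (ε := -ε)
  rw [neg_neg] at hfg'
  have hf' : parity (-ε) f ∈ K a := parity_mem_K hf
  have hg' : parity ε g ∈ K a := parity_mem_K (hfg.mem_K hf)
  rw [← inner_parity hε (cosT_transmuted hε ha h1), ← inner_parity hε' (cosT_transmuted hε' ha h2),
    inner_transmuted_eq hε ha h1 (cosT_parity hε g),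
    inner_transmuted_eq hε' ha h2 (cosT_parity hε' f)]
  have key : ∀ {ε : ℝ} {R : ℝ → ℝ} {g : HalfLineL2} (_ : g ∈ K a) (_ : R c = 0)
      (h : MemLp (volterraT ε a c (cut a c R)) 2 ν₀)
      (_ : ∀ x, c ≤ x → volterraT ε a c (cut a c R) x = 0),
      ⟪h.toLp _, g⟫ = ∫ x in a..c, (coreT ε c R x : ℂ) * g x := by
    intro ε R g hg hRc h hz
    rw [inner_toLp_left, intervalIntegral.integral_of_le hac.le]
    have hg0 := (mem_K_iff.1 hg).1
    have e1 : ∫ x in Ioi (0 : ℝ), g x * conj (volterraT ε a c (cut a c R) x) =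
        ∫ x in Ioi (0 : ℝ), (Ioc a c).indicator (fun x => (coreT ε c R x : ℂ) * g x) x := by
      refine integral_congr_ae ?_
      filter_upwards [hg0, Measure.ae_ne (μ := ν₀) a] with x hx hxa
      by_cases hm : x ∈ Ioc a c
      · rw [indicator_of_mem hm, volterraT_eq_coreT hRc
          (fun b hb hb' => absurd hm.1 (not_lt.2 (hb.trans hb'))) hm.2, Complex.conj_ofReal, mul_comm]
      · rw [indicator_of_notMem hm]
        rcases lt_or_gt_of_ne hxa with h3 | h3
        · rw [hx h3, zero_mul]
        · rw [hz x (not_le.1 fun h4 => hm ⟨h3, h4⟩).le, map_zero, mul_zero]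
    have hsub : Ioc a c ⊆ Ioi 0 := fun x hx => ha.trans hx.1
    rw [e1, setIntegral_indicator measurableSet_Ioc, inter_eq_self_of_subset_right hsub]
  rw [key hg' hRc _ (memLp_volterraT hε ha h1).2.2, key hf' hhc _ (memLp_volterraT hε' ha h2).2.2]
  have hKf := (mem_K_iff.1 hf').1
  generalize parity (-ε) f = f₁ at *
  generalize parity ε g = g₁ at *
  obtain ⟨F, hF, hfF, hgF⟩ := hfg'
  -- `F` vanishes at `a` by continuity
  have hFa : F a = 0 := by
    have h0 := hF.eqOn_zero_of_vanishesBelow hfF hKf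
    have hcl : a ∈ closure (Ioo 0 a) := by
      rw [closure_Ioo ha.ne]
      exact ⟨ha.le, le_rfl⟩
    have hca : ContinuousAt F a := hF.continuousOn_Ioi.continuousAt (Ioi_mem_nhds ha)
    have hne : (𝓝[Ioo 0 a] a).NeBot := mem_closure_iff_nhdsWithin_neBot.1 hcl
    refine tendsto_nhds_unique (hca.tendsto.mono_left (nhdsWithin_le_nhds (s := Ioo 0 a))) ?_
    refine tendsto_const_nhds.congr' ?_
    filter_upwards [self_mem_nhdsWithin] with x hx
    exact (h0 hx).symm
  have hwc : coreT ε c R c = 0 := by simp [coreT, hRc]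
  have hsub : Icc a c ⊆ Ioi 0 := fun x hx => ha.trans_le hx.1
  have hX : LocallyAC (fun x : ℝ => (x : ℂ) * (coreT ε c R x : ℂ)) (Ioi 0) :=
    LocallyAC.mul (LocallyAC.of_contDiff Complex.ofRealCLM.contDiff.contDiffOn)
      (locallyAC_coreT hε hc hR hRc hh)
  obtain ⟨p1, p2⟩ := ac_integral_mul (hX a c hac.le hsub) (hF a c hac.le hsub)
  rw [hFa, hwc, Complex.ofReal_zero, mul_zero, mul_zero, zero_mul, sub_zero] at p2
  have hRcont : ContinuousOn R (Ioi 0) := fun b hb => (hR b hb).continuousAt.continuousWithinAt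
  have hu : uIcc a c ⊆ Ioi 0 := by rwa [uIcc_of_le hac.le]
  have i1 : IntervalIntegrable (fun x => (coreT ε c R x : ℂ) * g₁ x) volume a c :=
    (L2_intervalIntegrable g₁ a c ha hac.le).continuousOn_mul
      (Complex.continuous_ofReal.comp_continuousOn ((continuousOn_coreT hε hc hRcont).mono hu))
  have i2 : IntervalIntegrable (fun x => (coreT (-ε) c (dirGen ε R) x : ℂ) * f₁ x) volume a c :=
    (L2_intervalIntegrable f₁ a c ha hac.le).continuousOn_mul
      (Complex.continuous_ofReal.comp_continuousOn ((continuousOn_coreT hε' hc hh).mono hu))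
  have hsum : (∫ x in a..c, (coreT ε c R x : ℂ) * g₁ x) -
      Complex.I * ∫ x in a..c, (coreT (-ε) c (dirGen ε R) x : ℂ) * f₁ x = 0 := by
    rw [← intervalIntegral.integral_const_mul, ← intervalIntegral.integral_sub i1 (i2.const_mul _)]
    have e := congrArg (fun z => -Complex.I * z) p2
    simp only [mul_zero] at e
    rw [← e, ← intervalIntegral.integral_const_mul]
    refine intervalIntegral.integral_congr_ae ?_
    have h3 := (ae_restrict_iff' measurableSet_Ioi).1 (hfF.and hgF)
    filter_upwards [h3] with x hx hxm
    rw [uIoc_of_le hac.le] at hxm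
    have hx0 : 0 < x := ha.trans hxm.1
    have hx0' : (x : ℂ) ≠ 0 := by exact_mod_cast hx0.ne'
    obtain ⟨hx1, hx2⟩ := hx hx0
    have hd := (Complex.ofRealCLM.hasDerivAt (x := x)).mul
      (hasDerivAt_coreT hε hc hR hRc hh hx0).ofReal_comp
    have hd' : deriv (fun x : ℝ => (x : ℂ) * (coreT ε c R x : ℂ)) x = _ := hd.deriv
    rw [hd', hx1, hx2]
    simp only [Complex.ofRealCLM_apply]
    push_cast
    field_simp
    ring
  linear_combination 2 * hsum

end Transmuted

/-! ### The unitary map and test pairs -/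

/-- The function `R(b) = η(log b) / (2√b)` corresponding to `η(u)`. -/
def expTest (η : ℝ → ℝ) (b : ℝ) : ℝ := η (log b) / (2 * sqrt b)

theorem expTest_exp (η : ℝ → ℝ) (u : ℝ) : 2 * (exp (u / 2) * expTest η (exp u)) = η u := by
  have hs : sqrt (exp u) = exp (u / 2) := by
    rw [← exp_half_sq, Real.sqrt_sq (Real.exp_pos _).le]
  have := Real.exp_ne_zero (u / 2)
  rw [expTest, Real.log_exp, hs]
  field_simp

theorem continuousOn_expTest {f : ℝ → ℝ} (hf : Continuous f) : ContinuousOn (expTest f) (Ioi 0) := by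
  refine ContinuousOn.div (hf.comp_continuousOn (Real.continuousOn_log.mono fun x hx => ne_of_gt hx))
    (by fun_prop) fun x hx => ?_
  have := Real.sqrt_pos.2 hx
  positivity

theorem contDiffAt_expTest {η : ℝ → ℝ} (hη : ContDiff ℝ 1 η) {b : ℝ} (hb : 0 < b) :
    ContDiffAt ℝ 1 (expTest η) b := by
  refine ContDiffAt.div (ContDiffAt.comp b hη.contDiffAt (Real.contDiffAt_log.2 hb.ne'))
    (contDiffAt_const.mul (Real.contDiffAt_sqrt hb.ne')) ?_
  have := Real.sqrt_pos.2 hb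
  positivity

theorem expTest_eq_zero {η : ℝ → ℝ} {n b : ℝ} (h : ∀ u, n ≤ u → η u = 0) (hb : exp n ≤ b) :
    expTest η b = 0 := by
  rw [expTest, h _ ((Real.le_log_iff_exp_le ((Real.exp_pos n).trans_le hb)).2 hb), zero_div]

theorem potential_log {ε b : ℝ} (hε : ε = 1 ∨ ε = -1) (hb : 0 < b) :
    b * (phi ε b b + phi (-ε) b b) = potential (log b) := by
  rw [potential_eq, Real.exp_log hb]
  rcases hε with rfl | rfl
  · rfl
  · rw [neg_neg, add_comm]

theorem dirGen_expTest {ε b : ℝ} (hε : ε = 1 ∨ ε = -1) {η : ℝ → ℝ} (hη : ContDiff ℝ 1 η)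
    (hb : 0 < b) : dirGen ε (expTest η) b =
      expTest (fun u => deriv η u + ε * potential u * η u) b := by
  have hs := Real.sqrt_pos.2 hb
  have h1 : HasDerivAt (fun b => η (log b)) (deriv η (log b) * b⁻¹) b :=
    (hη.differentiable (by simp) _).hasDerivAt.comp b (Real.hasDerivAt_log hb.ne')
  have h2 := h1.div ((Real.hasDerivAt_sqrt hb.ne').const_mul 2) (by positivity)
  have h3 : deriv (expTest η) b = _ := h2.deriv
  rw [dirGen, h3, potential_log hε hb, expTest, expTest]
  have hsq : sqrt b ^ 2 = b := Real.sq_sqrt hb.le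
  field_simp
  rw [hsq]
  field_simp
  ring

theorem CarriedBy.zero (a c : ℝ) : CarriedBy a c (fun _ => 0) :=
  ⟨MemLp.zero (ε := ℂ), fun _ _ => rfl⟩

theorem CarriedBy.const_mul {a c : ℝ} {R : ℝ → ℂ} (h : CarriedBy a c R) (z : ℂ) :
    CarriedBy a c (fun b => z * R b) :=
  ⟨h.memLp.const_mul z, fun x hx => by rw [h.eq_zero x hx, mul_zero]⟩

theorem transmuted_smul {ε a c : ℝ} (hε : ε * ε = 1) (ha : 0 < a) {R R' : ℝ → ℂ}
    (hR : CarriedBy a c R) (hR' : CarriedBy a c R') {z : ℂ} (h : ∀ b, R' b = z * R b) :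
    transmuted hε ha hR' = z • transmuted hε ha hR := by
  have e : (memLp_volterraT hε ha hR').1.toLp _ = z • (memLp_volterraT hε ha hR).1.toLp _ := by
    rw [← MemLp.toLp_const_smul]
    refine MemLp.toLp_congr _ _ (Eventually.of_forall fun x => ?_)
    simp only [volterraT, Pi.smul_apply, smul_eq_mul, h]
    rw [mul_sub, mul_left_comm z, ← integral_const_mul z]
    simp only [mul_left_comm z]
  rw [transmuted, transmuted, e, map_smul, smul_add, smul_comm z]

section

variable {a c : ℝ} (ha : 0 < a) {U : K a ≃ₗᵢ[ℂ] PairL2 (log a)} (hU : ∀ f, U f = uMap ha f)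
  {f : ℝ → ℝ} (hf : EventuallyZero f) (hfc : ∀ u, log c ≤ u → f u = 0)
include hU hfc

omit ha hU in
theorem two_mul_cut_expTest (ha : 0 < a) {u : ℝ} (hu : u ∈ Ioi (log a)) (hac : a < c) :
    2 * ((exp (u / 2) : ℂ) * cut a c (expTest f) (exp u)) = f u := by
  have hua : a < exp u := (Real.log_lt_iff_lt_exp ha).1 hu
  by_cases hc : exp u < c
  · rw [cut, indicator_of_mem (show exp u ∈ Ioo a c from ⟨hua, hc⟩), ← expTest_exp f u]
    push_cast
    ring
  · rw [cut, indicator_of_notMem (fun h : exp u ∈ Ioo a c => hc h.2), hfc u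
      ((Real.log_le_iff_le_exp (ha.trans hac)).2 (not_lt.1 hc))]
    simp

theorem symm_leftPair (hac : a < c) {R : ℝ → ℂ} (hR : CarriedBy a c R) {z : ℂ}
    (h : ∀ b, cut a c (expTest f) b = z * R b) :
    (U.symm (leftPair (log a) hf) : HalfLineL2) = z • transmuted one_mul_one_real ha hR := by
  have hcut : CarriedBy a c (cut a c (expTest f)) :=
    carriedBy_cut ha (continuousOn_expTest hf.continuous)
  have hrep : Represents (cut a c (expTest f)) (fun _ => 0) (leftPair (log a) hf) := by
    filter_upwards [leftPair_apply (u₀ := log a) hf, ae_restrict_mem measurableSet_Ioi] with u h1 h2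
    rw [h1.1, h1.2, two_mul_cut_expTest hfc ha h2 hac]
    simp
  have e := uMap_fromPair ha hcut (CarriedBy.zero a c) hrep
  rw [← hU] at e
  rw [← e, U.symm_apply_apply, ← transmuted_smul _ ha hR hcut h]
  change transmuted one_mul_one_real ha hcut + transmuted neg_one_mul_neg_one_real ha
    (CarriedBy.zero a c) = _
  rw [transmuted_smul neg_one_mul_neg_one_real ha (CarriedBy.zero a c) (CarriedBy.zero a c)
    (z := 0) (fun b => by rw [mul_zero]), zero_smul, add_zero]

theorem symm_rightPair (hac : a < c) {R : ℝ → ℂ} (hR : CarriedBy a c R) {z : ℂ}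
    (h : ∀ b, cut a c (expTest f) b = z * R b) :
    (U.symm (rightPair (log a) hf) : HalfLineL2) =
      (Complex.I * z) • transmuted neg_one_mul_neg_one_real ha hR := by
  have hcut : CarriedBy a c (cut a c (expTest f)) :=
    carriedBy_cut ha (continuousOn_expTest hf.continuous)
  have hrep : Represents (fun _ => 0) (fun b => Complex.I * cut a c (expTest f) b)
      (rightPair (log a) hf) := by
    filter_upwards [rightPair_apply (u₀ := log a) hf, ae_restrict_mem measurableSet_Ioi]
      with u h1 h2
    rw [h1.1, h1.2, ← two_mul_cut_expTest hfc ha h2 hac]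
    constructor
    · simp
    · linear_combination (2 * (exp (u / 2) : ℂ) * cut a c (expTest f) (exp u)) *
        Complex.I_sq
  have e := uMap_fromPair ha (CarriedBy.zero a c) (hcut.const_mul Complex.I) hrep
  rw [← hU] at e
  rw [← e, U.symm_apply_apply, ← transmuted_smul _ ha hR (hcut.const_mul Complex.I)
    (z := Complex.I * z) (fun b => by rw [h b, mul_assoc])]
  change transmuted one_mul_one_real ha (CarriedBy.zero a c) + transmuted neg_one_mul_neg_one_real ha
    (hcut.const_mul Complex.I) = _
  rw [transmuted_smul one_mul_one_real ha (CarriedBy.zero a c) (CarriedBy.zero a c)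
    (z := 0) (fun b => by rw [mul_zero]), zero_smul, zero_add]

end

section Intertwine

variable {a : ℝ} (ha : 0 < a) {U : K a ≃ₗᵢ[ℂ] PairL2 (log a)} (hU : ∀ f, U f = uMap ha f)
  {η : ℝ → ℝ} (hη : IsRightTest η)
include hη

/-- The data attached to a test function `η`: a point `c` beyond its support, and the function
`R = expTest η` on `(a,c)` together with `(b ∂_b + 1/2 + ε μ) R`. -/
theorem IsRightTest.exists_cut (ha : 0 < a) {ε : ℝ} (hε : ε = 1 ∨ ε = -1) : ∃ c, a < c ∧
    (∀ u, log c ≤ u → η u = 0) ∧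
    (∀ u, log c ≤ u → deriv η u + ε * potential u * η u = 0) ∧
    expTest η c = 0 ∧ (∀ b, 0 < b → ContDiffAt ℝ 1 (expTest η) b) ∧
    ContinuousOn (dirGen ε (expTest η)) (Ioi 0) ∧ dirGen ε (expTest η) c = 0 ∧
    (∀ b, cut a c (dirGen ε (expTest η)) b =
      cut a c (expTest fun u => deriv η u + ε * potential u * η u) b) ∧
    ∀ b, c ≤ b → expTest η b = 0 := by
  obtain ⟨n, hn⟩ := hη.eq_zero
  obtain ⟨n', hn'⟩ := (hη.eventuallyZero_deriv (continuous_potential.const_mul (-ε)) 1).eq_zero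
  set N := max (max n n') (log a + 1) with hN
  have h1 : n ≤ N := (le_max_left _ _).trans (le_max_left _ _)
  have h2 : n' ≤ N := (le_max_right _ _).trans (le_max_left _ _)
  have hac : a < exp N := by
    rw [← Real.log_lt_iff_lt_exp ha]
    linarith [le_max_right (max n n') (log a + 1)]
  have hη' : ∀ u, N ≤ u → deriv η u + ε * potential u * η u = 0 := fun u hu => by
    rw [← hn' u (h2.trans hu)]
    ring
  have hz : ∀ u, N ≤ u → η u = 0 := fun u hu => hn u (h1.trans hu)
  have hd : ∀ b, 0 < b → dirGen ε (expTest η) b =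
      expTest (fun u => deriv η u + ε * potential u * η u) b := fun b hb =>
    dirGen_expTest hε hη.contDiff hb
  have hcont : Continuous fun u => deriv η u + ε * potential u * η u := by
    have c1 := hη.contDiff.continuous_deriv_one
    have c2 := hη.contDiff.continuous
    have c3 := continuous_potential
    fun_prop
  refine ⟨exp N, hac, by rwa [Real.log_exp], by rwa [Real.log_exp],
    expTest_eq_zero hz le_rfl, fun b hb => contDiffAt_expTest hη.contDiff hb,
    (continuousOn_expTest hcont).congr hd, ?_, fun b => ?_, fun b hb => expTest_eq_zero hz hb⟩
  · rw [hd _ (Real.exp_pos N)]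
    exact expTest_eq_zero (η := fun u => deriv η u + ε * potential u * η u) hη' le_rfl
  · by_cases hb : b ∈ Ioo a (exp N)
    · rw [cut, cut, indicator_of_mem hb, indicator_of_mem hb, hd b (ha.trans hb.1)]
    · rw [cut, cut, indicator_of_notMem hb, indicator_of_notMem hb]

include hU

/-- The weak form of `H_0^a (U f) = U g` for `g = H_0 f`, tested against `(η, 0)` with no condition on
`η` at the end point; this encodes that the second component of `U f` vanishes there. -/
theorem inner_leftPair_freeRel {f g : K a} (h : FreeRel (f : HalfLineL2) (g : HalfLineL2)) :
    ⟪leftPair (log a) hη.eventuallyZero, U g⟫ =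
      ⟪rightPair (log a) (hη.eventuallyZero_deriv continuous_potential (-1)), U f⟫ := by
  obtain ⟨c, hac, hc1, hc2, hRc, hR, hh, hhc, hcut, -⟩ := hη.exists_cut ha (ε := 1) (Or.inl rfl)
  have k1 : CarriedBy a c (cut a c (expTest η)) :=
    carriedBy_cut ha (continuousOn_expTest hη.contDiff.continuous)
  have k2 : CarriedBy a c (cut a c (dirGen 1 (expTest η))) := carriedBy_cut ha hh
  have e1 := symm_leftPair ha hU hη.eventuallyZero hc1 hac k1 (z := 1) (fun b => (one_mul _).symm)
  have e2 := symm_rightPair ha hU (hη.eventuallyZero_deriv continuous_potential (-1))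
    (fun u hu => by linear_combination -hc2 u hu) hac k2 (z := -1) (fun b => by
      rw [hcut]
      by_cases hb : b ∈ Ioo a c
      · rw [cut, cut, indicator_of_mem hb, indicator_of_mem hb, expTest, expTest]
        push_cast
        ring
      · rw [cut, cut, indicator_of_notMem hb, indicator_of_notMem hb, mul_zero])
  rw [← U.symm.inner_map_map, ← U.symm.inner_map_map (rightPair _ _), U.symm_apply_apply,
    U.symm_apply_apply, Submodule.coe_inner, Submodule.coe_inner, e1, e2, one_smul, inner_smul_left,
    inner_transmuted_freeRel one_mul_one_real ha hac hR hRc hh hhc k1 k2 neg_one_mul_neg_one_real h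
      f.2]
  simp

/-- The analogue of `inner_leftPair_freeRel` for `(0, η)`. -/
theorem inner_rightPair_freeRel {f g : K a} (h : FreeRel (f : HalfLineL2) (g : HalfLineL2)) :
    ⟪rightPair (log a) hη.eventuallyZero, U g⟫ =
      ⟪leftPair (log a) (hη.eventuallyZero_deriv continuous_potential 1), U f⟫ := by
  obtain ⟨c, hac, hc1, hc2, hRc, hR, hh, hhc, hcut, -⟩ := hη.exists_cut ha (ε := -1) (Or.inr rfl)
  have k1 : CarriedBy a c (cut a c (expTest η)) :=
    carriedBy_cut ha (continuousOn_expTest hη.contDiff.continuous)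
  have k2 : CarriedBy a c (cut a c (dirGen (-1) (expTest η))) := carriedBy_cut ha hh
  have e1 := symm_rightPair ha hU hη.eventuallyZero hc1 hac k1 (z := 1) (fun b => (one_mul _).symm)
  have e2 := symm_leftPair ha hU (hη.eventuallyZero_deriv continuous_potential 1)
    (fun u hu => by linear_combination hc2 u hu) hac k2 (z := 1) (fun b => by
      rw [hcut]
      by_cases hb : b ∈ Ioo a c
      · rw [cut, cut, indicator_of_mem hb, indicator_of_mem hb, expTest, expTest]
        push_cast
        ring
      · rw [cut, cut, indicator_of_notMem hb, indicator_of_notMem hb, mul_zero])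
  have key : ∀ {ε' : ℝ} (hε' : ε' * ε' = 1) (_ : - -1 = ε'), ⟪transmuted neg_one_mul_neg_one_real ha k1,
      (g : HalfLineL2)⟫ = Complex.I * ⟪transmuted hε' ha k2, (f : HalfLineL2)⟫ := by
    rintro ε' hε' rfl
    exact inner_transmuted_freeRel neg_one_mul_neg_one_real ha hac hR hRc hh hhc k1 k2 hε' h f.2
  rw [← U.symm.inner_map_map, ← U.symm.inner_map_map (leftPair _ _), U.symm_apply_apply,
    U.symm_apply_apply, Submodule.coe_inner, Submodule.coe_inner, e1, e2, one_smul, inner_smul_left,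
    key one_mul_one_real (neg_neg 1)]
  simp only [mul_one, Complex.conj_I]
  linear_combination -⟪transmuted one_mul_one_real ha k2, (f : HalfLineL2)⟫ * Complex.I_sq

end Intertwine

/-! ### The restriction of `H_0` to `K_a` -/

section Deficiency

variable {a : ℝ} (ha : 0 < a) {U : K a ≃ₗᵢ[ℂ] PairL2 (log a)} (hU : ∀ f, U f = uMap ha f)
include hU

omit ha hU in
theorem IsTest.expTest_eq_zero {η : ℝ → ℝ} (h : IsTest (log a) η) (ε b : ℝ) (hb : 0 < b)
    (hba : b ≤ a) : expTest η b = 0 ∧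
      expTest (fun u => _root_.deriv η u + ε * potential u * η u) b = 0 := by
  have hl : log b ≤ log a := Real.log_le_log hb hba
  rw [expTest, expTest, h.eq_zero_of_le hl, h.deriv.eq_zero_of_le hl]
  simp

/-- The inverse of `U` carries the Dirac operator on test pairs `(η, 0)` to `H_0`. -/
theorem freeRel_symm_leftPair {η : ℝ → ℝ} (h : IsTest (log a) η) :
    FreeRel (U.symm (leftPair (log a) h.isRightTest.eventuallyZero))
      (U.symm (rightPair (log a)
        (h.isRightTest.eventuallyZero_deriv continuous_potential (-1)))) := by
  have hη := h.isRightTest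
  obtain ⟨c, hac, hc1, hc2, hRc, hR, hh, hhc, hcut, hRc'⟩ := hη.exists_cut ha (ε := 1) (Or.inl rfl)
  have k1 : CarriedBy a c (cut a c (expTest η)) :=
    carriedBy_cut ha (continuousOn_expTest hη.contDiff.continuous)
  have k2 : CarriedBy a c (cut a c (dirGen 1 (expTest η))) := carriedBy_cut ha hh
  have e1 := symm_leftPair ha hU hη.eventuallyZero hc1 hac k1 (z := 1) (fun b => (one_mul _).symm)
  have e2 := symm_rightPair ha hU (hη.eventuallyZero_deriv continuous_potential (-1))
    (fun u hu => by linear_combination -hc2 u hu) hac k2 (z := -1) (fun b => by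
      rw [hcut]
      by_cases hb : b ∈ Ioo a c
      · rw [cut, cut, indicator_of_mem hb, indicator_of_mem hb, expTest, expTest]
        push_cast
        ring
      · rw [cut, cut, indicator_of_notMem hb, indicator_of_notMem hb, mul_zero])
  rw [e1, e2, one_smul, mul_neg, mul_one]
  exact freeRel_transmuted one_mul_one_real ha hac hR hRc hh
    (fun b hb hba => (h.expTest_eq_zero 1 b hb hba).1) hRc' (fun b hb hba => by
      rw [dirGen_expTest (Or.inl rfl) hη.contDiff hb]
      exact (h.expTest_eq_zero 1 b hb hba).2) hhc k1 k2 neg_one_mul_neg_one_real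

theorem freeRel_symm_rightPair {η : ℝ → ℝ} (h : IsTest (log a) η) :
    FreeRel (U.symm (rightPair (log a) h.isRightTest.eventuallyZero))
      (U.symm (leftPair (log a)
        (h.isRightTest.eventuallyZero_deriv continuous_potential 1))) := by
  have hη := h.isRightTest
  obtain ⟨c, hac, hc1, hc2, hRc, hR, hh, hhc, hcut, hRc'⟩ :=
    hη.exists_cut ha (ε := -1) (Or.inr rfl)
  have k1 : CarriedBy a c (cut a c (expTest η)) :=
    carriedBy_cut ha (continuousOn_expTest hη.contDiff.continuous)
  have k2 : CarriedBy a c (cut a c (dirGen (-1) (expTest η))) := carriedBy_cut ha hh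
  have e1 := symm_rightPair ha hU hη.eventuallyZero hc1 hac k1 (z := 1) (fun b => (one_mul _).symm)
  have e2 := symm_leftPair ha hU (hη.eventuallyZero_deriv continuous_potential 1)
    (fun u hu => by linear_combination hc2 u hu) hac k2 (z := 1) (fun b => by
      rw [hcut]
      by_cases hb : b ∈ Ioo a c
      · rw [cut, cut, indicator_of_mem hb, indicator_of_mem hb, expTest, expTest]
        push_cast
        ring
      · rw [cut, cut, indicator_of_notMem hb, indicator_of_notMem hb, mul_zero])
  have key : ∀ {ε' : ℝ} (hε' : ε' * ε' = 1) (_ : - -1 = ε'), FreeRel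
      (transmuted neg_one_mul_neg_one_real ha k1) (-Complex.I • transmuted hε' ha k2) := by
    rintro ε' hε' rfl
    exact freeRel_transmuted neg_one_mul_neg_one_real ha hac hR hRc hh
      (fun b hb hba => (h.expTest_eq_zero 1 b hb hba).1) hRc' (fun b hb hba => by
        rw [dirGen_expTest (Or.inr rfl) hη.contDiff hb]
        exact (h.expTest_eq_zero (-1) b hb hba).2) hhc k1 k2 hε'
  have := (key one_mul_one_real (neg_neg 1)).smul Complex.I
  rw [smul_smul, mul_neg, Complex.I_mul_I, neg_neg] at this
  rwa [e1, e2, mul_one]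

omit ha hU in
theorem mem_restrictTo_graph {f g : K a} :
    (f, g) ∈ (restrictTo freeOp (K a)).graph ↔ FreeRel (f : HalfLineL2) (g : HalfLineL2) := by
  rw [restrictTo_graph, Submodule.mem_comap, freeOp_graph]
  rfl

/-- The unitary map carries the restriction of `H_0` into the Dirac operator; moreover both
components vanish at the end point. -/
theorem FreeRel.diracAC {f g : K a} (h : FreeRel (f : HalfLineL2) (g : HalfLineL2)) :
    ∃ α β : ℝ → ℂ, DiracAC potential (log a) α β (U f) (U g) ∧ α (log a) = 0 ∧
      β (log a) = 0 := by
  obtain ⟨α, β, hαβ⟩ := DiracAC.of_weak (z := U f) (y := U g) continuous_potential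
    (fun η hη => (inner_leftPair_freeRel ha hU hη.isRightTest h).symm)
    (fun η hη => (inner_rightPair_freeRel ha hU hη.isRightTest h).symm)
  obtain ⟨χ, hχ, hχ1⟩ := exists_isRightTest_eq_one (log a)
  have e1 := (diracAC_rightPair continuous_potential hχ).green hαβ
  have e2 := (diracAC_leftPair continuous_potential hχ).green hαβ
  rw [inner_rightPair_freeRel ha hU hχ h, sub_self] at e1
  rw [inner_leftPair_freeRel ha hU hχ h, sub_self] at e2
  simp only [hχ1, map_zero, mul_zero, sub_zero, zero_sub, Complex.ofReal_one, map_one, mul_one]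
    at e1 e2
  exact ⟨α, β, hαβ, by linear_combination 2 * e1, by linear_combination -2 * e2⟩

theorem FreeRel.mem_boundOp_graph {f g : K a} (h : FreeRel (f : HalfLineL2) (g : HalfLineL2)) :
    (U f, U g) ∈ (boundOp a).graph := by
  obtain ⟨α, β, h1, h2, -⟩ := h.diracAC ha hU
  exact mem_diracOp_iff.2 ⟨α, β, h1, h2⟩

theorem dense_restrictTo_domain :
    Dense ((restrictTo freeOp (K a)).domain : Set (K a)) := by
  rw [Submodule.dense_iff_topologicalClosure_eq_top, Submodule.topologicalClosure_eq_top_iff,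
    Submodule.eq_bot_iff]
  intro z hz
  rw [Submodule.mem_orthogonal] at hz
  rw [← U.map_eq_zero_iff]
  refine pair_eq_zero_of_inner_test (fun η hη => ?_) (fun η hη => ?_)
  · rw [← U.symm.inner_map_map, U.symm_apply_apply]
    exact hz _ (LinearPMap.mem_domain_of_mem_graph
      (mem_restrictTo_graph.2 (freeRel_symm_leftPair ha hU hη)))
  · rw [← U.symm.inner_map_map, U.symm_apply_apply]
    exact hz _ (LinearPMap.mem_domain_of_mem_graph
      (mem_restrictTo_graph.2 (freeRel_symm_rightPair ha hU hη)))

omit ha hU in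
theorem restrictTo_isFormalAdjoint :
    (restrictTo freeOp (K a)).IsFormalAdjoint (restrictTo freeOp (K a)) := by
  intro x y
  exact (mem_restrictTo_graph.1 ((restrictTo freeOp (K a)).mem_graph y)).inner_eq
    (mem_restrictTo_graph.1 ((restrictTo freeOp (K a)).mem_graph x)) |>.symm

omit ha hU in
theorem mem_orthogonal_range_iff {σ : ℂ} {z : K a} :
    z ∈ (LinearMap.range ((restrictTo freeOp (K a)).toFun +
      σ • (restrictTo freeOp (K a)).domain.subtype))ᗮ ↔
    ∀ f g : K a, FreeRel (f : HalfLineL2) (g : HalfLineL2) → ⟪g + σ • f, z⟫ = 0 := by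
  rw [Submodule.mem_orthogonal]
  constructor
  · intro h f g hfg
    obtain ⟨x, hx1, hx2⟩ := (LinearPMap.mem_graph_iff _).1 (mem_restrictTo_graph.2 hfg)
    refine h _ ⟨x, ?_⟩
    simp only at hx1 hx2
    rw [← hx1, ← hx2]
    rfl
  · rintro h _ ⟨x, rfl⟩
    exact h _ _ (mem_restrictTo_graph.1 ((restrictTo freeOp (K a)).mem_graph x))

/-- Deficiency vectors are the square integrable solutions of the Dirac system without boundary
condition. -/
theorem exists_diracAC_of_deficiency {σ : ℂ} (hσ : conj σ = -σ) {z : K a}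
    (hz : ∀ f g : K a, FreeRel (f : HalfLineL2) (g : HalfLineL2) → ⟪g + σ • f, z⟫ = 0) :
    ∃ α β : ℝ → ℂ, DiracAC potential (log a) α β (U z) (σ • U z) := by
  have key : ∀ {d e : PairL2 (log a)}, FreeRel (U.symm d : HalfLineL2) (U.symm e : HalfLineL2) →
      ⟪e, U z⟫ = ⟪d, σ • U z⟫ := by
    intro d e h
    have h1 := hz _ _ h
    rw [inner_add_left, inner_smul_left (U.symm d) z σ, hσ] at h1
    rw [← U.symm.inner_map_map e, U.symm_apply_apply, inner_smul_right, ← U.symm.inner_map_map d,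
      U.symm_apply_apply]
    linear_combination h1
  exact DiracAC.of_weak continuous_potential
    (fun η hη => key (freeRel_symm_leftPair ha hU hη))
    (fun η hη => key (freeRel_symm_rightPair ha hU hη))

omit ha hU in
theorem DiracAC.add {m : ℝ → ℝ} {u₀ : ℝ} {α β α' β' : ℝ → ℂ} {T S T' S' : PairL2 u₀}
    (h : DiracAC m u₀ α β T S) (h' : DiracAC m u₀ α' β' T' S') :
    DiracAC m u₀ (fun u => α u + α' u) (fun u => β u + β' u) (T + T') (S + S') := by
  refine ⟨h.left.add h'.left, h.right.add h'.right, ?_⟩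
  filter_upwards [h.eq, h'.eq, pair_add_apply T T', pair_add_apply S S',
      h.left.of_Ici.ae_differentiableAt, h.right.of_Ici.ae_differentiableAt,
      h'.left.of_Ici.ae_differentiableAt, h'.right.of_Ici.ae_differentiableAt]
      with u ⟨a1, a2, a3, a4⟩ ⟨b1, b2, b3, b4⟩ c1 c2 d1 d2 d3 d4
  simp only [c1, c2, a1, a2, a3, a4, b1, b2, b3, b4, deriv_fun_add d1 d3, deriv_fun_add d2 d4,
    true_and]
  constructor <;> ring

omit ha hU in
theorem DiracAC.smul {m : ℝ → ℝ} {u₀ : ℝ} {α β : ℝ → ℂ} {T S : PairL2 u₀}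
    (h : DiracAC m u₀ α β T S) (c : ℂ) :
    DiracAC m u₀ (fun u => c * α u) (fun u => c * β u) (c • T) (c • S) := by
  refine ⟨h.left.const_mul c, h.right.const_mul c, ?_⟩
  filter_upwards [h.eq, pair_smul_apply c T, pair_smul_apply c S,
      h.left.of_Ici.ae_differentiableAt, h.right.of_Ici.ae_differentiableAt]
      with u ⟨a1, a2, a3, a4⟩ c1 c2 d1 d2
  simp only [c1, c2, a1, a2, a3, a4, deriv_const_mul c d1, deriv_const_mul c d2, true_and]
  constructor <;> ring

omit ha hU in
/-- The self-adjoint Dirac operator has no imaginary eigenvalues. -/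
theorem DiracAC.eq_zero_of_eigen {σ : ℂ} (hσ : conj σ = -σ) (hσ0 : σ ≠ 0) {m : ℝ → ℝ}
    {u₀ : ℝ} {α β : ℝ → ℂ} {T : PairL2 u₀} (h : DiracAC m u₀ α β T (σ • T)) (h0 : α u₀ = 0) :
    T = 0 := by
  have e := h.green h
  rw [h0, inner_smul_left, inner_smul_right, hσ] at e
  simp only [zero_mul, map_zero, mul_zero, sub_zero] at e
  have e' : (-2 * σ) * ⟪T, T⟫ = 0 := by linear_combination e
  rcases mul_eq_zero.1 e' with h1 | h1
  · simp [hσ0] at h1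
  · exact inner_self_eq_zero.1 h1

/-- The range of `S + σ` is not dense: otherwise `(0,χ)` would be a graph limit of pairs whose
second component vanishes at the end point, contradicting Green's formula. -/
theorem orthogonal_range_ne_bot {σ : ℂ} (hσ : conj σ = -σ) (hσ1 : ‖σ‖ = 1) :
    (LinearMap.range ((restrictTo freeOp (K a)).toFun +
      σ • (restrictTo freeOp (K a)).domain.subtype))ᗮ ≠ ⊥ := by
  intro hbot
  rw [← Submodule.topologicalClosure_eq_top_iff, ← Submodule.dense_iff_topologicalClosure_eq_top]
    at hbot
  obtain ⟨χ, hχ, hχ1⟩ := exists_isRightTest_eq_one (log a)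
  have hm := continuous_potential
  set d := rightPair (log a) hχ.eventuallyZero with hd
  set e := leftPair (log a) (hχ.eventuallyZero_deriv hm 1) with he
  set T := leftPair (log a) hχ.eventuallyZero with hT
  set S := rightPair (log a) (hχ.eventuallyZero_deriv hm (-1)) with hS
  have hde : (d, e) ∈ (boundOp a).graph := rightPair_mem_graph hm hχ
  have g1 : ⟪S, d⟫ - ⟪T, e⟫ = 1 / 2 := by
    have := (diracAC_leftPair (u₀ := log a) hm hχ).green
      (diracAC_rightPair (u₀ := log a) hm hχ)
    rw [this, hχ1]
    simp
  -- small enough for `g3` to contradict Cauchy-Schwarz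
  set δ : ℝ := 1 / (4 * (‖S‖ + ‖T‖ + 1)) with hδ
  have hpos : 0 < ‖S‖ + ‖T‖ + 1 := by positivity
  have hδ0 : 0 < δ := by positivity
  obtain ⟨_, hy, ⟨x, rfl⟩⟩ := Metric.dense_iff.1 hbot (U.symm (e + σ • d)) δ hδ0
  set f : K a := (x : K a) with hf
  set g : K a := restrictTo freeOp (K a) x with hg
  have hfg : FreeRel (f : HalfLineL2) (g : HalfLineL2) :=
    mem_restrictTo_graph.1 ((restrictTo freeOp (K a)).mem_graph x)
  have hy' : ‖(U g - e) + σ • (U f - d)‖ < δ := by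
    have h1 : dist (g + σ • f) (U.symm (e + σ • d)) < δ := hy
    rw [← U.dist_map, U.apply_symm_apply, dist_eq_norm, map_add, map_smul] at h1
    have h2 : (U g - e) + σ • (U f - d) = U g + σ • U f - (e + σ • d) := by module
    rwa [h2]
  have hgr : (U f - d, U g - e) ∈ (boundOp a).graph :=
    (boundOp a).graph.sub_mem (hfg.mem_boundOp_graph ha hU) hde
  set X := U f - d with hX
  set Y := U g - e with hY
  have hsym : ⟪Y, X⟫ = ⟪X, Y⟫ := by
    obtain ⟨α, β, h, h0⟩ := mem_diracOp_iff.1 hgr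
    have := h.green h
    rw [h0, map_zero, zero_mul, mul_zero, sub_zero, mul_zero] at this
    exact sub_eq_zero.1 this
  -- as `S` is symmetric and `σ` imaginary, `Y + σ X` bounds `X` and `Y` separately
  have hnorm : ‖Y + σ • X‖ ^ 2 = ‖Y‖ ^ 2 + ‖X‖ ^ 2 := by
    rw [@norm_add_sq ℂ, norm_smul, hσ1, one_mul, inner_smul_right]
    have h1 : conj (σ * ⟪Y, X⟫) = -(σ * ⟪Y, X⟫) := by
      rw [map_mul, hσ, inner_conj_symm, ← hsym, neg_mul]
    have h2 : (σ * ⟪Y, X⟫).re = 0 := by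
      have := congrArg Complex.re h1
      rw [Complex.conj_re, Complex.neg_re] at this
      linarith
    change ‖Y‖ ^ 2 + 2 * (σ * ⟪Y, X⟫).re + ‖X‖ ^ 2 = _
    rw [h2]
    ring
  have hXle : ‖X‖ < δ := by
    refine lt_of_le_of_lt ?_ hy'
    refine le_of_sq_le_sq ?_ (norm_nonneg _)
    rw [hnorm]
    nlinarith [norm_nonneg Y]
  have hYle : ‖Y‖ < δ := by
    refine lt_of_le_of_lt ?_ hy'
    refine le_of_sq_le_sq ?_ (norm_nonneg _)
    rw [hnorm]
    nlinarith [norm_nonneg X]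
  obtain ⟨α, β, h, h1, h2⟩ := hfg.diracAC ha hU
  have g2 := (diracAC_leftPair (u₀ := log a) hm hχ).green h
  rw [h1, h2] at g2
  simp only [zero_mul, sub_zero, mul_zero] at g2
  have g3 : ⟪T, Y⟫ - ⟪S, X⟫ = 1 / 2 := by
    rw [hX, hY, inner_sub_right, inner_sub_right]
    linear_combination g1 - g2
  have g4 : (1 / 2 : ℝ) ≤ ‖T‖ * ‖Y‖ + ‖S‖ * ‖X‖ := by
    have : ‖(1 / 2 : ℂ)‖ ≤ ‖T‖ * ‖Y‖ + ‖S‖ * ‖X‖ := by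
      rw [← g3]
      exact (norm_sub_le _ _).trans (add_le_add (norm_inner_le_norm _ _) (norm_inner_le_norm _ _))
    simpa using this
  have g5 : (‖S‖ + ‖T‖ + 1) * δ = 1 / 4 := by
    rw [hδ]
    field_simp
  nlinarith [norm_nonneg T, norm_nonneg S, mul_le_mul_of_nonneg_left hYle.le (norm_nonneg T),
    mul_le_mul_of_nonneg_left hXle.le (norm_nonneg S)]

/-- Two elements of a deficiency space with the same value `α(log a)` differ by an eigenvector of the
self-adjoint operator, so they are equal. -/
theorem rank_deficiency {σ : ℂ} (hσ : conj σ = -σ) (hσ1 : ‖σ‖ = 1) :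
    Module.rank ℂ (LinearMap.range ((restrictTo freeOp (K a)).toFun +
      σ • (restrictTo freeOp (K a)).domain.subtype))ᗮ = 1 := by
  have hσ0 : σ ≠ 0 := fun h => by simp [h] at hσ1
  obtain ⟨z, hz, hz0⟩ := Submodule.exists_mem_ne_zero_of_ne_bot
    (orthogonal_range_ne_bot ha hU hσ hσ1)
  have hex : ∀ {w : K a}, w ∈ (LinearMap.range ((restrictTo freeOp (K a)).toFun +
      σ • (restrictTo freeOp (K a)).domain.subtype))ᗮ →
      ∃ α β : ℝ → ℂ, DiracAC potential (log a) α β (U w) (σ • U w) := fun hw =>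
    exists_diracAC_of_deficiency ha hU hσ (mem_orthogonal_range_iff.1 hw)
  obtain ⟨α, β, h⟩ := hex hz
  have hα : α (log a) ≠ 0 := fun h0 => hz0 (by
    have := h.eq_zero_of_eigen hσ hσ0 h0
    rwa [U.map_eq_zero_iff] at this)
  refine rank_eq_one ⟨z, hz⟩ (fun h0 => hz0 (congrArg Subtype.val h0)) fun ⟨w, hw⟩ => ?_
  obtain ⟨α', β', h'⟩ := hex hw
  refine ⟨α' (log a) / α (log a), Subtype.ext ?_⟩
  have h1 := (h.smul (α' (log a) / α (log a))).add (h'.smul (-1))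
  rw [smul_comm _ σ (U z), smul_comm _ σ (U w), ← smul_add] at h1
  have h2 := h1.eq_zero_of_eigen hσ hσ0 (by field_simp; ring)
  rw [neg_one_smul, ← sub_eq_add_neg, sub_eq_zero, ← map_smul] at h2
  exact U.injective h2

theorem hasDeficiencyIndices_restrictTo :
    HasDeficiencyIndices (restrictTo freeOp (K a)) 1 1 where
  dense := dense_restrictTo_domain ha hU
  symmetric := restrictTo_isFormalAdjoint
  rank_plus := by
    rw [Nat.cast_one]
    exact rank_deficiency ha hU (by simp) (by simp)
  rank_minus := by
    rw [Nat.cast_one, sub_eq_add_neg, ← neg_smul]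
    exact rank_deficiency ha hU (by simp) (by simp)

theorem boundOp_uMap (f : (restrictTo freeOp (K a)).domain) :
    ∃ h : U f ∈ (boundOp a).domain, boundOp a ⟨U f, h⟩ = U (restrictTo freeOp (K a) f) := by
  have h1 := (mem_restrictTo_graph.1 ((restrictTo freeOp (K a)).mem_graph f)).mem_boundOp_graph ha hU
  obtain ⟨x, hx1, hx2⟩ := (LinearPMap.mem_graph_iff _).1 h1
  simp only at hx1 hx2
  have hx : U f ∈ (boundOp a).domain := hx1 ▸ x.2
  refine ⟨hx, ?_⟩
  rw [← hx2]
  congr 1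
  exact Subtype.ext hx1.symm

end Deficiency

section

/-! ### Gaussians and the functional equation of the completed Mellin transform -/

/-- The self-dual Gaussian `e^{-π x²}`. -/
def gauss (x : ℝ) : ℂ := Complex.exp (-π * x ^ 2)

theorem continuous_gauss : Continuous gauss := by
  unfold gauss
  fun_prop

theorem norm_gauss (x : ℝ) : ‖gauss x‖ = exp (-(π * x ^ 2)) := by
  rw [gauss, show -(π : ℂ) * x ^ 2 = ((-(π * x ^ 2) : ℝ) : ℂ) by push_cast; ring,
    Complex.norm_exp_ofReal]

/-- The Mellin transform of the Gaussian is `π^{-s/2} Γ(s/2) / 2`. -/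
theorem hasMellin_gauss {s : ℂ} (hs : 0 < s.re) : HasMellin gauss s (s.Gammaℝ / 2) := by
  set F : ℝ → ℂ := fun t => (exp (-t) : ℂ) with hF
  have hs2 : 0 < (s / 2).re := by
    rw [Complex.div_ofNat_re]
    positivity
  have hcongr : ∀ t ∈ Ioi (0 : ℝ), (t : ℂ) ^ (s - 1) • gauss t =
      (t : ℂ) ^ (s - 1) • (fun t : ℝ => F (π * t ^ (2 : ℝ))) t := fun t _ => by
    simp only [gauss, hF, Real.rpow_two]
    push_cast
    ring_nf
  have hconv : MellinConvergent F (s / 2) := by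
    refine (Complex.GammaIntegral_convergent hs2).congr (Eventually.of_forall fun t => ?_)
    simp only [hF, smul_eq_mul]
    ring
  have hconv' : MellinConvergent (fun t : ℝ => F (π * t)) (s / (2 : ℝ)) := by
    rw [MellinConvergent.comp_mul_left Real.pi_pos]
    simpa using hconv
  refine ⟨?_, ?_⟩
  · have := (MellinConvergent.comp_rpow (f := fun t : ℝ => F (π * t)) (s := s)
      (two_ne_zero (α := ℝ))).2 hconv'
    exact (integrableOn_congr_fun hcongr measurableSet_Ioi).2 this
  · rw [mellin, setIntegral_congr_fun measurableSet_Ioi hcongr]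
    have h1 := mellin_comp_rpow (fun t : ℝ => F (π * t)) s 2
    rw [mellin] at h1
    rw [h1, mellin_comp_mul_left _ _ Real.pi_pos]
    have h2 : mellin F (s / 2) = Complex.Gamma (s / 2) := by
      rw [Complex.Gamma_eq_integral hs2, Complex.GammaIntegral_eq_mellin]
    have h3 : s / ((2 : ℝ) : ℂ) = s / 2 := by norm_num
    rw [h3, h2, Complex.Gammaℝ_def, abs_of_pos (two_pos (α := ℝ)), Complex.real_smul, smul_eq_mul]
    push_cast
    ring_nf

theorem integrable_gauss_comp {t : ℝ} (ht : 0 < t) : Integrable fun x => gauss (t * x) := by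
  have := integrable_cexp_neg_mul_sq (b := (π * t ^ 2 : ℝ)) (by
    rw [Complex.ofReal_re]
    positivity)
  refine this.congr (Eventually.of_forall fun x => ?_)
  simp only [gauss]
  push_cast
  ring_nf

/-- The Gaussian is self-dual for the cosine transform. -/
theorem cosInt_gauss {t : ℝ} (ht : 0 < t) (y : ℝ) :
    cosInt (fun x => gauss (t * x)) y = (t : ℂ)⁻¹ * gauss (t⁻¹ * y) := by
  rw [← fourier_evenExt (integrable_gauss_comp ht).integrableOn]
  have h0 : (fun x => (Ioi (0 : ℝ)).indicator (fun x => gauss (t * x)) x +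
      (Ioi (0 : ℝ)).indicator (fun x => gauss (t * x)) (-x)) =ᵐ[volume]
      fun x : ℝ => Complex.exp (-π * ((t : ℂ) ^ 2) * x ^ 2) := by
    have : ∀ᵐ x : ℝ, x ≠ 0 := by simp [ae_iff]
    filter_upwards [this] with x hx
    have e : gauss (t * x) = Complex.exp (-π * ((t : ℂ) ^ 2) * x ^ 2) := by
      rw [gauss]
      push_cast
      ring_nf
    rcases hx.lt_or_gt with h | h
    · rw [indicator_of_notMem (show x ∉ Ioi 0 from not_lt.2 h.le),
        indicator_of_mem (show -x ∈ Ioi 0 from neg_pos.2 h), zero_add, ← e, gauss, gauss]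
      push_cast
      ring_nf
    · rw [indicator_of_notMem (show -x ∉ Ioi 0 from not_lt.2 (neg_neg_of_pos h).le),
        indicator_of_mem (show x ∈ Ioi 0 from h), add_zero, e]
  have h1 : 𝓕 (fun x => (Ioi (0 : ℝ)).indicator (fun x => gauss (t * x)) x +
      (Ioi (0 : ℝ)).indicator (fun x => gauss (t * x)) (-x)) y =
      𝓕 (fun x : ℝ => Complex.exp (-π * ((t : ℂ) ^ 2) * x ^ 2)) y := by
    rw [Real.fourier_real_eq_integral_exp_smul, Real.fourier_real_eq_integral_exp_smul]
    refine integral_congr_ae ?_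
    filter_upwards [h0] with x hx
    rw [hx]
  have hb : 0 < ((t : ℂ) ^ 2).re := by
    rw [← Complex.ofReal_pow, Complex.ofReal_re]
    positivity
  have ht' : (t : ℂ) ≠ 0 := by exact_mod_cast ht.ne'
  have h2 : ((t : ℂ) ^ 2) ^ (1 / 2 : ℂ) = t := by
    have := Complex.ofReal_cpow (x := t ^ 2) (by positivity) (1 / 2)
    rw [← Real.sqrt_eq_rpow, Real.sqrt_sq ht.le] at this
    push_cast at this
    exact this.symm
  rw [h1, fourier_gaussian_pi hb]
  simp only [h2, gauss]
  push_cast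
  rw [one_div]
  congr 2
  field_simp

/-- The weighted Mellin transform `∫_0^∞ κ(t) t^{s-1} e^{-π t² x²} dt`. -/
def thetaMellin (κ : ℝ → ℂ) (s : ℂ) (x : ℝ) : ℂ :=
  mellin (fun t => κ t * gauss (t * x)) s

theorem thetaMellin_one {s : ℂ} (hs : 0 < s.re) {x : ℝ} (hx : 0 < x) :
    thetaMellin (fun _ => 1) s x = s.Gammaℝ / 2 * (x : ℂ) ^ (-s) := by
  rw [thetaMellin]
  simp only [one_mul]
  rw [mellin_comp_mul_right _ _ hx, (hasMellin_gauss hs).2, smul_eq_mul, mul_comm]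

variable {κ : ℝ → ℂ} {s : ℂ} {h : ℝ → ℂ}

theorem integrableOn_rpow_mul_gauss {x : ℝ} (hx : 0 < x) :
    IntegrableOn (fun t : ℝ => t ^ (-(1 / 2) : ℝ) * ‖gauss (t * x)‖) (Ioi 0) ∧
    ∫ t in Ioi 0, t ^ (-(1 / 2) : ℝ) * ‖gauss (t * x)‖ =
      x ^ (-(1 / 2) : ℝ) * ∫ t in Ioi (0 : ℝ), t ^ (-(1 / 2) : ℝ) * ‖gauss t‖ := by
  have h0 : IntegrableOn (fun t : ℝ => t ^ (-(1 / 2) : ℝ) * ‖gauss t‖) (Ioi 0) := by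
    have := (hasMellin_gauss (s := 1 / 2) (by norm_num)).1.norm
    refine this.congr ((ae_restrict_iff' measurableSet_Ioi).2 (Eventually.of_forall fun t ht => ?_))
    simp only [norm_smul]
    rw [Complex.norm_cpow_eq_rpow_re_of_pos ht]
    norm_num
  have e : ∀ t ∈ Ioi (0 : ℝ), t ^ (-(1 / 2) : ℝ) * ‖gauss (t * x)‖ =
      x ^ (1 / 2 : ℝ) * ((t * x) ^ (-(1 / 2) : ℝ) * ‖gauss (t * x)‖) := fun t ht => by
    rw [Real.mul_rpow (le_of_lt ht) hx.le, Real.rpow_neg hx.le]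
    have : x ^ (1 / 2 : ℝ) ≠ 0 := (Real.rpow_pos_of_pos hx _).ne'
    field_simp
  refine ⟨?_, ?_⟩
  · rw [integrableOn_congr_fun e measurableSet_Ioi]
    have := (integrableOn_Ioi_comp_mul_right_iff
      (fun t : ℝ => t ^ (-(1 / 2) : ℝ) * ‖gauss t‖) 0 hx).2 (by simpa using h0)
    exact Integrable.const_mul this _
  · rw [setIntegral_congr_fun measurableSet_Ioi e, integral_const_mul,
      integral_comp_mul_right_Ioi (fun t : ℝ => t ^ (-(1 / 2) : ℝ) * ‖gauss t‖) 0 hx, zero_mul,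
      smul_eq_mul, ← mul_assoc]
    congr 1
    rw [← Real.rpow_neg_one, ← Real.rpow_add hx]
    norm_num

theorem norm_cpow_critical (hs : s.re = 1 / 2) {t : ℝ} (ht : 0 < t) :
    ‖(t : ℂ) ^ (s - 1)‖ = t ^ (-(1 / 2) : ℝ) := by
  rw [Complex.norm_cpow_eq_rpow_re_of_pos ht, Complex.sub_re, hs]
  norm_num

theorem measurable_cpow_ofReal (z : ℂ) : Measurable fun t : ℝ => (t : ℂ) ^ z :=
  (Complex.measurable_ofReal).pow_const z

/-- The double integral of `κ(t) t^{s-1} e^{-π t² x²} h(x)` converges absolutely. -/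
theorem integrable_prod_gauss (hκ : Measurable κ) (hκ1 : ∀ t, ‖κ t‖ ≤ 1) (hs : s.re = 1 / 2)
    (hm : AEStronglyMeasurable h ν₀)
    (hh : IntegrableOn (fun x : ℝ => x ^ (-(1 / 2) : ℝ) * ‖h x‖) (Ioi 0)) :
    Integrable (fun p : ℝ × ℝ => h p.1 * ((p.2 : ℂ) ^ (s - 1) * (κ p.2 * gauss (p.2 * p.1))))
      ((ν₀).prod ν₀) := by
  set C := ∫ t in Ioi (0 : ℝ), t ^ (-(1 / 2) : ℝ) * ‖gauss t‖ with hC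
  have hmeas : AEStronglyMeasurable (fun p : ℝ × ℝ => h p.1 *
      ((p.2 : ℂ) ^ (s - 1) * (κ p.2 * gauss (p.2 * p.1)))) ((ν₀).prod ν₀) := by
    refine AEStronglyMeasurable.mul hm.comp_fst (AEStronglyMeasurable.mul ?_ ?_)
    · exact ((measurable_cpow_ofReal (s - 1)).comp measurable_snd).aestronglyMeasurable
    · refine AEStronglyMeasurable.mul (hκ.comp measurable_snd).aestronglyMeasurable ?_
      exact (continuous_gauss.comp (by fun_prop : Continuous fun p : ℝ × ℝ => p.2 * p.1)
        ).aestronglyMeasurable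
  have hdom : Integrable (fun p : ℝ × ℝ => ‖h p.1‖ * (p.2 ^ (-(1 / 2) : ℝ) * ‖gauss (p.2 * p.1)‖))
      ((ν₀).prod ν₀) := by
    have hm' : AEStronglyMeasurable (fun p : ℝ × ℝ =>
        ‖h p.1‖ * (p.2 ^ (-(1 / 2) : ℝ) * ‖gauss (p.2 * p.1)‖)) ((ν₀).prod ν₀) := by
      refine AEStronglyMeasurable.mul hm.comp_fst.norm (AEStronglyMeasurable.mul ?_ ?_)
      · exact (measurable_snd.pow_const _).aestronglyMeasurable
      · exact (continuous_gauss.comp (by fun_prop : Continuous fun p : ℝ × ℝ => p.2 * p.1)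
          ).norm.aestronglyMeasurable
    rw [integrable_prod_iff hm']
    refine ⟨?_, ?_⟩
    · filter_upwards [ae_restrict_mem measurableSet_Ioi] with x hx
      exact (integrableOn_rpow_mul_gauss hx).1.const_mul _
    · refine (hh.mul_const C).congr ?_
      filter_upwards [ae_restrict_mem measurableSet_Ioi] with x hx
      have e : ∀ t ∈ Ioi (0 : ℝ), ‖‖h x‖ * (t ^ (-(1 / 2) : ℝ) * ‖gauss (t * x)‖)‖ =
          ‖h x‖ * (t ^ (-(1 / 2) : ℝ) * ‖gauss (t * x)‖) := fun t ht => by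
        rw [Real.norm_of_nonneg]
        have := Real.rpow_nonneg (le_of_lt (mem_Ioi.1 ht)) (-(1 / 2))
        positivity
      rw [setIntegral_congr_fun measurableSet_Ioi e, integral_const_mul,
        (integrableOn_rpow_mul_gauss hx).2]
      ring
  refine hdom.mono' hmeas ?_
  rw [Measure.prod_restrict]
  filter_upwards [ae_restrict_mem (measurableSet_Ioi.prod measurableSet_Ioi)] with p hp
  rw [norm_mul, norm_mul, norm_mul, norm_cpow_critical hs hp.2]
  refine mul_le_mul_of_nonneg_left (mul_le_mul_of_nonneg_left ?_ ?_) (norm_nonneg _)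
  · exact mul_le_of_le_one_left (norm_nonneg _) (hκ1 _)
  · exact Real.rpow_nonneg (le_of_lt hp.2) _

theorem integral_mul_thetaMellin (hκ : Measurable κ) (hκ1 : ∀ t, ‖κ t‖ ≤ 1) (hs : s.re = 1 / 2)
    (hm : AEStronglyMeasurable h ν₀)
    (hh : IntegrableOn (fun x : ℝ => x ^ (-(1 / 2) : ℝ) * ‖h x‖) (Ioi 0)) :
    IntegrableOn (fun x => h x * thetaMellin κ s x) (Ioi 0) ∧
    ∫ x in Ioi 0, h x * thetaMellin κ s x =
      mellin (fun t => κ t * ∫ x in Ioi 0, h x * gauss (t * x)) s := by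
  have hI := integrable_prod_gauss hκ hκ1 hs hm hh
  refine ⟨hI.integral_prod_left.congr (Eventually.of_forall fun x => ?_), ?_⟩
  · simp only [thetaMellin, mellin, smul_eq_mul]
    exact integral_const_mul (h x) _
  · have := integral_integral_swap (f := fun x t : ℝ =>
      h x * ((t : ℂ) ^ (s - 1) * (κ t * gauss (t * x)))) hI
    calc _ = ∫ x in Ioi (0 : ℝ), ∫ t in Ioi (0 : ℝ), h x * ((t : ℂ) ^ (s - 1) * (κ t * gauss (t * x))) := by
          congr 1
          ext x
          exact (integral_const_mul (h x) _).symm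
      _ = _ := this
      _ = _ := by
          rw [mellin]
          congr 1
          ext t
          rw [smul_eq_mul, ← integral_const_mul, ← integral_const_mul]
          congr 1
          ext x
          ring

/-- Parseval's formula for the cosine transform against a Gaussian. -/
theorem integral_cosInt_mul_gauss (hi : IntegrableOn h (Ioi 0)) {t : ℝ} (ht : 0 < t) :
    ∫ y in Ioi 0, cosInt h y * gauss (t * y) = (t : ℂ)⁻¹ * ∫ x in Ioi 0, h x * gauss (t⁻¹ * x) := by
  have hg := (integrable_gauss_comp ht).integrableOn (s := Ioi 0)
  have hI : Integrable (fun p : ℝ × ℝ => (cosKernel p.2 p.1 : ℂ) * (gauss (t * p.1) * h p.2))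
      ((ν₀).prod ν₀) := by
    refine (hg.mul_prod hi).bdd_mul (c := 2) ?_ (Eventually.of_forall fun p => ?_)
    · exact (Complex.continuous_ofReal.comp (continuous_cosKernel.comp continuous_swap)
        ).aestronglyMeasurable
    · rw [Complex.norm_real]
      exact abs_cosKernel_le _ _
  have e1 : ∀ y, cosInt h y * gauss (t * y) =
      ∫ x in Ioi 0, (cosKernel x y : ℂ) * (gauss (t * y) * h x) := fun y => by
    rw [cosInt, ← integral_mul_const]
    congr 1
    ext x
    ring
  have e2 : ∀ x, ∫ y in Ioi 0, (cosKernel x y : ℂ) * (gauss (t * y) * h x) =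
      (t : ℂ)⁻¹ * (h x * gauss (t⁻¹ * x)) := fun x => by
    rw [show (t : ℂ)⁻¹ * (h x * gauss (t⁻¹ * x)) = (t : ℂ)⁻¹ * gauss (t⁻¹ * x) * h x by ring,
      ← cosInt_gauss ht, cosInt, ← integral_mul_const]
    congr 1
    ext y
    rw [cosKernel_comm]
    ring
  simp only [e1]
  have := integral_integral_swap (f := fun y x : ℝ =>
      (cosKernel x y : ℂ) * (gauss (t * y) * h x)) hI
  rw [this]
  simp only [e2]
  exact integral_const_mul _ _

/-- The functional equation: the cosine transform exchanges `s` with `1 - s`, and the weight `κ(t)`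
with `κ(1/t)`. -/
theorem integral_cosInt_mul_thetaMellin {κ' : ℝ → ℂ} (hκ : Measurable κ) (hκ1 : ∀ t, ‖κ t‖ ≤ 1)
    (hκ' : Measurable κ') (hκ1' : ∀ t, ‖κ' t‖ ≤ 1) (hκκ : ∀ t, 0 < t → κ t = κ' t⁻¹)
    (hs : s.re = 1 / 2) (hi : IntegrableOn h (Ioi 0))
    (hh : IntegrableOn (fun x : ℝ => x ^ (-(1 / 2) : ℝ) * ‖h x‖) (Ioi 0))
    (hh' : IntegrableOn (fun x : ℝ => x ^ (-(1 / 2) : ℝ) * ‖cosInt h x‖) (Ioi 0)) :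
    ∫ y in Ioi 0, cosInt h y * thetaMellin κ s y =
      ∫ x in Ioi 0, h x * thetaMellin κ' (1 - s) x := by
  have hs' : (1 - s).re = 1 / 2 := by
    rw [Complex.sub_re, hs]
    norm_num
  rw [(integral_mul_thetaMellin hκ hκ1 hs (continuous_cosInt hi).aestronglyMeasurable hh').2,
    (integral_mul_thetaMellin hκ' hκ1' hs' hi.aestronglyMeasurable hh).2,
    show 1 - s = -(s - 1) by ring, ← mellin_comp_inv, mellin, mellin]
  refine setIntegral_congr_fun measurableSet_Ioi fun t ht => ?_
  have ht0 : (t : ℂ) ≠ 0 := by exact_mod_cast (ne_of_gt (mem_Ioi.1 ht))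
  simp only [smul_eq_mul]
  rw [integral_cosInt_mul_gauss hi ht, hκκ t ht, Complex.cpow_sub (s - 1) 1 ht0, Complex.cpow_one]
  field_simp

end

/-! ### The theta splitting of the completed Mellin transform -/

/-- `∫_1^∞ t^{s-1} e^{-π t² x²} dt`, which decays rapidly in `x` for every `s`. -/
def thetaTail (s : ℂ) (x : ℝ) : ℂ := thetaMellin ((Ioi 1).indicator fun _ => 1) s x

theorem norm_indicator_one_le (S : Set ℝ) (t : ℝ) : ‖S.indicator (fun _ => (1 : ℂ)) t‖ ≤ 1 := by
  refine (norm_indicator_le_norm_self _ _).trans ?_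
  simp

theorem measurable_indicator_one {S : Set ℝ} (hS : MeasurableSet S) :
    Measurable (S.indicator fun _ => (1 : ℂ)) := measurable_const.indicator hS

theorem norm_cpow_neg_critical {s : ℂ} (hs : s.re = 1 / 2) {x : ℝ} (hx : 0 < x) :
    ‖(x : ℂ) ^ (-s)‖ = x ^ (-(1 / 2) : ℝ) := by
  rw [Complex.norm_cpow_eq_rpow_re_of_pos hx, Complex.neg_re, hs]

theorem one_sub_re {s : ℂ} (hs : s.re = 1 / 2) : (1 - s).re = 1 / 2 := by
  rw [Complex.sub_re, hs]
  norm_num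

theorem mellinConvergent_weight_gauss {κ : ℝ → ℂ} (hκ : Measurable κ) (hκ1 : ∀ t, ‖κ t‖ ≤ 1)
    {s : ℂ} (hs : s.re = 1 / 2) {x : ℝ} (hx : 0 < x) :
    MellinConvergent (fun t => κ t * gauss (t * x)) s := by
  refine (integrableOn_rpow_mul_gauss hx).1.mono' ?_ ?_
  · refine AEStronglyMeasurable.mul (measurable_cpow_ofReal _).aestronglyMeasurable
      (hκ.aestronglyMeasurable.mul ?_)
    exact (continuous_gauss.comp (by fun_prop : Continuous fun t : ℝ => t * x)).aestronglyMeasurable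
  · filter_upwards [ae_restrict_mem measurableSet_Ioi] with t ht
    rw [norm_smul, norm_mul, norm_cpow_critical hs ht]
    exact mul_le_mul_of_nonneg_left (mul_le_of_le_one_left (norm_nonneg _) (hκ1 _))
      (Real.rpow_nonneg (le_of_lt ht) _)

/-- Splitting the Mellin integral of the Gaussian at `t = 1`. -/
theorem thetaMellin_Iio_add_thetaTail {s : ℂ} (hs : s.re = 1 / 2) {x : ℝ} (hx : 0 < x) :
    thetaMellin ((Iio 1).indicator fun _ => 1) s x =
      s.Gammaℝ / 2 * (x : ℂ) ^ (-s) - thetaTail s x := by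
  rw [eq_sub_iff_add_eq, ← thetaMellin_one (by rw [hs]; norm_num) hx, thetaTail, thetaMellin,
    thetaMellin, thetaMellin, mellin, mellin, mellin, ← integral_add
    (mellinConvergent_weight_gauss (measurable_indicator_one measurableSet_Iio)
      (norm_indicator_one_le _) hs hx)
    (mellinConvergent_weight_gauss (measurable_indicator_one measurableSet_Ioi)
      (norm_indicator_one_le _) hs hx)]
  have h1 : ∀ᵐ t : ℝ, t ≠ 1 := by simp [ae_iff]
  refine integral_congr_ae ?_
  filter_upwards [ae_restrict_of_ae h1] with t ht
  rcases ht.lt_or_gt with h | h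
  · rw [indicator_of_mem (show t ∈ Iio 1 from h), indicator_of_notMem (show t ∉ Ioi 1 from not_lt.2 h.le)]
    simp
  · rw [indicator_of_notMem (show t ∉ Iio 1 from not_lt.2 h.le), indicator_of_mem (show t ∈ Ioi 1 from h)]
    simp

theorem exists_norm_thetaTail_le {s : ℂ} (hs : s.re = 1 / 2) :
    ∃ C, ∀ x, 0 < x → ‖thetaTail s x‖ ≤ C * x ^ (-2 : ℝ) := by
  have hint : IntegrableOn (fun t : ℝ => t ^ (-(5 / 2) : ℝ)) (Ioi 1) :=
    integrableOn_Ioi_rpow_of_lt (by norm_num) one_pos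
  refine ⟨∫ t in Ioi (1 : ℝ), t ^ (-(5 / 2) : ℝ), fun x hx => ?_⟩
  have e : thetaTail s x = ∫ t in Ioi (1 : ℝ), (t : ℂ) ^ (s - 1) * gauss (t * x) := by
    rw [thetaTail, thetaMellin, mellin, ← integral_indicator measurableSet_Ioi,
      ← integral_indicator measurableSet_Ioi]
    congr 1
    ext t
    by_cases h : t ∈ Ioi (1 : ℝ)
    · rw [indicator_of_mem h, indicator_of_mem (show t ∈ Ioi 0 from one_pos.trans (mem_Ioi.1 h)),
        indicator_of_mem h, one_mul, smul_eq_mul]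
    · rw [indicator_of_notMem h]
      by_cases h' : t ∈ Ioi (0 : ℝ)
      · rw [indicator_of_mem h', indicator_of_notMem h]
        simp
      · rw [indicator_of_notMem h']
  rw [e, ← integral_mul_const]
  refine norm_integral_le_of_norm_le (hint.mul_const _) ?_
  filter_upwards [ae_restrict_mem measurableSet_Ioi] with t ht
  have ht0 : 0 < t := one_pos.trans ht
  rw [norm_mul, norm_cpow_critical hs ht0, norm_gauss]
  -- the elementary bound `e^{-z} ≤ 1 / z`, with `z = π t² x² ≥ t² x²`
  have h1 : exp (-(π * (t * x) ^ 2)) ≤ ((t * x) ^ 2)⁻¹ := by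
    rw [Real.exp_neg]
    have hz : 0 < (t * x) ^ 2 := by positivity
    refine inv_anti₀ hz ?_
    have h2 := Real.add_one_le_exp (π * (t * x) ^ 2)
    nlinarith [Real.pi_gt_three]
  refine (mul_le_mul_of_nonneg_left h1 (Real.rpow_nonneg ht0.le _)).trans (le_of_eq ?_)
  have h3 : ((t * x) ^ 2)⁻¹ = t ^ (-2 : ℝ) * x ^ (-2 : ℝ) := by
    rw [Real.rpow_neg ht0.le, Real.rpow_neg hx.le, Real.rpow_two, Real.rpow_two, mul_pow, mul_inv]
  rw [h3, ← mul_assoc, ← Real.rpow_add ht0]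
  norm_num

theorem aestronglyMeasurable_thetaMellin {κ : ℝ → ℂ} (hκ : Measurable κ) (s : ℂ) :
    AEStronglyMeasurable (thetaMellin κ s) ν₀ := by
  have hmeas : AEStronglyMeasurable (fun p : ℝ × ℝ =>
      (p.2 : ℂ) ^ (s - 1) • (κ p.2 * gauss (p.2 * p.1))) ((ν₀).prod ν₀) := by
    refine AEStronglyMeasurable.mul ?_ (AEStronglyMeasurable.mul
      (hκ.comp measurable_snd).aestronglyMeasurable ?_)
    · exact ((measurable_cpow_ofReal (s - 1)).comp measurable_snd).aestronglyMeasurable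
    · exact (continuous_gauss.comp (by fun_prop : Continuous fun p : ℝ × ℝ => p.2 * p.1)
        ).aestronglyMeasurable
  exact hmeas.integral_prod_right'

/-- The conjugate of `2 ∫_1^∞ t^{s-1} e^{-π t² x²} dt`, cut off to `x > a`. -/
def tailKernel (a : ℝ) (s : ℂ) : ℝ → ℂ :=
  (Ioi a).indicator fun x => conj (2 * thetaTail s x)

theorem memLp_tailKernel {a : ℝ} (ha : 0 < a) {s : ℂ} (hs : s.re = 1 / 2) :
    MemLp (tailKernel a s) 2 ν₀ := by
  obtain ⟨C, hC⟩ := exists_norm_thetaTail_le hs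
  have hm : AEStronglyMeasurable (tailKernel a s) ν₀ := by
    refine AEStronglyMeasurable.indicator ?_ measurableSet_Ioi
    exact Complex.continuous_conj.comp_aestronglyMeasurable
      ((aestronglyMeasurable_thetaMellin (measurable_indicator_one measurableSet_Ioi) s).const_mul 2)
  have h1 : IntegrableOn (fun x : ℝ => x ^ (-4 : ℝ)) (Ioi a) :=
    integrableOn_Ioi_rpow_of_lt (by norm_num) ha
  rw [memLp_two_iff_integrable_sq_norm hm]
  have h2 : Integrable ((Ioi a).indicator fun x : ℝ => (2 * C) ^ 2 * x ^ (-4 : ℝ)) ν₀ :=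
    (IntegrableOn.integrable_indicator (Integrable.const_mul h1 ((2 * C) ^ 2))
      measurableSet_Ioi).integrableOn
  refine h2.mono' (hm.norm.pow 2) (Eventually.of_forall fun x => ?_)
  rw [Real.norm_of_nonneg (by positivity), tailKernel]
  by_cases hx : x ∈ Ioi a
  · rw [indicator_of_mem hx, indicator_of_mem hx, RCLike.norm_conj, norm_mul]
    have hx0 : 0 < x := ha.trans hx
    have h4 : x ^ (-4 : ℝ) = (x ^ (-2 : ℝ)) ^ 2 := by
      rw [← Real.rpow_natCast, ← Real.rpow_mul hx0.le]
      norm_num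
    rw [h4, ← mul_pow]
    refine pow_le_pow_left₀ (by positivity) ?_ 2
    rw [Complex.norm_ofNat, mul_assoc]
    exact mul_le_mul_of_nonneg_left (hC x hx0) (by norm_num)
  · rw [indicator_of_notMem hx, indicator_of_notMem hx]
    simp

section FunctionalEquation

variable {s : ℂ} {h : ℝ → ℂ} (hs : s.re = 1 / 2) (hi : IntegrableOn h (Ioi 0))
  (hh : IntegrableOn (fun x : ℝ => x ^ (-(1 / 2) : ℝ) * ‖h x‖) (Ioi 0))
  (hh' : IntegrableOn (fun x : ℝ => x ^ (-(1 / 2) : ℝ) * ‖cosInt h x‖) (Ioi 0))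

include hs in
theorem integrableOn_mul_cpow (hm : AEStronglyMeasurable h ν₀)
    (hh : IntegrableOn (fun x : ℝ => x ^ (-(1 / 2) : ℝ) * ‖h x‖) (Ioi 0)) :
    IntegrableOn (fun x : ℝ => h x * (x : ℂ) ^ (-s)) (Ioi 0) := by
  refine Integrable.mono' hh (hm.mul (measurable_cpow_ofReal _).aestronglyMeasurable) ?_
  filter_upwards [ae_restrict_mem measurableSet_Ioi] with x hx
  rw [norm_mul, norm_cpow_neg_critical hs hx, mul_comm]

include hs in
theorem integrableOn_mul_thetaTail (hm : AEStronglyMeasurable h ν₀)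
    (hh : IntegrableOn (fun x : ℝ => x ^ (-(1 / 2) : ℝ) * ‖h x‖) (Ioi 0)) :
    IntegrableOn (fun x => h x * thetaTail s x) (Ioi 0) :=
  (integral_mul_thetaMellin (measurable_indicator_one measurableSet_Ioi)
    (norm_indicator_one_le _) hs hm hh).1

include hs hi hh hh' in
theorem gammaℝ_mul_integral_cosInt : s.Gammaℝ * ∫ x in Ioi 0, cosInt h x * (x : ℂ) ^ (-s) =
    (1 - s).Gammaℝ * ∫ x in Ioi 0, h x * (x : ℂ) ^ (-(1 - s)) := by
  have h0 := integral_cosInt_mul_thetaMellin (κ := fun _ => 1) (κ' := fun _ => 1) measurable_const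
    (by simp) measurable_const (by simp) (by simp) hs hi hh hh'
  have hs' := one_sub_re hs
  have e : ∀ (z : ℂ) (g : ℝ → ℂ), z.re = 1 / 2 →
      ∫ x in Ioi 0, g x * thetaMellin (fun _ => 1) z x =
        z.Gammaℝ / 2 * ∫ x in Ioi 0, g x * (x : ℂ) ^ (-z) := fun z g hz => by
    rw [← integral_const_mul]
    refine setIntegral_congr_fun measurableSet_Ioi fun x hx => ?_
    rw [thetaMellin_one (by rw [hz]; norm_num) hx]
    ring
  rw [e _ _ hs, e _ _ hs'] at h0
  linear_combination 2 * h0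

include hs hi hh hh' in
/-- The theta splitting of the completed Mellin transform of `h`. -/
theorem integral_cosInt_mul_thetaTail_add :
    (∫ x in Ioi 0, cosInt h x * thetaTail s x) + ∫ x in Ioi 0, h x * thetaTail (1 - s) x =
      (1 - s).Gammaℝ / 2 * ∫ x in Ioi 0, h x * (x : ℂ) ^ (-(1 - s)) := by
  have hs' := one_sub_re hs
  have h0 := integral_cosInt_mul_thetaMellin (κ := (Ioi 1).indicator fun _ => 1)
    (κ' := (Iio 1).indicator fun _ => 1) (measurable_indicator_one measurableSet_Ioi)
    (norm_indicator_one_le _) (measurable_indicator_one measurableSet_Iio)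
    (norm_indicator_one_le _) (fun t ht => by
      have hiff : t ∈ Ioi (1 : ℝ) ↔ t⁻¹ ∈ Iio (1 : ℝ) := (inv_lt_one₀ ht).symm
      by_cases h1 : t ∈ Ioi (1 : ℝ)
      · rw [indicator_of_mem h1, indicator_of_mem (hiff.1 h1)]
      · rw [indicator_of_notMem h1, indicator_of_notMem fun h2 => h1 (hiff.2 h2)]) hs hi hh hh'
  have e : ∫ x in Ioi 0, h x * thetaMellin ((Iio 1).indicator fun _ => 1) (1 - s) x =
      (1 - s).Gammaℝ / 2 * (∫ x in Ioi 0, h x * (x : ℂ) ^ (-(1 - s))) -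
        ∫ x in Ioi 0, h x * thetaTail (1 - s) x := by
    rw [← integral_const_mul, ← integral_sub
      ((integrableOn_mul_cpow hs' hi.aestronglyMeasurable hh).const_mul _)
      (integrableOn_mul_thetaTail hs' hi.aestronglyMeasurable hh)]
    refine setIntegral_congr_fun measurableSet_Ioi fun x hx => ?_
    rw [thetaMellin_Iio_add_thetaTail hs' hx]
    ring
  have h0' : ∫ x in Ioi 0, cosInt h x * thetaTail s x = _ := h0
  rw [h0', e]
  ring

end FunctionalEquation

/-! ### Decay of cosine integrals -/

/-- Integration by parts: the cosine integral of a continuously differentiable function decays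
like `1 / y`. -/
theorem abs_integral_cosKernel_mul_le {u u' : ℝ → ℝ} {p q M y : ℝ} (hpq : p ≤ q)
    (hu : ∀ x ∈ Icc p q, HasDerivAt u (u' x) x) (hu' : ContinuousOn u' (Icc p q))
    (hM : ∀ x ∈ Icc p q, |u x| ≤ M) (hM' : ∀ x ∈ Icc p q, |u' x| ≤ M) (hy : 0 < y) :
    |∫ x in p..q, cosKernel x y * u x| ≤ (2 * M + M * (q - p)) * y⁻¹ := by
  set v : ℝ → ℝ := fun x => Real.sin (2 * π * x * y) / (π * y) with hv
  have hpy : 0 < π * y := mul_pos Real.pi_pos hy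
  have hvd : ∀ x, HasDerivAt v (cosKernel x y) x := fun x => by
    have h1 : HasDerivAt (fun x : ℝ => 2 * π * x * y) (2 * π * y) x := by
      simpa using ((hasDerivAt_id x).const_mul (2 * π)).mul_const y
    refine (h1.sin.div_const (π * y)).congr_deriv ?_
    rw [cosKernel]
    field_simp
  have hvb : ∀ x, |v x| ≤ y⁻¹ := fun x => by
    rw [hv, abs_div, abs_of_pos hpy, div_le_iff₀ hpy]
    have : y⁻¹ * (π * y) = π := by field_simp
    rw [this]
    exact (Real.abs_sin_le_one _).trans (by linarith [Real.pi_gt_three])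
  have hc : Continuous fun x => cosKernel x y := by unfold cosKernel; fun_prop
  have hM0 : 0 ≤ M := (abs_nonneg _).trans (hM p ⟨le_rfl, hpq⟩)
  have e := intervalIntegral.integral_mul_deriv_eq_deriv_mul (a := p) (b := q) (u := u) (u' := u')
    (v := v) (v' := fun x => cosKernel x y) (by rwa [uIcc_of_le hpq]) (fun x _ => hvd x)
    (ContinuousOn.intervalIntegrable (by rwa [uIcc_of_le hpq])) (hc.intervalIntegrable _ _)
  have e' : ∫ x in p..q, cosKernel x y * u x = ∫ x in p..q, u x * cosKernel x y := by
    simp only [mul_comm]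
  have hb : ∀ x ∈ Icc p q, |u x * v x| ≤ M * y⁻¹ := fun x hx => by
    rw [abs_mul]
    exact mul_le_mul (hM x hx) (hvb x) (abs_nonneg _) hM0
  have hb' : |∫ x in p..q, u' x * v x| ≤ M * y⁻¹ * (q - p) := by
    have := intervalIntegral.norm_integral_le_of_norm_le_const (a := p) (b := q)
      (f := fun x => u' x * v x) (C := M * y⁻¹) fun x hx => by
        rw [uIoc_of_le hpq] at hx
        rw [Real.norm_eq_abs, abs_mul]
        exact mul_le_mul (hM' x (Ioc_subset_Icc_self hx)) (hvb x) (abs_nonneg _) hM0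
    rwa [abs_of_nonneg (sub_nonneg.2 hpq)] at this
  rw [e', e]
  have h1 := hb p ⟨le_rfl, hpq⟩
  have h2 := hb q ⟨hpq, le_rfl⟩
  rw [abs_le] at *
  constructor <;> linarith [h1.1, h1.2, h2.1, h2.2, hb'.1, hb'.2]

theorem exists_abs_integral_cosKernel_mul_phi_le {ε : ℝ} (hε : ε * ε = 1) {a c : ℝ} (ha : 0 < a) :
    ∃ C, ∀ b ∈ Icc a c, ∀ y, 0 < y → |∫ x in (0 : ℝ)..b, cosKernel x y * phi ε b x| ≤ C * y⁻¹ := by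
  have hcomp : IsCompact (Icc a c ×ˢ Icc 0 c) := isCompact_Icc.prod isCompact_Icc
  obtain ⟨M, hM⟩ := hcomp.exists_bound_of_continuousOn (f := fun p : ℝ × ℝ => phi ε p.1 p.2)
    fun p hp => (continuousAt_phi₂ hε (ha.trans_le hp.1.1) p.2).continuousWithinAt
  obtain ⟨M', hM'⟩ := hcomp.exists_bound_of_continuousOn (f := fun p : ℝ × ℝ => phiX ε p.1 p.2)
    fun p hp => (continuousAt_phiX hε (ha.trans_le hp.1.1) p.2).continuousWithinAt
  set N := max (max M M') 0 with hN
  refine ⟨2 * N + N * c, fun b hb y hy => ?_⟩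
  have hb0 := ha.trans_le hb.1
  refine (abs_integral_cosKernel_mul_le (M := N) hb0.le
    (fun x _ => hasDerivAt_phiX hε hb0 x) (continuous_phiX hε hb0).continuousOn
    (fun x hx => ?_) (fun x hx => ?_) hy).trans ?_
  · exact (hM (b, x) ⟨hb, hx.1, hx.2.trans hb.2⟩).trans ((le_max_left _ _).trans (le_max_left _ _))
  · exact (hM' (b, x) ⟨hb, hx.1, hx.2.trans hb.2⟩).trans ((le_max_right _ _).trans (le_max_left _ _))
  · refine mul_le_mul_of_nonneg_right ?_ (inv_pos.2 hy).le
    have : N * (b - 0) ≤ N * c := mul_le_mul_of_nonneg_left (by linarith [hb.2]) (le_max_right _ _)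
    linarith

/-- A continuous function of size `O(1/y)` is integrable against `y^{-1/2}`. -/
theorem integrableOn_rpow_mul_norm {g : ℝ → ℂ} (hg : Continuous g) {C : ℝ}
    (hC : ∀ y, 0 < y → ‖g y‖ ≤ C * y⁻¹) :
    IntegrableOn (fun y : ℝ => y ^ (-(1 / 2) : ℝ) * ‖g y‖) (Ioi 0) := by
  obtain ⟨M, hM⟩ := (isCompact_Icc (a := (0 : ℝ)) (b := 1)).exists_bound_of_continuousOn
    hg.continuousOn
  have hm : ∀ S : Set ℝ, AEStronglyMeasurable (fun y : ℝ => y ^ (-(1 / 2) : ℝ) * ‖g y‖)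
      (volume.restrict S) := fun S =>
    (measurable_id.pow_const _).aestronglyMeasurable.mul hg.norm.aestronglyMeasurable
  rw [← Ioc_union_Ioi_eq_Ioi (zero_le_one (α := ℝ))]
  refine IntegrableOn.union ?_ ?_
  · have h1 : IntegrableOn (fun y : ℝ => y ^ (-(1 / 2) : ℝ) * M) (Ioc 0 1) :=
      ((intervalIntegrable_iff_integrableOn_Ioc_of_le zero_le_one).1
        (intervalIntegral.intervalIntegrable_rpow' (by norm_num))).mul_const _
    refine Integrable.mono' h1 (hm _) ?_
    filter_upwards [ae_restrict_mem measurableSet_Ioc] with y hy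
    have := Real.rpow_nonneg hy.1.le (-(1 / 2))
    rw [Real.norm_of_nonneg (by positivity)]
    exact mul_le_mul_of_nonneg_left (hM y ⟨hy.1.le, hy.2⟩) this
  · have h1 : IntegrableOn (fun y : ℝ => C * y ^ (-(3 / 2) : ℝ)) (Ioi 1) :=
      (integrableOn_Ioi_rpow_of_lt (by norm_num) one_pos).const_mul _
    refine Integrable.mono' h1 (hm _) ?_
    filter_upwards [ae_restrict_mem measurableSet_Ioi] with y hy
    have hy0 : 0 < y := one_pos.trans hy
    have := Real.rpow_nonneg hy0.le (-(1 / 2))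
    rw [Real.norm_of_nonneg (by positivity)]
    refine (mul_le_mul_of_nonneg_left (hC y hy0) this).trans (le_of_eq ?_)
    rw [← Real.rpow_neg_one, mul_left_comm, ← Real.rpow_add hy0]
    norm_num

/-! ### The functions `ℰ_b(s)` as truncated Mellin transforms -/

/-- `b^{-s} - ε ∫_0^b φ_b^ε(x) x^{-s} dx`. -/
def phiMellin (ε : ℝ) (s : ℂ) (b : ℝ) : ℂ :=
  (b : ℂ) ^ (-s) - ε * ∫ x in Ioo 0 b, (phi ε b x : ℂ) * (x : ℂ) ^ (-s)

theorem integrableOn_rpow_mul_norm_indicator {u : ℝ → ℝ} (hu : Continuous u) {b : ℝ} (hb : 0 < b) :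
    IntegrableOn (fun x : ℝ => x ^ (-(1 / 2) : ℝ) *
      ‖(Ioo 0 b).indicator (fun x => (u x : ℂ)) x‖) (Ioi 0) := by
  have h1 : IntervalIntegrable (fun x : ℝ => x ^ (-(1 / 2) : ℝ) * |u x|) volume 0 b :=
    (intervalIntegral.intervalIntegrable_rpow' (by norm_num)).mul_continuousOn
      hu.abs.continuousOn
  have h2 := ((intervalIntegrable_iff_integrableOn_Ioc_of_le hb.le).1 h1).mono_set
    Ioo_subset_Ioc_self
  refine (h2.integrable_indicator measurableSet_Ioo).integrableOn.congr
    (Eventually.of_forall fun x => ?_)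
  by_cases hx : x ∈ Ioo 0 b
  · simp only [indicator_of_mem hx, Complex.norm_real, Real.norm_eq_abs]
  · simp only [indicator_of_notMem hx, norm_zero, mul_zero]

theorem integrableOn_indicator_Ioo {u : ℝ → ℝ} (hu : Continuous u) (b : ℝ) (S : Set ℝ) :
    IntegrableOn ((Ioo 0 b).indicator fun x => (u x : ℂ)) S :=
  ((integrable_Ioo_of_continuous (Complex.continuous_ofReal.comp hu) 0 b).integrable_indicator
    measurableSet_Ioo).integrableOn

theorem setIntegral_indicator_Ioo_mul (u : ℝ → ℂ) (k : ℝ → ℂ) (b : ℝ) :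
    ∫ x in Ioi 0, (Ioo 0 b).indicator u x * k x = ∫ x in Ioo 0 b, u x * k x := by
  have h : ∀ x, (Ioo 0 b).indicator u x * k x = (Ioo 0 b).indicator (fun x => u x * k x) x :=
    fun x => by
      by_cases hx : x ∈ Ioo 0 b
      · simp only [indicator_of_mem hx]
      · simp only [indicator_of_notMem hx, zero_mul]
  have hsub : Ioo 0 b ⊆ Ioi 0 := fun x hx => hx.1
  simp only [h]
  rw [setIntegral_indicator measurableSet_Ioo, inter_eq_self_of_subset_right hsub]

theorem cosInt_indicator_Ioo (u : ℝ → ℝ) {b : ℝ} (hb : 0 < b) (y : ℝ) :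
    cosInt ((Ioo 0 b).indicator fun x => (u x : ℂ)) y =
      ((∫ x in (0 : ℝ)..b, cosKernel x y * u x : ℝ) : ℂ) := by
  rw [cosInt, intervalIntegral.integral_of_le hb.le, integral_Ioc_eq_integral_Ioo,
    ← integral_complex_ofReal]
  simp only [mul_comm (cosKernel _ y : ℂ)]
  rw [setIntegral_indicator_Ioo_mul]
  congr 1
  ext x
  push_cast
  ring

/-- The half-sum of `φ_b^±`, cut off to `(0,b)`, has as cosine transform minus the half-difference;
the latter enters the definition of `ℰ_b`. -/
theorem phi_half_sub {b : ℝ} (hb : 0 < b) (y : ℝ) :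
    ∫ x in (0 : ℝ)..b, cosKernel x y * ((phi 1 b x + phi (-1) b x) / 2) =
      -((phi 1 b y - phi (-1) b y) / 2) := by
  have h1 := phi_eq one_mul_one_real hb y
  have h2 := phi_eq neg_one_mul_neg_one_real hb y
  have hc : Continuous fun x => cosKernel x y := by unfold cosKernel; fun_prop
  have hc' : ∀ x, cosKernel x y = cosKernel y x := fun x => cosKernel_comm x y
  have e : ∀ x, cosKernel x y * ((phi 1 b x + phi (-1) b x) / 2) =
      (1 / 2) * (cosKernel y x * phi 1 b x) + (1 / 2) * (cosKernel y x * phi (-1) b x) := fun x => by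
    rw [hc']
    ring
  have i1 : ∀ ε : ℝ, ε * ε = 1 → IntervalIntegrable
      (fun x => (1 / 2) * (cosKernel y x * phi ε b x)) volume 0 b := fun ε hε => by
    simp only [← hc']
    exact (continuous_const.mul (hc.mul (continuous_phi hε hb))).intervalIntegrable _ _
  simp only [e]
  rw [intervalIntegral.integral_add (i1 _ one_mul_one_real) (i1 _ neg_one_mul_neg_one_real),
    intervalIntegral.integral_const_mul, intervalIntegral.integral_const_mul]
  linarith

/-- The functional equation turns the integral over `(b,∞)` which defines `ℰ_b` into integrals over
`(0,b)`. -/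
theorem curlyE_add {ε : ℝ} (hε : ε = 1 ∨ ε = -1) {b : ℝ} (hb : 0 < b) {s : ℂ}
    (hs : s.re = 1 / 2) : curlyE b s + ε * curlyE b (1 - s) =
      (sqrt b : ℂ) * (s.Gammaℝ * phiMellin ε s b +
        ε * ((1 - s).Gammaℝ * phiMellin ε (1 - s) b)) := by
  have hcp := continuous_phi one_mul_one_real hb
  have hcm := continuous_phi neg_one_mul_neg_one_real hb
  set χ : ℝ → ℝ := fun x => (phi 1 b x + phi (-1) b x) / 2 with hχ
  set ψ : ℝ → ℝ := fun x => (phi 1 b x - phi (-1) b x) / 2 with hψ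
  have hχc : Continuous χ := (hcp.add hcm).div_const 2
  have hψc : Continuous ψ := (hcp.sub hcm).div_const 2
  -- the functional equation is applied to the half-sum of `φ_b^±` on `(0,b)`
  set h : ℝ → ℂ := (Ioo 0 b).indicator fun x => (χ x : ℂ) with hh
  have hcos : ∀ y, cosInt h y = ((-ψ y : ℝ) : ℂ) := fun y => by
    rw [hh, cosInt_indicator_Ioo χ hb, phi_half_sub hb]
  have hi : IntegrableOn h (Ioi 0) := integrableOn_indicator_Ioo hχc b _
  have hh1 := integrableOn_rpow_mul_norm_indicator hχc hb
  obtain ⟨C1, hC1⟩ := exists_abs_integral_cosKernel_mul_phi_le one_mul_one_real (c := b) hb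
  obtain ⟨C2, hC2⟩ := exists_abs_integral_cosKernel_mul_phi_le neg_one_mul_neg_one_real (c := b) hb
  have hdecay : ∀ y, 0 < y → ‖cosInt h y‖ ≤ ((C1 + C2) / 2) * y⁻¹ := fun y hy => by
    rw [hcos, Complex.norm_real, Real.norm_eq_abs]
    have h1 := phi_eq one_mul_one_real hb y
    have h2 := phi_eq neg_one_mul_neg_one_real hb y
    have h3 := abs_le.1 (hC1 b ⟨le_rfl, le_rfl⟩ y hy)
    have h4 := abs_le.1 (hC2 b ⟨le_rfl, le_rfl⟩ y hy)
    simp only [cosKernel_comm _ y] at h3 h4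
    rw [hψ, abs_le]
    constructor <;> linarith [h3.1, h3.2, h4.1, h4.2]
  have hh2 := integrableOn_rpow_mul_norm (continuous_cosInt hi) hdecay
  have hs' := one_sub_re hs
  have f1 := gammaℝ_mul_integral_cosInt hs hi hh1 hh2
  have f2 := gammaℝ_mul_integral_cosInt hs' hi hh1 hh2
  rw [sub_sub_cancel] at f2
  have hsplit : ∀ z : ℂ, z.re = 1 / 2 → ∫ x in Ioi 0, cosInt h x * (x : ℂ) ^ (-z) =
      -(∫ x in Ioo 0 b, (ψ x : ℂ) * (x : ℂ) ^ (-z)) - ∫ x in Ioi b, (ψ x : ℂ) * (x : ℂ) ^ (-z) := by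
    intro z hz
    have hI := integrableOn_mul_cpow hz (continuous_cosInt hi).aestronglyMeasurable hh2
    rw [← Ioc_union_Ioi_eq_Ioi hb.le, setIntegral_union (Ioc_disjoint_Ioi le_rfl) measurableSet_Ioi
      (hI.mono_set Ioc_subset_Ioi_self) (hI.mono_set (Ioi_subset_Ioi hb.le)),
      integral_Ioc_eq_integral_Ioo, sub_eq_add_neg, ← integral_neg, ← integral_neg]
    simp only [hcos]
    push_cast
    simp only [neg_mul]
  have hE : ∀ z : ℂ, curlyE b z = (sqrt b : ℂ) * (z.Gammaℝ * ((b : ℂ) ^ (-z) +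
      ∫ x in Ioi b, (ψ x : ℂ) * (x : ℂ) ^ (-z))) := fun z => by
    rw [curlyE, ← integral_const_mul]
    have : ∀ x : ℝ, 1 / 2 * (((phi 1 b x - phi (-1) b x : ℝ) : ℂ) * (x : ℂ) ^ (-z)) =
        (ψ x : ℂ) * (x : ℂ) ^ (-z) := fun x => by
      simp only [hψ]
      push_cast
      ring
    simp only [this]
    ring
  have hψI : ∀ z : ℂ, z.re = 1 / 2 → ∀ u : ℝ → ℝ, Continuous u →
      IntegrableOn (fun x : ℝ => (u x : ℂ) * (x : ℂ) ^ (-z)) (Ioo 0 b) := fun z hz u hu => by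
    have := (integrableOn_mul_cpow hz (integrableOn_indicator_Ioo hu b _).aestronglyMeasurable
      (integrableOn_rpow_mul_norm_indicator hu hb)).mono_set (t := Ioi 0) (s := Ioo 0 b)
        fun x hx => hx.1
    refine (integrableOn_congr_fun (fun x hx => ?_) measurableSet_Ioo).1 this
    simp only [indicator_of_mem hx]
  have hphi : ∀ z : ℂ, z.re = 1 / 2 → ∫ x in Ioo 0 b, (phi ε b x : ℂ) * (x : ℂ) ^ (-z) =
      (∫ x in Ioo 0 b, (χ x : ℂ) * (x : ℂ) ^ (-z)) +
        ε * ∫ x in Ioo 0 b, (ψ x : ℂ) * (x : ℂ) ^ (-z) := fun z hz => by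
    rw [← integral_const_mul, ← integral_add (hψI z hz χ hχc) ((hψI z hz ψ hψc).const_mul _)]
    congr 1
    ext x
    simp only [hχ, hψ]
    rcases hε with rfl | rfl
    · push_cast
      ring
    · push_cast
      ring
  have hεε : (ε : ℂ) * ε = 1 := by
    rcases hε with rfl | rfl <;> norm_num
  rw [hsplit s hs, hh, setIntegral_indicator_Ioo_mul] at f1
  rw [hsplit _ hs', hh, setIntegral_indicator_Ioo_mul] at f2
  rw [hE, hE, phiMellin, phiMellin, hphi s hs, hphi _ hs']
  linear_combination (-(sqrt b : ℂ)) * f1 - ε * (sqrt b : ℂ) * f2 +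
    (sqrt b : ℂ) * (s.Gammaℝ * ∫ x in Ioo 0 b, (ψ x : ℂ) * (x : ℂ) ^ (-s)) * hεε +
    (sqrt b : ℂ) * ((1 - s).Gammaℝ * ((∫ x in Ioo 0 b, (χ x : ℂ) * (x : ℂ) ^ (-(1 - s))) +
      ε * ∫ x in Ioo 0 b, (ψ x : ℂ) * (x : ℂ) ^ (-(1 - s)))) * hεε

/-! ### Completed Mellin transforms of the transmuted functions -/

section Transmuted

variable {ε a c : ℝ} (hε : ε * ε = 1) (ha : 0 < a) {s : ℂ} (hs : s.re = 1 / 2)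

include hε ha hs in
theorem integral_volterraT_mul_cpow {R : ℝ → ℂ} (hR : CarriedBy a c R) :
    IntegrableOn (fun x : ℝ => volterraT ε a c R x * (x : ℂ) ^ (-s)) (Ioi 0) ∧
    IntegrableOn (fun b => R b * phiMellin ε s b) (Ioo a c) ∧
    ∫ x in Ioi 0, volterraT ε a c R x * (x : ℂ) ^ (-s) =
      ∫ b in Ioo a c, R b * phiMellin ε s b := by
  obtain ⟨-, hi, hz⟩ := memLp_volterraT hε ha hR
  have hP := continuous_phiC hε ha
  have hg : IntegrableOn (fun x : ℝ => (x : ℂ) ^ (-s)) (Ioo 0 c) := by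
    rcases le_or_gt c 0 with hc | hc
    · rw [Ioo_eq_empty (not_lt.2 hc)]
      exact integrableOn_empty
    · refine Integrable.mono' (((intervalIntegrable_iff_integrableOn_Ioc_of_le hc.le).1
        (intervalIntegral.intervalIntegrable_rpow' (r := -(1 / 2)) (by norm_num))).mono_set
        Ioo_subset_Ioc_self) (measurable_cpow_ofReal _).aestronglyMeasurable ?_
      filter_upwards [ae_restrict_mem measurableSet_Ioo] with x hx
      exact (norm_cpow_neg_critical hs hx.1).le
  have hgR : IntegrableOn (fun x : ℝ => (x : ℂ) ^ (-s) * R x) (Ioo 0 c) := by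
    refine Integrable.mono' ((hR.integrable.norm.const_mul (a ^ (-(1 / 2) : ℝ))).integrableOn)
      ((measurable_cpow_ofReal _).aestronglyMeasurable.mul
        hR.integrable.aestronglyMeasurable.restrict) ?_
    filter_upwards [ae_restrict_mem measurableSet_Ioo] with x hx
    by_cases hxa : x ∈ Ioo a c
    · rw [norm_mul, norm_cpow_neg_critical hs hx.1]
      exact mul_le_mul_of_nonneg_right
        (Real.rpow_le_rpow_of_nonpos ha hxa.1.le (by norm_num)) (norm_nonneg _)
    · rw [hR.eq_zero x hxa]
      simp
  obtain ⟨t1, t2, t3⟩ := integral_triangle_swap hP hg hR.integrable.integrableOn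
  have e2 : ∀ x : ℝ, volterraT ε a c R x * (x : ℂ) ^ (-s) = (x : ℂ) ^ (-s) * R x -
      ε * ((x : ℂ) ^ (-s) * ∫ b in Ioo x c, phiC ε a (b, x) * R b) := fun x => by
    rw [volterraT]
    ring
  have hI : IntegrableOn (fun x : ℝ => volterraT ε a c R x * (x : ℂ) ^ (-s)) (Ioo 0 c) := by
    simp only [e2]
    exact hgR.sub (t1.const_mul _)
  have hz' : ∀ x ∈ Ioi (0 : ℝ) \ Ioo 0 c, volterraT ε a c R x * (x : ℂ) ^ (-s) = 0 := fun x hx => by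
    rw [hz x (not_lt.1 fun h => hx.2 ⟨hx.1, h⟩), zero_mul]
  have hsub : Ioo a c ⊆ Ioo 0 c := Ioo_subset_Ioo_left ha.le
  have e3 : ∀ b ∈ Ioo a c, R b * phiMellin ε s b = (b : ℂ) ^ (-s) * R b -
      ε * (R b * ∫ x in Ioo 0 b, phiC ε a (b, x) * (x : ℂ) ^ (-s)) := fun b hb => by
    simp only [phiC_of_le hb.1.le, phiMellin]
    ring
  have e4 : IntegrableOn (fun b : ℝ => (b : ℂ) ^ (-s) * R b -
      ε * (R b * ∫ x in Ioo 0 b, phiC ε a (b, x) * (x : ℂ) ^ (-s))) (Ioo 0 c) :=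
    hgR.sub (t2.const_mul _)
  refine ⟨?_, ?_, ?_⟩
  · exact hI.of_forall_sdiff_eq_zero measurableSet_Ioi hz'
  · exact (integrableOn_congr_fun e3 measurableSet_Ioo).2 (e4.mono_set hsub)
  · rw [setIntegral_eq_of_subset_of_forall_sdiff_eq_zero measurableSet_Ioi (fun x hx => hx.1) hz']
    simp only [e2]
    rw [integral_sub hgR (t1.const_mul _), integral_const_mul, t3, ← integral_const_mul,
      ← integral_sub hgR (t2.const_mul _), setIntegral_congr_fun measurableSet_Ioo e3]
    refine setIntegral_eq_of_subset_of_forall_sdiff_eq_zero measurableSet_Ioo hsub fun b hb => ?_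
    rw [hR.eq_zero b hb.2]
    ring

include hε ha in
/-- For `R` of class `C¹` the cosine transform decays fast enough for the integrals at `Re s = 1/2` to
converge absolutely. -/
theorem exists_norm_cosInt_volterraT_le {R : ℝ → ℝ} (hR : ContDiffOn ℝ 1 R (Ioi 0)) (hac : a < c) :
    ∃ C, ∀ y, 0 < y → ‖cosInt (volterraT ε a c (cut a c R)) y‖ ≤ C * y⁻¹ := by
  have hcut : CarriedBy a c (cut a c R) := carriedBy_cut ha hR.continuousOn
  have hsub : Icc a c ⊆ Ioi 0 := fun x hx => ha.trans_le hx.1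
  have hRc : ContinuousOn R (Icc a c) := hR.continuousOn.mono hsub
  have hR' : ContinuousOn (deriv R) (Icc a c) :=
    (hR.continuousOn_deriv_of_isOpen isOpen_Ioi (by norm_num)).mono hsub
  obtain ⟨M1, hM1⟩ := isCompact_Icc.exists_bound_of_continuousOn hRc
  obtain ⟨M2, hM2⟩ := isCompact_Icc.exists_bound_of_continuousOn hR'
  obtain ⟨C, hC⟩ := exists_abs_integral_cosKernel_mul_phi_le hε (c := c) ha
  have hM10 : 0 ≤ M1 := (norm_nonneg _).trans (hM1 a ⟨le_rfl, hac.le⟩)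
  set M := max M1 M2 with hM
  refine ⟨(2 * M + M * (c - a)) + C * M1 * (c - a), fun y hy => ?_⟩
  have e1 : cosInt (volterraT ε a c (cut a c R)) y = ((∫ b in a..c, phi ε b y * R b : ℝ) : ℂ) := by
    rw [cosInt_volterraT hε ha hcut, intervalIntegral.integral_of_le hac.le,
      integral_Ioc_eq_integral_Ioo, ← integral_complex_ofReal]
    refine setIntegral_congr_fun measurableSet_Ioo fun b hb => ?_
    rw [phiC_of_le hb.1.le, cut, indicator_of_mem hb]
    push_cast
    rfl
  have hk : ContinuousOn (fun b => cosKernel b y) (Icc a c) :=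
    (by unfold cosKernel; fun_prop : Continuous fun b => cosKernel b y).continuousOn
  have hφ : ContinuousOn (fun b => phi ε b y) (Icc a c) := fun b hb =>
    ((continuousAt_phi₂ hε (hsub hb) y).comp (f := fun b : ℝ => (b, y))
      (by fun_prop)).continuousWithinAt
  have hii : ∀ {F : ℝ → ℝ}, ContinuousOn F (Icc a c) → IntervalIntegrable F volume a c :=
    fun hF => ContinuousOn.intervalIntegrable (by rwa [uIcc_of_le hac.le])
  have e2 : ∫ b in a..c, phi ε b y * R b = (∫ b in a..c, cosKernel b y * R b) -
      ∫ b in a..c, (cosKernel b y - phi ε b y) * R b := by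
    rw [← intervalIntegral.integral_sub (f := fun b => cosKernel b y * R b)
      (g := fun b => (cosKernel b y - phi ε b y) * R b) (hii (hk.mul hRc))
      (hii ((hk.sub hφ).mul hRc))]
    congr 1
    ext b
    ring
  have b1 := abs_integral_cosKernel_mul_le (u := R) (u' := deriv R) (M := M) hac.le
    (fun x hx => ((hR.contDiffAt (isOpen_Ioi.mem_nhds (hsub hx))).differentiableAt
      (by norm_num)).hasDerivAt) hR' (fun x hx => (hM1 x hx).trans (le_max_left _ _))
    (fun x hx => (hM2 x hx).trans (le_max_right _ _)) hy
  have b2 := intervalIntegral.norm_integral_le_of_norm_le_const (a := a) (b := c)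
    (f := fun b => (cosKernel b y - phi ε b y) * R b) (C := C * y⁻¹ * M1) fun b hb => by
      rw [uIoc_of_le hac.le] at hb
      have hb' := Ioc_subset_Icc_self hb
      have h1 := phi_eq hε (hsub hb') y
      have h2 := hC b hb' y hy
      have hε1 : |ε| = 1 := by simpa using abs_pow_of_sq hε 1
      simp only [cosKernel_comm _ y] at h2
      rw [norm_mul]
      refine mul_le_mul ?_ (hM1 b hb') (norm_nonneg _) ((abs_nonneg _).trans h2)
      rw [← h1, add_sub_cancel_left, norm_mul, Real.norm_eq_abs, hε1, one_mul]
      exact h2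
  rw [abs_of_nonneg (sub_nonneg.2 hac.le), Real.norm_eq_abs] at b2
  rw [e1, Complex.norm_real, e2]
  refine (norm_sub_le _ _).trans ?_
  rw [Real.norm_eq_abs, Real.norm_eq_abs]
  linarith

/-- For the transmuted functions, the completed Mellin transform and its theta splitting are given
by the functions `ℰ_b`. -/
theorem mellin_transmuted (hε' : ε = 1 ∨ ε = -1) (hs : s.re = 1 / 2) {R : ℝ → ℝ}
    (hR : ContDiffOn ℝ 1 R (Ioi 0)) (hac : a < c) (hcut : CarriedBy a c (cut a c R)) :
    IntegrableOn (fun x => transmuted hε ha hcut x * (x : ℂ) ^ (-s)) (Ioi 0) ∧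
    s.Gammaℝ * (∫ x in Ioi 0, transmuted hε ha hcut x * (x : ℂ) ^ (-s)) =
      ∫ b in Ioo a c, cut a c R b * ((curlyE b s + ε * curlyE b (1 - s)) / (sqrt b : ℂ)) ∧
    2 * (∫ x in Ioi 0, transmuted hε ha hcut x * thetaTail s x) +
      ε * (2 * ∫ x in Ioi 0, transmuted hε ha hcut x * thetaTail (1 - s) x) =
      ∫ b in Ioo a c, cut a c R b * ((curlyE b s + ε * curlyE b (1 - s)) / (sqrt b : ℂ)) := by
  obtain ⟨h2, hi, -⟩ := memLp_volterraT hε ha hcut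
  set w := volterraT ε a c (cut a c R) with hw
  have hf : ∀ᵐ x ∂ν₀, transmuted hε ha hcut x = w x + ε * cosInt w x := by
    filter_upwards [Lp.coeFn_add (h2.toLp _) ((ε : ℂ) • cosT (h2.toLp _)),
      Lp.coeFn_smul (ε : ℂ) (cosT (h2.toLp _)), h2.coeFn_toLp, cosT_toLp_ae h2 hi] with x e1 e2 e3 e4
    have e0 : transmuted hε ha hcut x = (h2.toLp _ + (ε : ℂ) • cosT (h2.toLp _)) x := rfl
    rw [e0, e1, Pi.add_apply, e2, Pi.smul_apply, e3, e4, smul_eq_mul]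
  have hs' := one_sub_re hs
  obtain ⟨C, hC⟩ := exists_norm_cosInt_volterraT_le hε ha hR hac
  have hh' := integrableOn_rpow_mul_norm (continuous_cosInt hi) hC
  obtain ⟨v1, v2, v3⟩ := integral_volterraT_mul_cpow hε ha hs hcut
  obtain ⟨v1', v2', v3'⟩ := integral_volterraT_mul_cpow hε ha hs' hcut
  have hh : IntegrableOn (fun x : ℝ => x ^ (-(1 / 2) : ℝ) * ‖w x‖) (Ioi 0) := by
    refine v1.norm.congr ?_
    filter_upwards [ae_restrict_mem measurableSet_Ioi] with x hx
    rw [norm_mul, norm_cpow_neg_critical hs hx, mul_comm]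
  have hm := hi.aestronglyMeasurable
  have hm' : AEStronglyMeasurable (cosInt w) ν₀ := (continuous_cosInt hi).aestronglyMeasurable
  have hεε : (ε : ℂ) * ε = 1 := ofReal_mul_self_eq_one hε
  have key : ∀ k : ℝ → ℂ, IntegrableOn (fun x => w x * k x) (Ioi 0) →
      IntegrableOn (fun x => cosInt w x * k x) (Ioi 0) →
      IntegrableOn (fun x => transmuted hε ha hcut x * k x) (Ioi 0) ∧
      ∫ x in Ioi 0, transmuted hε ha hcut x * k x = (∫ x in Ioi 0, w x * k x) +
        ε * ∫ x in Ioi 0, cosInt w x * k x := fun k k1 k2 => by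
    have e : ∀ᵐ x ∂ν₀, transmuted hε ha hcut x * k x = w x * k x + ε * (cosInt w x * k x) := by
      filter_upwards [hf] with x hx
      rw [hx]
      ring
    refine ⟨(k1.add (k2.const_mul (ε : ℂ))).congr (e.mono fun x hx => hx.symm), ?_⟩
    rw [integral_congr_ae e, integral_add k1 (k2.const_mul _), integral_const_mul]
  have hmain : ∫ b in Ioo a c, cut a c R b * ((curlyE b s + ε * curlyE b (1 - s)) / (sqrt b : ℂ))
      = s.Gammaℝ * (∫ x in Ioi 0, w x * (x : ℂ) ^ (-s)) +
        ε * ((1 - s).Gammaℝ * ∫ x in Ioi 0, w x * (x : ℂ) ^ (-(1 - s))) := by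
    rw [v3, v3', ← integral_const_mul, ← integral_const_mul, ← integral_const_mul,
      ← integral_add (v2.const_mul _) ((v2'.const_mul _).const_mul _)]
    refine setIntegral_congr_fun measurableSet_Ioo fun b hb => ?_
    have hb0 := ha.trans hb.1
    have hsq : (sqrt b : ℂ) ≠ 0 := by
      rw [Complex.ofReal_ne_zero]
      exact (Real.sqrt_pos.2 hb0).ne'
    rw [curlyE_add hε' hb0 hs, mul_div_cancel_left₀ _ hsq]
    ring
  obtain ⟨k1, k2⟩ := key _ v1 (integrableOn_mul_cpow hs hm' hh')
  refine ⟨k1, ?_, ?_⟩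
  · rw [k2, hmain, mul_add, mul_left_comm, gammaℝ_mul_integral_cosInt hs hi hh hh']
  · rw [(key _ (integrableOn_mul_thetaTail hs hm hh) (integrableOn_mul_thetaTail hs hm' hh')).2,
      (key _ (integrableOn_mul_thetaTail hs' hm hh) (integrableOn_mul_thetaTail hs' hm' hh')).2,
      hmain]
    have f1 := integral_cosInt_mul_thetaTail_add hs hi hh hh'
    have f2 := integral_cosInt_mul_thetaTail_add hs' hi hh hh'
    rw [sub_sub_cancel] at f2
    linear_combination 2 * ε * f1 + 2 * f2 +
      2 * (∫ x in Ioi 0, cosInt w x * thetaTail (1 - s) x) * hεε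

end Transmuted

/-! ### The Mellin-Plancherel transform -/

/-- `e^{u/2} h(e^u)`: the unitary change of variables from `L²(0,∞)` to `L²(ℝ)`. -/
def expPull (h : ℝ → ℂ) (u : ℝ) : ℂ := (exp (u / 2) : ℂ) * h (exp u)

theorem integral_exp_univ {E : Type*} [NormedAddCommGroup E] [NormedSpace ℝ E] (F : ℝ → E) :
    ∫ b in Ioi 0, F b = ∫ u, exp u • F (exp u) := by
  simpa [Real.range_exp] using integral_exp_image MeasurableSet.univ F

theorem integrableOn_exp_univ {E : Type*} [NormedAddCommGroup E] [NormedSpace ℝ E] (F : ℝ → E) :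
    IntegrableOn F (Ioi 0) ↔ Integrable fun u => exp u • F (exp u) := by
  simpa [Real.range_exp] using integrableOn_exp_image MeasurableSet.univ F

theorem lintegral_exp_univ (F : ℝ → ℝ≥0∞) :
    ∫⁻ b in Ioi 0, F b = ∫⁻ u, ENNReal.ofReal (exp u) * F (exp u) := by
  simpa [Real.range_exp] using lintegral_image_eq_lintegral_abs_deriv_mul MeasurableSet.univ
    (fun x _ => (Real.hasDerivAt_exp x).hasDerivWithinAt) Real.exp_injective.injOn F

theorem quasiMeasurePreserving_exp : Measure.QuasiMeasurePreserving exp volume ν₀ := by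
  refine ⟨Real.measurable_exp, Measure.AbsolutelyContinuous.mk fun s hs h0 => ?_⟩
  rw [Measure.map_apply Real.measurable_exp hs]
  have h1 := lintegral_exp_univ (s.indicator fun _ => 1)
  rw [lintegral_indicator hs, setLIntegral_one, h0] at h1
  have h2 := (lintegral_eq_zero_iff (by
    refine Measurable.mul (by fun_prop) ?_
    exact (measurable_const.indicator hs).comp Real.measurable_exp)).1 h1.symm
  rw [measure_eq_zero_iff_ae_notMem]
  filter_upwards [h2] with u hu hu'
  have hu'' : exp u ∈ s := hu'
  simp only [indicator_of_mem hu'', Pi.zero_apply, mul_one, ENNReal.ofReal_eq_zero] at hu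
  exact absurd (Real.exp_pos u) (not_lt.2 hu)

theorem eLpNorm_expPull (h : ℝ → ℂ) : eLpNorm (expPull h) 2 volume = eLpNorm h 2 ν₀ := by
  rw [eLpNorm_eq_lintegral_rpow_enorm_toReal (by norm_num) (by norm_num),
    eLpNorm_eq_lintegral_rpow_enorm_toReal (by norm_num) (by norm_num), lintegral_exp_univ]
  congr 1
  refine lintegral_congr fun u => ?_
  simp only [ENNReal.toReal_ofNat, ENNReal.rpow_two, expPull, enorm_mul, mul_pow]
  congr 1
  rw [← ofReal_norm, Complex.norm_real, Real.norm_of_nonneg (Real.exp_pos _).le,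
    ← ENNReal.ofReal_pow (Real.exp_pos _).le, exp_half_sq]

theorem memLp_expPull {h : ℝ → ℂ} (hh : MemLp h 2 ν₀) : MemLp (expPull h) 2 volume := by
  refine ⟨?_, by rw [eLpNorm_expPull]; exact hh.2⟩
  exact (by fun_prop : Continuous fun u : ℝ => (exp (u / 2) : ℂ)).aestronglyMeasurable.mul
    (hh.1.comp_quasiMeasurePreserving quasiMeasurePreserving_exp)

theorem expPull_congr {h g : ℝ → ℂ} (e : h =ᵐ[ν₀] g) : expPull h =ᵐ[volume] expPull g := by
  filter_upwards [quasiMeasurePreserving_exp.ae e] with u hu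
  rw [expPull, expPull, hu]

/-- `f ↦ e^{u/2} f(e^u)` as an isometry from `L²(0,∞)` to `L²(ℝ)`. -/
def expIso : HalfLineL2 →ₗᵢ[ℂ] Lp ℂ 2 (volume : Measure ℝ) where
  toFun f := (memLp_expPull (Lp.memLp f)).toLp _
  map_add' f g := by
    rw [← MemLp.toLp_add]
    refine (MemLp.toLp_eq_toLp_iff _ _).2 ((expPull_congr (Lp.coeFn_add f g)).trans
      (Eventually.of_forall fun u => ?_))
    simp only [expPull, Pi.add_apply, mul_add]
  map_smul' c f := by
    rw [RingHom.id_apply, ← MemLp.toLp_const_smul]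
    refine (MemLp.toLp_eq_toLp_iff _ _).2 ((expPull_congr (Lp.coeFn_smul c f)).trans
      (Eventually.of_forall fun u => ?_))
    simp only [expPull, Pi.smul_apply, smul_eq_mul]
    ring
  norm_map' f := by
    change ‖(memLp_expPull (Lp.memLp f)).toLp _‖ = ‖f‖
    rw [Lp.norm_toLp, eLpNorm_expPull, Lp.norm_def]

/-- The Mellin-Plancherel transform, as a function of `ξ = E / (2π)`. -/
def mellinIso : HalfLineL2 →ₗᵢ[ℂ] Lp ℂ 2 (volume : Measure ℝ) :=
  (Lp.fourierTransformₗᵢ ℝ ℂ).toLinearIsometry.comp expIso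

/-- A version of the Mellin-Plancherel transform of `f`, as a function of `E`. -/
def mellinP (f : HalfLineL2) (E : ℝ) : ℂ := mellinIso f ((2 * π)⁻¹ * E)

/-- In the variable `u = log x`, the Mellin transform on the critical line is a Fourier transform. -/
theorem fourier_expPull {h : ℝ → ℂ} (E : ℝ) : 𝓕 (expPull h) ((2 * π)⁻¹ * E) =
    ∫ x in Ioi 0, h x * (x : ℂ) ^ (-critical E) := by
  rw [Real.fourier_real_eq_integral_exp_smul, integral_exp_univ]
  congr 1
  ext u
  have h1 : (exp u : ℂ) ≠ 0 := by exact_mod_cast (Real.exp_pos u).ne'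
  have h2 : Complex.log (exp u : ℂ) = u := by
    rw [← Complex.ofReal_log (Real.exp_pos u).le, Real.log_exp]
  rw [Complex.cpow_def_of_ne_zero h1, h2, expPull, critical, Complex.real_smul, smul_eq_mul]
  have e1 : Complex.exp (((-2 * π * u * ((2 * π)⁻¹ * E) : ℝ) : ℂ) * Complex.I) *
      (exp (u / 2) : ℂ) =
      (exp u : ℂ) * Complex.exp ((u : ℂ) * -(1 / 2 + Complex.I * E)) := by
    push_cast
    rw [← Complex.exp_add, ← Complex.exp_add]
    congr 1
    have : (π : ℂ) ≠ 0 := by exact_mod_cast Real.pi_ne_zero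
    field_simp
    ring
  rw [← mul_assoc, e1]
  ring

theorem integrable_expPull {h : ℝ → ℂ} {s : ℂ} (hs : s.re = 1 / 2)
    (hi : IntegrableOn (fun x : ℝ => h x * (x : ℂ) ^ (-s)) (Ioi 0)) (hm : AEStronglyMeasurable h ν₀) :
    Integrable (expPull h) := by
  have h1 := ((integrableOn_exp_univ _).1 hi).norm
  refine Integrable.mono' h1 ?_ (Eventually.of_forall fun u => ?_)
  · exact (by fun_prop : Continuous fun u : ℝ => (exp (u / 2) : ℂ)).aestronglyMeasurable.mul
      (hm.comp_quasiMeasurePreserving quasiMeasurePreserving_exp)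
  · refine le_of_eq ?_
    rw [norm_smul, norm_mul, norm_cpow_neg_critical hs (Real.exp_pos u), expPull, norm_mul,
      Complex.norm_real, Real.norm_of_nonneg (Real.exp_pos _).le,
      Real.norm_of_nonneg (Real.exp_pos _).le, ← Real.exp_mul, mul_left_comm, ← Real.exp_add,
      mul_comm]
    ring_nf

theorem critical_re (E : ℝ) : (critical E).re = 1 / 2 := by
  simp [critical]

theorem quasiMeasurePreserving_const_mul {c : ℝ} (hc : c ≠ 0) :
    Measure.QuasiMeasurePreserving (fun x : ℝ => c * x) volume volume := by
  refine ⟨measurable_const_mul c, ?_⟩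
  rw [Real.map_volume_mul_left hc]
  exact Measure.smul_absolutelyContinuous

theorem inv_two_pi_ne_zero : ((2 * π)⁻¹ : ℝ) ≠ 0 := inv_ne_zero (by positivity)

/-- The Mellin-Plancherel transform of `f` is given by the integral when it converges absolutely. -/
theorem mellinIso_ae_eq {f : HalfLineL2} {h : ℝ → ℂ} (hfh : f =ᵐ[ν₀] h)
    (hi : IntegrableOn (fun x : ℝ => h x * (x : ℂ) ^ (-critical 0)) (Ioi 0)) :
    mellinIso f =ᵐ[volume] 𝓕 (expPull h) := by
  have hm : MemLp h 2 ν₀ := (memLp_congr_ae hfh).1 (Lp.memLp f)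
  have h1 := integrable_expPull (critical_re 0) hi hm.1
  have h2 : expIso f = (memLp_expPull hm).toLp _ :=
    (MemLp.toLp_eq_toLp_iff (memLp_expPull (Lp.memLp f)) (memLp_expPull hm)).2 (expPull_congr hfh)
  have h3 : mellinIso f = 𝓕 ((memLp_expPull hm).toLp (expPull h)) := by
    rw [← h2]
    rfl
  rw [h3]
  exact fourier_toLp_ae_eq h1 (memLp_expPull hm)

theorem mellinP_ae_eq {f : HalfLineL2} {h : ℝ → ℂ} (hfh : f =ᵐ[ν₀] h)
    (hi : IntegrableOn (fun x : ℝ => h x * (x : ℂ) ^ (-critical 0)) (Ioi 0)) :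
    ∀ᵐ E : ℝ, mellinP f E = ∫ x in Ioi 0, h x * (x : ℂ) ^ (-critical E) := by
  filter_upwards [(quasiMeasurePreserving_const_mul inv_two_pi_ne_zero).ae
    (mellinIso_ae_eq hfh hi)] with E hE
  rw [mellinP, hE, fourier_expPull]

theorem eLpNorm_comp_const_mul {c : ℝ} (hc : c ≠ 0) {g : ℝ → ℂ}
    (hg : AEStronglyMeasurable g volume) : eLpNorm (fun x => g (c * x)) 2 volume =
      (ENNReal.ofReal |c⁻¹|) ^ (1 / 2 : ℝ) * eLpNorm g 2 volume := by
  have h1 : AEStronglyMeasurable g (Measure.map (fun x : ℝ => c * x) volume) :=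
    hg.mono_ac (quasiMeasurePreserving_const_mul hc).absolutelyContinuous
  have h2 := eLpNorm_map_measure (p := 2) h1 (measurable_const_mul c).aemeasurable
  rw [Real.map_volume_mul_left hc, eLpNorm_smul_measure_of_ne_top (by norm_num)] at h2
  rw [show (fun x => g (c * x)) = g ∘ fun x => c * x from rfl, ← h2]
  simp

theorem tendsto_truncate_two_sided {f : ℝ → ℂ} (hf : MemLp f 2 ν₀) :
    Tendsto (fun R : ℝ => eLpNorm (fun x => f x - (Ioo R⁻¹ R).indicator f x) 2 ν₀) atTop (𝓝 0) := by
  refine tendsto_truncate_of f hf (fun _ => measurableSet_Ioo) ?_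
  filter_upwards [ae_restrict_mem measurableSet_Ioi] with x hx
  filter_upwards [eventually_gt_atTop x, eventually_gt_atTop x⁻¹] with R h1 h2
  exact ⟨inv_lt_of_inv_lt₀ hx h2, h1⟩

theorem isMellinTransform_mellinP (f : HalfLineL2) : IsMellinTransform f (mellinP f) := by
  have hq := quasiMeasurePreserving_const_mul inv_two_pi_ne_zero
  refine ⟨(Lp.aestronglyMeasurable _).comp_quasiMeasurePreserving hq, ?_⟩
  have hS : ∀ R : ℝ, MemLp ((Ioo R⁻¹ R).indicator f) 2 ν₀ := fun R =>
    (Lp.memLp f).indicator measurableSet_Ioo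
  set c := (ENNReal.ofReal |((2 * π)⁻¹ : ℝ)⁻¹|) ^ (1 / 2 : ℝ) with hc
  have hlim := ENNReal.Tendsto.const_mul (a := c) (tendsto_truncate_two_sided (Lp.memLp f))
    (Or.inr (ENNReal.rpow_ne_top_of_nonneg (by norm_num) ENNReal.ofReal_ne_top))
  rw [mul_zero] at hlim
  refine hlim.congr' ?_
  filter_upwards [eventually_gt_atTop 0] with R hR
  have hR' : 0 < R⁻¹ := inv_pos.2 hR
  have hsub : Ioo R⁻¹ R ⊆ Ioi 0 := fun x hx => hR'.trans hx.1
  have hint : IntegrableOn (fun x : ℝ => (Ioo R⁻¹ R).indicator f x * (x : ℂ) ^ (-critical 0))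
      (Ioi 0) := by
    have h1 : IntegrableOn f (Ioo R⁻¹ R) := integrableOn_Ioo_of_L2 f hR'.le
    refine Integrable.mono' ((h1.integrable_indicator measurableSet_Ioo).norm.mul_const
      (R⁻¹ ^ (-(1 / 2) : ℝ))).integrableOn
      ((hS R).1.mul (measurable_cpow_ofReal _).aestronglyMeasurable) ?_
    filter_upwards [ae_restrict_mem measurableSet_Ioi] with x hx
    by_cases hx' : x ∈ Ioo R⁻¹ R
    · rw [norm_mul, norm_cpow_neg_critical (critical_re 0) hx]
      exact mul_le_mul_of_nonneg_left
        (Real.rpow_le_rpow_of_nonpos hR' hx'.1.le (by norm_num)) (norm_nonneg _)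
    · simp [indicator_of_notMem hx']
  have h1 := mellinP_ae_eq (hS R).coeFn_toLp hint
  have e1 : eLpNorm (fun E => mellinP f E - ∫ x in Ioo R⁻¹ R, f x * (x : ℂ) ^ (-critical E)) 2
      volume = eLpNorm (fun E => mellinIso (f - (hS R).toLp _) ((2 * π)⁻¹ * E)) 2 volume := by
    refine eLpNorm_congr_ae ?_
    rw [map_sub]
    filter_upwards [h1, hq.ae (Lp.coeFn_sub (mellinIso f) (mellinIso ((hS R).toLp _)))] with E h2 h3
    rw [h3, Pi.sub_apply]
    have h4 : mellinIso ((hS R).toLp _) ((2 * π)⁻¹ * E) = _ := h2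
    rw [h4, mellinP]
    congr 1
    have h5 : ∀ x : ℝ, (Ioo R⁻¹ R).indicator f x * (x : ℂ) ^ (-critical E) =
        (Ioo R⁻¹ R).indicator (fun x => f x * (x : ℂ) ^ (-critical E)) x := fun x => by
      by_cases hx : x ∈ Ioo R⁻¹ R
      · simp only [indicator_of_mem hx]
      · simp only [indicator_of_notMem hx, zero_mul]
    simp only [h5]
    rw [setIntegral_indicator measurableSet_Ioo, inter_eq_self_of_subset_right hsub]
  rw [e1, eLpNorm_comp_const_mul inv_two_pi_ne_zero (Lp.aestronglyMeasurable _)]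
  congr 1
  have h6 := mellinIso.norm_map (f - (hS R).toLp _)
  rw [Lp.norm_def, Lp.norm_def,
    ENNReal.toReal_eq_toReal_iff' (Lp.eLpNorm_ne_top _) (Lp.eLpNorm_ne_top _)] at h6
  rw [h6]
  refine eLpNorm_congr_ae ?_
  filter_upwards [Lp.coeFn_sub f ((hS R).toLp _), (hS R).coeFn_toLp] with x h7 h8
  rw [h7, Pi.sub_apply, h8]

/-! ### The completed Mellin transform at a point of the critical line -/

/-- The bounded functional on `L²(0,∞)` which extends the value at `s` of the completed Mellin
transform from the functions for which the latter converges to all of `K_a`. -/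
def thetaForm {a : ℝ} (ha : 0 < a) {s : ℂ} (hs : s.re = 1 / 2) : HalfLineL2 →L[ℂ] ℂ :=
  innerSL ℂ ((memLp_tailKernel ha hs).toLp _) +
    (innerSL ℂ ((memLp_tailKernel ha (one_sub_re hs)).toLp _)).comp
      cosT.toContinuousLinearMap

theorem inner_tailKernel {a : ℝ} (ha : 0 < a) {s : ℂ} (hs : s.re = 1 / 2) {f : HalfLineL2}
    (hf : VanishesBelow a f) : ⟪(memLp_tailKernel ha hs).toLp _, f⟫ =
      2 * ∫ x in Ioi 0, f x * thetaTail s x := by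
  rw [inner_toLp_left, ← integral_const_mul]
  refine integral_congr_ae ?_
  have h1 : ∀ᵐ x : ℝ, x ≠ a := by simp [ae_iff]
  filter_upwards [hf, ae_restrict_of_ae h1] with x hx hxa
  rcases hxa.lt_or_gt with h | h
  · rw [hx h]
    ring
  · rw [tailKernel, indicator_of_mem (show x ∈ Ioi a from h), Complex.conj_conj]
    ring

/-- On the eigenspaces of the cosine transform, `thetaForm` is the theta splitting. -/
theorem thetaForm_of_eigen {a ε : ℝ} (ha : 0 < a) {s : ℂ} (hs : s.re = 1 / 2) {f : HalfLineL2}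
    (hf : VanishesBelow a f) (hc : cosT f = (ε : ℂ) • f) : thetaForm ha hs f =
      2 * (∫ x in Ioi 0, f x * thetaTail s x) +
        ε * (2 * ∫ x in Ioi 0, f x * thetaTail (1 - s) x) := by
  have e : thetaForm ha hs f = ⟪(memLp_tailKernel ha hs).toLp _, f⟫ +
      ⟪(memLp_tailKernel ha (one_sub_re hs)).toLp _, cosT f⟫ := rfl
  rw [e, hc, inner_smul_right, inner_tailKernel ha hs hf, inner_tailKernel ha (one_sub_re hs) hf]

/-- The functions whose completed Mellin-Plancherel transform is given by `thetaForm`. -/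
def mellinThetaSpace {a : ℝ} (ha : 0 < a) : Submodule ℂ HalfLineL2 where
  carrier := {f | ∀ᵐ E : ℝ, (critical E).Gammaℝ * mellinP f E = thetaForm ha (critical_re E) f}
  zero_mem' := by
    have h := (quasiMeasurePreserving_const_mul inv_two_pi_ne_zero).ae
      (Lp.coeFn_zero ℂ 2 (volume : Measure ℝ))
    change ∀ᵐ E : ℝ, _
    filter_upwards [h] with E hE
    rw [mellinP, map_zero, map_zero, hE, Pi.zero_apply, mul_zero]
  add_mem' := by
    intro f g hf hg
    have h := (quasiMeasurePreserving_const_mul inv_two_pi_ne_zero).ae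
      (Lp.coeFn_add (mellinIso f) (mellinIso g))
    change ∀ᵐ E : ℝ, _
    filter_upwards [h, hf, hg] with E hE h1 h2
    rw [mellinP, map_add, map_add, hE, Pi.add_apply, ← h1, ← h2, mellinP, mellinP, mul_add]
  smul_mem' := by
    intro c f hf
    have h := (quasiMeasurePreserving_const_mul inv_two_pi_ne_zero).ae
      (Lp.coeFn_smul c (mellinIso f))
    change ∀ᵐ E : ℝ, _
    filter_upwards [h, hf] with E hE h1
    rw [mellinP, map_smul, map_smul, hE, Pi.smul_apply, ← h1, mellinP, smul_eq_mul, smul_eq_mul]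
    ring

theorem isClosed_mellinThetaSpace {a : ℝ} (ha : 0 < a) :
    IsClosed (mellinThetaSpace ha : Set HalfLineL2) := by
  refine IsSeqClosed.isClosed fun F f hF hlim => ?_
  have h1 : Tendsto (fun n => mellinIso (F n)) atTop (𝓝 (mellinIso f)) :=
    (mellinIso.continuous.tendsto f).comp hlim
  obtain ⟨ns, hns, hae⟩ := (tendstoInMeasure_of_tendsto_Lp h1).exists_seq_tendsto_ae
  have hall : ∀ᵐ E : ℝ, ∀ n, (critical E).Gammaℝ * mellinP (F n) E =
      thetaForm ha (critical_re E) (F n) := ae_all_iff.2 hF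
  change ∀ᵐ E : ℝ, _
  filter_upwards [(quasiMeasurePreserving_const_mul inv_two_pi_ne_zero).ae hae, hall] with E h2 h3
  have h4 : Tendsto (fun i => (critical E).Gammaℝ * mellinP (F (ns i)) E) atTop
      (𝓝 ((critical E).Gammaℝ * mellinP f E)) := h2.const_mul _
  have h5 : Tendsto (fun i => thetaForm ha (critical_re E) (F (ns i))) atTop
      (𝓝 (thetaForm ha (critical_re E) f)) :=
    ((thetaForm ha (critical_re E)).continuous.tendsto f).comp (hlim.comp hns.tendsto_atTop)
  exact tendsto_nhds_unique (h4.congr fun i => h3 _) h5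

/-- The combination `ℰ(s) + ε ℰ(1-s)`, at `b = e^u`. -/
def curlyD (ε : ℝ) (s : ℂ) (u : ℝ) : ℂ :=
  curlyE (exp u) s + ε * curlyE (exp u) (1 - s)

theorem two_mul_curlyA (u : ℝ) (s : ℂ) : 2 * curlyA u s = curlyD 1 s u := by
  rw [curlyA, curlyD, Complex.ofReal_one]
  ring

theorem two_mul_curlyB (u : ℝ) (s : ℂ) : 2 * curlyB u s = Complex.I * curlyD (-1) s u := by
  rw [curlyB, curlyD, Complex.ofReal_neg, Complex.ofReal_one]
  ring

theorem intervalIntegrable_curlyD {ε : ℝ} (hε : ε = 1 ∨ ε = -1) {s : ℂ} (hs : s.re = 1 / 2)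
    {x y : ℝ} (hxy : x ≤ y) : IntervalIntegrable (curlyD ε s) volume x y := by
  have hεε : ε * ε = 1 := by rcases hε with rfl | rfl <;> norm_num
  set S := Ioo (exp x) (exp y) with hS
  have hcar : CarriedBy (exp x) (exp y) (S.indicator fun _ => 1) :=
    ⟨memLp_indicator_const 2 measurableSet_Ioo 1 (Or.inr (by rw [Real.volume_Ioo]; simp)),
      fun b hb => indicator_of_notMem hb _⟩
  have hP : ∀ z : ℂ, z.re = 1 / 2 → IntervalIntegrable
      (fun u => exp u • phiMellin ε z (exp u)) volume x y := fun z hz => by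
    have h1 := (integral_volterraT_mul_cpow hεε (Real.exp_pos x) hz hcar).2.1
    have h2 : IntegrableOn (fun b => S.indicator (fun b => phiMellin ε z b) b) (Ioi 0) := by
      refine (IntegrableOn.integrable_indicator ?_ measurableSet_Ioo).integrableOn
      refine (integrableOn_congr_fun (fun b hb => ?_) measurableSet_Ioo).1 h1
      rw [indicator_of_mem hb, one_mul]
    rw [intervalIntegrable_iff_integrableOn_Ioo_of_le hxy]
    refine (integrableOn_congr_fun (fun u hu => ?_) measurableSet_Ioo).1
      ((integrableOn_exp_univ _).1 h2).integrableOn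
    rw [indicator_of_mem (show exp u ∈ S from
      ⟨Real.exp_lt_exp.2 hu.1, Real.exp_lt_exp.2 hu.2⟩)]
  have h3 := (((hP s hs).const_mul s.Gammaℝ).add
    (((hP (1 - s) (one_sub_re hs)).const_mul (1 - s).Gammaℝ).const_mul (ε : ℂ))).continuousOn_mul
    (g := fun u : ℝ => (exp (-(u / 2)) : ℂ))
    (by fun_prop : Continuous fun u : ℝ => (exp (-(u / 2)) : ℂ)).continuousOn
  refine h3.congr_ae (Eventually.of_forall fun u => ?_)
  have h4 : sqrt (exp u) = exp (-(u / 2)) * exp u := by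
    rw [← Real.exp_add, Real.sqrt_eq_iff_mul_self_eq (Real.exp_pos _).le (Real.exp_pos _).le,
      ← Real.exp_add]
    ring_nf
  rw [curlyD, curlyE_add hε (Real.exp_pos u) hs, h4]
  simp only [Complex.real_smul]
  push_cast
  ring

/-- The formulas of `mellin_transmuted`, in the variable `u = log b`. -/
theorem integral_cut_expTest {a c : ℝ} (ha : 0 < a) (hac : a < c) {f : ℝ → ℝ}
    (hfc : ∀ u, log c ≤ u → f u = 0) (ε : ℝ) (s : ℂ) :
    ∫ b in Ioo a c, cut a c (expTest f) b *
        ((curlyE b s + ε * curlyE b (1 - s)) / (sqrt b : ℂ)) =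
      1 / 2 * ∫ u in Ioi (log a), (f u : ℂ) * curlyD ε s u := by
  have hsub : Ioo a c ⊆ Ioi a := fun x hx => hx.1
  rw [← setIntegral_eq_of_subset_of_forall_sdiff_eq_zero measurableSet_Ioi hsub (fun b hb => by
      rw [cut, indicator_of_notMem hb.2, zero_mul]),
    integral_exp_comp ha, ← integral_const_mul]
  refine setIntegral_congr_fun measurableSet_Ioi fun u hu => ?_
  have h1 := two_mul_cut_expTest hfc ha hu hac
  have h2 : sqrt (exp u) = exp (u / 2) := by
    rw [← exp_half_sq, Real.sqrt_sq (Real.exp_pos _).le]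
  have h3 : (exp u : ℂ) = (exp (u / 2) : ℂ) * exp (u / 2) := by
    rw [← exp_half_sq u]
    push_cast
    ring
  have h4 : (exp (u / 2) : ℂ) ≠ 0 := by exact_mod_cast (Real.exp_pos _).ne'
  rw [← h1, h2, curlyD, Complex.real_smul, h3]
  field_simp

section Picture

variable {a : ℝ} (ha : 0 < a) {U : K a ≃ₗᵢ[ℂ] PairL2 (log a)} (hU : ∀ f, U f = uMap ha f)

theorem IsTest.exists_log_bound {a : ℝ} {η : ℝ → ℝ} (hη : IsTest (log a) η) (ha : 0 < a) :
    ∃ c, a < c ∧ ∀ u, log c ≤ u → η u = 0 := by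
  obtain ⟨p, q, h1, h2, h3⟩ := hη.bounds
  refine ⟨exp q, (Real.log_lt_iff_lt_exp ha).1 (h1.trans h2), fun u hu => ?_⟩
  rw [Real.log_exp] at hu
  exact h3 u fun h => absurd h.2 (not_lt.2 hu)

/-- For a transmuted function, both the completed Mellin-Plancherel transform and `thetaForm` are
given by the functions `ℰ`. -/
theorem transmuted_expTest {ε : ℝ} (hε : ε * ε = 1) (hε' : ε = 1 ∨ ε = -1) {η : ℝ → ℝ}
    (hη : ContDiff ℝ 1 η) {c : ℝ} (hac : a < c) (hc : ∀ u, log c ≤ u → η u = 0)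
    (hcut : CarriedBy a c (cut a c (expTest η))) :
    transmuted hε ha hcut ∈ mellinThetaSpace ha ∧ ∀ {s : ℂ} (hs : s.re = 1 / 2),
      thetaForm ha hs (transmuted hε ha hcut) =
        1 / 2 * ∫ u in Ioi (log a), (η u : ℂ) * curlyD ε s u := by
  have hR : ContDiffOn ℝ 1 (expTest η) (Ioi 0) := fun b hb =>
    (contDiffAt_expTest hη hb).contDiffWithinAt
  have h1 : ∀ {s : ℂ} (hs : s.re = 1 / 2), thetaForm ha hs (transmuted hε ha hcut) =
      ∫ b in Ioo a c, cut a c (expTest η) b *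
        ((curlyE b s + ε * curlyE b (1 - s)) / (sqrt b : ℂ)) := fun hs => by
    rw [thetaForm_of_eigen ha hs (mem_K_iff.1 (transmuted_mem_K hε ha hcut)).1
      (cosT_transmuted hε ha hcut)]
    exact (mellin_transmuted hε ha hε' hs hR hac hcut).2.2
  refine ⟨?_, fun hs => by rw [h1 hs, integral_cut_expTest ha hac hc]⟩
  change ∀ᵐ E : ℝ, _
  filter_upwards [mellinP_ae_eq (Filter.EventuallyEq.refl _ _)
    (mellin_transmuted hε ha hε' (critical_re 0) hR hac hcut).1] with E hE
  rw [hE, h1, (mellin_transmuted hε ha hε' (critical_re E) hR hac hcut).2.1]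

include hU in
theorem symm_leftPair_test {η : ℝ → ℝ} (hη : IsTest (log a) η) :
    (U.symm (leftPair (log a) hη.isRightTest.eventuallyZero) : HalfLineL2) ∈
      mellinThetaSpace ha ∧ ∀ {s : ℂ} (hs : s.re = 1 / 2),
      thetaForm ha hs (U.symm (leftPair (log a) hη.isRightTest.eventuallyZero)) =
        1 / 2 * ∫ u in Ioi (log a), (η u : ℂ) * (2 * curlyA u s) := by
  obtain ⟨c, hac, hc⟩ := hη.exists_log_bound ha
  have hη1 := hη.isRightTest.contDiff
  have hcut : CarriedBy a c (cut a c (expTest η)) :=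
    carriedBy_cut ha (continuousOn_expTest hη1.continuous)
  have e := symm_leftPair ha hU hη.isRightTest.eventuallyZero hc hac hcut (z := 1) fun b =>
    (one_mul _).symm
  have h := transmuted_expTest ha one_mul_one_real (Or.inl rfl) hη1 hac hc hcut
  rw [e, one_smul]
  refine ⟨h.1, fun hs => ?_⟩
  simp only [h.2 hs, two_mul_curlyA]

include hU in
theorem symm_rightPair_test {η : ℝ → ℝ} (hη : IsTest (log a) η) :
    (U.symm (rightPair (log a) hη.isRightTest.eventuallyZero) : HalfLineL2) ∈
      mellinThetaSpace ha ∧ ∀ {s : ℂ} (hs : s.re = 1 / 2),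
      thetaForm ha hs (U.symm (rightPair (log a) hη.isRightTest.eventuallyZero)) =
        1 / 2 * ∫ u in Ioi (log a), (η u : ℂ) * (2 * curlyB u s) := by
  obtain ⟨c, hac, hc⟩ := hη.exists_log_bound ha
  have hη1 := hη.isRightTest.contDiff
  have hcut : CarriedBy a c (cut a c (expTest η)) :=
    carriedBy_cut ha (continuousOn_expTest hη1.continuous)
  have e := symm_rightPair ha hU hη.isRightTest.eventuallyZero hc hac hcut (z := 1) fun b =>
    (one_mul _).symm
  have h := transmuted_expTest ha neg_one_mul_neg_one_real (Or.inr rfl) hη1 hac hc hcut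
  rw [e]
  refine ⟨Submodule.smul_mem _ _ h.1, fun hs => ?_⟩
  rw [map_smul, h.2 hs, smul_eq_mul, mul_left_comm, mul_one, ← integral_const_mul]
  simp only [two_mul_curlyB]
  congr 2
  ext u
  ring

include hU in
/-- The formula holds for transmuted test pairs, which are dense, and it passes to limits. -/
theorem K_le_mellinThetaSpace (f : K a) : (f : HalfLineL2) ∈ mellinThetaSpace ha := by
  set W : Submodule ℂ (PairL2 (log a)) :=
    (mellinThetaSpace ha).comap ((K a).subtype ∘ₗ U.symm.toLinearEquiv.toLinearMap) with hW
  have hcl : IsClosed (W : Set (PairL2 (log a))) :=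
    (isClosed_mellinThetaSpace ha).preimage (continuous_subtype_val.comp U.symm.continuous)
  have : CompleteSpace W := hcl.completeSpace_coe
  have hbot : Wᗮ = ⊥ := (Submodule.eq_bot_iff _).2 fun z hz => pair_eq_zero_of_inner_test
    (fun η hη => Submodule.mem_orthogonal _ _ |>.1 hz _ (symm_leftPair_test ha hU hη).1)
    (fun η hη => Submodule.mem_orthogonal _ _ |>.1 hz _ (symm_rightPair_test ha hU hη).1)
  have htop : W = ⊤ := Submodule.orthogonal_eq_bot_iff.1 hbot
  have h : U f ∈ W := htop ▸ Submodule.mem_top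
  have h' : (U.symm (U f) : HalfLineL2) ∈ mellinThetaSpace ha := h
  rwa [U.symm_apply_apply] at h'

include hU in
/-- The functions `𝒜` and `ℬ` represent the functional `thetaForm` in the `u`-picture, and are
therefore square-integrable. -/
theorem thetaForm_symm {s : ℂ} (hs : s.re = 1 / 2) (T : PairL2 (log a)) :
    IntegrableOn (fun u => T u 0 * (2 * curlyA u s) + T u 1 * (2 * curlyB u s))
      (Ioi (log a)) ∧
    thetaForm ha hs (U.symm T) =
      ∫ u in Ioi (log a), (T u 0 * (2 * curlyA u s) + T u 1 * (2 * curlyB u s)) / 2 := by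
  set L : PairL2 (log a) →L[ℂ] ℂ := (thetaForm ha hs).comp
    ((K a).subtypeL.comp (U.symm.toContinuousLinearEquiv : _ →L[ℂ] K a)) with hL
  -- Riesz representation; testing identifies the components of `k`
  obtain ⟨k, hk⟩ : ∃ k, ∀ T, ⟪k, T⟫ = L T :=
    ⟨(InnerProductSpace.toDual ℂ _).symm L, fun T => InnerProductSpace.toDual_symm_apply⟩
  have hLT : ∀ T, L T = thetaForm ha hs (U.symm T) := fun _ => rfl
  have hrep : ∀ (i : Fin 2) (D : ℝ → ℂ),
      (∀ x y, log a < x → x ≤ y → IntervalIntegrable D volume x y) →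
      (∀ η, IsTest (log a) η → conj (1 / 2 * ∫ u in Ioi (log a),
        (η u : ℂ) * k u i) = 1 / 2 * ∫ u in Ioi (log a), (η u : ℂ) * D u) →
      ∀ᵐ u ∂(volume.restrict (Ioi (log a))), conj (k u i) = D u := by
    intro i D hD h
    have hki : ∀ x y, log a < x → x ≤ y →
        IntervalIntegrable (fun u => conj (k u i)) volume x y := fun x y hx hxy => by
      have := pair_intervalIntegrable k i x y hx.le hxy
      exact ⟨Complex.conjLIE.integrable_comp_iff.2 this.1,
        Complex.conjLIE.integrable_comp_iff.2 this.2⟩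
    have h0 := ae_eq_zero_of_integral_test_mul (r := fun u => conj (k u i) - D u)
      (fun x y hx hxy => (hki x y hx hxy).sub (hD x y hx hxy)) fun η hη => by
        have h1 := h η hη
        rw [map_mul, ← integral_conj] at h1
        simp only [map_mul, Complex.conj_ofReal, map_div₀, map_one, map_ofNat] at h1
        simp only [mul_sub]
        rw [integral_sub (hη.integrableOn_mul hki) (hη.integrableOn_mul hD), sub_eq_zero]
        exact mul_left_cancel₀ (by norm_num) h1
    filter_upwards [h0] with u hu
    exact sub_eq_zero.1 hu
  have hk0 := hrep 0 (fun u => 2 * curlyA u s)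
    (fun x y _ hxy => by
      simp only [two_mul_curlyA]
      exact intervalIntegrable_curlyD (Or.inl rfl) hs hxy)
    (fun η hη => by
      rw [← inner_leftPair hη.isRightTest.eventuallyZero, inner_conj_symm, hk, hLT,
        (symm_leftPair_test ha hU hη).2 hs])
  have hk1 := hrep 1 (fun u => 2 * curlyB u s)
    (fun x y _ hxy => by
      simp only [two_mul_curlyB]
      exact (intervalIntegrable_curlyD (Or.inr rfl) hs hxy).const_mul _)
    (fun η hη => by
      rw [← inner_rightPair hη.isRightTest.eventuallyZero, inner_conj_symm, hk, hLT,
        (symm_rightPair_test ha hU hη).2 hs])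
  have he : ∀ᵐ u ∂(volume.restrict (Ioi (log a))),
      T u 0 * conj (k u 0) + T u 1 * conj (k u 1) =
        T u 0 * (2 * curlyA u s) + T u 1 * (2 * curlyB u s) := by
    filter_upwards [hk0, hk1] with u h0 h1
    rw [h0, h1]
  have hint : ∀ i, Integrable (fun u => T u i * conj (k u i))
      (volume.restrict (Ioi (log a))) := fun i =>
    MemLp.integrable_mul (memLp_pair_apply T i) (memLp_pair_apply k i).star
  refine ⟨((hint 0).add (hint 1)).congr he, ?_⟩
  rw [← hLT, ← hk, inner_pair_eq, integral_congr_ae he, integral_div]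
  ring

include hU in
theorem isUPicture (f : K a) : IsUPicture a f (U f) := by
  refine ⟨mellinP f, isMellinTransform_mellinP f, ?_⟩
  filter_upwards [K_le_mellinThetaSpace ha hU f] with E hE
  obtain ⟨h1, h2⟩ := thetaForm_symm ha hU (critical_re E) (U f)
  rw [U.symm_apply_apply] at h2
  exact ⟨h1, hE.trans h2⟩

end Picture

end

end DiracCosine

theorem mainTheorem2 (a : ℝ) (ha : 0 < a) :
    (∀ f : DiracCosine.freeOp.domain, (f : DiracCosine.HalfLineL2) ∈ DiracCosine.K a →
      DiracCosine.freeOp f ∈ DiracCosine.K a) ∧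
    DiracCosine.HasDeficiencyIndices
      (DiracCosine.restrictTo DiracCosine.freeOp (DiracCosine.K a)) 1 1 ∧
    IsSelfAdjoint (DiracCosine.boundOp a) ∧
    ∃ U : DiracCosine.K a ≃ₗᵢ[ℂ] DiracCosine.PairL2 (Real.log a),
      (∀ f : DiracCosine.K a, DiracCosine.IsUPicture a f (U f)) ∧
      ∀ f : (DiracCosine.restrictTo DiracCosine.freeOp (DiracCosine.K a)).domain,
        ∃ h : U f ∈ (DiracCosine.boundOp a).domain,
          DiracCosine.boundOp a ⟨U f, h⟩ =
            U (DiracCosine.restrictTo DiracCosine.freeOp (DiracCosine.K a) f) := by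
  obtain ⟨U, hU⟩ := DiracCosine.exists_uMap_unitary ha
  exact ⟨fun f hf => DiracCosine.freeOp_mem_K f hf,
    DiracCosine.hasDeficiencyIndices_restrictTo ha hU,
    DiracCosine.isSelfAdjoint_diracOp DiracCosine.continuous_potential,
    U, fun f => DiracCosine.isUPicture ha hU f, fun f => DiracCosine.boundOp_uMap ha hU f⟩
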